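/- **Setting.** Let $d\in\{2,3\}$ and let $\Omega\subset\mathbb R^d$ be a Lipschitz polytopal domain whose boundary is partitioned into relatively open, disjoint polytopal parts $\Gamma_D,\Gamma_N,\Gamma_R$ with $\partial\Omega=\overline{\Gamma_D}\cup\overline{\Gamma_N}\cup\overline{\Gamma_R}$. Let $\omega>0$; let $\mu>0$ and the symmetric positive definite matrix field $\boldsymbol A$ be constant on each set of a finite polytopal partition of $\Omega$, and $\gamma>0$ constant on each set of a finite polytopal partition of $\Gamma_R$. All functions are complex-valued, $(\cdot,\cdot)$ denotes $L^2$ inner products (antilinear in the second argument) and $\|v\|_{w,D}^2=(wv,v)_D$. Let $V=H^1_{\Gamma_D}(\Omega)$ be the space of functions of $H^1(\Omega)$ with zero trace on $\Gamma_D$, $$b(\phi,v)=-\omega^2(\mu\phi,v)_\Omega-i\omega(\gamma\phi,v)_{\Gamma_R}+(\boldsymbol A\nabla\phi,\nabla v)_\Omega ,\qquad \|v\|_{\omega,\Omega}^2=\omega^2\|v\|_{\mu,\Omega}^2+\omega\|v\|_{\gamma,\Gamma_R}^2+\|\nabla v\|_{\boldsymbol A,\Omega}^2 ,$$ and assume that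 the problem is well-posed: $\inf_{\phi\in V,\|\phi\|_{\omega,\Omega}=1}\ \sup_{v\in V,\|v\|_{\omega,\Omega}=1}\operatorname{Re}b(\phi,v)>0$. For $f\in L^2(\Omega)$ let $u\in V$ satisfy $b(u,v)=(f,v)_\Omega$ for all $v\in V$. Let $\mathcal T_h$ be a matching simplicial mesh of $\Omega$ that conforms with the partitions of the boundary and of the coefficients, with set of faces $\mathcal F_h$; $\mathcal F_h^D,\mathcal F_h^N,\mathcal F_h^R$ are the faces contained in $\overline{\Gamma_D},\overline{\Gamma_N},\overline{\Gamma_R}$, the other faces are interior, and $\boldsymbol n_F$ is a fixed unit normal of $F$ (outward to $\Omega$ if $F\subset\partial\Omega$). Write $h_K,h_F$ for diameters, $\mu_K$ for the value of $\mu$ on $K$, $\alpha_K$ for the least eigenvalue of $\boldsymbol A|_K$, $\vartheta_K=\sqrt{\alpha_K/\mu_K}$, and for $F\in\mathcal F_h^R$, with $K$ the element having $F$ as a face, $\alpha_F=\alpha_K$, $\gamma_F=\gamma|_F$, $\vartheta_F=\alpha_F/\gamma_F$. Let $H^1(\mathcal T_h)$ be the broken Sobolev space, on which $\nabla$ is taken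 element-wise; fix $p\ge1$ and let $\mathcal P_p(\mathcal T_h)$ be the space of piecewise polynomials of total degree at most $p$. Let $\{\!\{\cdot\}\!\}_F$ be the average of the two traces on an interior face and the trace on an exterior face; let $[\![\phi]\!]_F=\phi_+\boldsymbol n_+\cdot\boldsymbol n_F+\phi_-\boldsymbol n_-\cdot\boldsymbol n_F$ on an interior face, where $\pm$ refers to the two adjacent elements $K_\pm$ and $\boldsymbol n_\pm$ is the unit normal outward to $K_\pm$, $[\![\phi]\!]_F=\phi|_F$ for $F\in\mathcal F_h^D$, and $[\![\phi]\!]_F=0$ for the other exterior faces. The lifting $\mathfrak L(\phi)\in[\mathcal P_p(\mathcal T_h)]^d$ is defined by $(\mathfrak L(\phi),\boldsymbol w_h)_\Omega=\sum_{F\in\mathcal F_h}([\![\phi]\!]_F,\{\!\{\boldsymbol w_h\}\!\}_F\cdot\boldsymbol n_F)_F$ for all $\boldsymbol w_h\in[\mathcal P_p(\mathcal T_h)]^d$, and $\mathfrak G(\phi)=\nabla\phi-\mathfrak L(\phi)$. Set, for $v\in H^1(\mathcal T_h)$, $\|v\|_{\gamma,\mathcal F_h^R}^2=\sum_{F\in\mathcal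 F_h^R}\|v\|_{\gamma,F}^2$, $$\|v\|_{\omega,\mathcal T_h}^2=\omega^2\|v\|_{\mu,\Omega}^2+\omega\|v\|_{\gamma,\mathcal F_h^R}^2+\|\mathfrak G(v)\|_{\boldsymbol A,\Omega}^2,$$ $$\|v\|_{\dagger,1}^2=\sum_{K\in\mathcal T_h}\Big\{\max\Big(1,\frac{\omega^2h_K^2}{\vartheta_K^2}\Big)\frac{\alpha_K}{h_K^2}\|v\|_K^2+\|\mathfrak G(v)\|_{\boldsymbol A,K}^2\Big\}+\sum_{F\in\mathcal F_h^R}\max\Big(1,\frac{\omega h_F}{\vartheta_F}\Big)\frac{\alpha_F}{h_F}\|v\|_F^2,$$ and, for $\boldsymbol w$ in the space $X_{\Gamma_N}$ of fields of $H(\operatorname{div},\Omega)$ whose normal trace vanishes on $\Gamma_N$ and belongs to $L^2(\Gamma_R)$ on $\Gamma_R$, $$\|\boldsymbol w\|_{\dagger,\operatorname{div}}^2=\sum_{K\in\mathcal T_h}\Big\{\|\boldsymbol w\|_{\boldsymbol A^{-1},K}^2+\frac{h_K^2}{\alpha_K}\|\operatorname{div}\boldsymbol w\|_K^2\Big\}+\sum_{F\in\mathcal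 F_h^R}\frac{h_F}{\alpha_F}\|\boldsymbol w\cdot\boldsymbol n\|_F^2 .$$ Let $s_h$ be a sesquilinear form on $H^1(\mathcal T_h)$ with $s_h(\phi,v)=0$ whenever $\phi\in V$ or $v\in V$, and $$b_h(\phi,v)=-\omega^2(\mu\phi,v)_\Omega-i\omega\sum_{F\in\mathcal F_h^R}(\gamma\phi,v)_F+(\boldsymbol A\mathfrak G(\phi),\mathfrak G(v))_\Omega+s_h(\phi,v).$$ Let $\pi^g$ and $\pi_h^g$ be the best approximations in $V$ and in $\mathcal P_p(\mathcal T_h)\cap V$ for $\|\cdot\|_{\dagger,1}$, and $\pi_h^d$ the best approximation in $[\mathcal P_p(\mathcal T_h)]^d\cap X_{\Gamma_N}$ for $\|\cdot\|_{\dagger,\operatorname{div}}$. For $\psi\in L^2(\Omega)$ and $\Psi\in L^2(\Gamma_R)$ let $u^\star_\psi,U^\star_\Psi\in V$ solve $b(w,u^\star_\psi)=\omega(\mu w,\psi)_\Omega$ and $b(w,U^\star_\Psi)=\omega^{1/2}(\gamma w,\Psi)_{\Gamma_R}$ for all $w\in V$, and set $$\check\gamma_{ba,g}=\sup_{\|\psi\|_{\mu,\Omega}=1}\|u^\star_\psi-\pi_h^gu^\star_\psi\|_{\dagger,1},\qquad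 \check\gamma_{ba,d}=\sup_{\|\psi\|_{\mu,\Omega}=1}\|\boldsymbol A\nabla u^\star_\psi-\pi_h^d(\boldsymbol A\nabla u^\star_\psi)\|_{\dagger,\operatorname{div}},$$ $$\tilde\gamma_{ba,g}=\sup_{\|\Psi\|_{\gamma,\Gamma_R}=1}\|U^\star_\Psi-\pi_h^gU^\star_\Psi\|_{\dagger,1},\qquad \tilde\gamma_{ba,d}=\sup_{\|\Psi\|_{\gamma,\Gamma_R}=1}\|\boldsymbol A\nabla U^\star_\Psi-\pi_h^d(\boldsymbol A\nabla U^\star_\Psi)\|_{\dagger,\operatorname{div}}$$ (the last two are $0$ if $\Gamma_R=\emptyset$). **Lemma (Aubin–Nitsche).** The four suprema are finite, and if $u_h\in\mathcal P_p(\mathcal T_h)$ satisfies $b_h(u_h,v_h)=(f,v_h)_\Omega$ for all $v_h\in\mathcal P_p(\mathcal T_h)$, then $$\omega\|u-u_h\|_{\mu,\Omega}\le\check\gamma_{ba,g}\,\|u-u_h\|_{\omega,\mathcal T_h}+\check\gamma_{ba,d}\,\|u_h-\pi^gu_h\|_{\dagger,1}$$ and $$\omega^{1/2}\|u-u_h\|_{\gamma,\mathcal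 F_h^R}\le\tilde\gamma_{ba,g}\,\|u-u_h\|_{\omega,\mathcal T_h}+\tilde\gamma_{ba,d}\,\|u_h-\pi^gu_h\|_{\dagger,1}.$$ -/

import Mathlib

open MeasureTheory Filter
open scoped Topology ContDiff Matrix ComplexConjugate

noncomputable section

namespace IPDG

/-! ### Function spaces on subsets of `ℝ^d`

Complex-valued fields are represented by functions on all of `ℝ^d`; only their values almost
everywhere on the set under consideration matter. -/

/-- The Euclidean space `ℝ^d`. -/
abbrev E (d : ℕ) : Type := EuclideanSpace ℝ (Fin d)

/-- Complex scalar fields. -/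
abbrev Scal (d : ℕ) : Type := E d → ℂ

/-- Complex vector fields. The sup norm of the codomain `Fin d → ℂ` is never used in a formula:
all norms of vector fields below are written out as Hermitian forms of the components. -/
abbrev Vect (d : ℕ) : Type := E d → Fin d → ℂ

variable {d : ℕ}

/-- The `(d-1)`-dimensional surface measure of `ℝ^d`. -/
def surf (d : ℕ) : Measure (E d) := Measure.euclideanHausdorffMeasure (d - 1)

/-- `v ∈ L²(U)`. -/
def MemL2 (U : Set (E d)) (v : Scal d) : Prop := MemLp v 2 (volume.restrict U)

/-- `w ∈ [L²(U)]^d`. -/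
def MemL2Vec (U : Set (E d)) (w : Vect d) : Prop := ∀ i, MemL2 U (fun x => w x i)

/-- `g ∈ L²(S)` for a subset `S` of a hypersurface. -/
def MemL2Surf (S : Set (E d)) (g : Scal d) : Prop := MemLp g 2 ((surf d).restrict S)

/-- The classical gradient. -/
def cgrad (φ : Scal d) : Vect d := fun x i => fderiv ℝ φ x (EuclideanSpace.single i 1)

/-- Test functions `C_c^∞(U)`. -/
def IsTest (U : Set (E d)) (φ : Scal d) : Prop :=
  ContDiff ℝ ∞ φ ∧ HasCompactSupport φ ∧ tsupport φ ⊆ U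

/-- `G` is the gradient of `v` on `U` in the sense of distributions. -/
def IsWeakGrad (U : Set (E d)) (v : Scal d) (G : Vect d) : Prop :=
  ∀ φ, IsTest U φ → ∀ i, ∫ x in U, v x * cgrad φ x i = -∫ x in U, G x i * φ x

/-- `D` is the divergence of `w` on `U` in the sense of distributions. -/
def IsWeakDiv (U : Set (E d)) (w : Vect d) (D : Scal d) : Prop :=
  ∀ φ, IsTest U φ → ∫ x in U, w x ⬝ᵥ cgrad φ x = -∫ x in U, D x * φ x

/-- `v ∈ H¹(U)`. -/
def MemH1 (U : Set (E d)) (v : Scal d) : Prop :=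
  MemL2 U v ∧ ∃ G, MemL2Vec U G ∧ IsWeakGrad U v G

open Classical in
/-- The weak gradient of `v ∈ H¹(U)`. -/
def wgrad (U : Set (E d)) (v : Scal d) : Vect d :=
  if h : ∃ G, MemL2Vec U G ∧ IsWeakGrad U v G then h.choose else 0

/-- `w ∈ H(div, U)`. -/
def MemHdiv (U : Set (E d)) (w : Vect d) : Prop :=
  MemL2Vec U w ∧ ∃ D, MemL2 U D ∧ IsWeakDiv U w D

open Classical in
/-- The weak divergence of `w ∈ H(div, U)`. -/
def wdiv (U : Set (E d)) (w : Vect d) : Scal d :=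
  if h : ∃ D, MemL2 U D ∧ IsWeakDiv U w D then h.choose else 0

/-- `g ∈ L²(S)` is the trace on `S ⊆ ∂U` of `v ∈ H¹(U)`: the trace operator is the extension by
continuity, from functions that are smooth up to the boundary to `H¹(U)`, of the restriction
to `S`. -/
def IsTrace (U S : Set (E d)) (v g : Scal d) : Prop :=
  MemL2Surf S g ∧ ∃ φ : ℕ → Scal d, (∀ n, ContDiff ℝ ∞ (φ n)) ∧
    Tendsto (fun n => eLpNorm (φ n - v) 2 (volume.restrict U)) atTop (𝓝 0) ∧
    (∀ i, Tendsto (fun n => eLpNorm (fun x => cgrad (φ n) x i - wgrad U v x i) 2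
      (volume.restrict U)) atTop (𝓝 0)) ∧
    Tendsto (fun n => eLpNorm (φ n - g) 2 ((surf d).restrict S)) atTop (𝓝 0)

open Classical in
/-- The trace on `S ⊆ ∂U` of `v ∈ H¹(U)`. -/
def trace (U S : Set (E d)) (v : Scal d) : Scal d :=
  if h : ∃ g, IsTrace U S v g then h.choose else 0

/-- `H¹_Γ(U)`: the functions of `H¹(U)` whose trace on `Γ` vanishes. -/
def H1zero (U Γ : Set (E d)) : Set (Scal d) := {v | MemH1 U v ∧ IsTrace U Γ v 0}

/-- The normal trace of `w ∈ H(div, U)` on the relatively open set `Γ ⊆ ∂U` is `g ∈ L²(Γ)`.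
The normal trace on `Γ` is the functional that Green's formula defines on the traces of the
functions of `H¹(U)` that vanish on `∂U \ Γ`. -/
def IsNormalTrace (U Γ : Set (E d)) (w : Vect d) (g : Scal d) : Prop :=
  MemL2Surf Γ g ∧ ∀ φ ∈ H1zero U (frontier U \ Γ),
    (∫ x in U, w x ⬝ᵥ wgrad U φ x) + (∫ x in U, wdiv U w x * φ x) =
      ∫ x in Γ, g x * trace U Γ φ x ∂(surf d)

open Classical in
/-- The normal trace on `Γ`, when it belongs to `L²(Γ)`. -/
def normalTrace (U Γ : Set (E d)) (w : Vect d) : Scal d :=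
  if h : ∃ g, IsNormalTrace U Γ w g then h.choose else 0

/-- A minimizer of `N (v - s)` over `s ∈ S`. -/
def IsArgmin {X : Type*} [Sub X] (N : X → ℝ) (S : Set X) (v s : X) : Prop :=
  s ∈ S ∧ ∀ t ∈ S, N (v - s) ≤ N (v - t)

open Classical in
/-- The projection `arg min_{s ∈ S} N (v - s)`. -/
def argmin {X : Type*} [Sub X] [Zero X] (N : X → ℝ) (S : Set X) (v : X) : X :=
  if h : ∃ s, IsArgmin N S v s then h.choose else 0

/-! ### Geometry -/

/-- The closed simplex with vertex set `s`. -/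
abbrev hull (s : Finset (E d)) : Set (E d) := convexHull ℝ (s : Set (E d))

/-- `s` consists of the `k+1` vertices of a nondegenerate `k`-simplex. -/
def IsSimplex (k : ℕ) (s : Finset (E d)) : Prop :=
  s.card = k + 1 ∧ AffineIndependent ℝ ((↑) : s → E d)

/-- Open polytopal subsets of `ℝ^d`: interiors of finite unions of nondegenerate simplices. -/
def IsPolytopal (U : Set (E d)) : Prop :=
  ∃ 𝒮 : Finset (Finset (E d)), (∀ s ∈ 𝒮, IsSimplex d s) ∧ U = interior (⋃ s ∈ 𝒮, hull s)

/-- Relatively open polytopal subsets of `∂U`: relative interiors in `∂U` of finite unions of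
nondegenerate `(d-1)`-simplices contained in `∂U`. -/
def IsPolytopalPart (U Γ : Set (E d)) : Prop :=
  ∃ 𝒮 : Finset (Finset (E d)), (∀ s ∈ 𝒮, IsSimplex (d - 1) s ∧ hull s ⊆ frontier U) ∧
    Γ = {x ∈ frontier U | (⋃ s ∈ 𝒮, hull s) ∈ 𝓝[frontier U] x}

/-- Near each of its boundary points, `U` is the strict epigraph, in some direction `e`, of a
Lipschitz function `ζ` of the coordinates orthogonal to `e`. -/
def IsLipschitzSet (U : Set (E d)) : Prop :=
  ∀ x ∈ frontier U, ∃ e : E d, ‖e‖ = 1 ∧ ∃ r > 0, ∃ L : NNReal, ∃ ζ : E d → ℝ,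
    LipschitzWith L ζ ∧
    ∀ y ∈ Metric.ball x r, (y ∈ U ↔ ζ (y - inner ℝ e y • e) < inner ℝ e y)

/-- The smallest value of the quadratic form of `M` on the unit sphere. -/
def minForm (M : Matrix (Fin d) (Fin d) ℝ) : ℝ :=
  sInf {r | ∃ ξ : E d, ‖ξ‖ = 1 ∧ r = (fun i => ξ i) ⬝ᵥ (M *ᵥ fun i => ξ i)}

/-- The Hermitian product `M a · conj b`, for a real matrix `M`. -/
def herm (M : Matrix (Fin d) (Fin d) ℝ) (a b : Fin d → ℂ) : ℂ :=
  (M.map (fun t : ℝ => (t : ℂ)) *ᵥ a) ⬝ᵥ star b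

/-! ### The Helmholtz problem -/

/-- Domain, boundary partition, piecewise constant coefficients and frequency. -/
structure Problem (d : ℕ) where
  /-- the domain -/
  Ω : Set (E d)
  /-- the Dirichlet boundary -/
  ΓD : Set (E d)
  /-- the Neumann boundary -/
  ΓN : Set (E d)
  /-- the Robin boundary -/
  ΓR : Set (E d)
  μ : E d → ℝ
  A : E d → Matrix (Fin d) (Fin d) ℝ
  γ : E d → ℝ
  /-- the frequency `ω` -/
  om : ℝ
  /-- the partition of the domain subordinate to `μ` and `A` -/
  subdom : Finset (Set (E d))
  /-- the partition of the Robin boundary subordinate to `γ` -/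
  subrob : Finset (Set (E d))
  isConnected : IsConnected Ω
  isPolytopal : IsPolytopal Ω
  isLipschitz : IsLipschitzSet Ω
  partD : IsPolytopalPart Ω ΓD
  partN : IsPolytopalPart Ω ΓN
  partR : IsPolytopalPart Ω ΓR
  disjDN : Disjoint ΓD ΓN
  disjDR : Disjoint ΓD ΓR
  disjNR : Disjoint ΓN ΓR
  frontier_eq : frontier Ω = closure ΓD ∪ closure ΓN ∪ closure ΓR
  subdom_polytopal : ∀ P ∈ subdom, IsPolytopal P
  subdom_subset : ∀ P ∈ subdom, P ⊆ Ω
  subdom_disjoint : ∀ P ∈ subdom, ∀ P' ∈ subdom, P ≠ P' → Disjoint P P'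
  subdom_cover : Ω ⊆ ⋃ P ∈ subdom, closure P
  subrob_polytopal : ∀ Q ∈ subrob, IsPolytopalPart Ω Q
  subrob_subset : ∀ Q ∈ subrob, Q ⊆ ΓR
  subrob_disjoint : ∀ Q ∈ subrob, ∀ Q' ∈ subrob, Q ≠ Q' → Disjoint Q Q'
  subrob_cover : ΓR ⊆ ⋃ Q ∈ subrob, closure Q
  μ_const : ∀ P ∈ subdom, ∃ m : ℝ, 0 < m ∧ ∀ x ∈ P, μ x = m
  A_const : ∀ P ∈ subdom, ∃ M : Matrix (Fin d) (Fin d) ℝ, M.PosDef ∧ ∀ x ∈ P, A x = M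
  γ_const : ∀ Q ∈ subrob, ∃ g : ℝ, 0 < g ∧ ∀ x ∈ Q, γ x = g
  om_pos : 0 < om

namespace Problem

variable (P : Problem d)

/-- The space `H¹_{Γ_D}(Ω)`. -/
def V : Set (Scal d) := H1zero P.Ω P.ΓD

/-- The sesquilinear form of the Helmholtz problem. -/
def b (φ v : Scal d) : ℂ :=
  -(P.om : ℂ) ^ 2 * (∫ x in P.Ω, (P.μ x : ℂ) * φ x * conj (v x))
  - Complex.I * (P.om : ℂ) *
      (∫ x in P.ΓR, (P.γ x : ℂ) * trace P.Ω P.ΓR φ x * conj (trace P.Ω P.ΓR v x) ∂(surf d))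
  + ∫ x in P.Ω, herm (P.A x) (wgrad P.Ω φ x) (wgrad P.Ω v x)

/-- The energy norm of `H¹_{Γ_D}(Ω)`. -/
def energy (v : Scal d) : ℝ :=
  √(P.om ^ 2 * (∫ x in P.Ω, P.μ x * ‖v x‖ ^ 2)
    + P.om * (∫ x in P.ΓR, P.γ x * ‖trace P.Ω P.ΓR v x‖ ^ 2 ∂(surf d))
    + ∫ x in P.Ω, (herm (P.A x) (wgrad P.Ω v x) (wgrad P.Ω v x)).re)

/-- Well-posedness: the inf-sup constant of `b` for the energy norm is positive. -/
def WellPosed : Prop :=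
  ∃ γst : ℝ, 0 < γst ∧ ∀ φ ∈ P.V, P.energy φ = 1 →
    ∃ v ∈ P.V, P.energy v = 1 ∧ 1 / γst ≤ (P.b φ v).re

/-- `u` is the weak solution of the Helmholtz problem with right-hand side `f`. -/
def IsWeakSolution (f u : Scal d) : Prop :=
  u ∈ P.V ∧ ∀ v ∈ P.V, P.b u v = ∫ x in P.Ω, f x * conj (v x)

/-- `ξ = u*_ψ`: the solution of the adjoint problem with volume right-hand side `ψ ∈ L²(Ω)`. -/
def IsDualVol (ψ ξ : Scal d) : Prop :=
  ξ ∈ P.V ∧ ∀ w ∈ P.V, P.b w ξ = (P.om : ℂ) * ∫ x in P.Ω, (P.μ x : ℂ) * w x * conj (ψ x)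

/-- `χ = U*_Ψ`: the solution of the adjoint problem with Robin right-hand side `Ψ ∈ L²(Γ_R)`. -/
def IsDualRob (Ψ χ : Scal d) : Prop :=
  χ ∈ P.V ∧ ∀ w ∈ P.V, P.b w χ =
    ((√P.om : ℝ) : ℂ) * ∫ x in P.ΓR, (P.γ x : ℂ) * trace P.Ω P.ΓR w x * conj (Ψ x) ∂(surf d)

/-- The vector field `A ∇ξ`. -/
def flux (ξ : Scal d) : Vect d :=
  fun x => (P.A x).map (fun t : ℝ => (t : ℂ)) *ᵥ wgrad P.Ω ξ x

/-- The space `X_{Γ_N}(div, Ω)`: fields of `H(div, Ω)` with a vanishing normal trace on `Γ_N` and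
a square integrable normal trace on `Γ_R`. -/
def XN : Set (Vect d) :=
  {w | MemHdiv P.Ω w ∧ IsNormalTrace P.Ω P.ΓN w 0 ∧ ∃ g, IsNormalTrace P.Ω P.ΓR w g}

/-- Right-hand sides `ψ ∈ L²(Ω)` of unit `μ`-weighted norm. -/
def UnitVol (ψ : Scal d) : Prop :=
  MemL2 P.Ω ψ ∧ √(∫ x in P.Ω, P.μ x * ‖ψ x‖ ^ 2) = 1

/-- Right-hand sides `Ψ ∈ L²(Γ_R)` of unit `γ`-weighted norm. -/
def UnitRob (Ψ : Scal d) : Prop :=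
  MemL2Surf P.ΓR Ψ ∧ √(∫ x in P.ΓR, P.γ x * ‖Ψ x‖ ^ 2 ∂(surf d)) = 1

end Problem

/-! ### Meshes -/

/-- `ν` is the unit normal of the face `F` of the simplex `K` that points outside `K`. -/
def IsOuterNormal (K F : Finset (E d)) (ν : E d) : Prop :=
  ‖ν‖ = 1 ∧ (∀ x ∈ F, ∀ y ∈ F, inner ℝ ν (x - y) = (0 : ℝ)) ∧
    ∀ a ∈ K, a ∉ F → ∀ y ∈ F, inner ℝ ν (a - y) < (0 : ℝ)

open Classical in
/-- The outer unit normal of the face `F` of `K`. -/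
def outerNormal (K F : Finset (E d)) : E d :=
  if h : ∃ ν, IsOuterNormal K F ν then h.choose else 0

/-- A matching simplicial mesh of the domain that conforms with the partitions of the boundary
and of the coefficients, with a fixed orientation of its faces. The elements are the
`d`-simplices of a simplicial complex. -/
structure Mesh (P : Problem d) where
  cx : Geometry.SimplicialComplex ℝ (E d)
  finite : cx.faces.Finite
  pure : ∀ s ∈ cx.faces, ∃ K ∈ cx.faces, s ⊆ K ∧ K.card = d + 1
  space_eq : cx.space = closure P.Ω
  conf_subdom : ∀ K ∈ cx.faces, K.card = d + 1 → ∃ Q ∈ P.subdom, hull K ⊆ closure Q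
  conf_Γ : ∀ F ∈ cx.faces, F.card = d → hull F ⊆ frontier P.Ω →
    hull F ⊆ closure P.ΓD ∨ hull F ⊆ closure P.ΓN ∨ hull F ⊆ closure P.ΓR
  conf_subrob : ∀ F ∈ cx.faces, F.card = d → hull F ⊆ closure P.ΓR → ∃ Q ∈ P.subrob, hull F ⊆ closure Q
  /-- the fixed unit normals of the faces -/
  nF : Finset (E d) → E d
  /-- `nF F` is one of the two unit normals of `F`, and it points outside `Ω` when `F` is an
  exterior face, since `F` is then a face of a single element -/
  nF_spec : ∀ F ∈ cx.faces, F.card = d →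
    ∃ K ∈ cx.faces, K.card = d + 1 ∧ F ⊆ K ∧ IsOuterNormal K F (nF F)

namespace Mesh

variable {P : Problem d} (T : Mesh P)

open Classical in
/-- The elements of the mesh, given by their vertices. -/
def cells : Finset (Finset (E d)) := T.finite.toFinset.filter (fun K => K.card = d + 1)

open Classical in
/-- The faces of the mesh, given by their vertices. -/
def faces : Finset (Finset (E d)) := T.finite.toFinset.filter (fun F => F.card = d)

open Classical in
def facesD : Finset (Finset (E d)) := T.faces.filter (fun F => hull F ⊆ closure P.ΓD)

open Classical in
def facesN : Finset (Finset (E d)) := T.faces.filter (fun F => hull F ⊆ closure P.ΓN)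

open Classical in
def facesR : Finset (Finset (E d)) := T.faces.filter (fun F => hull F ⊆ closure P.ΓR)

open Classical in
/-- The interior faces. -/
def facesI : Finset (Finset (E d)) := T.faces \ (T.facesD ∪ T.facesN ∪ T.facesR)

open Classical in
/-- The element having the exterior face `F` as a face. -/
def cellOf (F : Finset (E d)) : Finset (E d) :=
  if h : ∃ K ∈ T.cells, F ⊆ K then h.choose else ∅

/-- The trace on the face `F` of `v|_K`. -/
def faceTrace (K F : Finset (E d)) (v : Scal d) : Scal d :=
  trace (interior (hull K)) (hull F) v

/-- The diameters `h_K` and `h_F`. -/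
def diam (s : Finset (E d)) : ℝ := Metric.diam (hull s)

/-- `μ_K`: as `μ` is constant in the interior of `K`, it is evaluated at the centroid. -/
def μK (P : Problem d) (K : Finset (E d)) : ℝ := P.μ (K.centroid ℝ id)

/-- `α_K`, the least eigenvalue of the value of `A` in the interior of `K`. -/
def αK (P : Problem d) (K : Finset (E d)) : ℝ := minForm (P.A (K.centroid ℝ id))

def ϑK (P : Problem d) (K : Finset (E d)) : ℝ := √(αK P K / μK P K)

def αF (F : Finset (E d)) : ℝ := αK P (T.cellOf F)

/-- `γ_F`: as `γ` is constant in the relative interior of `F`, it is evaluated at the centroid. -/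
def γF (P : Problem d) (F : Finset (E d)) : ℝ := P.γ (F.centroid ℝ id)

def ϑF (F : Finset (E d)) : ℝ := T.αF F / γF P F

/-- The broken space `H¹(T_h)`. -/
def H1 : Set (Scal d) := {v | MemL2 P.Ω v ∧ ∀ K ∈ T.cells, MemH1 (interior (hull K)) v}

/-- The element-wise weak gradient. -/
def grad (v : Scal d) : Vect d := fun x =>
  ∑ K ∈ T.cells, (interior (hull K)).indicator (wgrad (interior (hull K)) v) x

/-- The piecewise polynomials `P_p(T_h)`. -/
def poly (p : ℕ) : Set (Scal d) :=
  {v | ∀ K ∈ T.cells, ∃ q : MvPolynomial (Fin d) ℂ, q.totalDegree ≤ p ∧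
    ∀ᵐ x ∂(volume.restrict (hull K)), v x = MvPolynomial.eval (fun i => ((x i : ℝ) : ℂ)) q}

/-- The vector-valued piecewise polynomials `[P_p(T_h)]^d`. -/
def polyVec (p : ℕ) : Set (Vect d) := {w | ∀ i, (fun x => w x i) ∈ T.poly p}

open Classical in
/-- The jump of `φ ∈ H¹(T_h)` through `F`. -/
def jump (φ : Scal d) (F : Finset (E d)) : Scal d := fun x =>
  if F ∈ T.facesI then
    ∑ K ∈ T.cells.filter (fun K => F ⊆ K),
      faceTrace K F φ x * ((inner ℝ (outerNormal K F) (T.nF F) : ℝ) : ℂ)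
  else if F ∈ T.facesD then faceTrace (T.cellOf F) F φ x
  else 0

open Classical in
/-- The average on `F` of a piecewise polynomial vector field. -/
def avg (w : Vect d) (F : Finset (E d)) : Vect d := fun x i =>
  if F ∈ T.facesI then
    (1 / 2 : ℂ) * ∑ K ∈ T.cells.filter (fun K => F ⊆ K), faceTrace K F (fun y => w y i) x
  else faceTrace (T.cellOf F) F (fun y => w y i) x

/-- `L` is the lifting of (the jumps of) `φ`. -/
def IsLift (p : ℕ) (φ : Scal d) (L : Vect d) : Prop :=
  L ∈ T.polyVec p ∧ ∀ w ∈ T.polyVec p,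
    ∫ x in P.Ω, L x ⬝ᵥ star (w x) =
      ∑ F ∈ T.faces, ∫ x in hull F,
        T.jump φ F x * conj (T.avg w F x ⬝ᵥ fun i => ((T.nF F i : ℝ) : ℂ)) ∂(surf d)

open Classical in
/-- The lifting operator. -/
def lift (p : ℕ) (φ : Scal d) : Vect d :=
  if h : ∃ L, T.IsLift p φ L then h.choose else 0

/-- The discrete gradient `𝔊(φ) = ∇φ - lift φ`. -/
def 𝔊 (p : ℕ) (φ : Scal d) : Vect d := fun x => T.grad φ x - T.lift p φ x

/-- `‖v‖_{μ,T_h}`. -/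
def normμ (_T : Mesh P) (v : Scal d) : ℝ := √(∫ x in P.Ω, P.μ x * ‖v x‖ ^ 2)

/-- `‖v‖_{γ,F_h^R}`. -/
def normγ (v : Scal d) : ℝ :=
  √(∑ F ∈ T.facesR, ∫ x in hull F, P.γ x * ‖faceTrace (T.cellOf F) F v x‖ ^ 2 ∂(surf d))

/-- The broken energy norm. -/
def energy (p : ℕ) (v : Scal d) : ℝ :=
  √(P.om ^ 2 * T.normμ v ^ 2 + P.om * T.normγ v ^ 2
    + ∫ x in P.Ω, (herm (P.A x) (T.𝔊 p v x) (T.𝔊 p v x)).re)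

/-- The norm `‖v‖_{†,1,T_h}`. -/
def dagger1 (p : ℕ) (v : Scal d) : ℝ :=
  √(∑ K ∈ T.cells,
      (max 1 (P.om ^ 2 * diam K ^ 2 / ϑK P K ^ 2) * (αK P K / diam K ^ 2) *
          (∫ x in hull K, ‖v x‖ ^ 2)
        + ∫ x in hull K, (herm (P.A x) (T.𝔊 p v x) (T.𝔊 p v x)).re)
    + ∑ F ∈ T.facesR, max 1 (P.om * diam F / T.ϑF F) * (T.αF F / diam F) *
        ∫ x in hull F, ‖faceTrace (T.cellOf F) F v x‖ ^ 2 ∂(surf d))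

/-- The norm `‖w‖_{†,div,T_h}`. -/
def daggerDiv (w : Vect d) : ℝ :=
  √(∑ K ∈ T.cells,
      ((∫ x in hull K, (herm (P.A x)⁻¹ (w x) (w x)).re)
        + diam K ^ 2 / αK P K * ∫ x in hull K, ‖wdiv P.Ω w x‖ ^ 2)
    + ∑ F ∈ T.facesR, diam F / T.αF F *
        ∫ x in hull F, ‖normalTrace P.Ω P.ΓR w x‖ ^ 2 ∂(surf d))

/-- `s` is a sesquilinear form on `H¹(T_h)` that vanishes as soon as one of its arguments belongs
to `H¹_{Γ_D}(Ω)`. -/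
structure IsStabilization (s : Scal d → Scal d → ℂ) : Prop where
  add_left : ∀ φ ∈ T.H1, ∀ φ' ∈ T.H1, ∀ v ∈ T.H1, s (φ + φ') v = s φ v + s φ' v
  smul_left : ∀ c : ℂ, ∀ φ ∈ T.H1, ∀ v ∈ T.H1, s (c • φ) v = c * s φ v
  add_right : ∀ φ ∈ T.H1, ∀ v ∈ T.H1, ∀ v' ∈ T.H1, s φ (v + v') = s φ v + s φ v'
  smul_right : ∀ c : ℂ, ∀ φ ∈ T.H1, ∀ v ∈ T.H1, s φ (c • v) = conj c * s φ v
  zero_left : ∀ φ ∈ P.V, ∀ v ∈ T.H1, s φ v = 0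
  zero_right : ∀ φ ∈ T.H1, ∀ v ∈ P.V, s φ v = 0

/-- The form `a_h`. -/
def ah (p : ℕ) (s : Scal d → Scal d → ℂ) (φ v : Scal d) : ℂ :=
  (∫ x in P.Ω, herm (P.A x) (T.𝔊 p φ x) (T.𝔊 p v x)) + s φ v

/-- The form `b_h`. -/
def bh (p : ℕ) (s : Scal d → Scal d → ℂ) (φ v : Scal d) : ℂ :=
  -(P.om : ℂ) ^ 2 * (∫ x in P.Ω, (P.μ x : ℂ) * φ x * conj (v x))
  - Complex.I * (P.om : ℂ) *
      (∑ F ∈ T.facesR, ∫ x in hull F, (P.γ x : ℂ) * faceTrace (T.cellOf F) F φ x *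
        conj (faceTrace (T.cellOf F) F v x) ∂(surf d))
  + T.ah p s φ v

/-- `uh` is a solution of the IPDG discretization. -/
def IsDiscreteSolution (p : ℕ) (s : Scal d → Scal d → ℂ) (f uh : Scal d) : Prop :=
  uh ∈ T.poly p ∧ ∀ v ∈ T.poly p, T.bh p s uh v = ∫ x in P.Ω, f x * conj (v x)

/-- The projection `π_h^g` onto the Lagrange space. -/
def πhg (p : ℕ) (v : Scal d) : Scal d := argmin (T.dagger1 p) (T.poly p ∩ P.V) v

/-- The projection `π_h^d` onto the BDM space. -/
def πhd (p : ℕ) (w : Vect d) : Vect d := argmin T.daggerDiv (T.polyVec p ∩ P.XN) w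

/-- The conforming projection `π^g`. -/
def πg (p : ℕ) (v : Scal d) : Scal d := argmin (T.dagger1 p) P.V v

/-- The approximation errors whose supremum is `γ̌_{ba,g}`. -/
def errVolG (p : ℕ) : Set ℝ :=
  {r | ∃ ψ ξ, P.UnitVol ψ ∧ P.IsDualVol ψ ξ ∧ r = T.dagger1 p (ξ - T.πhg p ξ)}

/-- The approximation errors whose supremum is `γ̃_{ba,g}`. -/
def errRobG (p : ℕ) : Set ℝ :=
  {r | ∃ Ψ χ, P.UnitRob Ψ ∧ P.IsDualRob Ψ χ ∧ r = T.dagger1 p (χ - T.πhg p χ)}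

/-- The approximation errors whose supremum is `γ̌_{ba,d}`. -/
def errVolD (p : ℕ) : Set ℝ :=
  {r | ∃ ψ ξ, P.UnitVol ψ ∧ P.IsDualVol ψ ξ ∧
    r = T.daggerDiv (P.flux ξ - T.πhd p (P.flux ξ))}

/-- The approximation errors whose supremum is `γ̃_{ba,d}`. -/
def errRobD (p : ℕ) : Set ℝ :=
  {r | ∃ Ψ χ, P.UnitRob Ψ ∧ P.IsDualRob Ψ χ ∧
    r = T.daggerDiv (P.flux χ - T.πhd p (P.flux χ))}

/-- The approximation factor `γ̌_{ba,g}`. -/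
def checkG (p : ℕ) : ℝ := sSup (T.errVolG p)

/-- The approximation factor `γ̃_{ba,g}` (zero if `Γ_R` is empty). -/
def tildeG (p : ℕ) : ℝ := sSup (T.errRobG p)

/-- The approximation factor `γ̌_{ba,d}`. -/
def checkD (p : ℕ) : ℝ := sSup (T.errVolD p)

/-- The approximation factor `γ̃_{ba,d}` (zero if `Γ_R` is empty). -/
def tildeD (p : ℕ) : ℝ := sSup (T.errRobD p)

end Mesh

end IPDG

end

open MeasureTheory Filter
open scoped Topology ContDiff Matrix ComplexConjugate

noncomputable section

namespace IPDG

variable {d : ℕ}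

/-! ### Barycentric coordinates of a simplex -/

/-! Put `e = u - uh` and let `ξ` solve the adjoint problem whose datum is `e` itself, normalised.
The right-hand side of the adjoint problem, evaluated at `e` (`dualRhs`), is then the norm to be
bounded, `ω‖e‖_μ` or `ω^{1/2}‖e‖_γ`. Since `e` is not conforming, it cannot be inserted into the
adjoint equation. With `w = π^g uh`, which lies in `V`, one writes `e = (u - w) - (uh - w)`; the
equation does hold for `u - w`, whence `dualRhs e = bh₀ e ξ + (bh₀ (uh - w) ξ - dualRhs (uh - w))`,
where `bh₀` is `b_h` without stabilization. This identity is the core of `norm_dualRhs_le`.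

In the term `bh₀ e ξ`, the conforming discrete function `π_h^g ξ` may be subtracted from `ξ`: the
stabilization vanishes on conforming test functions, so Galerkin orthogonality holds
(`bh₀_sub_eq_zero`). Cauchy–Schwarz (`norm_bh₀_le`) and `energy_le_dagger1` give the first product
of the estimate.

The second term is a nonconformity residual. By the strong form of the adjoint problem it equals `(𝔊
v, σ) + (v, div σ) - (v, σ·n)_{Γ_R}` with `v = uh - w` and `σ = A∇ξ` (`residual_eq`). The same
expression vanishes when `σ` is replaced by a piecewise polynomial field of `X_{Γ_N}`, because the
lifting in `𝔊` is designed to absorb the jump terms of the element-wise Green formula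
(`integral_𝔊_add_wdiv`). Hence `π_h^d σ` can be subtracted, and `norm_residual_le` gives the second
product.

The suprema are finite because well-posedness makes the adjoint problem solvable and stable
(`exists_isDual`, `exists_energy_le_dualNorm`). The coefficients are real and symmetric, so complex
conjugation turns the inf-sup condition for `b` into the one for its adjoint. As `0` belongs to each
approximation space, every error is at most the norm of the function approximated, which on a fixed
mesh is controlled by the data (`exists_error_le`).

Traces are defined as `L²` limits of smooth functions, and weak derivatives, traces and normal
traces are chosen representatives. Their uniqueness is therefore essential. It rests on a trace
inequality on a simplex, obtained from a divergence theorem which is itself proved by viewing the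
simplex as a cone over each of its faces. -/

/-- The vertices of a nondegenerate `d`-simplex of `ℝ^d` as an affine basis. -/
def IsSimplex.basis {K : Finset (E d)} (hK : IsSimplex d K) : AffineBasis K ℝ (E d) :=
  ⟨(↑), hK.2, by
    rw [hK.2.affineSpan_eq_top_iff_card_eq_finrank_add_one]
    simp [hK.1]⟩

open Classical in
/-- The barycentric coordinate attached to the vertex `a`. -/
def IsSimplex.coord {K : Finset (E d)} (hK : IsSimplex d K) (a : E d) : E d →ᵃ[ℝ] ℝ :=
  if h : a ∈ K then hK.basis.coord ⟨a, h⟩ else 0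

namespace IsSimplex

variable {K : Finset (E d)} (hK : IsSimplex d K)
include hK

lemma coord_of_mem {a : E d} (ha : a ∈ K) : hK.coord a = hK.basis.coord ⟨a, ha⟩ := by
  simp [coord, ha]

lemma range_basis : Set.range hK.basis = (K : Set (E d)) := by
  change Set.range ((↑) : K → E d) = _
  simp

lemma coord_self {a : E d} (ha : a ∈ K) : hK.coord a a = 1 := by
  rw [hK.coord_of_mem ha]
  exact hK.basis.coord_apply_eq ⟨a, ha⟩

lemma coord_ne {a b : E d} (ha : a ∈ K) (hb : b ∈ K) (hab : b ≠ a) : hK.coord a b = 0 := by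
  rw [hK.coord_of_mem ha]
  exact hK.basis.coord_apply_ne (i := ⟨a, ha⟩) (j := ⟨b, hb⟩) (by simpa using hab.symm)

lemma sum_coord (x : E d) : ∑ a ∈ K, hK.coord a x = 1 := by
  rw [← hK.basis.sum_coord_apply_eq_one x, ← Finset.sum_coe_sort K]
  exact Finset.sum_congr rfl fun i _ => by rw [hK.coord_of_mem i.2]

lemma sum_coord_smul (x : E d) : ∑ a ∈ K, hK.coord a x • a = x := by
  conv_rhs => rw [← hK.basis.linear_combination_coord_eq_self x]
  rw [← Finset.sum_coe_sort K]
  exact Finset.sum_congr rfl fun i _ => by rw [hK.coord_of_mem i.2]; rfl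

lemma mem_hull {x : E d} : x ∈ hull K ↔ ∀ a ∈ K, 0 ≤ hK.coord a x := by
  rw [hull, ← hK.range_basis, hK.basis.convexHull_eq_nonneg_coord]
  simp only [Set.mem_ofPred_eq, Subtype.forall]
  exact forall₂_congr fun a ha => by rw [hK.coord_of_mem ha]

lemma mem_interior_hull {x : E d} : x ∈ interior (hull K) ↔ ∀ a ∈ K, 0 < hK.coord a x := by
  rw [hull, ← hK.range_basis, hK.basis.interior_convexHull]
  simp only [Set.mem_ofPred_eq, Subtype.forall]
  exact forall₂_congr fun a ha => by rw [hK.coord_of_mem ha]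

lemma continuous_coord (a : E d) : Continuous (hK.coord a) :=
  (hK.coord a).continuous_of_finiteDimensional

lemma affine_ext {f g : E d →ᵃ[ℝ] ℝ} (h : ∀ a ∈ K, f a = g a) : f = g := by
  refine AffineMap.ext_on hK.basis.tot ?_
  rintro _ ⟨i, rfl⟩
  exact h i i.2

/-- A face of a simplex is cut out by the vanishing of the coordinates of the missing vertices. All
later comparisons of faces and elements are reduced to this criterion. -/
lemma mem_hull_subset {G : Finset (E d)} (hG : G ⊆ K) {x : E d} :
    x ∈ hull G ↔ x ∈ hull K ∧ ∀ a ∈ K, a ∉ G → hK.coord a x = 0 := by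
  constructor
  · refine fun hx => ⟨convexHull_mono (by exact_mod_cast hG) hx, fun a ha haG => ?_⟩
    have hc : Convex ℝ {y | hK.coord a y = 0} :=
      (convex_singleton (0 : ℝ)).affine_preimage (hK.coord a)
    refine convexHull_min ?_ hc hx
    intro b hb
    have hb : b ∈ G := hb
    exact hK.coord_ne ha (hG hb) (fun h => haG (h ▸ hb))
  · rintro ⟨hx, h0⟩
    rw [hK.mem_hull] at hx
    refine Finset.mem_convexHull'.2 ⟨fun a => hK.coord a x, fun a ha => hx a (hG ha), ?_, ?_⟩
    · rw [← hK.sum_coord x]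
      exact Finset.sum_subset hG h0
    · conv_rhs => rw [← hK.sum_coord_smul x]
      exact Finset.sum_subset hG fun a ha haG => by simp [h0 a ha haG]

open Classical in
lemma mem_hull_erase {a x : E d} (ha : a ∈ K) :
    x ∈ hull (K.erase a) ↔ x ∈ hull K ∧ hK.coord a x = 0 := by
  rw [hK.mem_hull_subset (K.erase_subset a)]
  refine and_congr_right fun _ => ⟨fun h => h a ha (by simp), fun h b hb hba => ?_⟩
  have : b = a := by simpa [hb] using hba
  rwa [this]

/-- Outer normals are multiples of the gradients of the barycentric coordinates. -/
lemma exists_height {a ν : E d} [DecidableEq (E d)] (hd : 1 ≤ d) (ha : a ∈ K)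
    (hν : IsOuterNormal K (K.erase a) ν) :
    ∃ H > 0, ∀ y, inner ℝ ν (y - a) = H * (1 - hK.coord a y) := by
  obtain ⟨-, h1, h2⟩ := hν
  have hne : (K.erase a).Nonempty := by
    rw [← Finset.card_pos, Finset.card_erase_of_mem ha, hK.1]; omega
  obtain ⟨f, hf⟩ := hne
  -- `H` is the height of `a` above its opposite face. The identity is affine in `y`, so it is
  -- checked at the vertices (`key`) and extended by barycentric combination.
  refine ⟨inner ℝ ν (f - a), ?_, ?_⟩
  · have := h2 a ha (by simp) f hf
    rw [← neg_sub, inner_neg_right] at this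
    linarith
  · have key : ∀ b ∈ K, inner ℝ ν (b - a) = inner ℝ ν (f - a) * (1 - hK.coord a b) := by
      intro b hb
      by_cases hba : b = a
      · subst hba; simp [hK.coord_self ha]
      · rw [hK.coord_ne ha hb hba]
        have := h1 b (by simp [hba, hb]) f hf
        have e : b - a = (b - f) + (f - a) := by abel
        rw [e, inner_add_right, this]; ring
    intro y
    have hy := hK.sum_coord_smul y
    have hs := hK.sum_coord y
    have e1 : y - a = ∑ b ∈ K, hK.coord b y • (b - a) := by
      simp_rw [smul_sub, Finset.sum_sub_distrib, hy, ← Finset.sum_smul, hs, one_smul]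
    rw [e1, inner_sum]
    have e2 : ∀ b ∈ K, inner ℝ ν (hK.coord b y • (b - a)) =
        inner ℝ ν (f - a) * hK.coord b y - inner ℝ ν (f - a) * (hK.coord b y * hK.coord a b) := by
      intro b hb
      rw [inner_smul_right, key b hb]; ring
    rw [Finset.sum_congr rfl e2, Finset.sum_sub_distrib, ← Finset.mul_sum, ← Finset.mul_sum, hs,
      Finset.sum_eq_single_of_mem a ha (fun b hb hba => by rw [hK.coord_ne ha hb hba, mul_zero]),
      hK.coord_self ha]
    ring

/-- The coordinate of `a` vanishes on the opposite face and equals `1` at `a`, so its gradient is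
orthogonal to the face and points inwards. The normal is minus its normalisation. -/
lemma exists_outerNormal {a : E d} [DecidableEq (E d)] (hd : 1 ≤ d) (ha : a ∈ K) :
    ∃ ν, IsOuterNormal K (K.erase a) ν := by
  set L : E d →L[ℝ] ℝ := LinearMap.toContinuousLinearMap (hK.coord a).linear with hL
  set g := (InnerProductSpace.toDual ℝ (E d)).symm L with hg
  have hgi : ∀ x y, inner ℝ g (x - y) = hK.coord a x - hK.coord a y := by
    intro x y
    rw [hg, InnerProductSpace.toDual_symm_apply]
    have := (hK.coord a).linearMap_vsub x y
    simpa [hL] using this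
  have hne : (K.erase a).Nonempty := by
    rw [← Finset.card_pos, Finset.card_erase_of_mem ha, hK.1]; omega
  obtain ⟨f, hf⟩ := hne
  have hf' := Finset.mem_erase.1 hf
  have hg0 : g ≠ 0 := by
    intro h
    have := hgi a f
    rw [h, inner_zero_left, hK.coord_self ha, hK.coord_ne ha hf'.2 hf'.1] at this
    norm_num at this
  have hgn : 0 < ‖g‖ := norm_pos_iff.2 hg0
  refine ⟨-(‖g‖⁻¹ • g), ?_, ?_, ?_⟩
  · rw [norm_neg, norm_smul, norm_inv, norm_norm, inv_mul_cancel₀ hgn.ne']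
  · intro x hx y hy
    have hx := Finset.mem_erase.1 hx
    have hy := Finset.mem_erase.1 hy
    rw [inner_neg_left, real_inner_smul_left, hgi, hK.coord_ne ha hx.2 hx.1,
      hK.coord_ne ha hy.2 hy.1]
    simp
  · intro b hb hbF y hy
    have hba : b = a := by simpa [hb] using hbF
    subst hba
    have hy := Finset.mem_erase.1 hy
    rw [inner_neg_left, real_inner_smul_left, hgi, hK.coord_self ha, hK.coord_ne ha hy.2 hy.1]
    have := inv_pos.2 hgn
    linarith

/-- The outer normal is unique, and for two simplices sharing a face on the same side of it. -/
lemma outerNormal_unique {K' : Finset (E d)} (hK' : IsSimplex d K') [DecidableEq (E d)]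
    (hd : 1 ≤ d) {a a' ν ν' : E d} (ha : a ∈ K) (ha' : a' ∈ K') (hF : K.erase a = K'.erase a')
    (hν : IsOuterNormal K (K.erase a) ν) (hν' : IsOuterNormal K' (K'.erase a') ν') :
    (0 < hK.coord a a' → ν' = ν) ∧ (hK.coord a a' < 0 → ν' = -ν) := by
  obtain ⟨H, hH, h⟩ := hK.exists_height hd ha hν
  obtain ⟨H', hH', h'⟩ := hK'.exists_height hd ha' hν'
  -- Both coordinates vanish on the common face, hence are proportional. The sign of the factor says
  -- whether `a'` lies on the same side of the face as `a`.
  have prop : hK.coord a = (hK.coord a a') • hK'.coord a' := by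
    refine hK'.affine_ext fun b hb => ?_
    by_cases hba : b = a'
    · subst hba; simp [hK'.coord_self ha']
    · have hbF : b ∈ K.erase a := by rw [hF]; simp [hb, hba]
      have hbF := Finset.mem_erase.1 hbF
      simp [hK'.coord_ne ha' hb hba, hK.coord_ne ha hbF.2 hbF.1]
  have diff : ∀ v, inner ℝ ν v = (H * hK.coord a a' / H') * inner ℝ ν' v := by
    intro v
    have e1 := h (a + v)
    have e2 := h a
    have e3 := h' (a' + (v + (a - a')))
    have e4 := h' (a' + (a - a'))
    rw [prop] at e1 e2
    simp only [AffineMap.coe_smul, Pi.smul_apply, smul_eq_mul] at e1 e2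
    have f1 : a' + (v + (a - a')) = a + v := by abel
    have f2 : a' + (a - a') = a := by abel
    have f3 : a + v - a' = v + (a - a') := by abel
    rw [f1] at e3
    rw [f2] at e4
    rw [f3, inner_add_right] at e3
    rw [add_sub_cancel_left] at e1
    rw [sub_self, inner_zero_right] at e2
    have e5 : inner ℝ ν' v = H' * (hK'.coord a' a - hK'.coord a' (a + v)) := by linarith
    rw [e1, e5]
    field_simp
    nlinarith
  have hvec : ν = (H * hK.coord a a' / H') • ν' := by
    refine ext_inner_right ℝ fun v => ?_
    rw [diff v, real_inner_smul_left]
  -- Both normals have length one, so the proportionality factor is `1` or `-1`.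
  have hn : |H * hK.coord a a' / H'| = 1 := by
    have := congrArg norm hvec
    rw [norm_smul, hν.1, hν'.1, mul_one] at this
    exact this.symm
  constructor
  · intro hp
    rw [abs_of_pos (by positivity)] at hn
    rw [hvec, hn, one_smul]
  · intro hp
    have : H * hK.coord a a' / H' < 0 := div_neg_of_neg_of_pos (mul_neg_of_pos_of_neg hH hp) hH'
    rw [abs_of_neg this] at hn
    rw [hvec, show H * hK.coord a a' / H' = -1 by linarith]
    simp

end IsSimplex

/-! ### The cone formula and the divergence theorem on a simplex -/

lemma finrank_E : Module.finrank ℝ (E d) = d := by simp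

lemma isCompact_hull (s : Finset (E d)) : IsCompact (hull s) :=
  s.finite_toSet.isCompact_convexHull (𝕜 := ℝ)

lemma measurableSet_hull (s : Finset (E d)) : MeasurableSet (hull s) :=
  (isCompact_hull s).isClosed.measurableSet

namespace IsSimplex

variable {K : Finset (E d)} (hK : IsSimplex d K)
include hK

lemma coord_homothety {a b : E d} (t : ℝ) (y : E d) :
    hK.coord b (AffineMap.homothety a t y) = hK.coord b a + t * (hK.coord b y - hK.coord b a) := by
  rw [AffineMap.homothety_apply]
  have := (hK.coord b).map_vadd a (t • (y -ᵥ a))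
  rw [this, map_smul, AffineMap.linearMap_vsub]
  simp [add_comm]

-- The volume is disintegrated along the hyperplanes orthogonal to `ν`. The slice of the simplex at
-- parameter `t` is the image of the face under the homothety of centre `a` and ratio `t`, which
-- multiplies the surface measure by `t^(d-1)`.
open Classical in
lemma volume_inter_hull {a ν : E d} (ha : a ∈ K) {H : ℝ} (hH : 0 < H) (hν : ‖ν‖ = 1)
    (h : ∀ y, inner ℝ ν (y - a) = H * (1 - hK.coord a y)) {B : Set (E d)} (hB : MeasurableSet B) :
    volume (B ∩ hull K) = ENNReal.ofReal H * ∫⁻ t in Set.Ioo (0 : ℝ) 1,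
      ENNReal.ofReal (t ^ (d - 1)) *
        surf d (hull (K.erase a) ∩ (AffineMap.homothety a t) ⁻¹' B) := by
  have hvol : (μHE[Module.finrank ℝ (E d)] : Measure (E d)) = volume :=
    InnerProductSpace.euclideanHausdorffMeasure_eq_volume
  have hv : H • ν ≠ 0 := smul_ne_zero hH.ne' (norm_ne_zero_iff.1 (by rw [hν]; norm_num))
  have hn : ‖H • ν‖ₑ = ENNReal.ofReal H := by
    rw [← ofReal_norm, norm_smul, hν, mul_one, Real.norm_of_nonneg hH.le]
  rw [← hvol, EuclideanGeometry.euclideanHausdorffMeasure_eq_lintegral a hv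
    (hB.inter (measurableSet_hull K)), hn, finrank_E]
  congr 1
  rw [← lintegral_indicator measurableSet_Ioo]
  refine lintegral_congr_ae ?_
  -- The endpoints are discarded as null sets; `t ≠ 0` makes the homothety invertible.
  have h0 : ∀ᵐ t : ℝ, t ≠ 0 := by simp [ae_iff]
  have h1 : ∀ᵐ t : ℝ, t ≠ 1 := by simp [ae_iff]
  -- The hyperplane of parameter `t` is the level set `1 - t` of the coordinate of `a`.
  have hmem : ∀ (t : ℝ) (y : E d),
      y ∈ AffineSubspace.mk' (t • (H • ν) +ᵥ a) (Submodule.span ℝ {H • ν})ᗮ ↔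
        hK.coord a y = 1 - t := by
    intro t y
    rw [AffineSubspace.mem_mk', Submodule.mem_orthogonal_singleton_iff_inner_right,
      real_inner_smul_left]
    have : y -ᵥ (t • (H • ν) +ᵥ a) = (y - a) - (t * H) • ν := by
      simp only [vsub_eq_sub, vadd_eq_add, smul_smul]; abel
    rw [this, inner_sub_right, h, real_inner_smul_right, real_inner_self_eq_norm_sq, hν]
    constructor
    · intro e
      have e1 : H * (H * ((1 - hK.coord a y) - t)) = 0 := by linarith
      have := (mul_eq_zero.1 ((mul_eq_zero.1 e1).resolve_left hH.ne')).resolve_left hH.ne'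
      linarith
    · intro e; rw [e]; ring
  filter_upwards [h0, h1] with t ht0 ht1
  by_cases ht : t ∈ Set.Ioo (0 : ℝ) 1
  · rw [Set.indicator_of_mem ht]
    have himg : B ∩ hull K ∩ ↑(AffineSubspace.mk' (t • (H • ν) +ᵥ a) (Submodule.span ℝ {H • ν})ᗮ) =
        AffineMap.homothety a t '' (hull (K.erase a) ∩ (AffineMap.homothety a t) ⁻¹' B) := by
      ext x
      constructor
      · rintro ⟨⟨hxB, hxK⟩, hx⟩
        have hx : hK.coord a x = 1 - t := (hmem t x).1 hx
        have hinv : AffineMap.homothety a t (AffineMap.homothety a t⁻¹ x) = x := by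
          rw [← AffineMap.homothety_mul_apply, mul_inv_cancel₀ ht0]; simp
        refine ⟨AffineMap.homothety a t⁻¹ x, ⟨?_, ?_⟩, hinv⟩
        · rw [hK.mem_hull_erase ha, hK.mem_hull]
          rw [hK.mem_hull] at hxK
          have ha0 : hK.coord a (AffineMap.homothety a t⁻¹ x) = 0 := by
            rw [hK.coord_homothety, hK.coord_self ha, hx]; field_simp; ring
          refine ⟨fun b hb => ?_, ha0⟩
          by_cases hba : b = a
          · subst hba; exact ha0.ge
          · rw [hK.coord_homothety, hK.coord_ne hb ha (Ne.symm hba)]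
            have := hxK b hb
            have := inv_pos.2 ht.1
            simp only [sub_zero, zero_add]; positivity
        · rwa [Set.mem_preimage, hinv]
      · rintro ⟨y, ⟨hyF, hyB⟩, rfl⟩
        rw [hK.mem_hull_erase ha, hK.mem_hull] at hyF
        refine ⟨⟨hyB, ?_⟩, ?_⟩
        · rw [hK.mem_hull]
          intro b hb
          rw [hK.coord_homothety]
          have h1 := hyF.1 b hb
          by_cases hba : b = a
          · subst hba; rw [hK.coord_self ha, hyF.2]; linarith [ht.2]
          · rw [hK.coord_ne hb ha (Ne.symm hba)]
            have := ht.1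
            simp only [sub_zero, zero_add]; positivity
        · refine (hmem t _).2 ?_
          rw [hK.coord_homothety, hK.coord_self ha, hyF.2]; ring
    rw [himg, euclideanHausdorffMeasure_homothety_image _ _ ht0, ENNReal.smul_def, smul_eq_mul]
    congr 1
    rw [← ENNReal.ofReal_coe_nnreal]
    congr 1
    simp [abs_of_pos ht.1]
  · rw [Set.indicator_of_notMem ht]
    have hemp : B ∩ hull K ∩ ↑(AffineSubspace.mk' (t • (H • ν) +ᵥ a) (Submodule.span ℝ {H • ν})ᗮ) =
        ∅ := by
      ext x
      simp only [Set.mem_empty_iff_false, iff_false]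
      rintro ⟨⟨-, hxK⟩, hx⟩
      have hx : hK.coord a x = 1 - t := (hmem t x).1 hx
      rw [hK.mem_hull] at hxK
      have h2 := hxK a ha
      have h3 := hK.sum_coord x
      have h4 := Finset.single_le_sum (f := fun b => hK.coord b x) hxK ha
      simp only [h3] at h4
      exact ht ⟨lt_of_le_of_ne (by linarith) (Ne.symm ht0), lt_of_le_of_ne (by linarith) ht1⟩
    rw [hemp, measure_empty]

-- A face of infinite surface measure would, by the cone formula, give infinite volume to a compact
-- simplex.
open Classical in
lemma surf_hull_erase_lt_top (hd : 1 ≤ d) {a : E d} (ha : a ∈ K) :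
    surf d (hull (K.erase a)) < ⊤ := by
  obtain ⟨ν, hν⟩ := hK.exists_outerNormal hd ha
  obtain ⟨H, hH, h⟩ := hK.exists_height hd ha hν
  have key := hK.volume_inter_hull ha hH hν.1 h MeasurableSet.univ
  simp only [Set.univ_inter, Set.preimage_univ, Set.inter_univ] at key
  rw [lintegral_mul_const _ (by fun_prop)] at key
  by_contra hc
  have htop : surf d (hull (K.erase a)) = ⊤ := not_lt_top_iff.1 hc
  have hpos : (∫⁻ t in Set.Ioo (0 : ℝ) 1, ENNReal.ofReal (t ^ (d - 1))) ≠ 0 := by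
    rw [Ne, lintegral_eq_zero_iff (by fun_prop)]
    intro h0
    have h1 : ∀ᵐ t ∂(volume.restrict (Set.Ioo (0 : ℝ) 1)), False := by
      filter_upwards [h0, ae_restrict_mem measurableSet_Ioo] with t ht ht'
      have : (0:ℝ) < t ^ (d - 1) := pow_pos ht'.1 _
      simp only [Pi.zero_apply, ENNReal.ofReal_eq_zero] at ht
      linarith
    rw [ae_iff] at h1
    simp at h1
  rw [htop, ENNReal.mul_top hpos, ENNReal.mul_top (by simpa using hH)] at key
  exact (isCompact_hull K).measure_lt_top.ne key

-- Stating the cone formula as an identity between measures allows Fubini's theorem to be applied to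
-- complex-valued integrands.
open Classical in
lemma restrict_hull_eq_map (hd : 1 ≤ d) {a ν : E d} (ha : a ∈ K) {H : ℝ} (hH : 0 < H)
    (hν : ‖ν‖ = 1) (h : ∀ y, inner ℝ ν (y - a) = H * (1 - hK.coord a y)) :
    volume.restrict (hull K) = (((volume.restrict (Set.Ioo (0 : ℝ) 1)).withDensity
      (fun t => ENNReal.ofReal (H * t ^ (d - 1)))).prod
        ((surf d).restrict (hull (K.erase a)))).map (fun q : ℝ × E d => a + q.1 • (q.2 - a)) := by
  have : IsFiniteMeasure ((surf d).restrict (hull (K.erase a))) :=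
    isFiniteMeasure_restrict.2 (hK.surf_hull_erase_lt_top hd ha).ne
  have hcont : Continuous (fun q : ℝ × E d => a + q.1 • (q.2 - a)) := by fun_prop
  ext B hB
  rw [Measure.restrict_apply hB, Measure.map_apply hcont.measurable hB,
    Measure.prod_apply (hcont.measurable hB), hK.volume_inter_hull ha hH hν h hB,
    lintegral_withDensity_eq_lintegral_mul _ (by fun_prop)
      (measurable_measure_prodMk_left (hcont.measurable hB)), ← lintegral_const_mul']
  · refine setLIntegral_congr_fun measurableSet_Ioo fun t ht => ?_
    simp only [Pi.mul_apply]
    rw [ENNReal.ofReal_mul hH.le, mul_assoc]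
    congr 2
    rw [Measure.restrict_apply (by
      exact (hcont.measurable hB).preimage (measurable_prodMk_left)), Set.inter_comm]
    congr 1
    ext y
    simp only [Set.mem_inter_iff, Set.mem_preimage, AffineMap.homothety_apply, vsub_eq_sub,
      vadd_eq_add]
    rw [add_comm a]
  · exact ENNReal.ofReal_ne_top

open Classical in
/-- Integration over a simplex seen as a cone over one of its faces. -/
lemma setIntegral_hull (hd : 1 ≤ d) {a ν : E d} (ha : a ∈ K) {H : ℝ} (hH : 0 < H)
    (hν : ‖ν‖ = 1) (h : ∀ y, inner ℝ ν (y - a) = H * (1 - hK.coord a y)) {g : E d → ℂ}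
    (hg : Continuous g) :
    ∫ x in hull K, g x = ∫ y in hull (K.erase a),
      (∫ t in Set.Ioo (0 : ℝ) 1, (H * t ^ (d - 1)) • g (a + t • (y - a))) ∂(surf d) := by
  have hfin : IsFiniteMeasure ((surf d).restrict (hull (K.erase a))) :=
    isFiniteMeasure_restrict.2 (hK.surf_hull_erase_lt_top hd ha).ne
  have hcont : Continuous (fun q : ℝ × E d => a + q.1 • (q.2 - a)) := by fun_prop
  have hI : Integrable g (volume.restrict (hull K)) :=
    hg.continuousOn.integrableOn_compact (isCompact_hull K)
  have hmap := hK.restrict_hull_eq_map hd ha hH hν h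
  rw [hmap] at hI
  have hI' := (integrable_map_measure hI.aestronglyMeasurable hcont.measurable.aemeasurable).1 hI
  rw [hmap, integral_map hcont.measurable.aemeasurable hI.aestronglyMeasurable,
    integral_prod_symm (fun q : ℝ × E d => g (a + q.1 • (q.2 - a))) hI']
  refine integral_congr_ae (Eventually.of_forall fun y => ?_)
  simp only
  rw [integral_withDensity_eq_integral_toReal_smul (by fun_prop) (by simp)]
  refine setIntegral_congr_fun measurableSet_Ioo fun t ht => ?_
  rw [ENNReal.toReal_ofReal]
  have := ht.1
  positivity

open Classical in
/-- The divergence theorem for the fields `g (x - a)`. -/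
lemma integral_radial (hd : 1 ≤ d) {a ν : E d} (ha : a ∈ K) {H : ℝ} (hH : 0 < H)
    (hν : ‖ν‖ = 1) (h : ∀ y, inner ℝ ν (y - a) = H * (1 - hK.coord a y)) {g : E d → ℂ}
    (hg : ContDiff ℝ 1 g) :
    ∫ x in hull K, (d * g x + fderiv ℝ g x (x - a)) =
      H * ∫ y in hull (K.erase a), g y ∂(surf d) := by
  have hg' : Continuous (fderiv ℝ g) := hg.continuous_fderiv (by norm_num)
  have hc : Continuous fun x => (d * g x + fderiv ℝ g x (x - a)) := by
    have := hg.continuous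
    fun_prop
  rw [hK.setIntegral_hull hd ha hH hν h hc, ← integral_const_mul]
  refine integral_congr_ae (Eventually.of_forall fun y => ?_)
  simp only
  -- On the ray from `a` to `y` the integrand is the derivative of `H t^d g(a + t(y - a))`. Its
  -- primitive vanishes at `t = 0` because `d ≥ 1`, so only the value on the face remains.
  have hder : ∀ t ∈ Set.uIcc (0 : ℝ) 1, HasDerivAt
      (fun t : ℝ => ((H * t ^ d : ℝ) : ℂ) * g (a + t • (y - a)))
      ((H * t ^ (d - 1)) • (d * g (a + t • (y - a)) +
        fderiv ℝ g (a + t • (y - a)) (a + t • (y - a) - a))) t := by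
    intro t _
    have h1 : HasDerivAt (fun t : ℝ => a + t • (y - a)) (y - a) t := by
      simpa using ((hasDerivAt_id t).smul_const (y - a)).const_add a
    have h2 := ((hg.differentiable (by norm_num)) (a + t • (y - a))).hasFDerivAt.comp_hasDerivAt t h1
    have h3 : HasDerivAt (fun t : ℝ => ((H * t ^ d : ℝ) : ℂ)) ((H * (d * t ^ (d - 1)) : ℝ) : ℂ) t :=
      ((hasDerivAt_pow d t).const_mul H).ofReal_comp
    convert! h3.mul h2 using 1
    have e : t ^ d = t ^ (d - 1) * t := by
      rw [← pow_succ, Nat.sub_add_cancel hd]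
    rw [add_sub_cancel_left, map_smul, e]
    simp only [Complex.real_smul, Function.comp]
    push_cast
    ring
  have hFTC := intervalIntegral.integral_eq_sub_of_hasDerivAt hder
    (Continuous.intervalIntegrable (by fun_prop) _ _)
  rw [← integral_Ioc_eq_integral_Ioo, ← intervalIntegral.integral_of_le zero_le_one, hFTC]
  simp [show d ≠ 0 by omega]

open Classical in
/-- The divergence theorem on a simplex. -/
theorem integral_fderiv (hd : 1 ≤ d) {g : E d → ℂ} (hg : ContDiff ℝ 1 g) (e : E d) :
    ∫ x in hull K, fderiv ℝ g x e = ∑ a ∈ K,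
      ((inner ℝ (outerNormal K (K.erase a)) e : ℝ) : ℂ) *
        ∫ y in hull (K.erase a), g y ∂(surf d) := by
  have hν : ∀ a ∈ K, IsOuterNormal K (K.erase a) (outerNormal K (K.erase a)) := by
    intro a ha
    have := hK.exists_outerNormal hd ha
    rw [outerNormal, dif_pos this]
    exact this.choose_spec
  choose! H hH h using fun a ha => hK.exists_height hd ha (hν a ha)
  have hg' : Continuous (fderiv ℝ g) := hg.continuous_fderiv (by norm_num)
  -- With these weights the constant field `e` equals `∑ c a • (x - a)` for every `x`. It is thus a
  -- combination of radial fields, and `x - a` has a nonzero normal component only on the face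
  -- opposite to `a`.
  set c : E d → ℝ := fun a => inner ℝ (outerNormal K (K.erase a)) e / H a with hc
  have hlin : ∀ a ∈ K, (hK.coord a).linear e = - c a := by
    intro a ha
    have e1 := h a ha (a + e)
    have e2 := (hK.coord a).map_vadd a e
    simp only [vadd_eq_add] at e2
    rw [add_sub_cancel_left, add_comm, e2, hK.coord_self ha] at e1
    simp only [hc]
    rw [e1]
    field_simp [(hH a ha).ne']
    ring
  have hdec : ∀ x : E d, e = ∑ a ∈ K, c a • (x - a) := by
    intro x
    have e1 : ∀ x : E d, ∑ a ∈ K, (hK.coord a) (x + e) • a - ∑ a ∈ K, hK.coord a x • a = e := by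
      intro x; rw [hK.sum_coord_smul, hK.sum_coord_smul]; abel
    have e2 : ∀ a ∈ K, hK.coord a (x + e) - hK.coord a x = - c a := by
      intro a ha
      rw [← hlin a ha]
      have e2 := (hK.coord a).map_vadd x e
      simp only [vadd_eq_add] at e2
      rw [add_comm, e2]; ring
    have e3 : ∑ a ∈ K, c a = 0 := by
      have : ∑ a ∈ K, -c a = 0 := by
        rw [← Finset.sum_congr rfl e2, Finset.sum_sub_distrib, hK.sum_coord, hK.sum_coord, sub_self]
      rw [Finset.sum_neg_distrib] at this
      linarith
    conv_lhs => rw [← e1 x, ← Finset.sum_sub_distrib]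
    simp_rw [smul_sub, Finset.sum_sub_distrib, ← Finset.sum_smul, e3, zero_smul, zero_sub]
    rw [← Finset.sum_neg_distrib]
    rw [← Finset.sum_sub_distrib]
    refine Finset.sum_congr rfl fun a ha => ?_
    rw [← sub_smul, e2 a ha, neg_smul]
  -- Comparing the decomposition of `e` at two base points shows that the weights sum to zero, which
  -- removes the undifferentiated terms `d * g x`.
  have hc0 : ∑ a ∈ K, c a = 0 := by
    have h1 := hdec 0
    have h2 := hdec e
    simp_rw [smul_sub, Finset.sum_sub_distrib, ← Finset.sum_smul] at h1 h2
    rw [smul_zero] at h1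
    have h3 : (∑ a ∈ K, c a) • e = 0 := by
      have : (∑ a ∈ K, c a) • e = ((∑ a ∈ K, c a) • e - ∑ a ∈ K, c a • a) -
        (0 - ∑ a ∈ K, c a • a) := by abel
      rw [this, ← h1, ← h2, sub_self]
    rcases smul_eq_zero.1 h3 with h4 | h4
    · exact h4
    · subst h4; simp [hc]
  have hrad : ∀ a ∈ K, IntegrableOn (fun x => (c a : ℂ) * (d * g x + fderiv ℝ g x (x - a)))
      (hull K) := by
    intro a _
    refine ContinuousOn.integrableOn_compact (isCompact_hull K) (Continuous.continuousOn ?_)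
    have := hg.continuous
    fun_prop
  calc ∫ x in hull K, fderiv ℝ g x e
      = ∫ x in hull K, ∑ a ∈ K, (c a : ℂ) * (d * g x + fderiv ℝ g x (x - a)) := by
        refine integral_congr_ae (Eventually.of_forall fun x => ?_)
        simp only
        conv_lhs => rw [hdec x]
        rw [map_sum]
        simp_rw [mul_add, Finset.sum_add_distrib, ← Finset.sum_mul, ← Complex.ofReal_sum, hc0]
        simp
    _ = ∑ a ∈ K, (c a : ℂ) * (H a * ∫ y in hull (K.erase a), g y ∂(surf d)) := by
        rw [integral_finsetSum _ hrad]
        refine Finset.sum_congr rfl fun a ha => ?_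
        rw [integral_const_mul, hK.integral_radial hd ha (hH a ha) (hν a ha).1 (h a ha) hg]
    _ = _ := by
        refine Finset.sum_congr rfl fun a ha => ?_
        rw [← mul_assoc]
        congr 1
        rw [← Complex.ofReal_mul]
        congr 1
        simp only [hc]
        field_simp [(hH a ha).ne']

end IsSimplex

/-! ### Null sets -/

/-- The Hausdorff dimension of the subspace is that of its direction, hence below `d - 1`. -/
lemma surf_affineSubspace (A : AffineSubspace ℝ (E d)) (h : Module.finrank ℝ A.direction < d - 1) :
    surf d (A : Set (E d)) = 0 := by
  rcases (A : Set (E d)).eq_empty_or_nonempty with h0 | ⟨p, hp⟩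
  · rw [h0, measure_empty]
  have hsub : (A : Set (E d)) ⊆ Set.range (fun v : A.direction => (v : E d) + p) := by
    intro x hx
    exact ⟨⟨x - p, A.vsub_mem_direction hx hp⟩, by simp⟩
  have hL : LipschitzWith 1 (fun v : A.direction => (v : E d) + p) :=
    LipschitzWith.of_dist_le_mul fun x y => by simp [Subtype.dist_eq]
  have hdim : dimH (A : Set (E d)) < ((d - 1 : ℕ) : NNReal) := by
    refine (dimH_mono hsub).trans_lt (hL.dimH_range_le.trans_lt ?_)
    rw [Real.dimH_univ_eq_finrank]
    exact_mod_cast h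
  have := hausdorffMeasure_of_dimH_lt hdim
  rw [surf, Measure.euclideanHausdorffMeasure_def, Measure.smul_apply]
  simp only [NNReal.coe_natCast] at this
  rw [this, smul_zero]

lemma surf_hull_of_card_lt {s : Finset (E d)} (hs : s.card < d) : surf d (hull s) = 0 := by
  refine measure_mono_null (convexHull_subset_affineSpan _) ?_
  rcases s.eq_empty_or_nonempty with h0 | hne
  · simp [h0]
  refine surf_affineSubspace _ ?_
  rw [direction_affineSpan]
  have hc := Finset.card_pos.2 hne
  have h2 := finrank_vectorSpan_range_le ℝ (Subtype.val : s → E d) (n := s.card - 1)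
    (by simp; omega)
  rw [show Set.range (Subtype.val : s → E d) = (s : Set (E d)) by simp] at h2
  omega

lemma volume_hull_of_card_le {s : Finset (E d)} (hs : s.card ≤ d) : volume (hull s) = 0 := by
  refine measure_mono_null (convexHull_subset_affineSpan _) ?_
  refine Measure.addHaar_affineSubspace _ _ fun htop => ?_
  rcases s.eq_empty_or_nonempty with h0 | hne
  · have : (⊥ : AffineSubspace ℝ (E d)) = ⊤ := by rw [← htop, h0]; simp
    exact bot_ne_top this
  have hc := Finset.card_pos.2 hne
  have h2 := finrank_vectorSpan_range_le ℝ (Subtype.val : s → E d) (n := s.card - 1)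
    (by simp; omega)
  rw [show Set.range (Subtype.val : s → E d) = (s : Set (E d)) by simp] at h2
  have h3 := congrArg (fun A : AffineSubspace ℝ (E d) => Module.finrank ℝ A.direction) htop
  rw [direction_affineSpan, AffineSubspace.direction_top, finrank_top, finrank_E] at h3
  omega

/-- The frontier of a convex set is null. Elements can thus be taken open for weak derivatives and
closed for integrals. -/
lemma ae_restrict_hull (s : Finset (E d)) :
    volume.restrict (interior (hull s)) = volume.restrict (hull s) := by
  refine Measure.restrict_congr_set ?_
  refine (ae_eq_set).2 ⟨?_, ?_⟩
  · rw [Set.sdiff_eq_empty.2 interior_subset, measure_empty]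
  · refine measure_mono_null ?_ ((convex_convexHull ℝ (s : Set (E d))).addHaar_frontier volume)
    exact Set.sdiff_subset_sdiff_left subset_closure

/-! ### Square integrable functions -/

section L2

variable {α : Type*} [MeasurableSpace α] {m : Measure α}

lemma eLpNorm_two_sq (f : α → ℂ) : eLpNorm f 2 m ^ 2 = ∫⁻ x, ‖f x‖ₑ ^ 2 ∂m := by
  have := eLpNorm_nnreal_pow_eq_lintegral (μ := m) (f := f) (p := 2) (by norm_num)
  simpa using this

lemma integrable_mul_of_memLp {f g : α → ℂ} (hf : MemLp f 2 m) (hg : MemLp g 2 m) :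
    Integrable (fun x => f x * g x) m :=
  hf.integrable_mul hg

lemma tendsto_integral_mul {f : ℕ → α → ℂ} {g h : α → ℂ} (hf : ∀ n, MemLp (f n) 2 m)
    (hg : MemLp g 2 m) (hh : MemLp h 2 m)
    (hlim : Tendsto (fun n => eLpNorm (f n - g) 2 m) atTop (𝓝 0)) :
    Tendsto (fun n => ∫ x, f n x * h x ∂m) atTop (𝓝 (∫ x, g x * h x ∂m)) := by
  refine tendsto_integral_of_L1' _ (integrable_mul_of_memLp hg hh).aestronglyMeasurable
    (Eventually.of_forall fun n => integrable_mul_of_memLp (hf n) hh) ?_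
  have h0 : Tendsto (fun n => eLpNorm (f n - g) 2 m * eLpNorm h 2 m) atTop (𝓝 0) := by
    have := ENNReal.Tendsto.mul_const (b := eLpNorm h 2 m) hlim (Or.inr hh.2.ne)
    simpa using this
  refine tendsto_of_tendsto_of_tendsto_of_le_of_le tendsto_const_nhds h0 (fun _ => zero_le) ?_
  intro n
  have e : (fun x => f n x * h x) - (fun x => g x * h x) = (f n - g) • h := by
    ext x; simp [sub_mul]
  simp only [e]
  exact eLpNorm_smul_le_mul_eLpNorm hh.1 ((hf n).sub hg).1

lemma eLpNorm_star (f : α → ℂ) : eLpNorm (star f) 2 m = eLpNorm f 2 m :=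
  eLpNorm_congr_norm_ae (Eventually.of_forall fun x => by simp)

lemma tendsto_eLpNorm_add {f f' : ℕ → α → ℂ} {g g' : α → ℂ} (hf : ∀ n, AEStronglyMeasurable (f n) m)
    (hf' : ∀ n, AEStronglyMeasurable (f' n) m) (hg : AEStronglyMeasurable g m)
    (hg' : AEStronglyMeasurable g' m) (h : Tendsto (fun n => eLpNorm (f n - g) 2 m) atTop (𝓝 0))
    (h' : Tendsto (fun n => eLpNorm (f' n - g') 2 m) atTop (𝓝 0)) :
    Tendsto (fun n => eLpNorm ((f n + f' n) - (g + g')) 2 m) atTop (𝓝 0) := by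
  have h0 := h.add h'
  rw [add_zero] at h0
  refine tendsto_of_tendsto_of_tendsto_of_le_of_le tendsto_const_nhds h0 (fun _ => zero_le) ?_
  intro n
  simp only [add_sub_add_comm]
  exact eLpNorm_add_le ((hf n).sub hg) ((hf' n).sub hg') (by norm_num)

lemma tendsto_eLpNorm_smul {f : ℕ → α → ℂ} {g : α → ℂ} (c : ℂ)
    (h : Tendsto (fun n => eLpNorm (f n - g) 2 m) atTop (𝓝 0)) :
    Tendsto (fun n => eLpNorm (c • f n - c • g) 2 m) atTop (𝓝 0) := by
  simp_rw [← smul_sub, eLpNorm_const_smul]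
  simpa using ENNReal.Tendsto.const_mul (a := ‖c‖ₑ) h (Or.inr (by simp))

lemma tendsto_eLpNorm_star {f : ℕ → α → ℂ} {g : α → ℂ}
    (h : Tendsto (fun n => eLpNorm (f n - g) 2 m) atTop (𝓝 0)) :
    Tendsto (fun n => eLpNorm (star (f n) - star g) 2 m) atTop (𝓝 0) := by
  simp_rw [← star_sub, eLpNorm_star]
  exact h

lemma ae_eq_of_tendsto_eLpNorm {f f' : ℕ → α → ℂ} {g g' : α → ℂ}
    (hf : ∀ n, AEStronglyMeasurable (f n) m) (hf' : ∀ n, AEStronglyMeasurable (f' n) m)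
    (hg : AEStronglyMeasurable g m) (hg' : AEStronglyMeasurable g' m)
    (h : Tendsto (fun n => eLpNorm (f n - g) 2 m) atTop (𝓝 0))
    (h' : Tendsto (fun n => eLpNorm (f' n - g') 2 m) atTop (𝓝 0))
    (hd : Tendsto (fun n => eLpNorm (f n - f' n) 2 m) atTop (𝓝 0)) : g =ᵐ[m] g' := by
  have h0 := (hd.add h).add h'
  simp only [add_zero] at h0
  have hle : ∀ n, eLpNorm (g - g') 2 m ≤
      eLpNorm (f n - f' n) 2 m + eLpNorm (f n - g) 2 m + eLpNorm (f' n - g') 2 m := by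
    intro n
    have e : g - g' = (f n - f' n) - (f n - g) + (f' n - g') := by abel
    rw [e]
    refine (eLpNorm_add_le (((hf n).sub (hf' n)).sub ((hf n).sub hg)) ((hf' n).sub hg')
      (by norm_num)).trans ?_
    gcongr
    exact eLpNorm_sub_le ((hf n).sub (hf' n)) ((hf n).sub hg) (by norm_num)
  have hz : eLpNorm (g - g') 2 m = 0 := le_antisymm (ge_of_tendsto' h0 hle) zero_le
  rw [eLpNorm_eq_zero_iff (hg.sub hg') (by norm_num)] at hz
  filter_upwards [hz] with x hx
  simpa [sub_eq_zero] using hx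

/-- Completeness of `L²`. -/
lemma exists_tendsto_eLpNorm {f : ℕ → α → ℂ} (hf : ∀ n, MemLp (f n) 2 m)
    (hc : Tendsto (fun n : ℕ × ℕ => eLpNorm (f n.1 - f n.2) 2 m) atTop (𝓝 0)) :
    ∃ g, MemLp g 2 m ∧ Tendsto (fun n => eLpNorm (f n - g) 2 m) atTop (𝓝 0) := by
  have hC : CauchySeq fun n => (hf n).toLp (f n) := by
    rw [Lp.cauchySeq_Lp_iff_cauchySeq_eLpNorm]
    refine hc.congr fun n => ?_
    exact eLpNorm_congr_ae ((hf n.1).coeFn_toLp.symm.sub (hf n.2).coeFn_toLp.symm)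
  obtain ⟨G, hG⟩ := cauchySeq_tendsto_of_complete hC
  refine ⟨G, Lp.memLp G, ?_⟩
  rw [Lp.tendsto_Lp_iff_tendsto_eLpNorm'] at hG
  refine hG.congr fun n => ?_
  exact eLpNorm_congr_ae ((hf n).coeFn_toLp.sub (ae_eq_refl _))

end L2

/-! ### Classical gradients and test functions -/

lemma cgrad_add {φ ψ : Scal d} (hφ : Differentiable ℝ φ) (hψ : Differentiable ℝ ψ) (x : E d)
    (i : Fin d) : cgrad (φ + ψ) x i = cgrad φ x i + cgrad ψ x i := by
  simp [cgrad, fderiv_add (hφ x) (hψ x)]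

lemma cgrad_sub {φ ψ : Scal d} (hφ : Differentiable ℝ φ) (hψ : Differentiable ℝ ψ) (x : E d)
    (i : Fin d) : cgrad (φ - ψ) x i = cgrad φ x i - cgrad ψ x i := by
  simp [cgrad, fderiv_sub (hφ x) (hψ x)]

lemma cgrad_smul {φ : Scal d} (hφ : Differentiable ℝ φ) (c : ℂ) (x : E d) (i : Fin d) :
    cgrad (c • φ) x i = c * cgrad φ x i := by
  simp [cgrad, fderiv_const_smul (hφ x) c]

lemma cgrad_mul {φ ψ : Scal d} (hφ : Differentiable ℝ φ) (hψ : Differentiable ℝ ψ) (x : E d)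
    (i : Fin d) : cgrad (fun x => φ x * ψ x) x i = φ x * cgrad ψ x i + ψ x * cgrad φ x i := by
  simp [cgrad, fderiv_fun_mul (hφ x) (hψ x)]

lemma cgrad_star {φ : Scal d} (hφ : Differentiable ℝ φ) (x : E d) (i : Fin d) :
    cgrad (star φ) x i = star (cgrad φ x i) := by
  have h := (Complex.conjCLE : ℂ →L[ℝ] ℂ).hasFDerivAt.comp x (hφ x).hasFDerivAt
  have h' : HasFDerivAt (star φ) ((Complex.conjCLE : ℂ →L[ℝ] ℂ).comp (fderiv ℝ φ x)) x := h
  simp [cgrad, h'.fderiv]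

lemma contDiff_star {φ : Scal d} {n : WithTop ℕ∞} (hφ : ContDiff ℝ n φ) : ContDiff ℝ n (star φ) :=
  (Complex.conjCLE : ℂ →L[ℝ] ℂ).contDiff.comp hφ

lemma contDiff_cgrad {φ : Scal d} (hφ : ContDiff ℝ ∞ φ) (i : Fin d) :
    ContDiff ℝ ∞ (fun x => cgrad φ x i) :=
  (hφ.fderiv_right (m := ∞) (by norm_cast)).clm_apply contDiff_const

lemma _root_.ContDiff.diff {φ : Scal d} (hφ : ContDiff ℝ ∞ φ) : Differentiable ℝ φ :=
  hφ.differentiable (by norm_num)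

lemma continuous_cgrad {φ : Scal d} (hφ : ContDiff ℝ ∞ φ) (i : Fin d) :
    Continuous (fun x => cgrad φ x i) := (contDiff_cgrad hφ i).continuous

lemma cgrad_eq_zero_of_notMem {φ : Scal d} {x : E d} (hx : x ∉ tsupport φ) (i : Fin d) :
    cgrad φ x i = 0 := by
  have : fderiv ℝ φ x = 0 := by
    by_contra h
    exact hx (tsupport_fderiv_subset ℝ (subset_tsupport _ h))
  simp [cgrad, this]

namespace IsTest

variable {U : Set (E d)} {φ : Scal d}

lemma cgrad_hasCompactSupport (h : IsTest U φ) (i : Fin d) :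
    HasCompactSupport (fun x => cgrad φ x i) := by
  refine h.2.1.mono' fun x hx => ?_
  by_contra hc
  exact hx (cgrad_eq_zero_of_notMem hc i)

lemma memLp (h : IsTest U φ) (m : Measure (E d)) [IsFiniteMeasureOnCompacts m] : MemLp φ 2 m :=
  h.1.continuous.memLp_of_hasCompactSupport h.2.1

lemma memLp_cgrad (h : IsTest U φ) (m : Measure (E d)) [IsFiniteMeasureOnCompacts m] (i : Fin d) :
    MemLp (fun x => cgrad φ x i) 2 m :=
  (continuous_cgrad h.1 i).memLp_of_hasCompactSupport (h.cgrad_hasCompactSupport i)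

lemma star (h : IsTest U φ) : IsTest U (star φ) := by
  refine ⟨contDiff_star h.1, h.2.1.comp_left (g := conj) (by simp), ?_⟩
  refine (closure_mono fun x hx => ?_).trans h.2.2
  simpa using hx

lemma mono {U' : Set (E d)} (h : IsTest U φ) (hU : U ⊆ U') : IsTest U' φ :=
  ⟨h.1, h.2.1, h.2.2.trans hU⟩

lemma ofReal {g : E d → ℝ} (h1 : ContDiff ℝ ∞ g) (h2 : HasCompactSupport g) (h3 : tsupport g ⊆ U) :
    IsTest U (fun x => (g x : ℂ)) := by
  refine ⟨Complex.ofRealCLM.contDiff.comp h1, h2.comp_left (g := Complex.ofReal) (by simp), ?_⟩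
  refine (closure_mono fun x hx => ?_).trans h3
  simpa using hx

lemma eq_zero (h : IsTest U φ) {x : E d} (hx : x ∉ U) : φ x = 0 := by
  by_contra hc
  exact hx (h.2.2 (subset_tsupport _ hc))

lemma cgrad_eq_zero (h : IsTest U φ) {x : E d} (hx : x ∉ U) (i : Fin d) : cgrad φ x i = 0 :=
  cgrad_eq_zero_of_notMem (fun hc => hx (h.2.2 hc)) i

end IsTest

/-- The fundamental lemma of the calculus of variations. -/
lemma ae_eq_zero_of_forall_test {U : Set (E d)} (hU : IsOpen U) {m : Measure (E d)} {f : Scal d}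
    (hf : LocallyIntegrable f m) (h : ∀ φ, IsTest U φ → ∫ x, f x * φ x ∂m = 0) :
    ∀ᵐ x ∂m, x ∈ U → f x = 0 := by
  refine hU.ae_eq_zero_of_integral_contDiff_smul_eq_zero (hf.locallyIntegrableOn U) ?_
  intro g h1 h2 h3
  rw [← h _ (IsTest.ofReal h1 h2 h3)]
  exact integral_congr_ae (Eventually.of_forall fun x => by simp [mul_comm])

lemma ae_eq_of_forall_test {U : Set (E d)} (hU : IsOpen U) {f g : Scal d} (hf : MemL2 U f)
    (hg : MemL2 U g) (h : ∀ φ, IsTest U φ → ∫ x in U, f x * φ x = ∫ x in U, g x * φ x) :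
    f =ᵐ[volume.restrict U] g := by
  have := ae_eq_zero_of_forall_test hU (m := volume.restrict U)
    ((MemLp.sub hf hg).locallyIntegrable (by norm_num)) (fun φ hφ => by
      simp only [Pi.sub_apply, sub_mul]
      rw [integral_sub (integrable_mul_of_memLp hf (hφ.memLp _))
        (integrable_mul_of_memLp hg (hφ.memLp _)), h φ hφ, sub_self])
  filter_upwards [this, ae_restrict_mem hU.measurableSet] with x hx hxU
  simpa [sub_eq_zero] using hx hxU

/-! ### Weak gradients -/

section WeakGrad

variable {U : Set (E d)} {v v' : Scal d} {G G' : Vect d}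

lemma IsWeakGrad.congr (h : IsWeakGrad U v G) (hv : v =ᵐ[volume.restrict U] v') :
    IsWeakGrad U v' G := by
  intro φ hφ i
  rw [← h φ hφ i]
  refine integral_congr_ae ?_
  filter_upwards [hv] with x hx
  rw [hx]

lemma IsWeakGrad.add (hv : MemL2 U v) (hv' : MemL2 U v') (hG : MemL2Vec U G) (hG' : MemL2Vec U G')
    (h : IsWeakGrad U v G) (h' : IsWeakGrad U v' G') : IsWeakGrad U (v + v') (G + G') := by
  intro φ hφ i
  simp only [Pi.add_apply, add_mul]
  rw [integral_add (integrable_mul_of_memLp hv (hφ.memLp_cgrad _ i))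
    (integrable_mul_of_memLp hv' (hφ.memLp_cgrad _ i)),
    integral_add (integrable_mul_of_memLp (hG i) (hφ.memLp _))
    (integrable_mul_of_memLp (hG' i) (hφ.memLp _)), h φ hφ i, h' φ hφ i]
  ring

lemma IsWeakGrad.smul (c : ℂ) (h : IsWeakGrad U v G) : IsWeakGrad U (c • v) (c • G) := by
  intro φ hφ i
  simp only [Pi.smul_apply, smul_eq_mul, mul_assoc]
  rw [integral_const_mul, integral_const_mul, h φ hφ i]
  ring

lemma IsWeakGrad.star (h : IsWeakGrad U v G) : IsWeakGrad U (star v) (star G) := by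
  intro φ hφ i
  have h1 := h _ hφ.star i
  have h2 := congrArg conj h1
  rw [map_neg, ← integral_conj, ← integral_conj] at h2
  simp only [map_mul, Pi.star_apply, cgrad_star hφ.1.diff] at h2
  simpa using h2

lemma setIntegral_eq_of_test {U' : Set (E d)} (hU : MeasurableSet U) (hU' : U' ⊆ U) {F : Scal d}
    (hF : ∀ x, x ∉ U' → F x = 0) : ∫ x in U', F x = ∫ x in U, F x := by
  symm
  exact setIntegral_eq_of_subset_of_forall_sdiff_eq_zero hU hU' fun x hx => hF x hx.2

lemma IsWeakGrad.mono {U' : Set (E d)} (hU : IsOpen U) (hU' : U' ⊆ U) (h : IsWeakGrad U v G) :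
    IsWeakGrad U' v G := by
  intro φ hφ i
  rw [setIntegral_eq_of_test hU.measurableSet hU' (fun x hx => by simp [hφ.cgrad_eq_zero hx]),
    setIntegral_eq_of_test hU.measurableSet hU' (fun x hx => by simp [hφ.eq_zero hx])]
  exact h φ (hφ.mono hU') i

lemma IsWeakGrad.unique (hU : IsOpen U) (hG : MemL2Vec U G) (hG' : MemL2Vec U G')
    (h : IsWeakGrad U v G) (h' : IsWeakGrad U v G') : ∀ᵐ x ∂(volume.restrict U), G x = G' x := by
  have : ∀ i, (fun x => G x i) =ᵐ[volume.restrict U] fun x => G' x i := fun i =>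
    ae_eq_of_forall_test hU (hG i) (hG' i) fun φ hφ => by
      rw [← neg_inj, ← h φ hφ i, ← h' φ hφ i]
  filter_upwards [ae_all_iff.2 this] with x hx
  exact funext hx

lemma MemL2.mono {U' : Set (E d)} (h : MemL2 U v) (hU : U' ⊆ U) : MemL2 U' v :=
  h.mono_measure (Measure.restrict_mono hU le_rfl)

lemma MemL2Vec.mono {U' : Set (E d)} (h : MemL2Vec U G) (hU : U' ⊆ U) : MemL2Vec U' G :=
  fun i => (h i).mono hU

lemma MemL2Vec.add (h : MemL2Vec U G) (h' : MemL2Vec U G') : MemL2Vec U (G + G') :=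
  fun i => MemLp.add (h i) (h' i)

lemma MemL2Vec.sub (h : MemL2Vec U G) (h' : MemL2Vec U G') : MemL2Vec U (G - G') :=
  fun i => MemLp.sub (h i) (h' i)

lemma MemL2Vec.smul (c : ℂ) (h : MemL2Vec U G) : MemL2Vec U (c • G) :=
  fun i => MemLp.const_smul (h i) c

lemma MemL2Vec.star (h : MemL2Vec U G) : MemL2Vec U (star G) := fun i => MemLp.star (h i)

namespace MemH1

lemma wgrad_spec (h : MemH1 U v) : MemL2Vec U (wgrad U v) ∧ IsWeakGrad U v (wgrad U v) := by
  rw [wgrad, dif_pos h.2]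
  exact h.2.choose_spec

end MemH1

/-- `wgrad` is an arbitrary choice among almost everywhere equal fields, so every computation of a
weak gradient goes through this uniqueness. -/
lemma wgrad_eq (hU : IsOpen U) (hG : MemL2Vec U G) (h : IsWeakGrad U v G) :
    ∀ᵐ x ∂(volume.restrict U), wgrad U v x = G x := by
  have h1 : ∃ G, MemL2Vec U G ∧ IsWeakGrad U v G := ⟨G, hG, h⟩
  have h2 := h1.choose_spec
  rw [wgrad, dif_pos h1]
  exact h2.2.unique hU h2.1 hG h

namespace MemH1

lemma congr (h : MemH1 U v) (hv : v =ᵐ[volume.restrict U] v') : MemH1 U v' :=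
  ⟨(memLp_congr_ae hv).1 h.1, _, h.wgrad_spec.1, h.wgrad_spec.2.congr hv⟩

lemma wgrad_congr (hU : IsOpen U) (h : MemH1 U v) (hv : v =ᵐ[volume.restrict U] v') :
    ∀ᵐ x ∂(volume.restrict U), wgrad U v' x = wgrad U v x :=
  wgrad_eq hU h.wgrad_spec.1 (h.wgrad_spec.2.congr hv)

lemma add (h : MemH1 U v) (h' : MemH1 U v') : MemH1 U (v + v') :=
  ⟨MemLp.add h.1 h'.1, _, h.wgrad_spec.1.add h'.wgrad_spec.1,
    h.wgrad_spec.2.add h.1 h'.1 h.wgrad_spec.1 h'.wgrad_spec.1 h'.wgrad_spec.2⟩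

lemma wgrad_add (hU : IsOpen U) (h : MemH1 U v) (h' : MemH1 U v') :
    ∀ᵐ x ∂(volume.restrict U), wgrad U (v + v') x = wgrad U v x + wgrad U v' x :=
  wgrad_eq hU (h.wgrad_spec.1.add h'.wgrad_spec.1)
    (h.wgrad_spec.2.add h.1 h'.1 h.wgrad_spec.1 h'.wgrad_spec.1 h'.wgrad_spec.2)

lemma smul (c : ℂ) (h : MemH1 U v) : MemH1 U (c • v) :=
  ⟨MemLp.const_smul h.1 c, _, h.wgrad_spec.1.smul c, h.wgrad_spec.2.smul c⟩

lemma wgrad_smul (hU : IsOpen U) (c : ℂ) (h : MemH1 U v) :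
    ∀ᵐ x ∂(volume.restrict U), wgrad U (c • v) x = c • wgrad U v x :=
  wgrad_eq hU (h.wgrad_spec.1.smul c) (h.wgrad_spec.2.smul c)

lemma star (h : MemH1 U v) : MemH1 U (star v) :=
  ⟨MemLp.star h.1, _, h.wgrad_spec.1.star, h.wgrad_spec.2.star⟩

lemma wgrad_star (hU : IsOpen U) (h : MemH1 U v) :
    ∀ᵐ x ∂(volume.restrict U), wgrad U (Star.star v) x = Star.star (wgrad U v x) :=
  wgrad_eq hU h.wgrad_spec.1.star h.wgrad_spec.2.star

lemma mono {U' : Set (E d)} (hU : IsOpen U) (hU' : U' ⊆ U) (h : MemH1 U v) : MemH1 U' v :=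
  ⟨h.1.mono hU', _, h.wgrad_spec.1.mono hU', h.wgrad_spec.2.mono hU hU'⟩

lemma wgrad_mono {U' : Set (E d)} (hU : IsOpen U) (hUo : IsOpen U') (hU' : U' ⊆ U)
    (h : MemH1 U v) : ∀ᵐ x ∂(volume.restrict U'), wgrad U' v x = wgrad U v x :=
  wgrad_eq hUo (h.wgrad_spec.1.mono hU') (h.wgrad_spec.2.mono hU hU')

end MemH1

lemma memLp_of_continuous {φ : Scal d} (hφ : Continuous φ) {S : Set (E d)}
    (hS : Bornology.IsBounded S) {m : Measure (E d)} (hm : m S < ⊤) :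
    MemLp φ 2 (m.restrict S) := by
  have : IsFiniteMeasure (m.restrict S) := isFiniteMeasure_restrict.2 hm.ne
  have hc : IsCompact (closure S) := hS.isCompact_closure
  obtain ⟨C, hC⟩ := hc.exists_bound_of_continuousOn hφ.continuousOn
  refine MemLp.of_bound hφ.aestronglyMeasurable C ?_
  have : (m.restrict S) (closure S)ᶜ = 0 := by
    rw [Measure.restrict_apply isClosed_closure.measurableSet.compl]
    have : (closure S)ᶜ ∩ S = ∅ := by
      ext x
      simp only [Set.mem_inter_iff, Set.mem_compl_iff, Set.mem_empty_iff_false, iff_false]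
      exact fun h => h.1 (subset_closure h.2)
    rw [this, measure_empty]
  filter_upwards [mem_ae_iff.2 this] with x hx
  exact hC x hx

lemma isWeakGrad_cgrad {φ : Scal d} (hφ : ContDiff ℝ ∞ φ) :
    IsWeakGrad U φ (cgrad φ) := by
  intro ψ hψ i
  -- The test function is supported in `U`, so both integrals extend to the whole space, where
  -- integration by parts has no boundary term.
  rw [setIntegral_eq_of_test MeasurableSet.univ (Set.subset_univ U)
      (fun x hx => by simp [hψ.cgrad_eq_zero hx]),
    setIntegral_eq_of_test MeasurableSet.univ (Set.subset_univ U)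
      (fun x hx => by simp [hψ.eq_zero hx]), Measure.restrict_univ]
  refine integral_mul_fderiv_eq_neg_fderiv_mul_of_integrable ?_ ?_ ?_ (fun x _ => hφ.diff x)
    (fun x _ => hψ.1.diff x)
  · exact ((continuous_cgrad hφ i).mul hψ.1.continuous).integrable_of_hasCompactSupport
      hψ.2.1.mul_left
  · exact (hφ.continuous.mul (continuous_cgrad hψ.1 i)).integrable_of_hasCompactSupport
      (hψ.cgrad_hasCompactSupport i).mul_left
  · exact (hφ.continuous.mul hψ.1.continuous).integrable_of_hasCompactSupport hψ.2.1.mul_left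

lemma memH1_of_contDiff (hb : Bornology.IsBounded U) {φ : Scal d}
    (hφ : ContDiff ℝ ∞ φ) : MemH1 U φ :=
  ⟨memLp_of_continuous hφ.continuous hb hb.measure_lt_top, cgrad φ,
    fun i => memLp_of_continuous (continuous_cgrad hφ i) hb hb.measure_lt_top,
    isWeakGrad_cgrad hφ⟩

lemma wgrad_of_contDiff (hU : IsOpen U) (hb : Bornology.IsBounded U) {φ : Scal d}
    (hφ : ContDiff ℝ ∞ φ) : ∀ᵐ x ∂(volume.restrict U), wgrad U φ x = cgrad φ x :=
  wgrad_eq hU (fun i => memLp_of_continuous (continuous_cgrad hφ i) hb hb.measure_lt_top)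
    (isWeakGrad_cgrad hφ)

end WeakGrad

/-! ### Weak divergences -/

section WeakDiv

variable {U : Set (E d)} {w w' : Vect d} {D D' : Scal d}

lemma integrable_dot {m : Measure (E d)} {w z : Vect d} (hw : ∀ i, MemLp (fun x => w x i) 2 m)
    (hz : ∀ i, MemLp (fun x => z x i) 2 m) : Integrable (fun x => w x ⬝ᵥ z x) m := by
  simp only [dotProduct]
  exact integrable_finsetSum _ fun i _ => integrable_mul_of_memLp (hw i) (hz i)

lemma IsWeakDiv.unique (hU : IsOpen U) (hD : MemL2 U D) (hD' : MemL2 U D') (h : IsWeakDiv U w D)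
    (h' : IsWeakDiv U w D') : D =ᵐ[volume.restrict U] D' :=
  ae_eq_of_forall_test hU hD hD' fun φ hφ => by rw [← neg_inj, ← h φ hφ, ← h' φ hφ]

lemma wdiv_eq (hU : IsOpen U) (hD : MemL2 U D) (h : IsWeakDiv U w D) :
    wdiv U w =ᵐ[volume.restrict U] D := by
  have h1 : ∃ D, MemL2 U D ∧ IsWeakDiv U w D := ⟨D, hD, h⟩
  have h2 := h1.choose_spec
  rw [wdiv, dif_pos h1]
  exact h2.2.unique hU h2.1 hD h

lemma MemHdiv.wdiv_spec (h : MemHdiv U w) : MemL2 U (wdiv U w) ∧ IsWeakDiv U w (wdiv U w) := by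
  rw [wdiv, dif_pos h.2]
  exact h.2.choose_spec

lemma IsWeakDiv.sub (hw : MemL2Vec U w) (hw' : MemL2Vec U w') (hD : MemL2 U D) (hD' : MemL2 U D')
    (h : IsWeakDiv U w D) (h' : IsWeakDiv U w' D') : IsWeakDiv U (w - w') (D - D') := by
  intro φ hφ
  simp only [Pi.sub_apply, sub_mul, sub_dotProduct]
  rw [integral_sub (integrable_dot hw (hφ.memLp_cgrad _)) (integrable_dot hw' (hφ.memLp_cgrad _)),
    integral_sub (integrable_mul_of_memLp hD (hφ.memLp _))
    (integrable_mul_of_memLp hD' (hφ.memLp _)), h φ hφ, h' φ hφ]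
  ring

lemma IsWeakDiv.mono {U' : Set (E d)} (hU : IsOpen U) (hU' : U' ⊆ U) (h : IsWeakDiv U w D) :
    IsWeakDiv U' w D := by
  intro φ hφ
  rw [setIntegral_eq_of_test hU.measurableSet hU'
      (fun x hx => by simp [dotProduct, hφ.cgrad_eq_zero hx]),
    setIntegral_eq_of_test hU.measurableSet hU' (fun x hx => by simp [hφ.eq_zero hx])]
  exact h φ (hφ.mono hU')

end WeakDiv

/-! ### Traces -/

/-- `φ n → v` in `H¹(U)`, with `φ n` smooth. -/
structure IsApprox (U : Set (E d)) (v : Scal d) (φ : ℕ → Scal d) : Prop where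
  smooth : ∀ n, ContDiff ℝ ∞ (φ n)
  val : Tendsto (fun n => eLpNorm (φ n - v) 2 (volume.restrict U)) atTop (𝓝 0)
  grad : ∀ i, Tendsto (fun n => eLpNorm ((fun x => cgrad (φ n) x i) - fun x => wgrad U v x i) 2
    (volume.restrict U)) atTop (𝓝 0)

lemma isTrace_iff {U S : Set (E d)} {v g : Scal d} : IsTrace U S v g ↔ MemL2Surf S g ∧
    ∃ φ, IsApprox U v φ ∧ Tendsto (fun n => eLpNorm (φ n - g) 2 ((surf d).restrict S)) atTop (𝓝 0) :=
  ⟨fun ⟨h, φ, h1, h2, h3, h4⟩ => ⟨h, φ, ⟨h1, h2, h3⟩, h4⟩,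
    fun ⟨h, φ, h1, h2⟩ => ⟨h, φ, h1.smooth, h1.val, h1.grad, h2⟩⟩

/-- An open bounded set `U` and a set `S` of finite surface measure such that the restriction to
`S` of smooth functions is continuous for the norm of `H¹(U)`. -/
structure TracePair (U S : Set (E d)) : Prop where
  isOpen : IsOpen U
  bddU : Bornology.IsBounded U
  bddS : Bornology.IsBounded S
  fin : surf d S < ⊤
  ineq : ∃ C : NNReal, ∀ φ : Scal d, ContDiff ℝ ∞ φ →
    eLpNorm φ 2 ((surf d).restrict S) ^ 2 ≤ C * (eLpNorm φ 2 (volume.restrict U) ^ 2 +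
      ∑ i, eLpNorm (fun x => cgrad φ x i) 2 (volume.restrict U) ^ 2)

section Trace

variable {U S : Set (E d)} {v v' g g' : Scal d}

lemma MemH1.memL2_wgrad (h : MemH1 U v) (i : Fin d) : MemL2 U (fun x => wgrad U v x i) :=
  h.wgrad_spec.1 i

namespace TracePair

variable (hT : TracePair U S)
include hT

lemma memL2 {φ : Scal d} (hφ : ContDiff ℝ ∞ φ) : MemL2 U φ :=
  memLp_of_continuous hφ.continuous hT.bddU hT.bddU.measure_lt_top

lemma memL2_cgrad {φ : Scal d} (hφ : ContDiff ℝ ∞ φ) (i : Fin d) : MemL2 U fun x => cgrad φ x i :=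
  memLp_of_continuous (continuous_cgrad hφ i) hT.bddU hT.bddU.measure_lt_top

lemma memL2Surf {φ : Scal d} (hφ : ContDiff ℝ ∞ φ) : MemL2Surf S φ :=
  memLp_of_continuous hφ.continuous hT.bddS hT.fin

/-- The filter is arbitrary because the Cauchy property of traces is expressed with pairs of
indices. -/
lemma tendsto_surf {ι : Type*} {l : Filter ι} {φ : ι → Scal d} (h : ∀ n, ContDiff ℝ ∞ (φ n))
    (h0 : Tendsto (fun n => eLpNorm (φ n) 2 (volume.restrict U)) l (𝓝 0))
    (h1 : ∀ i, Tendsto (fun n => eLpNorm (fun x => cgrad (φ n) x i) 2 (volume.restrict U)) l (𝓝 0)) :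
    Tendsto (fun n => eLpNorm (φ n) 2 ((surf d).restrict S)) l (𝓝 0) := by
  obtain ⟨C, hC⟩ := hT.ineq
  have sq : ∀ {f : ι → ENNReal}, Tendsto f l (𝓝 0) → Tendsto (fun n => f n ^ 2) l (𝓝 0) := by
    intro f h
    simpa using ENNReal.Tendsto.pow (n := 2) h
  have hR : Tendsto (fun n => (C : ENNReal) * (eLpNorm (φ n) 2 (volume.restrict U) ^ 2 +
      ∑ i, eLpNorm (fun x => cgrad (φ n) x i) 2 (volume.restrict U) ^ 2)) l (𝓝 0) := by
    have h2 := (sq h0).add (tendsto_finsetSum Finset.univ fun i _ => sq (h1 i))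
    simp only [Finset.sum_const_zero, add_zero] at h2
    simpa using ENNReal.Tendsto.const_mul (a := (C : ENNReal)) h2 (Or.inr (by simp))
  have h3 := tendsto_of_tendsto_of_tendsto_of_le_of_le tendsto_const_nhds hR (fun _ => zero_le)
    fun n => hC _ (h n)
  have := (ENNReal.continuous_rpow_const (y := (1 / 2 : ℝ))).tendsto 0 |>.comp h3
  simp only [Function.comp_def] at this
  rw [ENNReal.zero_rpow_of_pos (by norm_num)] at this
  refine this.congr fun n => ?_
  rw [← ENNReal.rpow_natCast, ← ENNReal.rpow_mul]
  norm_num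

/-- The trace inequality is applied to the differences, which are small in `H¹(U)`. Taking `φ = ψ`
gives the Cauchy property, hence existence of traces; the diagonal of the pairs gives uniqueness. -/
lemma tendsto_sub {φ ψ : ℕ → Scal d} (hv : MemH1 U v) (hφ : IsApprox U v φ) (hψ : IsApprox U v ψ) :
    Tendsto (fun n : ℕ × ℕ => eLpNorm (φ n.1 - ψ n.2) 2 ((surf d).restrict S)) atTop (𝓝 0) := by
  rw [← prod_atTop_atTop_eq]
  have aux : ∀ {f g : ℕ → Scal d} {w : Scal d}, (∀ n, MemL2 U (f n)) → (∀ n, MemL2 U (g n)) →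
      MemL2 U w → Tendsto (fun n => eLpNorm (f n - w) 2 (volume.restrict U)) atTop (𝓝 0) →
      Tendsto (fun n => eLpNorm (g n - w) 2 (volume.restrict U)) atTop (𝓝 0) →
      Tendsto (fun n : ℕ × ℕ => eLpNorm (f n.1 - g n.2) 2 (volume.restrict U))
        (atTop ×ˢ atTop) (𝓝 0) := by
    intro f g w hf hg hw h1 h2
    have h3 := (h1.comp tendsto_fst).add (h2.comp tendsto_snd) (x := atTop ×ˢ atTop)
    rw [add_zero] at h3
    refine tendsto_of_tendsto_of_tendsto_of_le_of_le tendsto_const_nhds h3 (fun _ => zero_le) ?_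
    intro n
    have e : f n.1 - g n.2 = (f n.1 - w) - (g n.2 - w) := by abel
    simp only [e, Function.comp]
    exact eLpNorm_sub_le ((hf _).sub hw).1 ((hg _).sub hw).1 (by norm_num)
  refine hT.tendsto_surf (fun n => (hφ.smooth n.1).sub (hψ.smooth n.2)) ?_ fun i => ?_
  · exact aux (fun n => hT.memL2 (hφ.smooth n)) (fun n => hT.memL2 (hψ.smooth n)) hv.1 hφ.val hψ.val
  · have := aux (fun n => hT.memL2_cgrad (hφ.smooth n) i) (fun n => hT.memL2_cgrad (hψ.smooth n) i)
      (hv.memL2_wgrad i) (hφ.grad i) (hψ.grad i)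
    refine this.congr fun n => ?_
    congr 1
    ext x
    exact (cgrad_sub (hφ.smooth n.1).diff (hψ.smooth n.2).diff x i).symm

lemma unique (hv : MemH1 U v) (h : IsTrace U S v g) (h' : IsTrace U S v g') :
    g =ᵐ[(surf d).restrict S] g' := by
  obtain ⟨hg, φ, hφ, hφg⟩ := isTrace_iff.1 h
  obtain ⟨hg', ψ, hψ, hψg⟩ := isTrace_iff.1 h'
  have hd : Tendsto (fun n : ℕ => (n, n)) atTop atTop := by
    rw [← prod_atTop_atTop_eq]
    exact tendsto_id.prodMk tendsto_id
  have hlim : Tendsto (fun n => eLpNorm (φ n - ψ n) 2 ((surf d).restrict S)) atTop (𝓝 0) := by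
    have := Tendsto.comp (hT.tendsto_sub hv hφ hψ) hd
    simpa only [Function.comp_def] using this
  exact ae_eq_of_tendsto_eLpNorm (fun n => (hT.memL2Surf (hφ.smooth n)).1)
    (fun n => (hT.memL2Surf (hψ.smooth n)).1) hg.1 hg'.1 hφg hψg hlim

lemma exists_of_isApprox {φ : ℕ → Scal d} (hv : MemH1 U v) (hφ : IsApprox U v φ) :
    ∃ g, IsTrace U S v g := by
  obtain ⟨g, hg, hlim⟩ := exists_tendsto_eLpNorm (fun n => hT.memL2Surf (hφ.smooth n))
    (hT.tendsto_sub hv hφ hφ)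
  exact ⟨g, isTrace_iff.2 ⟨hg, φ, hφ, hlim⟩⟩

/-- Every approximating sequence converges to the trace. -/
lemma tendsto_trace {φ : ℕ → Scal d} (hv : MemH1 U v) (h : IsTrace U S v g) (hφ : IsApprox U v φ) :
    Tendsto (fun n => eLpNorm (φ n - g) 2 ((surf d).restrict S)) atTop (𝓝 0) := by
  obtain ⟨g', hg', hlim⟩ := exists_tendsto_eLpNorm (fun n => hT.memL2Surf (hφ.smooth n))
    (hT.tendsto_sub hv hφ hφ)
  have := hT.unique hv h (isTrace_iff.2 ⟨hg', φ, hφ, hlim⟩)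
  refine hlim.congr fun n => eLpNorm_congr_ae ?_
  filter_upwards [this] with x hx
  simp [hx]

lemma trace_ae_eq (hv : MemH1 U v) (h : IsTrace U S v g) :
    trace U S v =ᵐ[(surf d).restrict S] g := by
  have h1 : ∃ g, IsTrace U S v g := ⟨g, h⟩
  rw [trace, dif_pos h1]
  exact hT.unique hv h1.choose_spec h

end TracePair

lemma isTrace_trace (h : IsTrace U S v g) : IsTrace U S v (trace U S v) := by
  have h1 : ∃ g, IsTrace U S v g := ⟨g, h⟩
  rw [trace, dif_pos h1]
  exact h1.choose_spec

namespace IsApprox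

variable {φ ψ : ℕ → Scal d}

lemma congr (hU : IsOpen U) (hv : MemH1 U v) (h : IsApprox U v φ)
    (hvv : v =ᵐ[volume.restrict U] v') : IsApprox U v' φ := by
  refine ⟨h.smooth, h.val.congr fun n => eLpNorm_congr_ae ?_,
    fun i => (h.grad i).congr fun n => eLpNorm_congr_ae ?_⟩
  · filter_upwards [hvv] with x hx
    simp [hx]
  · filter_upwards [hv.wgrad_congr hU hvv] with x hx
    simp [hx]

lemma mono {U' : Set (E d)} (hU : IsOpen U) (hUo : IsOpen U') (hU' : U' ⊆ U) (hv : MemH1 U v)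
    (h : IsApprox U v φ) : IsApprox U' v φ := by
  have hm := Measure.restrict_mono hU' (le_refl (volume : Measure (E d)))
  refine ⟨h.smooth, tendsto_of_tendsto_of_tendsto_of_le_of_le tendsto_const_nhds h.val
    (fun _ => zero_le) fun n => eLpNorm_mono_measure _ hm, fun i => ?_⟩
  have h1 := tendsto_of_tendsto_of_tendsto_of_le_of_le tendsto_const_nhds (h.grad i)
    (fun _ => zero_le) fun n => eLpNorm_mono_measure _ hm
  refine h1.congr fun n => eLpNorm_congr_ae ?_
  filter_upwards [hv.wgrad_mono hU hUo hU'] with x hx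
  simp [hx]

lemma add (hU : IsOpen U) (hv : MemH1 U v) (hv' : MemH1 U v')
    (h : IsApprox U v φ) (h' : IsApprox U v' ψ) :
    IsApprox U (v + v') (fun n => φ n + ψ n) := by
  refine ⟨fun n => (h.smooth n).add (h'.smooth n), tendsto_eLpNorm_add
    (fun n => (h.smooth n).continuous.aestronglyMeasurable)
    (fun n => (h'.smooth n).continuous.aestronglyMeasurable) hv.1.1 hv'.1.1 h.val h'.val,
    fun i => ?_⟩
  have := tendsto_eLpNorm_add
    (fun n => (continuous_cgrad (h.smooth n) i).aestronglyMeasurable)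
    (fun n => (continuous_cgrad (h'.smooth n) i).aestronglyMeasurable) (hv.memL2_wgrad i).1
    (hv'.memL2_wgrad i).1 (h.grad i) (h'.grad i)
  refine this.congr fun n => eLpNorm_congr_ae ?_
  filter_upwards [hv.wgrad_add hU hv'] with x hx
  simp [hx, cgrad_add (h.smooth n).diff (h'.smooth n).diff]

lemma smul (hU : IsOpen U) (c : ℂ) (hv : MemH1 U v) (h : IsApprox U v φ) :
    IsApprox U (c • v) (fun n => c • φ n) := by
  refine ⟨fun n => contDiff_const.smul (h.smooth n), tendsto_eLpNorm_smul c h.val, fun i => ?_⟩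
  refine (tendsto_eLpNorm_smul c (h.grad i)).congr fun n => eLpNorm_congr_ae ?_
  filter_upwards [hv.wgrad_smul hU c] with x hx
  simp [hx, cgrad_smul (h.smooth n).diff]

lemma star (hU : IsOpen U) (hv : MemH1 U v) (h : IsApprox U v φ) :
    IsApprox U (star v) (fun n => star (φ n)) := by
  refine ⟨fun n => contDiff_star (h.smooth n), tendsto_eLpNorm_star h.val, fun i => ?_⟩
  refine (tendsto_eLpNorm_star (h.grad i)).congr fun n => eLpNorm_congr_ae ?_
  filter_upwards [hv.wgrad_star hU] with x hx
  simp [hx, cgrad_star (h.smooth n).diff]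

lemma const (hU : IsOpen U) (hb : Bornology.IsBounded U) {f : Scal d} (hf : ContDiff ℝ ∞ f) :
    IsApprox U f (fun _ => f) := by
  refine ⟨fun _ => hf, by simp, fun i => ?_⟩
  refine tendsto_const_nhds.congr fun n => ?_
  symm
  rw [eLpNorm_eq_zero_iff _ (by norm_num)]
  · filter_upwards [wgrad_of_contDiff hU hb hf] with x hx
    simp [hx]
  · exact ((continuous_cgrad hf i).aestronglyMeasurable).sub
      ((memH1_of_contDiff hb hf).memL2_wgrad i).1

end IsApprox

namespace IsTrace

lemma memL2Surf (h : IsTrace U S v g) : MemL2Surf S g := h.1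

lemma congr (hU : IsOpen U) (hv : MemH1 U v) (h : IsTrace U S v g)
    (hvv : v =ᵐ[volume.restrict U] v') (hgg : g =ᵐ[(surf d).restrict S] g') :
    IsTrace U S v' g' := by
  obtain ⟨hg, φ, hφ, hφg⟩ := isTrace_iff.1 h
  refine isTrace_iff.2 ⟨(memLp_congr_ae hgg).1 hg, φ, hφ.congr hU hv hvv,
    hφg.congr fun n => eLpNorm_congr_ae ?_⟩
  filter_upwards [hgg] with x hx
  simp [hx]

/-- The same representative serves on the smaller sets, since the approximants are smooth on the
whole space. Inclusion up to a null set is allowed because a face need only lie in the closure of a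
boundary part. -/
lemma mono {U' S' : Set (E d)} (hU : IsOpen U) (hUo : IsOpen U') (hU' : U' ⊆ U)
    (hS' : S' ≤ᵐ[surf d] S) (hv : MemH1 U v) (h : IsTrace U S v g) : IsTrace U' S' v g := by
  obtain ⟨hg, φ, hφ, hφg⟩ := isTrace_iff.1 h
  have hm := Measure.restrict_mono' hS' (le_refl (surf d))
  exact isTrace_iff.2 ⟨hg.mono_measure hm, φ, hφ.mono hU hUo hU' hv,
    tendsto_of_tendsto_of_tendsto_of_le_of_le tendsto_const_nhds hφg
    (fun _ => zero_le) fun n => eLpNorm_mono_measure _ hm⟩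

lemma add (hU : IsOpen U) (hv : MemH1 U v) (hv' : MemH1 U v')
    (h : IsTrace U S v g) (h' : IsTrace U S v' g') : IsTrace U S (v + v') (g + g') := by
  obtain ⟨hg, φ, hφ, hφg⟩ := isTrace_iff.1 h
  obtain ⟨hg', ψ, hψ, hψg⟩ := isTrace_iff.1 h'
  exact isTrace_iff.2 ⟨MemLp.add hg hg', _, hφ.add hU hv hv' hψ, tendsto_eLpNorm_add
    (fun n => (hφ.smooth n).continuous.aestronglyMeasurable)
    (fun n => (hψ.smooth n).continuous.aestronglyMeasurable) hg.1 hg'.1 hφg hψg⟩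

lemma smul (hU : IsOpen U) (c : ℂ) (hv : MemH1 U v) (h : IsTrace U S v g) :
    IsTrace U S (c • v) (c • g) := by
  obtain ⟨hg, φ, hφ, hφg⟩ := isTrace_iff.1 h
  exact isTrace_iff.2 ⟨MemLp.const_smul hg c, _, hφ.smul hU c hv, tendsto_eLpNorm_smul c hφg⟩

lemma star (hU : IsOpen U) (hv : MemH1 U v) (h : IsTrace U S v g) :
    IsTrace U S (star v) (star g) := by
  obtain ⟨hg, φ, hφ, hφg⟩ := isTrace_iff.1 h
  exact isTrace_iff.2 ⟨MemLp.star hg, _, hφ.star hU hv, tendsto_eLpNorm_star hφg⟩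

end IsTrace

lemma isTrace_of_contDiff (hU : IsOpen U) (hb : Bornology.IsBounded U) {φ : Scal d}
    (hφ : ContDiff ℝ ∞ φ) (hg : MemL2Surf S φ) : IsTrace U S φ φ :=
  isTrace_iff.2 ⟨hg, _, IsApprox.const hU hb hφ, by simp⟩

end Trace

/-! ### The trace inequality on a simplex -/

lemma fderiv_apply_eq_sum (φ : Scal d) (x e : E d) :
    fderiv ℝ φ x e = ∑ i, ((e i : ℝ) : ℂ) * cgrad φ x i := by
  have : e = ∑ i, (e i) • EuclideanSpace.single i (1 : ℝ) := by
    ext j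
    simp [Finset.sum_apply, Pi.single_apply]
  conv_lhs => rw [this, map_sum]
  simp [cgrad]

lemma abs_coord_le_norm (e : E d) (i : Fin d) : |e i| ≤ ‖e‖ := by
  simpa using PiLp.norm_apply_le e i

namespace IsSimplex

variable {K : Finset (E d)} (hK : IsSimplex d K)
include hK

lemma coord_centroid {G : Finset (E d)} (hG : G ⊆ K) (hne : G.Nonempty) {b : E d} (hb : b ∈ K) :
    hK.coord b (G.centroid ℝ id) = if b ∈ G then (G.card : ℝ)⁻¹ else 0 := by
  classical
  rw [Finset.centroid_def, Finset.map_affineCombination _ _ _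
    (G.sum_centroidWeights_eq_one_of_nonempty ℝ hne),
    Finset.affineCombination_eq_linear_combination _ _ _
    (G.sum_centroidWeights_eq_one_of_nonempty ℝ hne)]
  simp only [Finset.centroidWeights_apply, Function.comp, id, smul_eq_mul]
  have : ∀ a ∈ G, (G.card : ℝ)⁻¹ * hK.coord b a = if a = b then (G.card : ℝ)⁻¹ else 0 := by
    intro a ha
    by_cases hab : a = b
    · subst hab; simp [hK.coord_self hb]
    · simp [hK.coord_ne hb (hG ha) hab, hab]
  rw [Finset.sum_congr rfl this, Finset.sum_ite_eq']

lemma centroid_mem_interior : K.centroid ℝ id ∈ interior (hull K) := by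
  rw [hK.mem_interior_hull]
  intro a ha
  rw [hK.coord_centroid subset_rfl ⟨a, ha⟩ ha, if_pos ha]
  have : 0 < K.card := Finset.card_pos.2 ⟨a, ha⟩
  positivity

lemma nonempty : K.Nonempty := by
  rw [← Finset.card_pos, hK.1]; omega

lemma diam_pos (hd : 1 ≤ d) : 0 < Metric.diam (hull K) := by
  obtain ⟨a, ha⟩ := hK.nonempty
  have : 1 < K.card := by rw [hK.1]; omega
  obtain ⟨b, hb, hab⟩ := Finset.exists_mem_ne this a
  refine (dist_pos.2 hab).trans_le (Metric.dist_le_diam_of_mem (isCompact_hull K).isBounded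
    (subset_convexHull ℝ _ hb) (subset_convexHull ℝ _ ha))

-- The radial divergence theorem is applied to `|φ|²`. It expresses the integral of `|φ|²` over the
-- face opposite to `a` by volume integrals of `|φ|²` and of its derivative along `x - a`.
open Classical in
lemma tracePair_erase (hd : 1 ≤ d) {a : E d} (ha : a ∈ K) :
    TracePair (interior (hull K)) (hull (K.erase a)) := by
  refine ⟨isOpen_interior, (isCompact_hull K).isBounded.subset interior_subset,
    (isCompact_hull _).isBounded, hK.surf_hull_erase_lt_top hd ha, ?_⟩
  obtain ⟨ν, hν⟩ := hK.exists_outerNormal hd ha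
  obtain ⟨H, hH, h⟩ := hK.exists_height hd ha hν
  set R : ℝ := Metric.diam (hull K) with hR
  have hR0 : 0 ≤ R := Metric.diam_nonneg
  -- The term `d|φ|²` costs `d`. Each of the `d` partial derivatives of `|φ|²`, multiplied by a
  -- component of `x - a`, costs `R(|φ|² + |∂ᵢφ|²)`. The sum `C₀` dominates the coefficients of both
  -- resulting terms.
  set C₀ : ℝ := d + d * R + R with hC₀
  have hC₀' : 0 ≤ C₀ := by positivity
  refine ⟨Real.toNNReal (C₀ / H), fun φ hφ => ?_⟩
  rw [ae_restrict_hull]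
  simp only [eLpNorm_two_sq]
  have key := hK.integral_radial hd ha hH hν.1 h
    ((hφ.mul (contDiff_star hφ)).of_le (by norm_cast : (1 : WithTop ℕ∞) ≤ ∞))
  have hFfin : surf d (hull (K.erase a)) < ⊤ := hK.surf_hull_erase_lt_top hd ha
  have hL : ∫⁻ x in hull (K.erase a), ‖φ x‖ₑ ^ 2 ∂(surf d) =
      ENNReal.ofReal (∫ x in hull (K.erase a), ‖φ x‖ ^ 2 ∂(surf d)) := by
    have hint := (memLp_of_continuous hφ.continuous (isCompact_hull (K.erase a)).isBounded
      hFfin).integrable_norm_pow (by norm_num)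
    rw [ofReal_integral_eq_lintegral_ofReal (by simpa using hint)
      (Eventually.of_forall fun x => by positivity)]
    refine lintegral_congr fun x => ?_
    rw [ENNReal.ofReal_pow (norm_nonneg _), ofReal_norm]
  have hnn : 0 ≤ ∫ x in hull (K.erase a), ‖φ x‖ ^ 2 ∂(surf d) :=
    integral_nonneg fun x => by positivity
  have hR' : (H : ℂ) * ∫ y in hull (K.erase a), (φ * star φ) y ∂(surf d) =
      ((H * ∫ x in hull (K.erase a), ‖φ x‖ ^ 2 ∂(surf d) : ℝ) : ℂ) := by
    push_cast
    rw [← integral_complex_ofReal]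
    congr 1
    refine integral_congr_ae (Eventually.of_forall fun x => ?_)
    simp only [Pi.mul_apply, Pi.star_apply, RCLike.star_def, Complex.mul_conj]
    rw [Complex.normSq_eq_norm_sq]
  have hbound : ∀ x ∈ hull K, ‖(d : ℂ) * (φ * star φ) x + fderiv ℝ (φ * star φ) x (x - a)‖ ≤
      C₀ * (‖φ x‖ ^ 2 + ∑ i, ‖cgrad φ x i‖ ^ 2) := by
    intro x hx
    have hxa : ‖x - a‖ ≤ R := by
      rw [← dist_eq_norm]
      exact Metric.dist_le_diam_of_mem (isCompact_hull K).isBounded hx (subset_convexHull ℝ _ ha)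
    have e1 : ‖(d : ℂ) * (φ * star φ) x‖ = d * ‖φ x‖ ^ 2 := by
      simp [sq]
    have e2 : ‖fderiv ℝ (φ * star φ) x (x - a)‖ ≤ ∑ i, R * (‖φ x‖ ^ 2 + ‖cgrad φ x i‖ ^ 2) := by
      rw [fderiv_apply_eq_sum]
      refine (norm_sum_le _ _).trans (Finset.sum_le_sum fun i _ => ?_)
      rw [norm_mul]
      refine mul_le_mul ?_ ?_ (norm_nonneg _) hR0
      · rw [Complex.norm_real]
        exact (abs_coord_le_norm _ i).trans hxa
      · have := cgrad_mul hφ.diff (contDiff_star hφ).diff x i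
        change cgrad (φ * star φ) x i = _ at this
        rw [this, cgrad_star hφ.diff]
        refine (norm_add_le _ _).trans ?_
        simp only [norm_mul, norm_star, Pi.star_apply]
        nlinarith [sq_nonneg (‖φ x‖ - ‖cgrad φ x i‖)]
    refine (norm_add_le _ _).trans ?_
    rw [e1]
    rw [← Finset.mul_sum, Finset.sum_add_distrib] at e2
    simp only [Finset.sum_const, Finset.card_univ, Fintype.card_fin, nsmul_eq_mul] at e2
    have hs : 0 ≤ ∑ i, ‖cgrad φ x i‖ ^ 2 := Finset.sum_nonneg fun i _ => by positivity
    have hd0 : (0 : ℝ) ≤ d := by positivity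
    have h1 : 0 ≤ (d + d * R) * ∑ i, ‖cgrad φ x i‖ ^ 2 := by positivity
    have h2 : 0 ≤ R * ‖φ x‖ ^ 2 := by positivity
    rw [hC₀]
    nlinarith
  have hmain : ENNReal.ofReal (H * ∫ x in hull (K.erase a), ‖φ x‖ ^ 2 ∂(surf d)) ≤
      ENNReal.ofReal C₀ * ((∫⁻ x in hull K, ‖φ x‖ₑ ^ 2) +
        ∑ i, ∫⁻ x in hull K, ‖cgrad φ x i‖ₑ ^ 2) := by
    have e0 : ENNReal.ofReal (H * ∫ x in hull (K.erase a), ‖φ x‖ ^ 2 ∂(surf d)) =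
        ‖∫ x in hull K, ((d : ℂ) * (φ * star φ) x + fderiv ℝ (φ * star φ) x (x - a))‖ₑ := by
      have : ∫ x in hull K, ((d : ℂ) * (φ * star φ) x + fderiv ℝ (φ * star φ) x (x - a)) =
        ((H * ∫ x in hull (K.erase a), ‖φ x‖ ^ 2 ∂(surf d) : ℝ) : ℂ) := by
        rw [← hR']
        exact key
      rw [this, ← ofReal_norm, Complex.norm_real, Real.norm_of_nonneg (by positivity)]
    rw [e0]
    refine (enorm_integral_le_lintegral_enorm _).trans ?_
    rw [← lintegral_finsetSum' _ fun i _ =>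
      ((continuous_cgrad hφ i).aemeasurable.enorm.pow_const 2),
      ← lintegral_add_left' (hφ.continuous.aemeasurable.enorm.pow_const 2),
      ← lintegral_const_mul' _ _ ENNReal.ofReal_ne_top]
    refine setLIntegral_mono' (measurableSet_hull K) fun x hx => ?_
    rw [← ofReal_norm]
    refine (ENNReal.ofReal_le_ofReal (hbound x hx)).trans (le_of_eq ?_)
    rw [ENNReal.ofReal_mul hC₀', ENNReal.ofReal_add (by positivity)
      (Finset.sum_nonneg fun i _ => by positivity), ENNReal.ofReal_sum_of_nonneg
      fun i _ => by positivity]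
    simp only [ENNReal.ofReal_pow (norm_nonneg _), ofReal_norm]
  rw [hL]
  have hHe : ENNReal.ofReal H ≠ 0 := by simpa using hH
  rw [ENNReal.ofReal_mul hH.le] at hmain
  change _ ≤ ENNReal.ofReal (C₀ / H) * _
  rw [ENNReal.ofReal_div_of_pos hH, ENNReal.div_eq_inv_mul, mul_assoc, mul_comm _⁻¹,
    ← div_eq_mul_inv, ENNReal.le_div_iff_mul_le (Or.inl hHe) (Or.inl ENNReal.ofReal_ne_top),
    mul_comm]
  exact hmain

end IsSimplex

/-! ### Enlarging, restricting and uniting trace pairs -/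

namespace TracePair

variable {U S : Set (E d)}

lemma mono_left {U' : Set (E d)} (h : TracePair U S) (hU : U ⊆ U') (hUo : IsOpen U')
    (hb : Bornology.IsBounded U') : TracePair U' S := by
  obtain ⟨C, hC⟩ := h.ineq
  refine ⟨hUo, hb, h.bddS, h.fin, C, fun φ hφ => (hC φ hφ).trans ?_⟩
  have hm := Measure.restrict_mono hU (le_refl (volume : Measure (E d)))
  gcongr

lemma mono_right {S' : Set (E d)} (h : TracePair U S) (hS : S' ⊆ S) : TracePair U S' := by
  obtain ⟨C, hC⟩ := h.ineq
  refine ⟨h.isOpen, h.bddU, h.bddS.subset hS, (measure_mono hS).trans_lt h.fin, C,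
    fun φ hφ => le_trans ?_ (hC φ hφ)⟩
  gcongr

lemma biUnion {ι : Type*} {S : ι → Set (E d)} (I : Finset ι) (hU : IsOpen U)
    (hb : Bornology.IsBounded U) (h : ∀ i ∈ I, TracePair U (S i)) :
    TracePair U (⋃ i ∈ I, S i) := by
  classical
  choose! C hC using fun i hi => (h i hi).ineq
  refine ⟨hU, hb, (Bornology.isBounded_biUnion_finset I).2 fun i hi => (h i hi).bddS, ?_,
    ∑ i ∈ I, C i, fun φ hφ => ?_⟩
  · refine (measure_biUnion_finset_le _ _).trans_lt (ENNReal.sum_lt_top.2 fun i hi => (h i hi).fin)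
  · have hle : ∫⁻ x in ⋃ i ∈ I, S i, ‖φ x‖ₑ ^ 2 ∂(surf d) ≤
        ∑ i ∈ I, ∫⁻ x in S i, ‖φ x‖ₑ ^ 2 ∂(surf d) := by
      rw [← lintegral_finsetSum_measure]
      refine lintegral_mono' ?_ le_rfl
      refine Measure.le_iff.2 fun B hB => ?_
      rw [Measure.restrict_apply hB, Set.inter_iUnion₂, Measure.finsetSum_apply]
      refine (measure_biUnion_finset_le _ _).trans (Finset.sum_le_sum fun i _ => ?_)
      rw [Measure.restrict_apply hB]
    rw [eLpNorm_two_sq (m := (surf d).restrict (⋃ i ∈ I, S i))]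
    refine hle.trans ?_
    push_cast
    rw [Finset.sum_mul]
    refine Finset.sum_le_sum fun i hi => ?_
    rw [← eLpNorm_two_sq]
    exact hC i hi φ hφ

end TracePair

namespace IsSimplex

variable {K : Finset (E d)} (hK : IsSimplex d K)
include hK

/-! ### Pairs of simplices sharing a face -/

/-- The points in the relative interior of the face opposite to `a`. -/
def faceInterior (a : E d) : Set (E d) :=
  {x | hK.coord a x = 0 ∧ ∀ b ∈ K, b ≠ a → 0 < hK.coord b x}

open Classical in
lemma faceInterior_subset {a : E d} (ha : a ∈ K) : hK.faceInterior a ⊆ hull (K.erase a) := by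
  rintro x ⟨h0, h⟩
  rw [hK.mem_hull_erase ha, hK.mem_hull]
  refine ⟨fun b hb => ?_, h0⟩
  by_cases hba : b = a
  · subst hba; exact h0.ge
  · exact (h b hb hba).le

open Classical in
lemma centroid_mem_faceInterior (hd : 1 ≤ d) {a : E d} (ha : a ∈ K) :
    (K.erase a).centroid ℝ id ∈ hK.faceInterior a := by
  have hne : (K.erase a).Nonempty := by
    rw [← Finset.card_pos, Finset.card_erase_of_mem ha, hK.1]; omega
  refine ⟨?_, fun b hb hba => ?_⟩
  · rw [hK.coord_centroid (K.erase_subset a) hne ha, if_neg (by simp)]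
  · rw [hK.coord_centroid (K.erase_subset a) hne hb, if_pos (by simp [hb, hba])]
    have := Finset.card_pos.2 hne
    positivity

open Classical in
/-- Near a point of the relative interior of a face, `K` is the half-space `coord a ≥ 0`. -/
lemma eventually_coord_pos {a x : E d} (hx : x ∈ hK.faceInterior a) :
    ∀ᶠ y in 𝓝 x, ∀ b ∈ K, b ≠ a → 0 < hK.coord b y := by
  have : ∀ b ∈ K, ∀ᶠ y in 𝓝 x, b ≠ a → 0 < hK.coord b y := by
    intro b hb
    by_cases hba : b = a
    · exact Eventually.of_forall fun y h => absurd hba h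
    · filter_upwards [(hK.continuous_coord b).continuousAt.eventually_const_lt
        (hx.2 b hb hba)] with y hy _ using hy
  exact (K.eventually_all).2 this

-- Otherwise the coordinate of `a` would vanish at all vertices of `K'`, hence identically, whereas
-- it equals `1` at `a`.
open Classical in
lemma coord_ne_zero_of_erase_eq {K' : Finset (E d)} (hK' : IsSimplex d K') {a a' : E d}
    (ha : a ∈ K) (ha' : a' ∈ K') (hF : K.erase a = K'.erase a') : hK.coord a a' ≠ 0 := by
  intro h0
  have : hK.coord a = 0 := by
    refine hK'.affine_ext fun b hb => ?_
    by_cases hba : b = a'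
    · subst hba; simpa using h0
    · have hbF : b ∈ K.erase a := by rw [hF]; simp [hb, hba]
      have hbF := Finset.mem_erase.1 hbF
      simp [hK.coord_ne ha hbF.2 hbF.1]
  have h1 := hK.coord_self ha
  rw [this] at h1
  simp at h1

-- The two affine functions vanish on the common face, so their values at the remaining vertex `a'`
-- of `K'` determine the factor.
open Classical in
lemma coord_eq_mul {K' : Finset (E d)} (hK' : IsSimplex d K') {a a' : E d}
    (ha : a ∈ K) (ha' : a' ∈ K') (hF : K.erase a = K'.erase a') (x : E d) :
    hK.coord a x = hK.coord a a' * hK'.coord a' x := by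
  have prop : hK.coord a = (hK.coord a a') • hK'.coord a' := by
    refine hK'.affine_ext fun b hb => ?_
    by_cases hba : b = a'
    · subst hba; simp [hK'.coord_self ha']
    · have hbF : b ∈ K.erase a := by rw [hF]; simp [hb, hba]
      have hbF := Finset.mem_erase.1 hbF
      simp [hK'.coord_ne ha' hb hba, hK.coord_ne ha hbF.2 hbF.1]
  conv_lhs => rw [prop]
  simp

end IsSimplex

/-! ### Geometry of the mesh -/

lemma IsPolytopal.exists_closed {U : Set (E d)} (h : IsPolytopal U) :
    ∃ Z, IsClosed Z ∧ U = interior Z := by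
  obtain ⟨𝒮, -, h⟩ := h
  exact ⟨_, 𝒮.finite_toSet.isClosed_biUnion fun s _ => (isCompact_hull s).isClosed, h⟩

/-- The interior of a closed set is a regular open set. This turns inclusions of closed elements in
closures of subdomains into inclusions of their interiors in the subdomains. -/
lemma IsPolytopal.interior_closure {U : Set (E d)} (h : IsPolytopal U) :
    interior (closure U) = U := by
  obtain ⟨Z, hZ, rfl⟩ := h.exists_closed
  refine subset_antisymm (interior_mono ?_) (interior_maximal subset_closure isOpen_interior)
  exact closure_minimal interior_subset hZ

lemma IsPolytopal.isOpen {U : Set (E d)} (h : IsPolytopal U) : IsOpen U := by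
  obtain ⟨Z, hZ, rfl⟩ := h.exists_closed
  exact isOpen_interior

lemma IsPolytopalPart.exists_closed {U Γ : Set (E d)} (h : IsPolytopalPart U Γ) :
    ∃ Z, IsClosed Z ∧ Γ = {x ∈ frontier U | Z ∈ 𝓝[frontier U] x} := by
  obtain ⟨𝒮, -, h⟩ := h
  exact ⟨_, 𝒮.finite_toSet.isClosed_biUnion fun s _ => (isCompact_hull s).isClosed, h⟩

namespace IsPolytopalPart

variable {U Γ : Set (E d)} (h : IsPolytopalPart U Γ)
include h

lemma subset_frontier : Γ ⊆ frontier U := by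
  obtain ⟨Z, -, rfl⟩ := h.exists_closed
  exact fun x hx => hx.1

lemma closure_subset_frontier : closure Γ ⊆ frontier U :=
  closure_minimal h.subset_frontier isClosed_frontier

/-- `Γ` is relatively open. -/
lemma mem_nhdsWithin {x : E d} (hx : x ∈ Γ) : Γ ∈ 𝓝[frontier U] x := by
  obtain ⟨Z, -, rfl⟩ := h.exists_closed
  have h1 := eventually_eventually_nhdsWithin.2 hx.2
  filter_upwards [h1, self_mem_nhdsWithin] with y hy hy' using ⟨hy', hy⟩

lemma isClosed_diff : IsClosed (frontier U \ Γ) := by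
  refine isClosed_of_closure_subset fun x hx => ?_
  have hxf : x ∈ frontier U := closure_minimal Set.sdiff_subset isClosed_frontier hx
  refine ⟨hxf, fun hxΓ => ?_⟩
  have h1 := h.mem_nhdsWithin hxΓ
  rw [mem_nhdsWithin_iff_eventually] at h1
  obtain ⟨y, hy1, hy2⟩ := (mem_closure_iff_frequently.1 hx).and_eventually h1 |>.exists
  exact hy1.2 (hy2 hy1.1)

/-- A point of the relatively open `Γ` has a boundary neighbourhood contained in `Γ`, which `Γ'`
cannot meet. -/
lemma disjoint_closure {Γ' : Set (E d)} (hΓ' : Γ' ⊆ frontier U) (hd : Disjoint Γ Γ') :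
    Disjoint Γ (closure Γ') := by
  rw [Set.disjoint_left]
  intro x hx hx'
  have h1 := h.mem_nhdsWithin hx
  rw [mem_nhdsWithin_iff_eventually] at h1
  obtain ⟨y, hy1, hy2⟩ := (mem_closure_iff_frequently.1 hx').and_eventually h1 |>.exists
  exact Set.disjoint_left.1 hd (hy2 (hΓ' hy1)) hy1

/-- `Γ` is the relative interior of a closed set, which therefore contains `closure Γ` and hence the
neighbourhood `S`. -/
lemma mem_of_subset_closure {S : Set (E d)} (hS : S ⊆ closure Γ) {x : E d} (hx : x ∈ frontier U)
    (hxS : S ∈ 𝓝[frontier U] x) : x ∈ Γ := by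
  obtain ⟨Z, hZ, rfl⟩ := h.exists_closed
  refine ⟨hx, mem_of_superset hxS (hS.trans (closure_minimal ?_ hZ))⟩
  rintro y ⟨hy, hyZ⟩
  exact mem_of_mem_nhdsWithin hy hyZ

end IsPolytopalPart

namespace Mesh

variable {P : Problem d} (T : Mesh P)

lemma mem_cells {K : Finset (E d)} : K ∈ T.cells ↔ K ∈ T.cx.faces ∧ K.card = d + 1 := by
  simp [cells]

lemma mem_faces {F : Finset (E d)} : F ∈ T.faces ↔ F ∈ T.cx.faces ∧ F.card = d := by
  simp [faces]

variable {T}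

lemma isSimplex {K : Finset (E d)} (hK : K ∈ T.cells) : IsSimplex d K :=
  ⟨(T.mem_cells.1 hK).2, T.cx.indep (T.mem_cells.1 hK).1⟩

open Classical in
lemma erase_mem_faces (hd : 1 ≤ d) {K : Finset (E d)} (hK : K ∈ T.cells) {a : E d} (ha : a ∈ K) :
    K.erase a ∈ T.faces := by
  have hc := (isSimplex hK).1
  have hc' : (K.erase a).card = d := by rw [Finset.card_erase_of_mem ha, hc]; rfl
  exact T.mem_faces.2 ⟨T.cx.down_closed (T.mem_cells.1 hK).1 (K.erase_subset a)
    (Finset.card_pos.1 (by omega)), hc'⟩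

open Classical in
lemma eq_erase_of_subset {K F : Finset (E d)} (hK : K ∈ T.cells) (hF : F ∈ T.faces) (h : F ⊆ K) :
    ∃ a ∈ K, F = K.erase a := by
  have h1 := (isSimplex hK).1
  have h2 := (T.mem_faces.1 hF).2
  have h3 : (K \ F).card = 1 := by rw [Finset.card_sdiff_of_subset h]; omega
  obtain ⟨a, ha⟩ := Finset.card_eq_one.1 h3
  have haK : a ∈ K \ F := by rw [ha]; simp
  refine ⟨a, (Finset.mem_sdiff.1 haK).1, ?_⟩
  rw [← Finset.sdiff_singleton_eq_erase, ← ha, Finset.sdiff_sdiff_eq_self h]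

lemma exists_cell {F : Finset (E d)} (hF : F ∈ T.faces) : ∃ K ∈ T.cells, F ⊆ K := by
  obtain ⟨K, hK, h, hc⟩ := T.pure F (T.mem_faces.1 hF).1
  exact ⟨K, T.mem_cells.2 ⟨hK, hc⟩, h⟩

lemma cellOf_spec {F : Finset (E d)} (hF : F ∈ T.faces) : T.cellOf F ∈ T.cells ∧ F ⊆ T.cellOf F := by
  have h := exists_cell hF
  rw [cellOf, dif_pos h]
  exact h.choose_spec

variable (T) in
lemma space_eq_biUnion : T.cx.space = ⋃ K ∈ T.cells, hull K := by
  refine subset_antisymm ?_ (Set.iUnion₂_subset fun K hK =>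
    T.cx.convexHull_subset_space (T.mem_cells.1 hK).1)
  intro x hx
  obtain ⟨s, hs, hxs⟩ := T.cx.mem_space_iff.1 hx
  obtain ⟨K, hK, h, hc⟩ := T.pure s hs
  exact Set.mem_iUnion₂.2 ⟨K, T.mem_cells.2 ⟨hK, hc⟩, convexHull_mono (by exact_mod_cast h) hxs⟩

variable (T) in
lemma closure_eq_biUnion : closure P.Ω = ⋃ K ∈ T.cells, hull K := by
  rw [← T.space_eq, T.space_eq_biUnion]

lemma hull_subset_closure {K : Finset (E d)} (hK : K ∈ T.cells) : hull K ⊆ closure P.Ω := by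
  rw [T.closure_eq_biUnion]
  exact Set.subset_biUnion_of_mem hK

lemma interior_hull_subset {K : Finset (E d)} (hK : K ∈ T.cells) : interior (hull K) ⊆ P.Ω := by
  rw [← P.isPolytopal.interior_closure]
  exact interior_mono (hull_subset_closure hK)

lemma isBounded (T : Mesh P) : Bornology.IsBounded P.Ω := by
  have h : Bornology.IsBounded (closure P.Ω) := by
    rw [T.closure_eq_biUnion]
    exact (Bornology.isBounded_biUnion_finset _).2 fun K _ => (isCompact_hull K).isBounded
  exact h.subset subset_closure

lemma hull_inter_hull {s t : Finset (E d)} (hs : s ∈ T.cx.faces) (ht : t ∈ T.cx.faces)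
    [DecidableEq (E d)] : hull s ∩ hull t ⊆ hull (s ∩ t) := by
  have := T.cx.inter_subset_convexHull hs ht
  simpa [hull] using this

lemma card_inter_lt {s t : Finset (E d)} (h : s.card = t.card) (hne : s ≠ t) [DecidableEq (E d)] :
    (s ∩ t).card < s.card := by
  refine Finset.card_lt_card ⟨Finset.inter_subset_left, fun hc => hne ?_⟩
  exact Finset.eq_of_subset_of_card_le (hc.trans Finset.inter_subset_right) h.ge

/-- Overlaps of measure zero do not count. The lemma serves both for the elements filling `Ω` and
for the Robin faces filling `Γ_R`. -/
lemma restrict_biUnion_eq {m : Measure (E d)} {I : Finset (Finset (E d))} {U : Set (E d)}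
    (hd : ∀ s ∈ I, ∀ t ∈ I, s ≠ t → m (hull s ∩ hull t) = 0)
    (hU : (⋃ s ∈ I, hull s : Set (E d)) =ᵐ[m] U) :
    m.restrict U = ∑ s ∈ I, m.restrict (hull s) := by
  rw [← Measure.restrict_congr_set hU]
  refine Measure.ext_of_lintegral _ fun f _ => ?_
  rw [lintegral_finsetSum_measure, lintegral_biUnion_finset₀]
  · exact fun s hs t ht hst => hd s hs t ht hst
  · exact fun s _ => (measurableSet_hull s).nullMeasurableSet

variable (T) in
lemma restrict_Ω : volume.restrict P.Ω = ∑ K ∈ T.cells, volume.restrict (hull K) := by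
  classical
  refine restrict_biUnion_eq (fun s hs t ht hst => ?_) ?_
  · refine measure_mono_null (hull_inter_hull (T.mem_cells.1 hs).1 (T.mem_cells.1 ht).1)
      (volume_hull_of_card_le ?_)
    have h1 := (isSimplex hs).1
    have h2 := (isSimplex ht).1
    have := card_inter_lt (h1.trans h2.symm) hst
    omega
  · refine ae_eq_set.2 ⟨?_, ?_⟩
    -- Interiors of elements lie in `Ω`, so what the closed elements have outside `Ω` is contained
    -- in their frontiers, which are null.
    · have hsub : (⋃ s ∈ T.cells, hull s) \ P.Ω ⊆ ⋃ s ∈ T.cells, frontier (hull s) := by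
        rintro x ⟨hx, hxΩ⟩
        obtain ⟨s, hs, hxs⟩ := Set.mem_iUnion₂.1 hx
        exact Set.mem_iUnion₂.2 ⟨s, hs, subset_closure hxs,
          fun hc => hxΩ (interior_hull_subset hs hc)⟩
      refine measure_mono_null hsub ((measure_biUnion_null_iff (T.cells.countable_toSet)).2
        fun s _ => (convex_convexHull ℝ (s : Set (E d))).addHaar_frontier volume)
    · rw [Set.sdiff_eq_empty.2, measure_empty]
      rw [← T.closure_eq_biUnion]
      exact subset_closure

lemma ae_Ω_iff {p : E d → Prop} : (∀ᵐ x ∂(volume.restrict P.Ω), p x) ↔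
    ∀ K ∈ T.cells, ∀ᵐ x ∂(volume.restrict (interior (hull K))), p x := by
  rw [T.restrict_Ω, ae_finsetSum_measure_iff]
  simp only [ae_restrict_hull]

lemma integral_Ω {f : E d → ℂ} (hf : IntegrableOn f P.Ω) :
    ∫ x in P.Ω, f x = ∑ K ∈ T.cells, ∫ x in hull K, f x := by
  have := hf
  rw [IntegrableOn, T.restrict_Ω, integrable_finsetSum_measure] at this
  rw [T.restrict_Ω, integral_finsetSum_measure this]

lemma integral_Ω_real {f : E d → ℝ} (hf : IntegrableOn f P.Ω) :
    ∫ x in P.Ω, f x = ∑ K ∈ T.cells, ∫ x in hull K, f x := by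
  have := hf
  rw [IntegrableOn, T.restrict_Ω, integrable_finsetSum_measure] at this
  rw [T.restrict_Ω, integral_finsetSum_measure this]

lemma memL2_Ω_iff {v : Scal d} : MemL2 P.Ω v ↔ ∀ K ∈ T.cells, MemL2 (interior (hull K)) v := by
  constructor
  · exact fun h K hK => h.mono (interior_hull_subset hK)
  · intro h
    rw [MemL2, memLp_two_iff_integrable_sq_norm, T.restrict_Ω, integrable_finsetSum_measure]
    · intro K hK
      have := (h K hK)
      rw [MemL2, ae_restrict_hull] at this
      exact this.integrable_norm_pow (by norm_num)
    · rw [T.restrict_Ω]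
      rw [← Measure.sum_coe_finset, aestronglyMeasurable_sum_measure_iff]
      intro K
      have := (h K K.2)
      rw [MemL2, ae_restrict_hull] at this
      exact this.1

variable (T) in
/-- The union of the faces of the mesh. -/
def skeleton : Set (E d) := ⋃ F ∈ T.faces, hull F

lemma hull_subset_skeleton {F : Finset (E d)} (hF : F ∈ T.faces) : hull F ⊆ T.skeleton :=
  Set.subset_biUnion_of_mem (u := fun F => hull F) hF

-- A boundary point lies in some element but not in its interior, which is contained in `Ω`; one of
-- its barycentric coordinates therefore vanishes.
variable (T) in
lemma frontier_subset_skeleton (hd : 1 ≤ d) : frontier P.Ω ⊆ T.skeleton := by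
  classical
  intro x hx
  have hx1 := frontier_subset_closure hx
  rw [T.closure_eq_biUnion] at hx1
  obtain ⟨K, hK, hxK⟩ := Set.mem_iUnion₂.1 hx1
  have hxi : x ∉ interior (hull K) := fun hc => by
    have := interior_hull_subset hK hc
    rw [P.isPolytopal.isOpen.frontier_eq] at hx
    exact hx.2 this
  have hs := isSimplex hK
  rw [hs.mem_interior_hull] at hxi
  push Not at hxi
  obtain ⟨a, ha, hax⟩ := hxi
  refine hull_subset_skeleton (erase_mem_faces hd hK ha) ((hs.mem_hull_erase ha).2 ⟨hxK, ?_⟩)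
  exact le_antisymm hax (hs.mem_hull.1 hxK a ha)

open Classical in
/-- A face of the complex that meets the relative interior of `F` contains `F`. -/
lemma erase_subset_of_mem {K s : Finset (E d)} (hd : 1 ≤ d) (hK : K ∈ T.cells) {a x : E d}
    (ha : a ∈ K) (hx : x ∈ (isSimplex hK).faceInterior a) (hs : s ∈ T.cx.faces) (hxs : x ∈ hull s) :
    K.erase a ⊆ s := by
  have h1 := hull_inter_hull (T.mem_faces.1 (erase_mem_faces hd hK ha)).1 hs
    ⟨(isSimplex hK).faceInterior_subset ha hx, hxs⟩
  rw [(isSimplex hK).mem_hull_subset (Finset.inter_subset_left.trans (K.erase_subset a))] at h1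
  intro b hb
  by_contra hbs
  have hb' := Finset.mem_erase.1 hb
  exact (hx.2 b hb'.2 hb'.1).ne' (h1.2 b hb'.2 (by simp [hbs]))

-- The vanishing of a further coordinate would put the point on another face of the same element.
open Classical in
lemma mem_faceInterior (hd : 1 ≤ d) {K : Finset (E d)} (hK : K ∈ T.cells) {a x : E d}
    (ha : a ∈ K) (hx : x ∈ hull (K.erase a)) (h : ∀ F ∈ T.faces, F ≠ K.erase a → x ∉ hull F) :
    x ∈ (isSimplex hK).faceInterior a := by
  have hs := isSimplex hK
  have hx' := (hs.mem_hull_erase ha).1 hx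
  refine ⟨hx'.2, fun b hb hba => lt_of_le_of_ne (hs.mem_hull.1 hx'.1 b hb) fun h0 => ?_⟩
  refine h (K.erase b) (erase_mem_faces hd hK hb) (fun he => ?_)
    ((hs.mem_hull_erase hb).2 ⟨hx'.1, h0.symm⟩)
  have : b ∈ K.erase a := by simp [hb, hba]
  rw [← he] at this
  simp at this

open Classical in
/-- Distinct elements sharing a face lie on opposite sides of it. -/
lemma coord_neg (hd : 1 ≤ d) {K K' : Finset (E d)} (hK : K ∈ T.cells) (hK' : K' ∈ T.cells)
    {a a' : E d} (ha : a ∈ K) (ha' : a' ∈ K') (hF : K.erase a = K'.erase a') (hne : K ≠ K') :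
    (isSimplex hK).coord a a' < 0 := by
  have hs := isSimplex hK
  have hs' := isSimplex hK'
  refine lt_of_le_of_ne (le_of_not_gt fun hpos => ?_)
    (hs.coord_ne_zero_of_erase_eq hs' ha ha' hF)
  set c := (K.erase a).centroid ℝ id with hc
  have hcI := hs.centroid_mem_faceInterior hd ha
  -- The barycentre of the common face is moved slightly towards `a'`. If `a'` were on the side of
  -- `a`, the moved point would lie in both elements and have a positive coordinate at `a`, although
  -- the intersection is spanned by common vertices, and `a` is not one of them.
  have hlim : Tendsto (fun t : ℝ => AffineMap.lineMap c a' t) (𝓝[>] 0) (𝓝 c) := by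
    have := (AffineMap.lineMap_continuous (p := c) (q := a') (R := ℝ)).tendsto 0
    rw [AffineMap.lineMap_apply_zero] at this
    exact this.mono_left nhdsWithin_le_nhds
  have hev := hlim.eventually (hs.eventually_coord_pos hcI)
  have h1 : ∀ᶠ t : ℝ in 𝓝[>] 0, t ∈ Set.Ioo (0 : ℝ) 1 := Ioo_mem_nhdsGT one_pos
  obtain ⟨t, ht, ht1⟩ := (hev.and h1).exists
  have hca : hs.coord a (AffineMap.lineMap c a' t) = t * hs.coord a a' := by
    rw [AffineMap.apply_lineMap, hcI.1, AffineMap.lineMap_apply]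
    simp
  have hposa : 0 < hs.coord a (AffineMap.lineMap c a' t) := by
    rw [hca]; exact mul_pos ht1.1 hpos
  have hxK : AffineMap.lineMap c a' t ∈ hull K := by
    rw [hs.mem_hull]
    intro b hb
    by_cases hba : b = a
    · subst hba; exact hposa.le
    · exact (ht b hb hba).le
  have hxK' : AffineMap.lineMap c a' t ∈ hull K' := by
    refine (convex_convexHull ℝ (K' : Set (E d))).lineMap_mem ?_ (subset_convexHull ℝ _ ha')
      ⟨ht1.1.le, ht1.2.le⟩
    have hsub : K.erase a ⊆ K' := hF ▸ K'.erase_subset a'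
    exact convexHull_mono (by exact_mod_cast hsub) (hs.faceInterior_subset ha hcI)
  have hin := hull_inter_hull (T.mem_cells.1 hK).1 (T.mem_cells.1 hK').1 ⟨hxK, hxK'⟩
  rw [hs.mem_hull_subset Finset.inter_subset_left] at hin
  have haK' : a ∉ K' := by
    intro haK'
    refine hne (Finset.eq_of_subset_of_card_le ?_ (by rw [hs.1, hs'.1]))
    intro b hb
    by_cases hba : b = a
    · subst hba; exact haK'
    · have : b ∈ K'.erase a' := by rw [← hF]; simp [hb, hba]
      exact Finset.mem_of_mem_erase this
  exact hposa.ne' (hin.2 a ha (by simp [haK']))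

open Classical in
/-- The relative interior of a face shared by two elements lies in `Ω`. -/
lemma mem_Ω_of_two (hd : 1 ≤ d) {K K' : Finset (E d)} (hK : K ∈ T.cells) (hK' : K' ∈ T.cells)
    {a a' x : E d} (ha : a ∈ K) (ha' : a' ∈ K') (hF : K.erase a = K'.erase a') (hne : K ≠ K')
    (hx : x ∈ (isSimplex hK).faceInterior a) : x ∈ P.Ω := by
  have hs := isSimplex hK
  have hs' := isSimplex hK'
  have hneg := coord_neg hd hK hK' ha ha' hF hne
  have hx' : x ∈ hs'.faceInterior a' := by
    refine mem_faceInterior hd hK' ha' (hF ▸ hs.faceInterior_subset ha hx) fun F hF' hFne hxF => ?_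
    have h1 := erase_subset_of_mem hd hK ha hx (T.mem_faces.1 hF').1 hxF
    refine hFne ?_
    rw [← hF]
    refine (Finset.eq_of_subset_of_card_le h1 ?_).symm
    rw [(T.mem_faces.1 hF').2, (T.mem_faces.1 (erase_mem_faces hd hK ha)).2]
  -- Near `x` each of the two elements is a half-space, and these lie on opposite sides of the face.
  -- Together they fill a neighbourhood of `x`, so `x` is interior to `closure Ω`.
  rw [← P.isPolytopal.interior_closure, mem_interior_iff_mem_nhds, T.closure_eq_biUnion]
  filter_upwards [hs.eventually_coord_pos hx, hs'.eventually_coord_pos hx'] with y hy hy'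
  by_cases hya : 0 ≤ hs.coord a y
  · refine Set.mem_iUnion₂.2 ⟨K, hK, hs.mem_hull.2 fun b hb => ?_⟩
    by_cases hba : b = a
    · subst hba; exact hya
    · exact (hy b hb hba).le
  · refine Set.mem_iUnion₂.2 ⟨K', hK', hs'.mem_hull.2 fun b hb => ?_⟩
    by_cases hba : b = a'
    · subst hba
      rw [hs.coord_eq_mul hs' ha ha' hF] at hya
      by_contra hc
      exact hya (mul_nonneg_of_nonpos_of_nonpos hneg.le (not_le.1 hc).le)
    · exact (hy' b hb hba).le

open Classical in
/-- The face of a single element lies on the boundary. -/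
lemma hull_subset_frontier (hd : 1 ≤ d) {K : Finset (E d)} (hK : K ∈ T.cells) {a : E d}
    (ha : a ∈ K) (h : ∀ K' ∈ T.cells, K.erase a ⊆ K' → K' = K) :
    hull (K.erase a) ⊆ frontier P.Ω := by
  have hs := isSimplex hK
  -- No other element contains a point of the relative interior of the face. If such a point were in
  -- `Ω`, a whole neighbourhood of it would lie in `K`, contradicting the vanishing of its
  -- coordinate at `a`.
  have key : ∀ x ∈ hs.faceInterior a, x ∉ P.Ω := by
    intro x hx hxΩ
    have hev : ∀ᶠ y in 𝓝 x, ∀ K' ∈ T.cells, K' ≠ K → y ∉ hull K' := by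
      refine (Finset.eventually_all _).2 fun K' hK' => ?_
      by_cases hKK : K' = K
      · exact Eventually.of_forall fun y h => absurd hKK h
      · have : x ∉ hull K' := fun hc =>
          hKK (h K' hK' (erase_subset_of_mem hd hK ha hx (T.mem_cells.1 hK').1 hc))
        filter_upwards [(isCompact_hull K').isClosed.isOpen_compl.mem_nhds this] with y hy _
        exact hy
    have hxi : x ∈ interior (hull K) := by
      rw [mem_interior_iff_mem_nhds]
      filter_upwards [hev, P.isPolytopal.isOpen.mem_nhds hxΩ] with y hy hyΩ
      have := subset_closure hyΩ
      rw [T.closure_eq_biUnion] at this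
      obtain ⟨K', hK', hyK'⟩ := Set.mem_iUnion₂.1 this
      by_cases hKK : K' = K
      · rwa [hKK] at hyK'
      · exact absurd hyK' (hy K' hK' hKK)
    exact (hs.mem_interior_hull.1 hxi a ha).ne' hx.1
  intro x hx
  have hx' := (hs.mem_hull_erase ha).1 hx
  rw [P.isPolytopal.isOpen.frontier_eq]
  refine ⟨hull_subset_closure hK hx'.1, fun hxΩ => ?_⟩
  set c := (K.erase a).centroid ℝ id with hc
  have hcI := hs.centroid_mem_faceInterior hd ha
  -- The remaining points of the face are pushed towards its barycentre. A small displacement stays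
  -- in the open set `Ω` and enters the relative interior, where `key` applies.
  have hlim : Tendsto (fun t : ℝ => AffineMap.lineMap x c t) (𝓝[>] 0) (𝓝 x) := by
    have := (AffineMap.lineMap_continuous (p := x) (q := c) (R := ℝ)).tendsto 0
    rw [AffineMap.lineMap_apply_zero] at this
    exact this.mono_left nhdsWithin_le_nhds
  have hev := hlim.eventually (P.isPolytopal.isOpen.mem_nhds hxΩ)
  have h1 : ∀ᶠ t : ℝ in 𝓝[>] 0, t ∈ Set.Ioo (0 : ℝ) 1 := Ioo_mem_nhdsGT one_pos
  obtain ⟨t, ht, ht1⟩ := (hev.and h1).exists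
  refine key _ ⟨?_, fun b hb hba => ?_⟩ ht
  · rw [AffineMap.apply_lineMap, hx'.2, hcI.1]; simp
  · rw [AffineMap.apply_lineMap, AffineMap.lineMap_apply]
    have h2 := hcI.2 b hb hba
    have h3 := hs.mem_hull.1 hx'.1 b hb
    simp only [vsub_eq_sub, smul_eq_mul, vadd_eq_add]
    nlinarith [ht1.1, ht1.2, mul_pos ht1.1 h2, mul_nonneg (sub_nonneg.2 ht1.2.le) h3]

/-- A face on the boundary belongs to a single element. -/
lemma cell_unique (hd : 1 ≤ d) {F K K' : Finset (E d)} (hF : F ∈ T.faces)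
    (hext : hull F ⊆ frontier P.Ω) (hK : K ∈ T.cells) (hK' : K' ∈ T.cells) (h : F ⊆ K)
    (h' : F ⊆ K') : K = K' := by
  classical
  by_contra hne
  obtain ⟨a, ha, rfl⟩ := eq_erase_of_subset hK hF h
  obtain ⟨a', ha', he⟩ := eq_erase_of_subset hK' hF h'
  have hcI := (isSimplex hK).centroid_mem_faceInterior hd ha
  have h1 := mem_Ω_of_two hd hK hK' ha ha' he hne hcI
  have h2 := hext ((isSimplex hK).faceInterior_subset ha hcI)
  rw [P.isPolytopal.isOpen.frontier_eq] at h2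
  exact h2.2 h1

open Classical in
/-- A face that is not on the boundary belongs to exactly two elements. -/
lemma exists_two_cells (hd : 1 ≤ d) {F : Finset (E d)} (hF : F ∈ T.faces)
    (hint : ¬ hull F ⊆ frontier P.Ω) : ∃ K K', K ≠ K' ∧ T.cells.filter (fun K => F ⊆ K) = {K, K'} := by
  obtain ⟨K, hK, h⟩ := exists_cell hF
  obtain ⟨a, ha, rfl⟩ := eq_erase_of_subset hK hF h
  have : ¬ ∀ K' ∈ T.cells, K.erase a ⊆ K' → K' = K := fun hc =>
    hint (hull_subset_frontier hd hK ha hc)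
  push Not at this
  obtain ⟨K', hK', h', hne⟩ := this
  refine ⟨K, K', hne.symm, ?_⟩
  ext L
  simp only [Finset.mem_filter, Finset.mem_insert, Finset.mem_singleton]
  constructor
  · rintro ⟨hL, hFL⟩
    by_contra hc
    push Not at hc
    obtain ⟨a', ha', he'⟩ := eq_erase_of_subset hK' hF h'
    obtain ⟨a'', ha'', he''⟩ := eq_erase_of_subset hL hF hFL
    -- For three elements around one face, all the pairwise coordinates `h1`, `h2`, `h3` would be
    -- negative, while `coord_eq_mul` makes the second the product of the other two.
    have h1 := coord_neg hd hK hK' ha ha' he' hne.symm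
    have h2 := coord_neg hd hK hL ha ha'' he'' hc.1.symm
    have h3 := coord_neg hd hK' hL ha' ha'' (he'.symm.trans he'') hc.2.symm
    rw [(isSimplex hK).coord_eq_mul (isSimplex hK') ha ha' he'] at h2
    linarith [mul_pos_of_neg_of_neg h1 h3]
  · rintro (rfl | rfl)
    · exact ⟨hK, h⟩
    · exact ⟨hK', h'⟩

end Mesh

/-! ### Boundary faces, coefficients and normals -/

namespace Mesh

variable {P : Problem d} {T : Mesh P}

/-- The faces cover the boundary, and the other ones form a closed set that misses `x`. -/
lemma hull_mem_nhdsWithin (hd : 1 ≤ d) {F : Finset (E d)} {x : E d}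
    (h : ∀ F' ∈ T.faces, F' ≠ F → x ∉ hull F') : hull F ∈ 𝓝[frontier P.Ω] x := by
  have hev : ∀ᶠ y in 𝓝 x, ∀ F' ∈ T.faces, F' ≠ F → y ∉ hull F' := by
    refine (Finset.eventually_all _).2 fun F' hF' => ?_
    by_cases hFF : F' = F
    · exact Eventually.of_forall fun y h => absurd hFF h
    · filter_upwards [(isCompact_hull F').isClosed.isOpen_compl.mem_nhds (h F' hF' hFF)]
        with y hy _ using hy
  filter_upwards [mem_nhdsWithin_of_mem_nhds hev, self_mem_nhdsWithin] with y hy hyf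
  obtain ⟨F', hF', hyF'⟩ := Set.mem_iUnion₂.1 (T.frontier_subset_skeleton hd hyf)
  by_cases hFF : F' = F
  · exact hFF ▸ hyF'
  · exact absurd hyF' (hy F' hF' hFF)

lemma surf_inter_hull {F F' : Finset (E d)} (hF : F ∈ T.faces) (hF' : F' ∈ T.faces)
    (hne : F ≠ F') : surf d (hull F ∩ hull F') = 0 := by
  classical
  rw [T.mem_faces] at hF hF'
  refine measure_mono_null (hull_inter_hull hF.1 hF'.1) (surf_hull_of_card_lt ?_)
  have := card_inter_lt (hF.2.trans hF'.2.symm) hne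
  omega

lemma ae_notMem_hull {F : Finset (E d)} (hF : F ∈ T.faces) :
    ∀ᵐ x ∂((surf d).restrict (hull F)), ∀ F' ∈ T.faces, F' ≠ F → x ∉ hull F' := by
  rw [Filter.eventually_all_finset]
  intro F' hF'
  by_cases hFF : F' = F
  · exact Eventually.of_forall fun y h => absurd hFF h
  · rw [ae_restrict_iff' (measurableSet_hull F)]
    refine mem_ae_iff.2 (measure_mono_null ?_ (surf_inter_hull hF hF' (Ne.symm hFF)))
    intro x hx
    simp only [Set.mem_compl_iff, Set.mem_ofPred_eq, Classical.not_imp, not_not] at hx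
    exact ⟨hx.1, hx.2.2⟩

lemma centroid_notMem_hull (hd : 1 ≤ d) {F : Finset (E d)} (hF : F ∈ T.faces) :
    F.centroid ℝ id ∈ hull F ∧ ∀ F' ∈ T.faces, F' ≠ F → F.centroid ℝ id ∉ hull F' := by
  classical
  obtain ⟨K, hK, h⟩ := exists_cell hF
  obtain ⟨a, ha, rfl⟩ := eq_erase_of_subset hK hF h
  have hcI := (isSimplex hK).centroid_mem_faceInterior hd ha
  refine ⟨(isSimplex hK).faceInterior_subset ha hcI, fun F' hF' hne hc => hne ?_⟩
  have h1 := erase_subset_of_mem hd hK ha hcI (T.mem_faces.1 hF').1 hc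
  refine (Finset.eq_of_subset_of_card_le h1 ?_).symm
  rw [(T.mem_faces.1 hF').2, (T.mem_faces.1 hF).2]

section Part

variable {Γ : Set (E d)} (hΓ : IsPolytopalPart P.Ω Γ)
include hΓ

/-- Conformity only places `F` in `closure Γ`. Away from the other faces, `F` is a boundary
neighbourhood of its points, which forces them into the relatively open `Γ`. -/
lemma mem_part (hd : 1 ≤ d) {F : Finset (E d)} {x : E d} (hx : x ∈ hull F)
    (h : ∀ F' ∈ T.faces, F' ≠ F → x ∉ hull F') (hFΓ : hull F ⊆ closure Γ) : x ∈ Γ :=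
  hΓ.mem_of_subset_closure hFΓ (hΓ.closure_subset_frontier (hFΓ hx)) (hull_mem_nhdsWithin hd h)

lemma ae_mem_part (hd : 1 ≤ d) {F : Finset (E d)} (hF : F ∈ T.faces) (hFΓ : hull F ⊆ closure Γ) :
    ∀ᵐ x ∂((surf d).restrict (hull F)), x ∈ Γ := by
  filter_upwards [ae_notMem_hull hF, ae_restrict_mem (measurableSet_hull F)] with x hx hxF
  exact mem_part hΓ hd hxF hx hFΓ

lemma hull_ae_le_part (hd : 1 ≤ d) {F : Finset (E d)} (hF : F ∈ T.faces)
    (hFΓ : hull F ⊆ closure Γ) : (hull F : Set (E d)) ≤ᵐ[surf d] Γ := by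
  have := ae_mem_part hΓ hd hF hFΓ
  rw [ae_restrict_iff' (measurableSet_hull F)] at this
  exact this

lemma centroid_mem_part (hd : 1 ≤ d) {F : Finset (E d)} (hF : F ∈ T.faces)
    (hFΓ : hull F ⊆ closure Γ) : F.centroid ℝ id ∈ Γ :=
  mem_part hΓ hd (centroid_notMem_hull hd hF).1 (centroid_notMem_hull hd hF).2 hFΓ

end Part

lemma mem_facesD {F : Finset (E d)} : F ∈ T.facesD ↔ F ∈ T.faces ∧ hull F ⊆ closure P.ΓD := by
  simp [facesD]

lemma mem_facesN {F : Finset (E d)} : F ∈ T.facesN ↔ F ∈ T.faces ∧ hull F ⊆ closure P.ΓN := by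
  simp [facesN]

lemma mem_facesR {F : Finset (E d)} : F ∈ T.facesR ↔ F ∈ T.faces ∧ hull F ⊆ closure P.ΓR := by
  simp [facesR]

/-- Interior faces are defined by exclusion of the three boundary types; conformity with the
boundary partition makes this a geometric condition. -/
lemma mem_facesI {F : Finset (E d)} : F ∈ T.facesI ↔ F ∈ T.faces ∧ ¬ hull F ⊆ frontier P.Ω := by
  simp only [facesI, Finset.mem_sdiff, Finset.mem_union, mem_facesD, mem_facesN, mem_facesR]
  constructor
  · rintro ⟨hF, h⟩
    refine ⟨hF, fun hc => h ?_⟩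
    rcases T.conf_Γ F (T.mem_faces.1 hF).1 (T.mem_faces.1 hF).2 hc with h1 | h1 | h1
    · exact Or.inl (Or.inl ⟨hF, h1⟩)
    · exact Or.inl (Or.inr ⟨hF, h1⟩)
    · exact Or.inr ⟨hF, h1⟩
  · rintro ⟨hF, h⟩
    refine ⟨hF, fun hc => h ?_⟩
    rcases hc with (h1 | h1) | h1
    · exact h1.2.trans P.partD.closure_subset_frontier
    · exact h1.2.trans P.partN.closure_subset_frontier
    · exact h1.2.trans P.partR.closure_subset_frontier

lemma faces_cases {F : Finset (E d)} (hF : F ∈ T.faces) :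
    F ∈ T.facesI ∨ F ∈ T.facesD ∨ F ∈ T.facesN ∨ F ∈ T.facesR := by
  by_cases h : hull F ⊆ frontier P.Ω
  · rcases T.conf_Γ F (T.mem_faces.1 hF).1 (T.mem_faces.1 hF).2 h with h1 | h1 | h1
    · exact Or.inr (Or.inl (mem_facesD.2 ⟨hF, h1⟩))
    · exact Or.inr (Or.inr (Or.inl (mem_facesN.2 ⟨hF, h1⟩)))
    · exact Or.inr (Or.inr (Or.inr (mem_facesR.2 ⟨hF, h1⟩)))
  · exact Or.inl (mem_facesI.2 ⟨hF, h⟩)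

lemma notMem_facesD_of_facesN (hd : 1 ≤ d) {F : Finset (E d)} (h : F ∈ T.facesN) : F ∉ T.facesD :=
  fun h' => Set.disjoint_left.1 P.disjDN
    (centroid_mem_part P.partD hd (mem_facesD.1 h').1 (mem_facesD.1 h').2)
    (centroid_mem_part P.partN hd (mem_facesN.1 h).1 (mem_facesN.1 h).2)

lemma notMem_facesD_of_facesR (hd : 1 ≤ d) {F : Finset (E d)} (h : F ∈ T.facesR) : F ∉ T.facesD :=
  fun h' => Set.disjoint_left.1 P.disjDR
    (centroid_mem_part P.partD hd (mem_facesD.1 h').1 (mem_facesD.1 h').2)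
    (centroid_mem_part P.partR hd (mem_facesR.1 h).1 (mem_facesR.1 h).2)

lemma notMem_facesN_of_facesR (hd : 1 ≤ d) {F : Finset (E d)} (h : F ∈ T.facesR) : F ∉ T.facesN :=
  fun h' => Set.disjoint_left.1 P.disjNR
    (centroid_mem_part P.partN hd (mem_facesN.1 h').1 (mem_facesN.1 h').2)
    (centroid_mem_part P.partR hd (mem_facesR.1 h).1 (mem_facesR.1 h).2)

lemma frontier_of_facesR {F : Finset (E d)} (h : F ∈ T.facesR) : hull F ⊆ frontier P.Ω :=
  (mem_facesR.1 h).2.trans P.partR.closure_subset_frontier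

variable (T) in
/-- Up to null sets, `ΓR` is the union of the Robin faces. -/
lemma restrict_ΓR (hd : 1 ≤ d) :
    (surf d).restrict P.ΓR = ∑ F ∈ T.facesR, (surf d).restrict (hull F) := by
  classical
  refine restrict_biUnion_eq (fun s hs t ht hst =>
    surf_inter_hull (mem_facesR.1 hs).1 (mem_facesR.1 ht).1 hst) (ae_eq_set.2 ⟨?_, ?_⟩)
  · have : (⋃ s ∈ T.facesR, hull s) \ P.ΓR ⊆ ⋃ s ∈ T.facesR, hull s \ P.ΓR := by
      rintro x ⟨hx, hx'⟩
      obtain ⟨s, hs, hxs⟩ := Set.mem_iUnion₂.1 hx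
      exact Set.mem_iUnion₂.2 ⟨s, hs, hxs, hx'⟩
    refine measure_mono_null this ((measure_biUnion_null_iff T.facesR.countable_toSet).2 ?_)
    intro s hs
    exact ae_le_set.1 (hull_ae_le_part P.partR hd (mem_facesR.1 hs).1 (mem_facesR.1 hs).2)
  -- Up to intersections of distinct faces, which are null, a point of `Γ_R` lies on a single face.
  -- That face is not interior, since its relative interior would lie in `Ω`, nor of Dirichlet or
  -- Neumann type, since `Γ_R` misses the closures of the other two parts.
  · have : P.ΓR \ (⋃ s ∈ T.facesR, hull s) ⊆
        ⋃ F ∈ T.faces, ⋃ F' ∈ T.faces.erase F, hull F ∩ hull F' := by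
      rintro x ⟨hx, hx'⟩
      have hxf := P.partR.subset_frontier hx
      obtain ⟨F, hF, hxF⟩ := Set.mem_iUnion₂.1 (T.frontier_subset_skeleton hd hxf)
      by_contra hc
      have hoff : ∀ F' ∈ T.faces, F' ≠ F → x ∉ hull F' := by
        intro F' hF' hne hxF'
        refine hc (Set.mem_iUnion₂.2 ⟨F, hF, Set.mem_iUnion₂.2 ⟨F', ?_, hxF, hxF'⟩⟩)
        simp [hF', hne]
      rcases faces_cases hF with h | h | h | h
      · obtain ⟨K, K', hne, hKK⟩ := exists_two_cells hd hF (mem_facesI.1 h).2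
        have hK : K ∈ T.cells.filter (fun K => F ⊆ K) := by rw [hKK]; simp
        have hK' : K' ∈ T.cells.filter (fun K => F ⊆ K) := by rw [hKK]; simp
        rw [Finset.mem_filter] at hK hK'
        obtain ⟨a, ha, he⟩ := eq_erase_of_subset hK.1 hF hK.2
        obtain ⟨a', ha', he'⟩ := eq_erase_of_subset hK'.1 hF hK'.2
        have := mem_Ω_of_two hd hK.1 hK'.1 ha ha' (he.symm.trans he') hne
          (mem_faceInterior hd hK.1 ha (he ▸ hxF) (he ▸ hoff))
        rw [P.isPolytopal.isOpen.frontier_eq] at hxf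
        exact hxf.2 this
      · exact Set.disjoint_left.1 (P.partR.disjoint_closure P.partD.subset_frontier P.disjDR.symm)
          hx ((mem_facesD.1 h).2 hxF)
      · exact Set.disjoint_left.1 (P.partR.disjoint_closure P.partN.subset_frontier P.disjNR.symm)
          hx ((mem_facesN.1 h).2 hxF)
      · exact hx' (Set.mem_iUnion₂.2 ⟨F, h, hxF⟩)
    refine measure_mono_null this ((measure_biUnion_null_iff T.faces.countable_toSet).2 ?_)
    intro F hF
    refine (measure_biUnion_null_iff (Finset.countable_toSet _)).2 fun F' hF' => ?_
    have hF' := Finset.mem_erase.1 hF'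
    exact surf_inter_hull hF hF'.2 hF'.1.symm

/-! Coefficients -/

/-- Regularity of polytopal sets puts the interior of `K` inside one subdomain, where the
coefficients are constant; the centroid is one of its points. -/
lemma coeff_cell {K : Finset (E d)} (hK : K ∈ T.cells) :
    (0 < μK P K ∧ ∀ x ∈ interior (hull K), P.μ x = μK P K) ∧
    ((P.A (K.centroid ℝ id)).PosDef ∧
      ∀ x ∈ interior (hull K), P.A x = P.A (K.centroid ℝ id)) := by
  obtain ⟨Q, hQ, h⟩ := T.conf_subdom K (T.mem_cells.1 hK).1 (T.mem_cells.1 hK).2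
  have hsub : interior (hull K) ⊆ Q := by
    rw [← (P.subdom_polytopal Q hQ).interior_closure]
    exact interior_mono h
  have hc := hsub (isSimplex hK).centroid_mem_interior
  obtain ⟨m, hm, hμ⟩ := P.μ_const Q hQ
  obtain ⟨M, hM, hA⟩ := P.A_const Q hQ
  refine ⟨⟨?_, fun x hx => ?_⟩, ?_, fun x hx => ?_⟩
  · rw [μK, hμ _ hc]; exact hm
  · rw [μK, hμ _ hc, hμ _ (hsub hx)]
  · rw [hA _ hc]; exact hM
  · rw [hA _ hc, hA _ (hsub hx)]

lemma coeff_face (hd : 1 ≤ d) {F : Finset (E d)} (hF : F ∈ T.facesR) :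
    0 < γF P F ∧ ∀ᵐ x ∂((surf d).restrict (hull F)), P.γ x = γF P F := by
  rw [mem_facesR] at hF
  have hF' := T.mem_faces.1 hF.1
  obtain ⟨Q, hQ, h⟩ := T.conf_subrob F hF'.1 hF'.2 hF.2
  obtain ⟨g, hg, hγ⟩ := P.γ_const Q hQ
  have hc := centroid_mem_part (P.subrob_polytopal Q hQ) hd hF.1 h
  refine ⟨by rw [γF, hγ _ hc]; exact hg, ?_⟩
  filter_upwards [ae_mem_part (P.subrob_polytopal Q hQ) hd hF.1 h] with x hx
  rw [γF, hγ _ hc, hγ _ hx]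

/-! Normals -/

open Classical in
lemma outerNormal_spec (hd : 1 ≤ d) {K : Finset (E d)} (hK : K ∈ T.cells) {a : E d} (ha : a ∈ K) :
    IsOuterNormal K (K.erase a) (outerNormal K (K.erase a)) := by
  have := (isSimplex hK).exists_outerNormal hd ha
  rw [outerNormal, dif_pos this]
  exact this.choose_spec

lemma cellOf_eq (hd : 1 ≤ d) {F K : Finset (E d)} (hF : F ∈ T.faces)
    (hext : hull F ⊆ frontier P.Ω) (hK : K ∈ T.cells) (h : F ⊆ K) : T.cellOf F = K :=
  cell_unique hd hF hext (cellOf_spec hF).1 hK (cellOf_spec hF).2 h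

open Classical in
lemma filter_cells_of_ext (hd : 1 ≤ d) {F : Finset (E d)} (hF : F ∈ T.faces)
    (hext : hull F ⊆ frontier P.Ω) : T.cells.filter (fun K => F ⊆ K) = {T.cellOf F} := by
  ext K
  simp only [Finset.mem_filter, Finset.mem_singleton]
  constructor
  · rintro ⟨hK, h⟩
    exact (cellOf_eq hd hF hext hK h).symm
  · rintro rfl
    exact cellOf_spec hF

lemma normal_eq (hd : 1 ≤ d) {F K : Finset (E d)} (hF : F ∈ T.faces) (hK : K ∈ T.cells)
    (h : F ⊆ K) {ν : E d} (hν : IsOuterNormal K F ν) : ν = outerNormal K F := by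
  classical
  obtain ⟨a, ha, rfl⟩ := eq_erase_of_subset hK hF h
  refine ((isSimplex hK).outerNormal_unique (isSimplex hK) hd ha ha rfl
    (outerNormal_spec hd hK ha) hν).1 ?_
  rw [(isSimplex hK).coord_self ha]
  exact one_pos

lemma nF_of_ext (hd : 1 ≤ d) {F : Finset (E d)} (hF : F ∈ T.faces)
    (hext : hull F ⊆ frontier P.Ω) : T.nF F = outerNormal (T.cellOf F) F := by
  obtain ⟨K, hK, hc, h, hν⟩ := T.nF_spec F (T.mem_faces.1 hF).1 (T.mem_faces.1 hF).2
  have hK' := T.mem_cells.2 ⟨hK, hc⟩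
  rw [cellOf_eq hd hF hext hK' h]
  exact normal_eq hd hF hK' h hν

/-- The normals on the two sides of an interior face are opposite. -/
lemma outerNormal_opposite (hd : 1 ≤ d) {F K K' : Finset (E d)} (hF : F ∈ T.faces)
    (hK : K ∈ T.cells) (hK' : K' ∈ T.cells) (h : F ⊆ K) (h' : F ⊆ K') (hne : K ≠ K') :
    outerNormal K' F = -outerNormal K F := by
  classical
  obtain ⟨a, ha, rfl⟩ := eq_erase_of_subset hK hF h
  obtain ⟨a', ha', he⟩ := eq_erase_of_subset hK' hF h'
  have h1 := outerNormal_spec hd hK ha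
  have h2 := outerNormal_spec hd hK' ha'
  have := ((isSimplex hK).outerNormal_unique (isSimplex hK') hd ha ha' he h1 h2).2
    (coord_neg hd hK hK' ha ha' he hne)
  rwa [← he] at this

/-- The fixed normal of a face is the outer normal of an element, up to the sign
`outerNormal · nF`. -/
lemma outerNormal_eq_smul (hd : 1 ≤ d) {F K : Finset (E d)} (hF : F ∈ T.faces) (hK : K ∈ T.cells)
    (h : F ⊆ K) : outerNormal K F = (inner ℝ (outerNormal K F) (T.nF F) : ℝ) • T.nF F := by
  classical
  obtain ⟨K', hK', hc, h', hν⟩ := T.nF_spec F (T.mem_faces.1 hF).1 (T.mem_faces.1 hF).2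
  have hK' := T.mem_cells.2 ⟨hK', hc⟩
  have e := normal_eq hd hF hK' h' hν
  have hn : inner ℝ (T.nF F) (T.nF F) = (1 : ℝ) := by
    rw [real_inner_self_eq_norm_sq, hν.1, one_pow]
  by_cases hKK : K = K'
  · subst hKK
    rw [← e, hn, one_smul]
  · have := outerNormal_opposite hd hF hK' hK h' h (Ne.symm hKK)
    rw [← e] at this
    rw [this, inner_neg_left, hn, neg_smul, one_smul]

end Mesh

/-! ### Broken functions -/

/-- The components of a real vector as complex numbers. -/
def cvec (ν : E d) : Fin d → ℂ := fun i => ((ν i : ℝ) : ℂ)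

lemma cvec_smul (c : ℝ) (ν : E d) : cvec (c • ν) = (c : ℂ) • cvec ν := by
  ext i; simp [cvec]

lemma cvec_neg (ν : E d) : cvec (-ν) = -cvec ν := by
  ext i; simp [cvec]

/-- The classical divergence. -/
def cdiv (τ : Vect d) : Scal d := fun x => ∑ i, cgrad (fun y => τ y i) x i

/-- A vector field with smooth components. -/
def SmoothVec (τ : Vect d) : Prop := ∀ i, ContDiff ℝ ∞ (fun x => τ x i)

lemma SmoothVec.star {τ : Vect d} (h : SmoothVec τ) : SmoothVec (star τ) :=
  fun i => contDiff_star (h i)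

lemma SmoothVec.cdiv_star {τ : Vect d} (h : SmoothVec τ) : cdiv (Star.star τ) = Star.star (cdiv τ) := by
  ext x
  simp only [cdiv, Pi.star_apply, star_sum]
  exact Finset.sum_congr rfl fun i _ => cgrad_star (h i).diff x i

lemma SmoothVec.continuous_cdiv {τ : Vect d} (h : SmoothVec τ) : Continuous (cdiv τ) :=
  continuous_finsetSum _ fun i _ => continuous_cgrad (h i) i

lemma SmoothVec.dot {τ : Vect d} (h : SmoothVec τ) (c : Fin d → ℂ) :
    ContDiff ℝ ∞ (fun x => τ x ⬝ᵥ c) := by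
  simp only [dotProduct]
  exact ContDiff.sum fun i _ => (h i).mul contDiff_const

namespace IsSimplex

variable {K : Finset (E d)} (hK : IsSimplex d K)
include hK

open Classical in
/-- Green's formula for smooth functions. -/
lemma green_smooth (hd : 1 ≤ d) {φ : Scal d} (hφ : ContDiff ℝ ∞ φ) {τ : Vect d}
    (hτ : SmoothVec τ) :
    ∫ x in hull K, (cgrad φ x ⬝ᵥ τ x + φ x * cdiv τ x) =
      ∑ a ∈ K, ∫ x in hull (K.erase a),
        φ x * (τ x ⬝ᵥ cvec (outerNormal K (K.erase a))) ∂(surf d) := by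
  have hcont : ∀ i, ContDiff ℝ ∞ (fun x => φ x * τ x i) := fun i => hφ.mul (hτ i)
  have h1 : ∀ i, ∫ x in hull K, cgrad (fun y => φ y * τ y i) x i = ∑ a ∈ K,
      ((outerNormal K (K.erase a) i : ℝ) : ℂ) *
        ∫ x in hull (K.erase a), φ x * τ x i ∂(surf d) := by
    intro i
    have := hK.integral_fderiv hd ((hcont i).of_le (by norm_cast : (1 : WithTop ℕ∞) ≤ ∞))
      (EuclideanSpace.single i (1 : ℝ))
    simp only [EuclideanSpace.inner_single_right] at this
    simpa [cgrad] using this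
  have h2 : ∀ x, cgrad φ x ⬝ᵥ τ x + φ x * cdiv τ x = ∑ i, cgrad (fun y => φ y * τ y i) x i := by
    intro x
    simp only [dotProduct, cdiv, Finset.mul_sum, ← Finset.sum_add_distrib]
    refine Finset.sum_congr rfl fun i _ => ?_
    rw [cgrad_mul hφ.diff (hτ i).diff]
    ring
  simp_rw [h2]
  rw [integral_finsetSum _ fun i _ => ((continuous_cgrad (hcont i) i).continuousOn.integrableOn_compact
    (isCompact_hull K)), Finset.sum_congr rfl fun i _ => h1 i, Finset.sum_comm]
  refine Finset.sum_congr rfl fun a ha => ?_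
  have hint : ∀ i ∈ Finset.univ, Integrable (fun x => φ x * τ x i *
      ((outerNormal K (K.erase a) i : ℝ) : ℂ)) ((surf d).restrict (hull (K.erase a))) := by
    intro i _
    have := (memLp_of_continuous (hcont i).continuous (isCompact_hull (K.erase a)).isBounded
      (hK.surf_hull_erase_lt_top hd ha))
    have hf : IsFiniteMeasure ((surf d).restrict (hull (K.erase a))) :=
      isFiniteMeasure_restrict.2 (hK.surf_hull_erase_lt_top hd ha).ne
    exact (this.integrable (by norm_num)).mul_const _
  simp only [dotProduct, Finset.mul_sum, cvec, ← mul_assoc]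
  rw [integral_finsetSum _ hint]
  refine Finset.sum_congr rfl fun i _ => ?_
  rw [integral_mul_const, mul_comm]

open Classical in
/-- Green's formula on a simplex. -/
lemma green (hd : 1 ≤ d) {w : Scal d} (hw : MemH1 (interior (hull K)) w) {φ : ℕ → Scal d}
    (hφ : IsApprox (interior (hull K)) w φ) {τ : Vect d} (hτ : SmoothVec τ) :
    ∫ x in interior (hull K), (wgrad (interior (hull K)) w x ⬝ᵥ τ x + w x * cdiv τ x) =
      ∑ a ∈ K, ∫ x in hull (K.erase a), trace (interior (hull K)) (hull (K.erase a)) w x *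
        (τ x ⬝ᵥ cvec (outerNormal K (K.erase a))) ∂(surf d) := by
  set U := interior (hull K) with hU
  have hUb : Bornology.IsBounded U := (isCompact_hull K).isBounded.subset interior_subset
  have hL2 : ∀ {f : Scal d}, Continuous f → MemL2 U f := fun hf =>
    memLp_of_continuous hf hUb hUb.measure_lt_top
  have hlim1 : Tendsto (fun n => ∫ x in U, (cgrad (φ n) x ⬝ᵥ τ x + φ n x * cdiv τ x)) atTop
      (𝓝 (∫ x in U, (wgrad U w x ⬝ᵥ τ x + w x * cdiv τ x))) := by
    have e : ∀ (v : Scal d) (G : Vect d), MemL2 U v → MemL2Vec U G →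
        ∫ x in U, (G x ⬝ᵥ τ x + v x * cdiv τ x) =
          ∑ i, (∫ x in U, G x i * τ x i) + ∫ x in U, v x * cdiv τ x := by
      intro v G hv hG
      rw [integral_add (integrable_dot hG fun i => hL2 (hτ i).continuous)
        (integrable_mul_of_memLp hv (hL2 hτ.continuous_cdiv))]
      simp only [dotProduct]
      rw [integral_finsetSum _ fun i _ => integrable_mul_of_memLp (hG i) (hL2 (hτ i).continuous)]
    rw [e _ _ hw.1 hw.wgrad_spec.1]
    simp_rw [fun n => e _ _ (hL2 (hφ.smooth n).continuous)
      (fun i => hL2 (continuous_cgrad (hφ.smooth n) i))]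
    refine (tendsto_finsetSum _ fun i _ => ?_).add ?_
    · exact tendsto_integral_mul (fun n => hL2 (continuous_cgrad (hφ.smooth n) i))
        (hw.memL2_wgrad i) (hL2 (hτ i).continuous) (hφ.grad i)
    · exact tendsto_integral_mul (fun n => hL2 (hφ.smooth n).continuous) hw.1
        (hL2 hτ.continuous_cdiv) hφ.val
  have hlim2 : Tendsto (fun n => ∑ a ∈ K, ∫ x in hull (K.erase a),
      φ n x * (τ x ⬝ᵥ cvec (outerNormal K (K.erase a))) ∂(surf d)) atTop
      (𝓝 (∑ a ∈ K, ∫ x in hull (K.erase a), trace U (hull (K.erase a)) w x *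
        (τ x ⬝ᵥ cvec (outerNormal K (K.erase a))) ∂(surf d))) := by
    -- The approximating sequence is given in advance; `tendsto_trace` ensures that its restriction
    -- to each face converges to the chosen trace.
    refine tendsto_finsetSum _ fun a ha => ?_
    have hT := hK.tracePair_erase hd ha
    obtain ⟨g, hg⟩ := hT.exists_of_isApprox hw hφ
    have htr := isTrace_trace hg
    exact tendsto_integral_mul (fun n => hT.memL2Surf (hφ.smooth n)) htr.1
      (hT.memL2Surf (hτ.dot _)) (hT.tendsto_trace hw htr hφ)
  refine tendsto_nhds_unique hlim1 (hlim2.congr fun n => ?_)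
  rw [← hK.green_smooth hd (hφ.smooth n) hτ, hU, ae_restrict_hull]

end IsSimplex

namespace Mesh

variable {P : Problem d} {T : Mesh P}

variable (T) in
/-- Functions that are limits of smooth functions in `H¹(K)` for all elements `K`. -/
def IsBroken (v : Scal d) : Prop :=
  ∀ K ∈ T.cells, MemH1 (interior (hull K)) v ∧ ∃ φ, IsApprox (interior (hull K)) v φ

variable (T) in
/-- `τ K` is smooth and equal to `w` on each element `K`. -/
def IsSmoothRep (w : Vect d) (τ : Finset (E d) → Vect d) : Prop :=
  ∀ K ∈ T.cells, SmoothVec (τ K) ∧ ∀ᵐ x ∂(volume.restrict (interior (hull K))), w x = τ K x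

namespace IsBroken

variable {v w : Scal d} (hv : T.IsBroken v)
include hv

lemma add (hw : T.IsBroken w) : T.IsBroken (v + w) := fun K hK => by
  obtain ⟨h, φ, hφ⟩ := hv K hK
  obtain ⟨h', ψ, hψ⟩ := hw K hK
  exact ⟨h.add h', _, hφ.add isOpen_interior h h' hψ⟩

lemma smul (c : ℂ) : T.IsBroken (c • v) := fun K hK => by
  obtain ⟨h, φ, hφ⟩ := hv K hK
  exact ⟨h.smul c, _, hφ.smul isOpen_interior c h⟩

lemma neg : T.IsBroken (-v) := by
  have := hv.smul (-1)
  rwa [neg_one_smul] at this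

lemma sub (hw : T.IsBroken w) : T.IsBroken (v - w) := by
  rw [sub_eq_add_neg]
  exact hv.add hw.neg

lemma memL2 : MemL2 P.Ω v := memL2_Ω_iff.2 fun K hK => (hv K hK).1.1

lemma mem_H1 : v ∈ T.H1 := ⟨hv.memL2, fun K hK => (hv K hK).1⟩

open Classical in
lemma isTrace_erase (hd : 1 ≤ d) {K : Finset (E d)} (hK : K ∈ T.cells) {a : E d} (ha : a ∈ K) :
    IsTrace (interior (hull K)) (hull (K.erase a)) v (faceTrace K (K.erase a) v) := by
  obtain ⟨h, φ, hφ⟩ := hv K hK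
  obtain ⟨g, hg⟩ := ((isSimplex hK).tracePair_erase hd ha).exists_of_isApprox h hφ
  exact isTrace_trace hg

lemma isTrace (hd : 1 ≤ d) {K F : Finset (E d)} (hK : K ∈ T.cells) (hF : F ∈ T.faces)
    (h : F ⊆ K) : IsTrace (interior (hull K)) (hull F) v (faceTrace K F v) := by
  classical
  obtain ⟨a, ha, rfl⟩ := eq_erase_of_subset hK hF h
  exact hv.isTrace_erase hd hK ha

end IsBroken

lemma tracePair_face (hd : 1 ≤ d) {K F : Finset (E d)} (hK : K ∈ T.cells) (hF : F ∈ T.faces)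
    (h : F ⊆ K) : TracePair (interior (hull K)) (hull F) := by
  classical
  obtain ⟨a, ha, rfl⟩ := eq_erase_of_subset hK hF h
  exact (isSimplex hK).tracePair_erase hd ha

variable (T) in
lemma tracePair_skeleton (hd : 1 ≤ d) : TracePair P.Ω T.skeleton := by
  refine TracePair.biUnion _ P.isPolytopal.isOpen T.isBounded fun F hF => ?_
  obtain ⟨K, hK, h⟩ := exists_cell hF
  exact (tracePair_face hd hK hF h).mono_left (interior_hull_subset hK) P.isPolytopal.isOpen
    T.isBounded

lemma surf_hull_lt_top (hd : 1 ≤ d) {F : Finset (E d)} (hF : F ∈ T.faces) :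
    surf d (hull F) < ⊤ := by
  obtain ⟨K, hK, h⟩ := exists_cell hF
  exact (tracePair_face hd hK hF h).fin

lemma memL2Surf_of_continuous (hd : 1 ≤ d) {F : Finset (E d)} (hF : F ∈ T.faces) {f : Scal d}
    (hf : Continuous f) : MemL2Surf (hull F) f :=
  memLp_of_continuous hf (isCompact_hull F).isBounded (surf_hull_lt_top hd hF)

section FaceTrace

variable (hd : 1 ≤ d) {K F : Finset (E d)} (hK : K ∈ T.cells) (hF : F ∈ T.faces) (h : F ⊆ K)
include hd hK hF h

lemma faceTrace_ae_eq {v g : Scal d} (hv : MemH1 (interior (hull K)) v)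
    (hg : IsTrace (interior (hull K)) (hull F) v g) :
    faceTrace K F v =ᵐ[(surf d).restrict (hull F)] g :=
  (tracePair_face hd hK hF h).trace_ae_eq hv hg

lemma faceTrace_add {v w : Scal d} (hv : T.IsBroken v) (hw : T.IsBroken w) :
    faceTrace K F (v + w) =ᵐ[(surf d).restrict (hull F)] faceTrace K F v + faceTrace K F w :=
  faceTrace_ae_eq hd hK hF h ((hv K hK).1.add (hw K hK).1)
    ((hv.isTrace hd hK hF h).add isOpen_interior (hv K hK).1 (hw K hK).1 (hw.isTrace hd hK hF h))

lemma faceTrace_smul {v : Scal d} (c : ℂ) (hv : T.IsBroken v) :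
    faceTrace K F (c • v) =ᵐ[(surf d).restrict (hull F)] c • faceTrace K F v :=
  faceTrace_ae_eq hd hK hF h ((hv K hK).1.smul c)
    ((hv.isTrace hd hK hF h).smul isOpen_interior c (hv K hK).1)

lemma faceTrace_of_ae_eq {v φ : Scal d} (hφ : ContDiff ℝ ∞ φ)
    (hv : φ =ᵐ[volume.restrict (interior (hull K))] v) :
    faceTrace K F v =ᵐ[(surf d).restrict (hull F)] φ := by
  have hb : Bornology.IsBounded (interior (hull K)) :=
    (isCompact_hull K).isBounded.subset interior_subset
  have h1 := memH1_of_contDiff (U := interior (hull K)) hb hφ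
  exact faceTrace_ae_eq hd hK hF h (h1.congr hv)
    ((isTrace_of_contDiff isOpen_interior hb hφ (memL2Surf_of_continuous hd hF
      hφ.continuous)).congr isOpen_interior h1 hv (ae_eq_refl _))

end FaceTrace

lemma isBroken_of_ae_eq {v : Scal d} {φ : Finset (E d) → Scal d}
    (h : ∀ K ∈ T.cells, ContDiff ℝ ∞ (φ K) ∧ v =ᵐ[volume.restrict (interior (hull K))] φ K) :
    T.IsBroken v := fun K hK => by
  have hb : Bornology.IsBounded (interior (hull K)) :=
    (isCompact_hull K).isBounded.subset interior_subset
  obtain ⟨h1, h2⟩ := h K hK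
  have h3 := memH1_of_contDiff (U := interior (hull K)) hb h1
  exact ⟨h3.congr h2.symm, _, (IsApprox.const isOpen_interior hb h1).congr isOpen_interior h3 h2.symm⟩

lemma isBroken_of_contDiff {φ : Scal d} (hφ : ContDiff ℝ ∞ φ) : T.IsBroken φ :=
  isBroken_of_ae_eq (φ := fun _ => φ) fun _ _ => ⟨hφ, ae_eq_refl _⟩

/-! The element-wise gradient -/

lemma notMem_interior {K K' : Finset (E d)} (hK : K ∈ T.cells) (hK' : K' ∈ T.cells) (hne : K ≠ K')
    {x : E d} (hx : x ∈ interior (hull K)) : x ∉ interior (hull K') := by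
  classical
  intro hx'
  have h1 := hull_inter_hull (T.mem_cells.1 hK).1 (T.mem_cells.1 hK').1
    ⟨interior_subset hx, interior_subset hx'⟩
  rw [(isSimplex hK).mem_hull_subset Finset.inter_subset_left] at h1
  rw [(isSimplex hK).mem_interior_hull] at hx
  refine hne (Finset.eq_of_subset_of_card_le (fun b hb => ?_)
    (by rw [(isSimplex hK).1, (isSimplex hK').1]))
  by_contra hc
  exact (hx b hb).ne' (h1.2 b hb (by simp [hc]))

lemma grad_eq {K : Finset (E d)} (hK : K ∈ T.cells) {x : E d} (hx : x ∈ interior (hull K))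
    (v : Scal d) : T.grad v x = wgrad (interior (hull K)) v x := by
  rw [grad, Finset.sum_eq_single_of_mem K hK, Set.indicator_of_mem hx]
  intro K' hK' hne
  exact Set.indicator_of_notMem (notMem_interior hK hK' hne.symm hx) _

lemma IsBroken.memL2_grad {v : Scal d} (hv : T.IsBroken v) : MemL2Vec P.Ω (T.grad v) := by
  intro i
  rw [memL2_Ω_iff (T := T)]
  intro K hK
  refine (memLp_congr_ae ?_).2 ((hv K hK).1.memL2_wgrad i)
  filter_upwards [ae_restrict_mem isOpen_interior.measurableSet] with x hx
  rw [grad_eq hK hx]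

lemma IsBroken.grad_add {v w : Scal d} (hv : T.IsBroken v) (hw : T.IsBroken w) :
    ∀ᵐ x ∂(volume.restrict P.Ω), T.grad (v + w) x = T.grad v x + T.grad w x := by
  rw [ae_Ω_iff (T := T)]
  intro K hK
  filter_upwards [(hv K hK).1.wgrad_add isOpen_interior (hw K hK).1,
    ae_restrict_mem isOpen_interior.measurableSet] with x hx hxK
  simp only [grad_eq hK hxK, hx]

lemma IsBroken.grad_smul {v : Scal d} (c : ℂ) (hv : T.IsBroken v) :
    ∀ᵐ x ∂(volume.restrict P.Ω), T.grad (c • v) x = c • T.grad v x := by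
  rw [ae_Ω_iff (T := T)]
  intro K hK
  filter_upwards [(hv K hK).1.wgrad_smul isOpen_interior c,
    ae_restrict_mem isOpen_interior.measurableSet] with x hx hxK
  simp only [grad_eq hK hxK, hx]

lemma grad_of_memH1 {v : Scal d} (hv : MemH1 P.Ω v) :
    ∀ᵐ x ∂(volume.restrict P.Ω), T.grad v x = wgrad P.Ω v x := by
  rw [ae_Ω_iff (T := T)]
  intro K hK
  filter_upwards [hv.wgrad_mono P.isPolytopal.isOpen isOpen_interior (interior_hull_subset hK),
    ae_restrict_mem isOpen_interior.measurableSet] with x hx hxK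
  rw [grad_eq hK hxK, hx]

open Classical in
lemma sum_erase_eq (hd : 1 ≤ d) {K : Finset (E d)} (hK : K ∈ T.cells) (f : Finset (E d) → ℂ) :
    ∑ a ∈ K, f (K.erase a) = ∑ F ∈ T.faces.filter (fun F => F ⊆ K), f F := by
  refine Finset.sum_bij (fun a _ => K.erase a) (fun a ha => ?_) (fun a ha b hb hab => ?_)
    (fun F hF => ?_) (fun _ _ => rfl)
  · exact Finset.mem_filter.2 ⟨erase_mem_faces hd hK ha, K.erase_subset a⟩
  · exact K.erase_injOn ha hb hab
  · have hF := Finset.mem_filter.1 hF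
    obtain ⟨a, ha, rfl⟩ := eq_erase_of_subset hK hF.1 hF.2
    exact ⟨a, ha, rfl⟩

open Classical in
/-- The element-wise Green formula, with the boundary terms collected face by face. -/
lemma green_sum (hd : 1 ≤ d) {w : Scal d} (hw : T.IsBroken w) {z : Vect d}
    {τ : Finset (E d) → Vect d} (hτ : T.IsSmoothRep z τ) {D : Scal d} (hD : MemL2 P.Ω D)
    (hz : MemL2Vec P.Ω z)
    (hDτ : ∀ K ∈ T.cells, D =ᵐ[volume.restrict (interior (hull K))] cdiv (τ K)) :
    ∫ x in P.Ω, (T.grad w x ⬝ᵥ z x + w x * D x) =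
      ∑ F ∈ T.faces, ∑ K ∈ T.cells.filter (fun K => F ⊆ K), ∫ x in hull F,
        faceTrace K F w x * (τ K x ⬝ᵥ cvec (outerNormal K F)) ∂(surf d) := by
  have hint : Integrable (fun x => T.grad w x ⬝ᵥ z x + w x * D x) (volume.restrict P.Ω) :=
    (integrable_dot hw.memL2_grad hz).add (integrable_mul_of_memLp hw.memL2 hD)
  rw [integral_Ω (T := T) hint]
  have key : ∀ K ∈ T.cells, ∫ x in hull K, (T.grad w x ⬝ᵥ z x + w x * D x) =
      ∑ F ∈ T.faces.filter (fun F => F ⊆ K), ∫ x in hull F,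
        faceTrace K F w x * (τ K x ⬝ᵥ cvec (outerNormal K F)) ∂(surf d) := by
    intro K hK
    obtain ⟨h, φ, hφ⟩ := hw K hK
    rw [← sum_erase_eq hd hK (fun F => ∫ x in hull F,
      faceTrace K F w x * (τ K x ⬝ᵥ cvec (outerNormal K F)) ∂(surf d))]
    have := (isSimplex hK).green hd h hφ (hτ K hK).1
    simp only [faceTrace]
    rw [← this, ← ae_restrict_hull]
    refine integral_congr_ae ?_
    filter_upwards [(hτ K hK).2, hDτ K hK, ae_restrict_mem isOpen_interior.measurableSet]
      with x h1 h2 h3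
    rw [grad_eq hK h3, h1, h2]
  rw [Finset.sum_congr rfl key]
  simp only [Finset.sum_filter]
  exact Finset.sum_comm

end Mesh

/-! ### Piecewise polynomials -/

lemma contDiff_eval (q : MvPolynomial (Fin d) ℂ) :
    ContDiff ℝ ∞ (fun x : E d => MvPolynomial.eval (fun i => ((x i : ℝ) : ℂ)) q) := by
  induction q using MvPolynomial.induction_on with
  | C a => simpa using contDiff_const
  | add p q hp hq => simpa using hp.add hq
  | mul_X p i hp =>
    simp only [map_mul, MvPolynomial.eval_X]
    exact hp.mul (Complex.ofRealCLM.contDiff.comp (EuclideanSpace.proj (𝕜 := ℝ) i).contDiff)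

namespace Mesh

variable {P : Problem d} {T : Mesh P} {p : ℕ}

lemma poly_zero : (0 : Scal d) ∈ T.poly p := fun _ _ => ⟨0, by simp, by simp⟩

lemma poly_add {v w : Scal d} (hv : v ∈ T.poly p) (hw : w ∈ T.poly p) : v + w ∈ T.poly p := by
  intro K hK
  obtain ⟨q, hq, h⟩ := hv K hK
  obtain ⟨q', hq', h'⟩ := hw K hK
  refine ⟨q + q', (MvPolynomial.totalDegree_add _ _).trans (max_le hq hq'), ?_⟩
  filter_upwards [h, h'] with x hx hx'
  simp [hx, hx']

lemma poly_smul {v : Scal d} (c : ℂ) (hv : v ∈ T.poly p) : c • v ∈ T.poly p := by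
  intro K hK
  obtain ⟨q, hq, h⟩ := hv K hK
  refine ⟨c • q, (MvPolynomial.totalDegree_smul_le _ _).trans hq, ?_⟩
  filter_upwards [h] with x hx
  simp [hx]

lemma exists_rep_of_poly {v : Scal d} (hv : v ∈ T.poly p) : ∃ φ : Finset (E d) → Scal d,
    ∀ K ∈ T.cells, ContDiff ℝ ∞ (φ K) ∧ v =ᵐ[volume.restrict (interior (hull K))] φ K := by
  have : ∀ K, ∃ φ : Scal d, K ∈ T.cells →
      ContDiff ℝ ∞ φ ∧ v =ᵐ[volume.restrict (interior (hull K))] φ := by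
    intro K
    by_cases hK : K ∈ T.cells
    · obtain ⟨q, -, h⟩ := hv K hK
      rw [← ae_restrict_hull] at h
      exact ⟨_, fun _ => ⟨contDiff_eval q, h⟩⟩
    · exact ⟨0, fun h => absurd h hK⟩
  choose φ hφ using this
  exact ⟨φ, hφ⟩

lemma isBroken_of_poly {v : Scal d} (hv : v ∈ T.poly p) : T.IsBroken v := by
  obtain ⟨φ, hφ⟩ := exists_rep_of_poly hv
  exact isBroken_of_ae_eq hφ

lemma exists_rep_of_polyVec {z : Vect d} (hz : z ∈ T.polyVec p) : ∃ τ, T.IsSmoothRep z τ := by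
  choose φ hφ using fun i => exists_rep_of_poly (hz i)
  refine ⟨fun K x i => φ i K x, fun K hK => ⟨fun i => (hφ i K hK).1, ?_⟩⟩
  filter_upwards [ae_all_iff.2 fun i => (hφ i K hK).2] with x hx
  exact funext hx

lemma memL2Vec_of_polyVec {z : Vect d} (hz : z ∈ T.polyVec p) : MemL2Vec P.Ω z :=
  fun i => (isBroken_of_poly (hz i)).memL2

end Mesh

/-! ### Conforming functions -/

section H1zero

variable {U Γ : Set (E d)} {v w : Scal d}

lemma H1zero_zero (hU : IsOpen U) (hb : Bornology.IsBounded U) : (0 : Scal d) ∈ H1zero U Γ :=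
  ⟨memH1_of_contDiff hb contDiff_const, isTrace_of_contDiff hU hb contDiff_const MemLp.zero⟩

lemma H1zero_add (hU : IsOpen U) (hv : v ∈ H1zero U Γ) (hw : w ∈ H1zero U Γ) :
    v + w ∈ H1zero U Γ :=
  ⟨hv.1.add hw.1, by simpa using hv.2.add hU hv.1 hw.1 hw.2⟩

lemma H1zero_smul (hU : IsOpen U) (c : ℂ) (hv : v ∈ H1zero U Γ) : c • v ∈ H1zero U Γ :=
  ⟨hv.1.smul c, by simpa using hv.2.smul hU c hv.1⟩

lemma H1zero_sub (hU : IsOpen U) (hv : v ∈ H1zero U Γ) (hw : w ∈ H1zero U Γ) :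
    v - w ∈ H1zero U Γ := by
  have := H1zero_add hU hv (H1zero_smul hU (-1) hw)
  rwa [neg_one_smul, ← sub_eq_add_neg] at this

lemma H1zero_star (hU : IsOpen U) (hv : v ∈ H1zero U Γ) : star v ∈ H1zero U Γ :=
  ⟨hv.1.star, by simpa using hv.2.star hU hv.1⟩

lemma H1zero_mono (hU : IsOpen U) {Γ' : Set (E d)} (h : Γ' ⊆ Γ) (hv : v ∈ H1zero U Γ) :
    v ∈ H1zero U Γ' :=
  ⟨hv.1, hv.2.mono hU hU subset_rfl (LE.le.eventuallyLE h) hv.1⟩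

/-- `IsTrace` carries an approximating sequence of smooth functions even when `Γ` is empty.
Approximation by functions smooth up to the boundary is thus part of the membership and needs no
density theorem. -/
lemma exists_isApprox_of_H1zero (hv : v ∈ H1zero U Γ) : ∃ φ, IsApprox U v φ := by
  obtain ⟨-, φ, hφ, -⟩ := isTrace_iff.1 hv.2
  exact ⟨φ, hφ⟩

end H1zero

namespace Mesh

variable {P : Problem d} {T : Mesh P} {p : ℕ} {v : Scal d}

lemma tracePair_of_subset (T : Mesh P) (hd : 1 ≤ d) {S : Set (E d)} (hS : S ⊆ frontier P.Ω) :
    TracePair P.Ω S :=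
  (tracePair_skeleton T hd).mono_right (hS.trans (frontier_subset_skeleton T hd))

lemma isBroken_of_isApprox (hv : MemH1 P.Ω v) {φ : ℕ → Scal d} (hφ : IsApprox P.Ω v φ) :
    T.IsBroken v := fun _ hK =>
  ⟨hv.mono P.isPolytopal.isOpen (interior_hull_subset hK), φ,
    hφ.mono P.isPolytopal.isOpen isOpen_interior (interior_hull_subset hK) hv⟩

lemma isBroken_of_V (hv : v ∈ P.V) : T.IsBroken v := by
  obtain ⟨φ, hφ⟩ := exists_isApprox_of_H1zero hv
  exact isBroken_of_isApprox hv.1 hφ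

/-- One trace `t` on the whole skeleton is the reference to which all one-sided traces and boundary
traces are compared. The traces from the two sides of a face agree because both equal `t`. -/
lemma faceTrace_of_isTrace (hd : 1 ≤ d) {K F : Finset (E d)} (hK : K ∈ T.cells) (hF : F ∈ T.faces)
    (h : F ⊆ K) (hv : MemH1 P.Ω v) {t : Scal d} (ht : IsTrace P.Ω T.skeleton v t) :
    faceTrace K F v =ᵐ[(surf d).restrict (hull F)] t :=
  faceTrace_ae_eq hd hK hF h (hv.mono P.isPolytopal.isOpen (interior_hull_subset hK))
    (ht.mono P.isPolytopal.isOpen isOpen_interior (interior_hull_subset hK)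
      (LE.le.eventuallyLE (hull_subset_skeleton hF)) hv)

lemma trace_of_isTrace (hd : 1 ≤ d) {S : Set (E d)} (hS : S ⊆ frontier P.Ω) (hv : MemH1 P.Ω v)
    {t : Scal d} (ht : IsTrace P.Ω T.skeleton v t) :
    trace P.Ω S v =ᵐ[(surf d).restrict S] t :=
  (tracePair_of_subset T hd hS).trace_ae_eq hv (ht.mono P.isPolytopal.isOpen P.isPolytopal.isOpen
    subset_rfl (LE.le.eventuallyLE (hS.trans (frontier_subset_skeleton T hd))) hv)

/-- Functions with a trace on a part of the boundary have a trace on the skeleton. -/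
lemma exists_isTrace (hd : 1 ≤ d) {Γ : Set (E d)} (hΓ : Γ ⊆ frontier P.Ω)
    (hv : v ∈ H1zero P.Ω Γ) :
    ∃ t, IsTrace P.Ω T.skeleton v t ∧ t =ᵐ[(surf d).restrict Γ] 0 := by
  obtain ⟨φ, hφ⟩ := exists_isApprox_of_H1zero hv
  obtain ⟨t, ht⟩ := (tracePair_skeleton T hd).exists_of_isApprox hv.1 hφ
  refine ⟨t, ht, (trace_of_isTrace hd hΓ hv.1 ht).symm.trans
    ((tracePair_of_subset T hd hΓ).trace_ae_eq hv.1 hv.2)⟩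

lemma trace_hull_R (hd : 1 ≤ d) {F : Finset (E d)} (hF : F ∈ T.facesR) (hv : v ∈ P.V) :
    faceTrace (T.cellOf F) F v =ᵐ[(surf d).restrict (hull F)] trace P.Ω P.ΓR v := by
  have hF' := mem_facesR.1 hF
  obtain ⟨t, ht, -⟩ := exists_isTrace (T := T) hd P.partD.subset_frontier hv
  refine (faceTrace_of_isTrace hd (cellOf_spec hF'.1).1 hF'.1 (cellOf_spec hF'.1).2 hv.1 ht).trans ?_
  have h := trace_of_isTrace hd P.partR.subset_frontier hv.1 ht
  exact EventuallyEq.symm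
    (ae_mono (Measure.restrict_mono' (hull_ae_le_part P.partR hd hF'.1 hF'.2) le_rfl) h)

/-- Conforming functions have no jumps. -/
lemma jump_of_V (hd : 1 ≤ d) {F : Finset (E d)} (hF : F ∈ T.faces) (hv : v ∈ P.V) :
    T.jump v F =ᵐ[(surf d).restrict (hull F)] 0 := by
  classical
  obtain ⟨t, ht, ht0⟩ := exists_isTrace (T := T) hd P.partD.subset_frontier hv
  by_cases hI : F ∈ T.facesI
  · obtain ⟨K, K', hne, hfil⟩ := exists_two_cells hd hF (mem_facesI.1 hI).2
    have hKm : K ∈ T.cells.filter (fun K => F ⊆ K) := by simp [hfil]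
    have hKm' : K' ∈ T.cells.filter (fun K => F ⊆ K) := by simp [hfil]
    rw [Finset.mem_filter] at hKm hKm'
    -- Both one-sided traces equal `t`, and the outer normals on the two sides are opposite, so the
    -- two contributions to the jump cancel.
    filter_upwards [faceTrace_of_isTrace hd hKm.1 hF hKm.2 hv.1 ht,
      faceTrace_of_isTrace hd hKm'.1 hF hKm'.2 hv.1 ht] with x h1 h2
    rw [jump, if_pos hI]
    have hfil' : ∀ f : Finset (E d) → ℂ,
        ∑ K ∈ T.cells.filter (fun K => F ⊆ K), f K = f K + f K' := by
      intro f
      rw [hfil, Finset.sum_pair hne]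
    have := hfil' (fun K => faceTrace K F v x * ((inner ℝ (outerNormal K F) (T.nF F) : ℝ) : ℂ))
    convert this using 1
    · rw [h1, h2, outerNormal_opposite hd hF hKm.1 hKm'.1 hKm.2 hKm'.2 hne, inner_neg_left]
      push_cast
      simp
  · by_cases hD : F ∈ T.facesD
    · have h0 := ae_mono (Measure.restrict_mono'
        (hull_ae_le_part P.partD hd hF (mem_facesD.1 hD).2) le_rfl) ht0
      filter_upwards [faceTrace_of_isTrace hd (cellOf_spec hF).1 hF (cellOf_spec hF).2 hv.1 ht, h0]
        with x h1 h2
      rw [jump, if_neg hI, if_pos hD, h1, h2]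
    · exact Eventually.of_forall fun x => by rw [jump, if_neg hI, if_neg hD, Pi.zero_apply]

end Mesh

/-! ### Normal components of piecewise polynomial fields of `H(div, Ω)` -/

/-- The classical divergence is the weak divergence. -/
lemma SmoothVec.isWeakDiv {U : Set (E d)} (hb : Bornology.IsBounded U) {τ : Vect d}
    (hτ : SmoothVec τ) : IsWeakDiv U τ (cdiv τ) := by
  intro φ hφ
  have hL2 : ∀ {f : Scal d}, Continuous f → MemL2 U f := fun hf =>
    memLp_of_continuous hf hb hb.measure_lt_top
  simp only [dotProduct, cdiv, Finset.sum_mul]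
  rw [integral_finsetSum _ fun i _ =>
      integrable_mul_of_memLp (hL2 (hτ i).continuous) (hφ.memLp_cgrad _ i),
    integral_finsetSum _ fun i _ =>
      integrable_mul_of_memLp (hL2 (continuous_cgrad (hτ i) i)) (hφ.memLp _),
    ← Finset.sum_neg_distrib]
  exact Finset.sum_congr rfl fun i _ => isWeakGrad_cgrad (hτ i) φ hφ i

lemma IsWeakDiv.congr {U : Set (E d)} {w z : Vect d} {D : Scal d} (h : IsWeakDiv U w D)
    (hwz : ∀ᵐ x ∂(volume.restrict U), w x = z x) : IsWeakDiv U z D := by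
  intro φ hφ
  rw [← h φ hφ]
  refine integral_congr_ae ?_
  filter_upwards [hwz] with x hx
  rw [hx]

lemma IsPolytopalPart.measurableSet {U Γ : Set (E d)} (hΓ : IsPolytopalPart U Γ) :
    MeasurableSet Γ := by
  have := (isClosed_frontier (s := U)).measurableSet.diff hΓ.isClosed_diff.measurableSet
  rwa [Set.sdiff_sdiff_cancel_left hΓ.subset_frontier] at this

namespace Mesh

variable {P : Problem d} {T : Mesh P} {p : ℕ} {z : Vect d} {τ : Finset (E d) → Vect d}

lemma IsSmoothRep.wdiv_eq (hτ : T.IsSmoothRep z τ) (hz : MemHdiv P.Ω z) {K : Finset (E d)}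
    (hK : K ∈ T.cells) : wdiv P.Ω z =ᵐ[volume.restrict (interior (hull K))] cdiv (τ K) := by
  have hb : Bornology.IsBounded (interior (hull K)) :=
    (isCompact_hull K).isBounded.subset interior_subset
  refine IsWeakDiv.unique isOpen_interior (hz.wdiv_spec.1.mono (interior_hull_subset hK))
    (memLp_of_continuous (hτ K hK).1.continuous_cdiv hb hb.measure_lt_top)
    (hz.wdiv_spec.2.mono P.isPolytopal.isOpen (interior_hull_subset hK))
    (((hτ K hK).1.isWeakDiv hb).congr ?_)
  filter_upwards [(hτ K hK).2] with x hx
  exact hx.symm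

open Classical in
variable (T) in
/-- The sum over the elements around `F` of the outer normal components. -/
def normalSum (τ : Finset (E d) → Vect d) (F : Finset (E d)) : Scal d := fun x =>
  ∑ K ∈ T.cells.filter (fun K => F ⊆ K), τ K x ⬝ᵥ cvec (outerNormal K F)

open Classical in
lemma IsSmoothRep.continuous_normalSum (hτ : T.IsSmoothRep z τ) (F : Finset (E d)) :
    Continuous (T.normalSum τ F) :=
  continuous_finsetSum _ fun K hK => ((hτ K (Finset.mem_filter.1 hK).1).1.dot _).continuous

/-- As `φ` vanishes on the other faces, the sum over faces in Green's formula keeps only `F`, where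
the contributions of the adjacent elements add up to `normalSum`. -/
lemma IsSmoothRep.green_local (hd : 1 ≤ d) (hτ : T.IsSmoothRep z τ) (hz : MemHdiv P.Ω z)
    {F : Finset (E d)} (hF : F ∈ T.faces) {φ : Scal d} (hφ : ContDiff ℝ ∞ φ)
    (h0 : ∀ F' ∈ T.faces, F' ≠ F → ∀ x ∈ hull F', φ x = 0) :
    (∫ x in P.Ω, z x ⬝ᵥ wgrad P.Ω φ x) + (∫ x in P.Ω, wdiv P.Ω z x * φ x) =
      ∫ x in hull F, T.normalSum τ F x * φ x ∂(surf d) := by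
  classical
  have hφ1 := memH1_of_contDiff T.isBounded hφ
  have key := green_sum hd (isBroken_of_contDiff (T := T) hφ) hτ hz.wdiv_spec.1 hz.1
    fun K hK => hτ.wdiv_eq hz hK
  rw [Finset.sum_eq_single_of_mem F hF] at key
  · rw [← integral_add (integrable_dot hz.1 hφ1.memL2_wgrad)
      (integrable_mul_of_memLp hz.wdiv_spec.1 hφ1.1)]
    have h1 : ∫ x in P.Ω, (z x ⬝ᵥ wgrad P.Ω φ x + wdiv P.Ω z x * φ x) =
        ∫ x in P.Ω, (T.grad φ x ⬝ᵥ z x + φ x * wdiv P.Ω z x) := by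
      refine integral_congr_ae ?_
      filter_upwards [grad_of_memH1 (T := T) hφ1] with x hx
      rw [hx, dotProduct_comm, mul_comm]
    rw [h1, key, ← integral_finsetSum]
    · refine integral_congr_ae ?_
      have : ∀ᵐ x ∂((surf d).restrict (hull F)), ∀ K ∈ T.cells.filter (fun K => F ⊆ K),
          faceTrace K F φ x = φ x := by
        rw [Filter.eventually_all_finset]
        intro K hK
        rw [Finset.mem_filter] at hK
        exact faceTrace_of_ae_eq hd hK.1 hF hK.2 hφ (ae_eq_refl _)
      filter_upwards [this] with x hx
      rw [normalSum, Finset.sum_mul]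
      exact Finset.sum_congr rfl fun K hK => by rw [hx K hK, mul_comm]
    · intro K hK
      rw [Finset.mem_filter] at hK
      exact integrable_mul_of_memLp ((isBroken_of_contDiff hφ).isTrace hd hK.1 hF hK.2).1
        (memL2Surf_of_continuous hd hF ((hτ K hK.1).1.dot _).continuous)
  · intro F' hF' hne
    refine Finset.sum_eq_zero fun K hK => ?_
    rw [Finset.mem_filter] at hK
    refine integral_eq_zero_of_ae ?_
    filter_upwards [faceTrace_of_ae_eq hd hK.1 hF' hK.2 hφ (ae_eq_refl _),
      ae_restrict_mem (measurableSet_hull F')] with x hx hxF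
    rw [hx, h0 F' hF' hne x hxF, zero_mul, Pi.zero_apply]

variable (T) in
/-- The complement of the other faces. -/
def offFaces (F : Finset (E d)) : Set (E d) := (⋃ F' ∈ (T.faces : Set (Finset (E d))) \ {F}, hull F')ᶜ

lemma mem_offFaces {F : Finset (E d)} {x : E d} :
    x ∈ T.offFaces F ↔ ∀ F' ∈ T.faces, F' ≠ F → x ∉ hull F' := by
  simp [offFaces]

lemma isOpen_offFaces (F : Finset (E d)) : IsOpen (T.offFaces F) := by
  rw [offFaces, isOpen_compl_iff]
  exact (T.faces.finite_toSet.subset Set.sdiff_subset).isClosed_biUnion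
    fun F' _ => (isCompact_hull F').isClosed

lemma _root_.IPDG.IsTest.eq_zero_of_mem_hull {F : Finset (E d)} {φ : Scal d}
    (hφ : IsTest (T.offFaces F) φ) : ∀ F' ∈ T.faces, F' ≠ F → ∀ x ∈ hull F', φ x = 0 :=
  fun F' hF' hne _ hx => hφ.eq_zero fun h => mem_offFaces.1 h F' hF' hne hx

lemma locallyIntegrable_surf {F : Finset (E d)} (hd : 1 ≤ d) (hF : F ∈ T.faces) {g : Scal d}
    (hg : MemL2Surf (hull F) g) : LocallyIntegrable g ((surf d).restrict (hull F)) := by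
  have : IsFiniteMeasure ((surf d).restrict (hull F)) :=
    isFiniteMeasure_restrict.2 (surf_hull_lt_top hd hF).ne
  exact (hg.integrable (by norm_num)).locallyIntegrable

/-- The normal component is continuous through the interior faces. -/
lemma IsSmoothRep.normalSum_I (hd : 1 ≤ d) (hτ : T.IsSmoothRep z τ) (hz : MemHdiv P.Ω z)
    {F : Finset (E d)} (hF : F ∈ T.facesI) :
    T.normalSum τ F =ᵐ[(surf d).restrict (hull F)] 0 := by
  classical
  rw [mem_facesI] at hF
  have hmem : ∀ x ∈ hull F, x ∈ T.offFaces F → x ∈ P.Ω := by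
    intro x hx hxF
    obtain ⟨K, K', hne, hfil⟩ := exists_two_cells hd hF.1 hF.2
    have hKm : K ∈ T.cells.filter (fun K => F ⊆ K) := by simp [hfil]
    have hKm' : K' ∈ T.cells.filter (fun K => F ⊆ K) := by simp [hfil]
    rw [Finset.mem_filter] at hKm hKm'
    obtain ⟨a, ha, rfl⟩ := eq_erase_of_subset hKm.1 hF.1 hKm.2
    obtain ⟨a', ha', hFa⟩ := eq_erase_of_subset hKm'.1 hF.1 hKm'.2
    exact mem_Ω_of_two hd hKm.1 hKm'.1 ha ha' hFa hne
      (mem_faceInterior hd hKm.1 ha hx (mem_offFaces.1 hxF))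
  -- For test functions supported in `Ω` and away from the other faces, the definition of the weak
  -- divergence makes the left-hand side of `green_local` vanish. The fundamental lemma is then used
  -- for the surface measure of `F`.
  have key := ae_eq_zero_of_forall_test ((isOpen_offFaces (T := T) F).inter P.isPolytopal.isOpen)
    (locallyIntegrable_surf hd hF.1 (memL2Surf_of_continuous hd hF.1 (hτ.continuous_normalSum F)))
    fun φ hφ => by
      rw [← hτ.green_local hd hz hF.1 hφ.1
        (hφ.mono Set.inter_subset_left).eq_zero_of_mem_hull]
      have h1 := hz.wdiv_spec.2 φ (hφ.mono Set.inter_subset_right)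
      have h2 : ∫ x in P.Ω, z x ⬝ᵥ wgrad P.Ω φ x = ∫ x in P.Ω, z x ⬝ᵥ cgrad φ x := by
        refine integral_congr_ae ?_
        filter_upwards [wgrad_of_contDiff P.isPolytopal.isOpen T.isBounded hφ.1] with x hx
        rw [hx]
      rw [h2, h1, neg_add_cancel]
  filter_upwards [key, ae_notMem_hull hF.1, ae_restrict_mem (measurableSet_hull F)] with x h1 h2 h3
  exact h1 ⟨mem_offFaces.2 h2, hmem x h3 (mem_offFaces.2 h2)⟩

/-- On exterior faces the normal trace is the normal component. -/
lemma IsSmoothRep.normalSum_ext (hd : 1 ≤ d) (hτ : T.IsSmoothRep z τ) (hz : MemHdiv P.Ω z)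
    {Γ : Set (E d)} (hΓ : IsPolytopalPart P.Ω Γ) {g : Scal d} (hg : IsNormalTrace P.Ω Γ z g)
    {F : Finset (E d)} (hF : F ∈ T.faces) (hFΓ : hull F ⊆ closure Γ) :
    T.normalSum τ F =ᵐ[(surf d).restrict (hull F)] g := by
  have hΩ := P.isPolytopal.isOpen
  have hgF : MemL2Surf (hull F) g :=
    hg.1.mono_measure (Measure.restrict_mono' (hull_ae_le_part hΓ hd hF hFΓ) le_rfl)
  have hsF := memL2Surf_of_continuous hd hF (hτ.continuous_normalSum F)
  have hΓm := hΓ.measurableSet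
  have key := ae_eq_zero_of_forall_test (isOpen_offFaces (T := T) F)
    (locallyIntegrable_surf hd hF (MemLp.sub hsF hgF)) fun φ hφ => by
      have h0 := hφ.eq_zero_of_mem_hull
      have hφ1 := memH1_of_contDiff T.isBounded hφ.1
      have hφs : ∀ {S : Set (E d)}, S ⊆ frontier P.Ω → IsTrace P.Ω S φ φ := fun hS =>
        isTrace_of_contDiff hΩ T.isBounded hφ.1
          ((tracePair_of_subset T hd hS).memL2Surf hφ.1)
      -- A boundary point where `φ` does not vanish lies on no face other than `F`, hence belongs to
      -- `Γ` by `mem_part`. Thus `φ` is admissible in the definition of the normal trace.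
      have hφΓ : φ ∈ H1zero P.Ω (frontier P.Ω \ Γ) := by
        refine ⟨hφ1, (hφs Set.sdiff_subset).congr hΩ hφ1 (ae_eq_refl _) ?_⟩
        filter_upwards [ae_restrict_mem hΓ.isClosed_diff.measurableSet] with x hx
        by_contra hc
        have hxF : x ∈ T.offFaces F := by
          by_contra h
          exact hc (hφ.eq_zero h)
        rw [mem_offFaces] at hxF
        obtain ⟨F', hF', hxF'⟩ := Set.mem_iUnion₂.1 (frontier_subset_skeleton T hd hx.1)
        by_cases hne : F' = F
        · subst hne
          exact hx.2 (mem_part hΓ hd hxF' hxF hFΓ)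
        · exact hxF F' hF' hne hxF'
      have h1 := hg.2 φ hφΓ
      rw [hτ.green_local hd hz hF hφ.1 h0] at h1
      have h2 : ∫ x in Γ, g x * trace P.Ω Γ φ x ∂(surf d) = ∫ x in Γ, g x * φ x ∂(surf d) := by
        refine integral_congr_ae ?_
        filter_upwards [(tracePair_of_subset T hd hΓ.subset_frontier).trace_ae_eq hφ1
          (hφs hΓ.subset_frontier)] with x hx
        rw [hx]
      -- The part of `Γ` outside `F` is covered by other faces, on which `φ` vanishes; conversely
      -- `F` lies in `Γ` up to a null set.
      have h3 : ∫ x in Γ, g x * φ x ∂(surf d) = ∫ x in hull F, g x * φ x ∂(surf d) := by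
        rw [setIntegral_eq_of_subset_of_forall_sdiff_eq_zero hΓm
          (Set.inter_subset_left : Γ ∩ hull F ⊆ Γ)]
        · refine setIntegral_congr_set ?_
          filter_upwards [hull_ae_le_part hΓ hd hF hFΓ] with x hx
          exact propext ⟨fun h => h.2, fun h => ⟨hx h, h⟩⟩
        · intro x hx
          obtain ⟨F', hF', hxF'⟩ := Set.mem_iUnion₂.1
            (frontier_subset_skeleton T hd (hΓ.subset_frontier hx.1))
          have hne : F' ≠ F := by
            rintro rfl
            exact hx.2 ⟨hx.1, hxF'⟩
          rw [h0 F' hF' hne x hxF', mul_zero]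
      have hφF := memL2Surf_of_continuous hd hF hφ.1.continuous
      simp only [Pi.sub_apply, sub_mul]
      rw [integral_sub (integrable_mul_of_memLp hsF hφF) (integrable_mul_of_memLp hgF hφF), h1, h2,
        h3, sub_self]
  filter_upwards [key, ae_notMem_hull hF] with x h1 h2
  exact sub_eq_zero.1 (h1 (mem_offFaces.2 h2))

end Mesh

namespace Mesh

variable {P : Problem d} {T : Mesh P} {p : ℕ} {z : Vect d} {τ : Finset (E d) → Vect d} {w : Scal d}

/-! ### Discrete integration by parts -/

lemma IsSmoothRep.faceTrace_eq (hd : 1 ≤ d) (hτ : T.IsSmoothRep z τ) {K F : Finset (E d)}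
    (hK : K ∈ T.cells) (hF : F ∈ T.faces) (h : F ⊆ K) :
    ∀ᵐ x ∂((surf d).restrict (hull F)), ∀ i, faceTrace K F (fun y => z y i) x = τ K x i := by
  rw [ae_all_iff]
  intro i
  refine faceTrace_of_ae_eq hd hK hF h ((hτ K hK).1 i) ?_
  filter_upwards [(hτ K hK).2] with x hx
  rw [hx]

lemma memL2Surf_jump (hd : 1 ≤ d) (hw : T.IsBroken w) {F : Finset (E d)} (hF : F ∈ T.faces) :
    MemL2Surf (hull F) (T.jump w F) := by
  classical
  by_cases hI : F ∈ T.facesI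
  · have : MemL2Surf (hull F) (fun x => ∑ K ∈ T.cells.filter (fun K => F ⊆ K),
        faceTrace K F w x * ((inner ℝ (outerNormal K F) (T.nF F) : ℝ) : ℂ)) := by
      refine memLp_finsetSum _ fun K hK => ?_
      rw [Finset.mem_filter] at hK
      exact (hw.isTrace hd hK.1 hF hK.2).1.mul_const _
    convert this using 1
    ext x
    rw [jump, if_pos hI]
  · by_cases hD : F ∈ T.facesD
    · convert (hw.isTrace hd (cellOf_spec hF).1 hF (cellOf_spec hF).2).1 using 1
      ext x
      rw [jump, if_neg hI, if_pos hD]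
    · have : T.jump w F = 0 := by
        ext x
        rw [jump, if_neg hI, if_neg hD, Pi.zero_apply]
      rw [this]
      exact MemLp.zero

lemma notMem_facesI {F : Finset (E d)} (h : hull F ⊆ frontier P.Ω) : F ∉ T.facesI :=
  fun hF => (mem_facesI.1 hF).2 h

lemma notMem_facesR_of_facesD (hd : 1 ≤ d) {F : Finset (E d)} (h : F ∈ T.facesD) :
    F ∉ T.facesR := fun h' => notMem_facesD_of_facesR hd h' h

lemma notMem_facesR_of_facesN (hd : 1 ≤ d) {F : Finset (E d)} (h : F ∈ T.facesN) :
    F ∉ T.facesR := fun h' => notMem_facesN_of_facesR hd h' h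

open Classical in
lemma normalSum_of_ext (hd : 1 ≤ d) {F : Finset (E d)} (hF : F ∈ T.faces)
    (hext : hull F ⊆ frontier P.Ω) (x : E d) :
    T.normalSum τ F x = τ (T.cellOf F) x ⬝ᵥ cvec (outerNormal (T.cellOf F) F) := by
  have := filter_cells_of_ext hd hF hext
  have h2 : T.normalSum τ F x = ∑ K ∈ T.cells.filter (fun K => F ⊆ K),
    τ K x ⬝ᵥ cvec (outerNormal K F) := by rw [normalSum]
  rw [h2, this, Finset.sum_singleton]

open Classical in
/-- The contribution of one face to Green's formula. -/
lemma IsSmoothRep.face_term (hd : 1 ≤ d) (hτ : T.IsSmoothRep z τ) (hz : MemHdiv P.Ω z)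
    (hN : IsNormalTrace P.Ω P.ΓN z 0) {g : Scal d} (hR : IsNormalTrace P.Ω P.ΓR z g)
    (hw : T.IsBroken w) {F : Finset (E d)} (hF : F ∈ T.faces) :
    ∑ K ∈ T.cells.filter (fun K => F ⊆ K), ∫ x in hull F,
        faceTrace K F w x * (star (τ K) x ⬝ᵥ cvec (outerNormal K F)) ∂(surf d) =
      (∫ x in hull F, T.jump w F x * conj (T.avg z F x ⬝ᵥ cvec (T.nF F)) ∂(surf d)) +
      if F ∈ T.facesR then ∫ x in hull F, faceTrace (T.cellOf F) F w x * conj (g x) ∂(surf d)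
        else 0 := by
  have hstar : ∀ K x, star (τ K) x ⬝ᵥ cvec (outerNormal K F) =
      conj (τ K x ⬝ᵥ cvec (outerNormal K F)) := by
    intro K x
    simp [dotProduct, cvec]
  simp only [hstar]
  by_cases hI : F ∈ T.facesI
  · have hR' : F ∉ T.facesR := fun h => notMem_facesI (frontier_of_facesR h) hI
    rw [if_neg hR', add_zero]
    obtain ⟨K, K', hne, hfil⟩ := exists_two_cells hd hF (mem_facesI.1 hI).2
    have hKm : K ∈ T.cells.filter (fun K => F ⊆ K) := by simp [hfil]
    have hKm' : K' ∈ T.cells.filter (fun K => F ⊆ K) := by simp [hfil]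
    rw [Finset.mem_filter] at hKm hKm'
    have hsum : ∀ f : Finset (E d) → ℂ,
        ∑ K ∈ T.cells.filter (fun K => F ⊆ K), f K = f K + f K' := fun f => by
      rw [hfil, Finset.sum_pair hne]
    have hint : ∀ K ∈ T.cells, F ⊆ K → Integrable (fun x => faceTrace K F w x *
        conj (τ K x ⬝ᵥ cvec (outerNormal K F))) ((surf d).restrict (hull F)) := fun K hK h =>
      integrable_mul_of_memLp (hw.isTrace hd hK hF h).1 (memL2Surf_of_continuous hd hF
        (continuous_star.comp ((hτ K hK).1.dot _).continuous))
    rw [hsum, ← integral_add (hint K hKm.1 hKm.2) (hint K' hKm'.1 hKm'.2)]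
    refine integral_congr_ae ?_
    filter_upwards [hτ.normalSum_I hd hz hI, hτ.faceTrace_eq hd hKm.1 hF hKm.2,
      hτ.faceTrace_eq hd hKm'.1 hF hKm'.2] with x h1 h2 h3
    -- `c` is the sign relating the outer normal of `K` to the fixed normal. Only its being nonzero
    -- is needed.
    set c : ℝ := inner ℝ (outerNormal K F) (T.nF F) with hc
    have hn : outerNormal K F = c • T.nF F := outerNormal_eq_smul hd hF hKm.1 hKm.2
    have hn' : outerNormal K' F = -(c • T.nF F) := by
      rw [outerNormal_opposite hd hF hKm.1 hKm'.1 hKm.2 hKm'.2 hne, hn]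
    have hc0 : c ≠ 0 := by
      rintro h0
      obtain ⟨a, ha, rfl⟩ := eq_erase_of_subset hKm.1 hF hKm.2
      have := (outerNormal_spec hd hKm.1 ha).1
      rw [hn, h0, zero_smul, norm_zero] at this
      exact zero_ne_one this
    -- Since the field belongs to `H(div)`, the two outer normal components sum to zero. The
    -- component along the fixed normal is therefore single-valued, and equal to that of the
    -- average.
    have h4 : τ K x ⬝ᵥ cvec (T.nF F) = τ K' x ⬝ᵥ cvec (T.nF F) := by
      have h5 := hsum fun K => τ K x ⬝ᵥ cvec (outerNormal K F)
      have h6 : T.normalSum τ F x = ∑ K ∈ T.cells.filter (fun K => F ⊆ K),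
        τ K x ⬝ᵥ cvec (outerNormal K F) := by rw [normalSum]
      rw [← h6, h1, hn, hn', cvec_neg, cvec_smul, dotProduct_neg, dotProduct_smul,
        dotProduct_smul, ← sub_eq_add_neg, ← smul_sub, Pi.zero_apply] at h5
      have := (smul_eq_zero.1 h5.symm).resolve_left (by exact_mod_cast hc0)
      exact sub_eq_zero.1 this
    have h7 : T.jump w F x = faceTrace K F w x * c - faceTrace K' F w x * c := by
      have := hsum fun K => faceTrace K F w x * ((inner ℝ (outerNormal K F) (T.nF F) : ℝ) : ℂ)
      have hc' : inner ℝ (outerNormal K' F) (T.nF F) = -c := by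
        rw [outerNormal_opposite hd hF hKm.1 hKm'.1 hKm.2 hKm'.2 hne, inner_neg_left]
      rw [jump, if_pos hI]
      simp only [hc'] at this
      rw [sub_eq_add_neg, ← mul_neg, ← Complex.ofReal_neg]
      convert this
    have h8 : T.avg z F x ⬝ᵥ cvec (T.nF F) = τ K x ⬝ᵥ cvec (T.nF F) := by
      have h9 : T.avg z F x = (1 / 2 : ℂ) • (τ K x + τ K' x) := by
        ext i
        rw [avg, if_pos hI]
        have := hsum fun K => faceTrace K F (fun y => z y i) x
        simp only [h2, h3] at this
        simp only [Pi.smul_apply, Pi.add_apply, smul_eq_mul]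
        rw [← this]
      rw [h9, smul_dotProduct, add_dotProduct, ← h4, smul_eq_mul]
      ring
    rw [h7, h8, hn, hn', cvec_neg, cvec_smul, dotProduct_neg, dotProduct_smul, dotProduct_smul,
      ← h4]
    simp only [smul_eq_mul, map_neg, map_mul, Complex.conj_ofReal]
    ring
  · have hext : hull F ⊆ frontier P.Ω := by
      by_contra h
      exact hI (mem_facesI.2 ⟨hF, h⟩)
    obtain ⟨hKc, hFc⟩ := cellOf_spec hF
    rw [filter_cells_of_ext hd hF hext, Finset.sum_singleton]
    have hns := fun x => normalSum_of_ext (τ := τ) hd hF hext x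
    -- On a Dirichlet face the jump is the trace itself. On a Neumann face both the jump and the
    -- normal component vanish. On a Robin face the jump vanishes by convention, and the term with
    -- `g` is what remains.
    rcases faces_cases hF with h | hD | hN' | hR'
    · exact absurd h hI
    · rw [if_neg (notMem_facesR_of_facesD hd hD), add_zero]
      refine integral_congr_ae ?_
      filter_upwards [hτ.faceTrace_eq hd hKc hF hFc] with x hx
      have : T.avg z F x = τ (T.cellOf F) x := by
        ext i
        rw [avg, if_neg hI, hx i]
      rw [this, jump, if_neg hI, if_pos hD, nF_of_ext hd hF hext]
    · rw [if_neg (notMem_facesR_of_facesN hd hN'), add_zero]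
      refine integral_congr_ae ?_
      filter_upwards [hτ.normalSum_ext hd hz P.partN hN hF (mem_facesN.1 hN').2] with x hx
      rw [← hns, hx, jump, if_neg hI, if_neg (notMem_facesD_of_facesN hd hN')]
      simp
    · rw [if_pos hR']
      have : ∫ x in hull F, T.jump w F x * conj (T.avg z F x ⬝ᵥ cvec (T.nF F)) ∂(surf d) = 0 := by
        refine integral_eq_zero_of_ae (Eventually.of_forall fun x => ?_)
        simp [jump, if_neg hI, if_neg (notMem_facesD_of_facesR hd hR')]
      rw [this, zero_add]
      refine integral_congr_ae ?_
      filter_upwards [hτ.normalSum_ext hd hz P.partR hR hF (mem_facesR.1 hR').2] with x hx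
      rw [← hns, hx]

/-- Integration by parts against a piecewise polynomial field of `X_{Γ_N}`. -/
lemma integral_grad_add_wdiv (hd : 1 ≤ d) (hzp : z ∈ T.polyVec p) (hz : MemHdiv P.Ω z)
    (hN : IsNormalTrace P.Ω P.ΓN z 0) {g : Scal d} (hR : IsNormalTrace P.Ω P.ΓR z g)
    (hw : T.IsBroken w) :
    ∫ x in P.Ω, (T.grad w x ⬝ᵥ star (z x) + w x * conj (wdiv P.Ω z x)) =
      (∑ F ∈ T.faces, ∫ x in hull F,
        T.jump w F x * conj (T.avg z F x ⬝ᵥ cvec (T.nF F)) ∂(surf d)) +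
      ∑ F ∈ T.facesR, ∫ x in hull F, faceTrace (T.cellOf F) F w x * conj (g x) ∂(surf d) := by
  classical
  obtain ⟨τ, hτ⟩ := exists_rep_of_polyVec hzp
  have hτs : T.IsSmoothRep (star z) (fun K => star (τ K)) := fun K hK => by
    refine ⟨(hτ K hK).1.star, ?_⟩
    filter_upwards [(hτ K hK).2] with x hx
    rw [Pi.star_apply, Pi.star_apply, hx]
  have hD : MemL2 P.Ω (star (wdiv P.Ω z)) := MemLp.star hz.wdiv_spec.1
  have key := green_sum hd hw hτs hD hz.1.star fun K hK => by
    rw [(hτ K hK).1.cdiv_star]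
    filter_upwards [hτ.wdiv_eq hz hK] with x hx
    rw [Pi.star_apply, Pi.star_apply, hx]
  have hsub : T.facesR ⊆ T.faces := fun F hF => (mem_facesR.1 hF).1
  refine key.trans ?_
  rw [Finset.sum_congr rfl fun F hF => hτ.face_term hd hz hN hR hw hF, Finset.sum_add_distrib,
    ← Finset.sum_filter, Finset.filter_mem_eq_inter, Finset.inter_eq_right.2 hsub]

end Mesh

/-! ### The lifting operator -/

/-- Riesz representation on a finite-dimensional quotient. -/
lemma exists_riesz_of_finiteDimensional {M H : Type*} [AddCommGroup M] [Module ℂ M]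
    [NormedAddCommGroup H] [InnerProductSpace ℂ H] (J : M →ₗ[ℂ] H)
    [FiniteDimensional ℂ (LinearMap.range J)] (ℓ : M →ₗ[ℂ] ℂ) (h : ∀ v, J v = 0 → ℓ v = 0) :
    ∃ v₀, ∀ v, inner ℂ (J v₀) (J v) = ℓ v := by
  -- A form that vanishes on the kernel of `J` factors through its range, which is
  -- finite-dimensional, hence complete and with all its linear forms continuous.
  have h1 : ℓ ∈ LinearMap.range J.dualMap := by
    rw [LinearMap.range_dualMap_eq_dualAnnihilator_ker, Submodule.mem_dualAnnihilator]
    exact fun v hv => h v hv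
  obtain ⟨m, hm⟩ := h1
  let m' : LinearMap.range J →L[ℂ] ℂ :=
    LinearMap.toContinuousLinearMap (m.comp (LinearMap.range J).subtype)
  have : CompleteSpace (LinearMap.range J) := FiniteDimensional.complete ℂ _
  obtain ⟨⟨y, v₀, rfl⟩, hy⟩ := (InnerProductSpace.toDual ℂ (LinearMap.range J)).surjective m'
  refine ⟨v₀, fun v => ?_⟩
  have h2 := congrArg (fun f => f ⟨J v, v, rfl⟩) hy
  simp only [InnerProductSpace.toDual_apply_apply] at h2
  rw [← hm]
  exact h2

lemma ae_eq_zero_of_integral_dot {U : Set (E d)} {z : Vect d} (hz : MemL2Vec U z)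
    (h : ∫ x in U, z x ⬝ᵥ star (z x) = 0) : ∀ᵐ x ∂(volume.restrict U), z x = 0 := by
  have e : ∀ x, z x ⬝ᵥ star (z x) = ((∑ i, ‖z x i‖ ^ 2 : ℝ) : ℂ) := by
    intro x
    simp [dotProduct, Complex.mul_conj']
  have hint : Integrable (fun x => ∑ i, ‖z x i‖ ^ 2) (volume.restrict U) :=
    integrable_finsetSum _ fun i _ => (hz i).norm.integrable_sq
  simp only [e] at h
  rw [integral_complex_ofReal] at h
  have h1 := (integral_eq_zero_iff_of_nonneg
    (fun x => Finset.sum_nonneg fun i _ => sq_nonneg _) hint).1 (by exact_mod_cast h)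
  filter_upwards [h1] with x hx
  ext i
  have := (Finset.sum_eq_zero_iff_of_nonneg fun i _ => sq_nonneg _).1 hx i (Finset.mem_univ i)
  simpa using this

namespace Mesh

variable {P : Problem d} {T : Mesh P} {p : ℕ} {z z' : Vect d} {v w : Scal d}

lemma polyVec_add (hz : z ∈ T.polyVec p) (hz' : z' ∈ T.polyVec p) : z + z' ∈ T.polyVec p :=
  fun i => poly_add (hz i) (hz' i)

lemma polyVec_smul (c : ℂ) (hz : z ∈ T.polyVec p) : c • z ∈ T.polyVec p :=
  fun i => poly_smul c (hz i)

lemma polyVec_zero : (0 : Vect d) ∈ T.polyVec p := fun _ => poly_zero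

lemma polyVec_sub (hz : z ∈ T.polyVec p) (hz' : z' ∈ T.polyVec p) : z - z' ∈ T.polyVec p := by
  have := polyVec_add hz (polyVec_smul (-1) hz')
  rwa [neg_one_smul, ← sub_eq_add_neg] at this

variable (T p) in
/-- The space of piecewise polynomial fields as a submodule. -/
def polyVecSub : Submodule ℂ (Vect d) where
  carrier := T.polyVec p
  add_mem' := polyVec_add
  zero_mem' := polyVec_zero
  smul_mem' := fun c _ h => polyVec_smul c h

variable (T p) in
/-- The embedding of the piecewise polynomial fields in `[L²(Ω)]^d`. -/
def polyVecL2 : T.polyVecSub p →ₗ[ℂ] PiLp 2 fun _ : Fin d => Lp ℂ 2 (volume.restrict P.Ω) where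
  toFun z := WithLp.toLp 2 fun i => MemLp.toLp (fun x => z.1 x i) (memL2Vec_of_polyVec z.2 i)
  map_add' z z' := by
    ext1 i
    exact MemLp.toLp_add (memL2Vec_of_polyVec z.2 i) (memL2Vec_of_polyVec z'.2 i)
  map_smul' c z := by
    ext1 i
    exact MemLp.toLp_const_smul c (memL2Vec_of_polyVec z.2 i)

lemma inner_polyVecL2 (z z' : T.polyVecSub p) :
    inner ℂ (polyVecL2 T p z) (polyVecL2 T p z') = ∫ x in P.Ω, z'.1 x ⬝ᵥ star (z.1 x) := by
  have h : ∀ i, inner ℂ (polyVecL2 T p z i) (polyVecL2 T p z' i) =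
      ∫ x in P.Ω, z'.1 x i * star (z.1 x i) := by
    intro i
    rw [L2.inner_def]
    refine integral_congr_ae ?_
    filter_upwards [(memL2Vec_of_polyVec z.2 i).coeFn_toLp,
      (memL2Vec_of_polyVec z'.2 i).coeFn_toLp] with x h1 h2
    simp only [polyVecL2, LinearMap.coe_mk, AddHom.coe_mk]
    rw [h1, h2]
    simp
  rw [PiLp.inner_apply, Finset.sum_congr rfl fun i _ => h i]
  simp only [dotProduct, Pi.star_apply]
  rw [integral_finsetSum]
  exact fun i _ => integrable_mul_of_memLp (memL2Vec_of_polyVec z'.2 i)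
    (MemLp.star (memL2Vec_of_polyVec z.2 i))

/-- The piecewise polynomial field with given polynomials. -/
def ofPolys (T : Mesh P) (p : ℕ) :
    ((K : T.cells) → Fin d → MvPolynomial.restrictTotalDegree (Fin d) ℂ p) →ₗ[ℂ] Vect d where
  toFun q x i := ∑ K : T.cells, (interior (hull K.1)).indicator
    (fun x => MvPolynomial.eval (fun j => ((x j : ℝ) : ℂ)) (q K i).1) x
  map_add' q q' := by
    ext x i
    simp only [Pi.add_apply, ← Finset.sum_add_distrib]
    refine Finset.sum_congr rfl fun K _ => ?_
    by_cases hx : x ∈ interior (hull K.1) <;> simp [hx]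
  map_smul' c q := by
    ext x i
    simp only [Pi.smul_apply, smul_eq_mul, Finset.mul_sum, RingHom.id_apply]
    refine Finset.sum_congr rfl fun K _ => ?_
    by_cases hx : x ∈ interior (hull K.1) <;> simp [hx]

lemma ofPolys_apply (q) {K : T.cells} {x : E d} (hx : x ∈ interior (hull K.1)) (i : Fin d) :
    T.ofPolys p q x i = MvPolynomial.eval (fun j => ((x j : ℝ) : ℂ)) (q K i).1 := by
  simp only [ofPolys, LinearMap.coe_mk, AddHom.coe_mk]
  rw [Finset.sum_eq_single_of_mem K (Finset.mem_univ _), Set.indicator_of_mem hx]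
  intro K' _ hne
  exact Set.indicator_of_notMem (notMem_interior K.2 K'.2 (fun h => hne (Subtype.ext h.symm)) hx) _

lemma ofPolys_mem (q) : T.ofPolys p q ∈ T.polyVec p := by
  intro i K hK
  refine ⟨(q ⟨K, hK⟩ i).1, (MvPolynomial.mem_restrictTotalDegree _ _ _).1 (q ⟨K, hK⟩ i).2, ?_⟩
  rw [← ae_restrict_hull]
  filter_upwards [ae_restrict_mem isOpen_interior.measurableSet] with x hx
  exact ofPolys_apply q (K := ⟨K, hK⟩) hx i

/-- Members of `polyVecSub` are functions with arbitrary values on null sets, so only the image in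
`L²` can be expected to have finite dimension. It is spanned by the fields given by one polynomial
per element and component. -/
instance finiteDimensional_range_polyVecL2 :
    FiniteDimensional ℂ (LinearMap.range (polyVecL2 T p)) := by
  let Φ := (polyVecL2 T p).comp ((T.ofPolys p).codRestrict (T.polyVecSub p) fun q => ofPolys_mem q)
  have hle : LinearMap.range (polyVecL2 T p) ≤ LinearMap.range Φ := by
    rintro _ ⟨z, rfl⟩
    have : ∀ K : T.cells, ∀ i, ∃ q : MvPolynomial.restrictTotalDegree (Fin d) ℂ p,
        ∀ᵐ x ∂(volume.restrict (hull K.1)),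
          z.1 x i = MvPolynomial.eval (fun i => ((x i : ℝ) : ℂ)) q.1 := by
      intro K i
      obtain ⟨q, hq, h⟩ := z.2 i K.1 K.2
      exact ⟨⟨q, (MvPolynomial.mem_restrictTotalDegree _ _ _).2 hq⟩, h⟩
    choose q hq using this
    refine ⟨q, ?_⟩
    ext1 i
    refine (MemLp.toLp_eq_toLp_iff (memL2Vec_of_polyVec z.2 i)
      (memL2Vec_of_polyVec (ofPolys_mem q) i)).2 ?_ |>.symm
    rw [EventuallyEq, ae_Ω_iff (T := T)]
    intro K hK
    have h1 := hq ⟨K, hK⟩ i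
    rw [← ae_restrict_hull] at h1
    filter_upwards [h1, ae_restrict_mem isOpen_interior.measurableSet] with x h1 h2
    rw [h1]
    exact (ofPolys_apply q (K := ⟨K, hK⟩) h2 i).symm
  exact Submodule.finiteDimensional_of_le hle

/-! Linearity of jumps and averages -/

lemma jump_linear (hd : 1 ≤ d) (hv : T.IsBroken v) (hw : T.IsBroken w) (c : ℂ) {F : Finset (E d)}
    (hF : F ∈ T.faces) : T.jump (v + c • w) F =ᵐ[(surf d).restrict (hull F)]
      fun x => T.jump v F x + c * T.jump w F x := by
  classical
  have key : ∀ᵐ x ∂((surf d).restrict (hull F)), ∀ K ∈ T.cells.filter (fun K => F ⊆ K),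
      faceTrace K F (v + c • w) x = faceTrace K F v x + c * faceTrace K F w x := by
    rw [Filter.eventually_all_finset]
    intro K hK
    rw [Finset.mem_filter] at hK
    filter_upwards [faceTrace_add hd hK.1 hF hK.2 hv (hw.smul c),
      faceTrace_smul hd hK.1 hF hK.2 c hw] with x h1 h2
    rw [h1, Pi.add_apply, h2, Pi.smul_apply, smul_eq_mul]
  filter_upwards [key] with x hx
  by_cases hI : F ∈ T.facesI
  · have e : ∀ u, T.jump u F x = ∑ K ∈ T.cells.filter (fun K => F ⊆ K),
        faceTrace K F u x * ((inner ℝ (outerNormal K F) (T.nF F) : ℝ) : ℂ) := by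
      intro u
      rw [jump, if_pos hI]
    rw [e, e, e, Finset.mul_sum, ← Finset.sum_add_distrib]
    refine Finset.sum_congr rfl fun K hK => ?_
    rw [hx K hK]
    ring
  · by_cases hD : F ∈ T.facesD
    · simp only [jump, if_neg hI, if_pos hD]
      exact hx _ (Finset.mem_filter.2 (cellOf_spec hF))
    · simp [jump, if_neg hI, if_neg hD]

open Classical in
lemma IsSmoothRep.avg_eq (hd : 1 ≤ d) {τ : Finset (E d) → Vect d} (hτ : T.IsSmoothRep z τ)
    {F : Finset (E d)} (hF : F ∈ T.faces) :
    ∀ᵐ x ∂((surf d).restrict (hull F)), T.avg z F x = if F ∈ T.facesI then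
      (1 / 2 : ℂ) • ∑ K ∈ T.cells.filter (fun K => F ⊆ K), τ K x else τ (T.cellOf F) x := by
  have key : ∀ᵐ x ∂((surf d).restrict (hull F)), ∀ K ∈ T.cells.filter (fun K => F ⊆ K),
      ∀ i, faceTrace K F (fun y => z y i) x = τ K x i := by
    rw [Filter.eventually_all_finset]
    intro K hK
    rw [Finset.mem_filter] at hK
    exact hτ.faceTrace_eq hd hK.1 hF hK.2
  filter_upwards [key] with x hx
  ext i
  by_cases hI : F ∈ T.facesI
  · rw [avg, if_pos hI, if_pos hI, Pi.smul_apply, Finset.sum_apply, smul_eq_mul]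
    congr 1
    exact Finset.sum_congr rfl fun K hK => hx K hK i
  · rw [avg, if_neg hI, if_neg hI]
    exact hx _ (Finset.mem_filter.2 (cellOf_spec hF)) i

lemma memL2Surf_avg (hd : 1 ≤ d) (hz : z ∈ T.polyVec p) {F : Finset (E d)} (hF : F ∈ T.faces)
    (i : Fin d) : MemL2Surf (hull F) (fun x => T.avg z F x i) := by
  classical
  obtain ⟨τ, hτ⟩ := exists_rep_of_polyVec hz
  have hc : Continuous fun x => (if F ∈ T.facesI then
      (1 / 2 : ℂ) • ∑ K ∈ T.cells.filter (fun K => F ⊆ K), τ K x else τ (T.cellOf F) x) i := by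
    split_ifs
    · simp only [Pi.smul_apply, Finset.sum_apply]
      have hs : Continuous fun x => ∑ K ∈ T.cells.filter (fun K => F ⊆ K), τ K x i :=
        continuous_finsetSum _ fun K hK =>
          ((hτ K (Finset.mem_filter.1 hK).1).1 i).continuous
      exact hs.const_smul (1 / 2 : ℂ)
    · exact ((hτ _ (cellOf_spec hF).1).1 i).continuous
  refine (memLp_congr_ae ?_).2 (memL2Surf_of_continuous hd hF hc)
  filter_upwards [hτ.avg_eq hd hF] with x hx
  rw [hx]

lemma memL2Surf_avg_normal (hd : 1 ≤ d) (hz : z ∈ T.polyVec p) {F : Finset (E d)}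
    (hF : F ∈ T.faces) : MemL2Surf (hull F) (fun x => conj (T.avg z F x ⬝ᵥ cvec (T.nF F))) := by
  have : MemL2Surf (hull F) (fun x => T.avg z F x ⬝ᵥ cvec (T.nF F)) := by
    simp only [dotProduct]
    exact memLp_finsetSum _ fun i _ => (memL2Surf_avg hd hz hF i).mul_const _
  exact MemLp.star this

lemma avg_linear (hd : 1 ≤ d) (hz : z ∈ T.polyVec p) (hz' : z' ∈ T.polyVec p) (c : ℂ)
    {F : Finset (E d)} (hF : F ∈ T.faces) : ∀ᵐ x ∂((surf d).restrict (hull F)),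
      T.avg (z + c • z') F x = T.avg z F x + c • T.avg z' F x := by
  classical
  obtain ⟨τ, hτ⟩ := exists_rep_of_polyVec hz
  obtain ⟨τ', hτ'⟩ := exists_rep_of_polyVec hz'
  have h : T.IsSmoothRep (z + c • z') (fun K => τ K + c • τ' K) := fun K hK => by
    refine ⟨fun i => ((hτ K hK).1 i).add (((hτ' K hK).1 i).const_smul c), ?_⟩
    filter_upwards [(hτ K hK).2, (hτ' K hK).2] with x h1 h2
    simp [h1, h2]
  filter_upwards [hτ.avg_eq hd hF, hτ'.avg_eq hd hF, h.avg_eq hd hF] with x h1 h2 h3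
  rw [h1, h2, h3]
  split_ifs
  · simp only [Pi.add_apply, Pi.smul_apply, Finset.sum_add_distrib, ← Finset.smul_sum, smul_add]
    rw [smul_comm]
  · rfl

variable (T) in
/-- The right-hand side of the problem that defines the lifting. -/
def liftRhs (v : Scal d) (z : Vect d) : ℂ :=
  ∑ F ∈ T.faces, ∫ x in hull F, T.jump v F x * conj (T.avg z F x ⬝ᵥ cvec (T.nF F)) ∂(surf d)

lemma liftRhs_linear (hd : 1 ≤ d) (hv : T.IsBroken v) (hw : T.IsBroken w) (c : ℂ)
    (hz : z ∈ T.polyVec p) : T.liftRhs (v + c • w) z = T.liftRhs v z + c * T.liftRhs w z := by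
  simp only [liftRhs, Finset.mul_sum, ← Finset.sum_add_distrib]
  refine Finset.sum_congr rfl fun F hF => ?_
  have ha := memL2Surf_avg_normal hd hz hF
  rw [← integral_const_mul, ← integral_add
    (integrable_mul_of_memLp (memL2Surf_jump hd hv hF) ha)
    ((integrable_mul_of_memLp (memL2Surf_jump hd hw hF) ha).const_mul c)]
  refine integral_congr_ae ?_
  filter_upwards [jump_linear hd hv hw c hF] with x hx
  rw [hx]
  ring

lemma liftRhs_semilinear (hd : 1 ≤ d) (hv : T.IsBroken v) (c : ℂ)
    (hz : z ∈ T.polyVec p) (hz' : z' ∈ T.polyVec p) :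
    T.liftRhs v (z + c • z') = T.liftRhs v z + conj c * T.liftRhs v z' := by
  simp only [liftRhs, Finset.mul_sum, ← Finset.sum_add_distrib]
  refine Finset.sum_congr rfl fun F hF => ?_
  have hj := memL2Surf_jump hd hv hF
  rw [← integral_const_mul, ← integral_add
    (integrable_mul_of_memLp hj (memL2Surf_avg_normal hd hz hF))
    ((integrable_mul_of_memLp hj (memL2Surf_avg_normal hd hz' hF)).const_mul _)]
  refine integral_congr_ae ?_
  filter_upwards [avg_linear hd hz hz' c hF] with x hx
  rw [hx, add_dotProduct, smul_dotProduct, map_add, smul_eq_mul, map_mul]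
  ring

lemma liftRhs_of_V (hd : 1 ≤ d) (hv : v ∈ P.V) (z : Vect d) : T.liftRhs v z = 0 := by
  refine Finset.sum_eq_zero fun F hF => integral_eq_zero_of_ae ?_
  filter_upwards [jump_of_V hd hF hv] with x hx
  rw [hx]
  simp

/-- Such a field is represented by `0` on each element, so all its averages vanish. This is the
compatibility with passage to `L²` that the Riesz argument requires. -/
lemma liftRhs_congr (hd : 1 ≤ d) (v : Scal d)
    (h : ∀ᵐ x ∂(volume.restrict P.Ω), z x = 0) : T.liftRhs v z = 0 := by
  classical
  have hrep : T.IsSmoothRep z (fun _ => 0) := fun K hK =>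
    ⟨fun i => contDiff_const, (ae_Ω_iff (T := T)).1 h K hK⟩
  refine Finset.sum_eq_zero fun F hF => integral_eq_zero_of_ae ?_
  filter_upwards [hrep.avg_eq hd hF] with x hx
  rw [hx]
  simp

/-- The lifting is a Riesz representative. The defining right-hand side is antilinear in the test
field, so its conjugate is the linear form to represent. -/
lemma exists_isLift (hd : 1 ≤ d) (hv : T.IsBroken v) : ∃ L, T.IsLift p v L := by
  let ℓ : T.polyVecSub p →ₗ[ℂ] ℂ :=
    { toFun := fun z => conj (T.liftRhs v z.1)
      map_add' := fun z z' => by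
        have := liftRhs_semilinear hd hv 1 z.2 z'.2
        rw [one_smul, map_one, one_mul] at this
        rw [Submodule.coe_add, this, map_add]
      map_smul' := fun c z => by
        have := liftRhs_semilinear hd hv c polyVec_zero z.2
        rw [zero_add, liftRhs_congr hd v (z := 0) (by simp), zero_add] at this
        rw [Submodule.coe_smul, this, map_mul, Complex.conj_conj, RingHom.id_apply, smul_eq_mul] }
  obtain ⟨L, hL⟩ := exists_riesz_of_finiteDimensional (polyVecL2 T p) ℓ fun z hz => by
    have h1 : ∀ᵐ x ∂(volume.restrict P.Ω), z.1 x = 0 := by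
      refine ae_eq_zero_of_integral_dot (memL2Vec_of_polyVec z.2) ?_
      rw [← inner_polyVecL2, hz, inner_zero_left]
    change conj (T.liftRhs v z.1) = 0
    rw [liftRhs_congr hd v h1, map_zero]
  refine ⟨L.1, L.2, fun z hz => ?_⟩
  have h1 : inner ℂ (polyVecL2 T p L) (polyVecL2 T p ⟨z, hz⟩) = conj (T.liftRhs v z) := hL ⟨z, hz⟩
  have h2 := congrArg conj h1
  rw [inner_conj_symm, inner_polyVecL2, Complex.conj_conj] at h2
  exact h2

lemma lift_spec (hd : 1 ≤ d) (hv : T.IsBroken v) : T.IsLift p v (T.lift p v) := by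
  have h := exists_isLift (p := p) hd hv
  rw [lift, dif_pos h]
  exact h.choose_spec

lemma polyVec_ae_eq (hz : z ∈ T.polyVec p) (hz' : z' ∈ T.polyVec p)
    (h : ∀ y ∈ T.polyVec p, ∫ x in P.Ω, z x ⬝ᵥ star (y x) = ∫ x in P.Ω, z' x ⬝ᵥ star (y x)) :
    ∀ᵐ x ∂(volume.restrict P.Ω), z x = z' x := by
  have hs := polyVec_sub hz hz'
  have h1 := h _ hs
  have h2 : ∫ x in P.Ω, (z - z') x ⬝ᵥ star ((z - z') x) = 0 := by
    have hi := (memL2Vec_of_polyVec hs).star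
    calc ∫ x in P.Ω, (z - z') x ⬝ᵥ star ((z - z') x)
        = ∫ x in P.Ω, (z x ⬝ᵥ star ((z - z') x) - z' x ⬝ᵥ star ((z - z') x)) := by
          simp only [Pi.sub_apply, sub_dotProduct]
      _ = 0 := by
          refine (integral_sub (integrable_dot (memL2Vec_of_polyVec hz) hi)
            (integrable_dot (memL2Vec_of_polyVec hz') hi)).trans ?_
          exact sub_eq_zero.2 h1
  filter_upwards [ae_eq_zero_of_integral_dot (memL2Vec_of_polyVec hs) h2] with x hx
  exact sub_eq_zero.1 hx

lemma lift_linear (hd : 1 ≤ d) (hv : T.IsBroken v) (hw : T.IsBroken w) (c : ℂ) :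
    ∀ᵐ x ∂(volume.restrict P.Ω),
      T.lift p (v + c • w) x = T.lift p v x + c • T.lift p w x := by
  have h1 := lift_spec (p := p) hd hv
  have h2 := lift_spec (p := p) hd hw
  have h3 := lift_spec (p := p) hd (hv.add (hw.smul c))
  refine polyVec_ae_eq h3.1 (polyVec_add h1.1 (polyVec_smul c h2.1)) fun y hy => ?_
  have e1 := integrable_dot (memL2Vec_of_polyVec h1.1) (memL2Vec_of_polyVec hy).star
  have e2 := integrable_dot (memL2Vec_of_polyVec h2.1) (memL2Vec_of_polyVec hy).star
  rw [h3.2 y hy]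
  simp only [add_dotProduct, smul_dotProduct]
  refine (liftRhs_linear hd hv hw c hy).trans ?_
  have := integral_add e1 (e2.const_mul c)
  rw [integral_const_mul] at this
  refine Eq.trans ?_ this.symm
  exact congrArg₂ (fun a b => a + c * b) (h1.2 y hy).symm (h2.2 y hy).symm

lemma lift_of_V (hd : 1 ≤ d) (hv : v ∈ P.V) :
    ∀ᵐ x ∂(volume.restrict P.Ω), T.lift p v x = 0 := by
  have h := lift_spec (p := p) hd (isBroken_of_V (T := T) hv)
  refine polyVec_ae_eq h.1 polyVec_zero fun y hy => ?_
  rw [h.2 y hy]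
  refine (liftRhs_of_V hd hv y).trans ?_
  simp

/-! The discrete gradient -/

lemma memL2Vec_𝔊 (hd : 1 ≤ d) (hv : T.IsBroken v) : MemL2Vec P.Ω (T.𝔊 p v) :=
  hv.memL2_grad.sub (memL2Vec_of_polyVec (lift_spec hd hv).1)

lemma 𝔊_linear (hd : 1 ≤ d) (hv : T.IsBroken v) (hw : T.IsBroken w) (c : ℂ) :
    ∀ᵐ x ∂(volume.restrict P.Ω), T.𝔊 p (v + c • w) x = T.𝔊 p v x + c • T.𝔊 p w x := by
  filter_upwards [lift_linear (p := p) hd hv hw c, hv.grad_add (hw.smul c), hw.grad_smul c]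
    with x h1 h2 h3
  rw [𝔊, 𝔊, 𝔊, h1, h2, h3, smul_sub]
  abel

/-- Without jumps there is no lifting. Through this identity `bh₀` and the broken energy extend `b`
and the energy norm from `V`. -/
lemma 𝔊_of_V (hd : 1 ≤ d) (hv : v ∈ P.V) :
    ∀ᵐ x ∂(volume.restrict P.Ω), T.𝔊 p v x = wgrad P.Ω v x := by
  filter_upwards [lift_of_V (p := p) (T := T) hd hv, grad_of_memH1 (T := T) hv.1] with x h1 h2
  rw [𝔊, h1, h2, sub_zero]

/-- Integration by parts with the discrete gradient. -/
lemma integral_𝔊_add_wdiv (hd : 1 ≤ d) (hzp : z ∈ T.polyVec p) (hz : MemHdiv P.Ω z)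
    (hN : IsNormalTrace P.Ω P.ΓN z 0) {g : Scal d} (hR : IsNormalTrace P.Ω P.ΓR z g)
    (hw : T.IsBroken w) :
    ∫ x in P.Ω, (T.𝔊 p w x ⬝ᵥ star (z x) + w x * conj (wdiv P.Ω z x)) =
      ∑ F ∈ T.facesR, ∫ x in hull F, faceTrace (T.cellOf F) F w x * conj (g x) ∂(surf d) := by
  have h1 := integral_grad_add_wdiv hd hzp hz hN hR hw
  have h2 := (lift_spec (p := p) hd hw).2 z hzp
  have e1 : Integrable (fun x => T.grad w x ⬝ᵥ star (z x) + w x * conj (wdiv P.Ω z x))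
      (volume.restrict P.Ω) := (integrable_dot hw.memL2_grad hz.1.star).add
        (integrable_mul_of_memLp hw.memL2 (MemLp.star hz.wdiv_spec.1))
  have e2 := integrable_dot (memL2Vec_of_polyVec (lift_spec (p := p) hd hw).1) hz.1.star
  have h3 : ∫ x in P.Ω, (T.𝔊 p w x ⬝ᵥ star (z x) + w x * conj (wdiv P.Ω z x)) =
      ∫ x in P.Ω, ((T.grad w x ⬝ᵥ star (z x) + w x * conj (wdiv P.Ω z x)) -
        T.lift p w x ⬝ᵥ star (z x)) := by
    refine integral_congr_ae (Eventually.of_forall fun x => ?_)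
    simp only [𝔊, sub_dotProduct]
    ring
  have h4 := integral_sub e1 e2
  rw [h3]
  refine h4.trans ?_
  rw [h1]
  -- By definition of the lifting, the jump terms of the element-wise formula are its product with
  -- `z`; subtracting it leaves the Robin terms only.
  refine sub_eq_of_eq_add' ?_
  exact congrArg (· + _) h2.symm

end Mesh

/-! ### Cauchy–Schwarz inequalities -/

section CauchySchwarz

lemma exists_pos_forall_le {ι : Type*} (s : Finset ι) (f : ι → ℝ) (h : ∀ i ∈ s, 0 < f i) :
    ∃ c, 0 < c ∧ ∀ i ∈ s, c ≤ f i := by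
  classical
  induction s using Finset.induction_on with
  | empty => exact ⟨1, one_pos, by simp⟩
  | insert i s hi ih =>
    obtain ⟨c, hc, hcs⟩ := ih fun j hj => h j (Finset.mem_insert_of_mem hj)
    refine ⟨min c (f i), lt_min hc (h i (Finset.mem_insert_self i s)), fun j hj => ?_⟩
    rcases Finset.mem_insert.1 hj with rfl | hj
    · exact min_le_right _ _
    · exact (min_le_left _ _).trans (hcs j hj)

lemma exists_forall_le {ι : Type*} (s : Finset ι) (f : ι → ℝ) : ∃ c, 0 < c ∧ ∀ i ∈ s, f i ≤ c := by
  refine ⟨1 + ∑ i ∈ s, |f i|, by positivity, fun i hi => ?_⟩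
  have := Finset.single_le_sum (f := fun i => |f i|) (fun i _ => abs_nonneg _) hi
  have h2 := le_abs_self (f i)
  linarith

/-- This is Cauchy–Schwarz in `ℝ²`. It assembles local estimates into norms that are square roots of
sums of squares. -/
lemma sqrt_mul_sqrt_add_le {a b a' b' : ℝ} (ha : 0 ≤ a) (hb : 0 ≤ b) (ha' : 0 ≤ a') (hb' : 0 ≤ b') :
    √a * √b + √a' * √b' ≤ √(a + a') * √(b + b') := by
  rw [← Real.sqrt_mul (by positivity) (b + b')]
  refine Real.le_sqrt_of_sq_le ?_
  nlinarith [Real.sq_sqrt ha, Real.sq_sqrt hb, Real.sq_sqrt ha', Real.sq_sqrt hb',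
    sq_nonneg (√a * √b' - √a' * √b)]

lemma norm_add_le_sqrt {x y : ℂ} {a b a' b' : ℝ} (ha : 0 ≤ a) (hb : 0 ≤ b) (ha' : 0 ≤ a')
    (hb' : 0 ≤ b') (hx : ‖x‖ ≤ √a * √b) (hy : ‖y‖ ≤ √a' * √b') :
    ‖x + y‖ ≤ √(a + a') * √(b + b') :=
  (norm_add_le x y).trans ((add_le_add hx hy).trans (sqrt_mul_sqrt_add_le ha hb ha' hb'))

lemma norm_sum_le_sqrt {ι : Type*} (s : Finset ι) {x : ι → ℂ} {a b : ι → ℝ}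
    (ha : ∀ i ∈ s, 0 ≤ a i) (hb : ∀ i ∈ s, 0 ≤ b i) (h : ∀ i ∈ s, ‖x i‖ ≤ √(a i) * √(b i)) :
    ‖∑ i ∈ s, x i‖ ≤ √(∑ i ∈ s, a i) * √(∑ i ∈ s, b i) := by
  classical
  induction s using Finset.induction_on with
  | empty => simp
  | insert i s hi ih =>
    rw [Finset.sum_insert hi, Finset.sum_insert hi, Finset.sum_insert hi]
    have hs : ∀ j ∈ s, j ∈ insert i s := fun j hj => Finset.mem_insert_of_mem hj
    have hi' := Finset.mem_insert_self i s
    exact norm_add_le_sqrt (ha i hi') (hb i hi') (Finset.sum_nonneg fun j hj => ha j (hs j hj))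
      (Finset.sum_nonneg fun j hj => hb j (hs j hj)) (h i hi')
      (ih (fun j hj => ha j (hs j hj)) (fun j hj => hb j (hs j hj)) fun j hj => h j (hs j hj))

variable {α : Type*} [MeasurableSpace α] {m : Measure α}

lemma norm_integral_le_sqrt {F : α → ℂ} {f g : α → ℝ} (hf : Integrable f m) (hg : Integrable g m)
    (hf0 : ∀ᵐ x ∂m, 0 ≤ f x) (hg0 : ∀ᵐ x ∂m, 0 ≤ g x) (h : ∀ᵐ x ∂m, ‖F x‖ ≤ √(f x) * √(g x)) :
    ‖∫ x, F x ∂m‖ ≤ √(∫ x, f x ∂m) * √(∫ x, g x ∂m) := by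
  have hs : ∀ {f : α → ℝ}, Integrable f m → (∀ᵐ x ∂m, 0 ≤ f x) →
      MemLp (fun x => √(f x)) 2 m ∧ ∫ x, √(f x) ^ (2 : ℝ) ∂m = ∫ x, f x ∂m := by
    intro f hf hf0
    have e : (fun x => √(f x) ^ 2) =ᵐ[m] f := by
      filter_upwards [hf0] with x hx using Real.sq_sqrt hx
    refine ⟨(memLp_two_iff_integrable_sq
      (Real.continuous_sqrt.comp_aestronglyMeasurable hf.1)).2 ((integrable_congr e).2 hf), ?_⟩
    simp only [Real.rpow_two]
    exact integral_congr_ae e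
  obtain ⟨f1, f2⟩ := hs hf hf0
  obtain ⟨g1, g2⟩ := hs hg hg0
  refine (norm_integral_le_of_norm_le (f1.integrable_mul g1) h).trans ?_
  have := integral_mul_le_Lp_mul_Lq_of_nonneg (μ := m) Real.HolderConjugate.two_two
    (Eventually.of_forall fun x => Real.sqrt_nonneg (f x))
    (Eventually.of_forall fun x => Real.sqrt_nonneg (g x)) (by simpa using f1) (by simpa using g1)
  rw [f2, g2, ← Real.sqrt_eq_rpow, ← Real.sqrt_eq_rpow] at this
  exact this

end CauchySchwarz

/-! ### Hermitian forms of real matrices -/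

section Herm

variable {M : Matrix (Fin d) (Fin d) ℝ} {a b : Fin d → ℂ}

/-- A real matrix as a complex matrix. -/
abbrev cmat (M : Matrix (Fin d) (Fin d) ℝ) : Matrix (Fin d) (Fin d) ℂ := M.map fun t : ℝ => (t : ℂ)

lemma cmat_mul (M N : Matrix (Fin d) (Fin d) ℝ) : cmat (M * N) = cmat M * cmat N :=
  Matrix.map_mul (f := Complex.ofRealHom)

lemma star_cmat_mulVec : star (cmat M *ᵥ a) = cmat M *ᵥ star a := by
  ext i
  simp [Matrix.mulVec, dotProduct]

lemma cmat_transpose_dot : (cmat M *ᵥ a) ⬝ᵥ b = a ⬝ᵥ (cmat Mᵀ *ᵥ b) := by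
  rw [Matrix.dotProduct_mulVec, cmat, cmat, Matrix.transpose_map, Matrix.vecMul_transpose]

lemma norm_dot_star_le (a b : Fin d → ℂ) :
    ‖a ⬝ᵥ star b‖ ≤ √(∑ i, ‖a i‖ ^ 2) * √(∑ i, ‖b i‖ ^ 2) := by
  have := norm_inner_le_norm (𝕜 := ℂ) (WithLp.toLp 2 b) (WithLp.toLp 2 a)
  rw [EuclideanSpace.norm_eq, EuclideanSpace.norm_eq, mul_comm] at this
  simpa [EuclideanSpace.inner_eq_star_dotProduct] using this

lemma dot_star_self (a : Fin d → ℂ) : a ⬝ᵥ star a = ((∑ i, ‖a i‖ ^ 2 : ℝ) : ℂ) := by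
  simp [dotProduct, Complex.mul_conj']

lemma herm_transpose_mul_self (B : Matrix (Fin d) (Fin d) ℝ) :
    herm (Bᵀ * B) a b = (cmat B *ᵥ a) ⬝ᵥ star (cmat B *ᵥ b) := by
  change (cmat (Bᵀ * B) *ᵥ a) ⬝ᵥ star b = _
  rw [cmat_mul, ← Matrix.mulVec_mulVec, cmat_transpose_dot, Matrix.transpose_transpose,
    star_cmat_mulVec]

-- Writing `M = Bᵀ * B` turns the Hermitian form of `M` into the Euclidean product of the images
-- under `B`, so that positivity and Cauchy–Schwarz are inherited.
open scoped MatrixOrder in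
lemma _root_.Matrix.PosDef.exists_factor (hM : M.PosDef) : ∃ B, M = Bᵀ * B := by
  obtain ⟨B, hB⟩ := CStarAlgebra.nonneg_iff_eq_star_mul_self.1 hM.posSemidef.nonneg
  exact ⟨B, by
    rwa [Matrix.star_eq_conjTranspose, Matrix.conjTranspose_eq_transpose_of_trivial] at hB⟩

lemma herm_self_re_nonneg (hM : M.PosDef) (a : Fin d → ℂ) : 0 ≤ (herm M a a).re := by
  obtain ⟨B, rfl⟩ := hM.exists_factor
  rw [herm_transpose_mul_self, dot_star_self, Complex.ofReal_re]
  positivity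

lemma norm_herm_le (hM : M.PosDef) (a b : Fin d → ℂ) :
    ‖herm M a b‖ ≤ √(herm M a a).re * √(herm M b b).re := by
  obtain ⟨B, rfl⟩ := hM.exists_factor
  rw [herm_transpose_mul_self, herm_transpose_mul_self, herm_transpose_mul_self, dot_star_self,
    dot_star_self, Complex.ofReal_re, Complex.ofReal_re]
  exact norm_dot_star_le _ _

lemma _root_.Matrix.PosDef.transpose_eq (hM : M.PosDef) : Mᵀ = M := by
  have := hM.isHermitian
  rwa [Matrix.IsHermitian, Matrix.conjTranspose_eq_transpose_of_trivial] at this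

lemma herm_eq_dot (hM : M.PosDef) (a b : Fin d → ℂ) : herm M a b = a ⬝ᵥ star (cmat M *ᵥ b) := by
  rw [herm, cmat_transpose_dot, hM.transpose_eq, star_cmat_mulVec]

lemma herm_star (hM : M.PosDef) (a b : Fin d → ℂ) : herm M (star b) (star a) = herm M a b := by
  rw [herm_eq_dot hM a b, herm, star_star, star_cmat_mulVec, dotProduct_comm]

lemma herm_conj (hM : M.PosDef) (a b : Fin d → ℂ) : conj (herm M a b) = herm M b a := by
  have : conj (herm M a b) = star (cmat M *ᵥ a) ⬝ᵥ b := by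
    simp [herm, dotProduct]
  rw [this, dotProduct_comm, ← herm_eq_dot hM]

lemma cmat_inv_mulVec (hM : M.PosDef) (a : Fin d → ℂ) : cmat M *ᵥ (cmat M⁻¹ *ᵥ a) = a := by
  have h1 : M * M⁻¹ = 1 := Matrix.mul_nonsing_inv M (M.isUnit_iff_isUnit_det.1 hM.isUnit)
  rw [Matrix.mulVec_mulVec, ← cmat_mul, h1]
  simp [cmat]

lemma herm_inv_self (hM : M.PosDef) (a : Fin d → ℂ) :
    herm M (cmat M⁻¹ *ᵥ a) (cmat M⁻¹ *ᵥ a) = herm M⁻¹ a a := by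
  rw [herm, cmat_inv_mulVec hM, herm_eq_dot hM.inv]

/-- With `b = M (M⁻¹ b)`, this is Cauchy–Schwarz for the form of `M`. It pairs the discrete
gradient, measured with `A`, with fluxes, measured with `A⁻¹`. -/
lemma norm_dot_star_le_herm (hM : M.PosDef) (a b : Fin d → ℂ) :
    ‖a ⬝ᵥ star b‖ ≤ √(herm M a a).re * √(herm M⁻¹ b b).re := by
  have h := norm_herm_le hM a (cmat M⁻¹ *ᵥ b)
  rwa [herm_inv_self hM, herm_eq_dot hM, cmat_inv_mulVec hM] at h

lemma herm_inv_mulVec (hM : M.PosDef) (a : Fin d → ℂ) :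
    herm M⁻¹ (cmat M *ᵥ a) (cmat M *ᵥ a) = herm M a a := by
  have h1 : M⁻¹ * M = 1 := Matrix.nonsing_inv_mul M (M.isUnit_iff_isUnit_det.1 hM.isUnit)
  rw [herm_eq_dot hM a a, herm, Matrix.mulVec_mulVec, ← cmat_mul, h1]
  simp [cmat]

lemma herm_self_re (M : Matrix (Fin d) (Fin d) ℝ) (a : Fin d → ℂ) :
    (herm M a a).re = (fun i => (a i).re) ⬝ᵥ (M *ᵥ fun i => (a i).re) +
      (fun i => (a i).im) ⬝ᵥ (M *ᵥ fun i => (a i).im) := by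
  simp only [herm, dotProduct, Matrix.mulVec, Matrix.map_apply, Pi.star_apply, Complex.re_sum,
    ← Finset.sum_add_distrib, Complex.mul_re, Complex.im_sum, Complex.mul_im, Complex.ofReal_re,
    Complex.ofReal_im, zero_mul, sub_zero, add_zero, RCLike.star_def, Complex.conj_re,
    Complex.conj_im]
  exact Finset.sum_congr rfl fun i _ => by ring

lemma minForm_pos (hd : 1 ≤ d) (hM : M.PosDef) : 0 < minForm M := by
  have hne : (Metric.sphere (0 : E d) 1).Nonempty := by
    have : Nontrivial (E d) := by
      have : Nonempty (Fin d) := ⟨⟨0, hd⟩⟩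
      infer_instance
    exact NormedSpace.sphere_nonempty.2 zero_le_one
  have hcont : Continuous fun ξ : E d => (fun i => ξ i) ⬝ᵥ (M *ᵥ fun i => ξ i) := by
    simp only [dotProduct, Matrix.mulVec]
    fun_prop
  obtain ⟨ξ, hξ, hmin⟩ := (isCompact_sphere (0 : E d) 1).exists_isMinOn hne hcont.continuousOn
  have hξ1 : ‖ξ‖ = 1 := by simpa using hξ
  have hpos : 0 < (fun i => ξ i) ⬝ᵥ (M *ᵥ fun i => ξ i) := by
    have hx : (fun i => ξ i) ≠ 0 := by
      intro h0
      have : ξ = 0 := by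
        ext i
        exact congrFun h0 i
      rw [this, norm_zero] at hξ1
      exact zero_ne_one hξ1
    simpa using hM.dotProduct_mulVec_pos hx
  refine hpos.trans_le (le_csInf ⟨_, ξ, hξ1, rfl⟩ ?_)
  rintro r ⟨η, hη, rfl⟩
  exact hmin (by simpa using hη)

/-- Coercivity of the Hermitian form of a positive definite matrix. -/
lemma minForm_mul_le (hM : M.PosDef) (a : Fin d → ℂ) :
    minForm M * ∑ i, ‖a i‖ ^ 2 ≤ (herm M a a).re := by
  -- On real vectors this is homogeneity. The form of a complex vector is the sum of those of its
  -- real and imaginary parts.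
  have key : ∀ x : Fin d → ℝ, minForm M * ∑ i, x i ^ 2 ≤ x ⬝ᵥ (M *ᵥ x) := by
    intro x
    set ξ : E d := WithLp.toLp 2 x with hξ
    have hn : ‖ξ‖ ^ 2 = ∑ i, x i ^ 2 := by simp [EuclideanSpace.norm_sq_eq, hξ]
    have hps : ∀ y : Fin d → ℝ, 0 ≤ y ⬝ᵥ (M *ᵥ y) := fun y => by
      simpa using hM.posSemidef.dotProduct_mulVec_nonneg y
    by_cases h0 : ‖ξ‖ = 0
    · rw [← hn, h0]
      simpa using hps x
    · have h1 : minForm M ≤ (fun i => (‖ξ‖⁻¹ • ξ) i) ⬝ᵥ (M *ᵥ fun i => (‖ξ‖⁻¹ • ξ) i) := by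
        refine csInf_le ⟨0, ?_⟩ ⟨‖ξ‖⁻¹ • ξ, ?_, rfl⟩
        · rintro r ⟨η, -, rfl⟩
          exact hps _
        · rw [norm_smul, norm_inv, norm_norm, inv_mul_cancel₀ h0]
      have h2 : (fun i => (‖ξ‖⁻¹ • ξ) i) = ‖ξ‖⁻¹ • x := rfl
      rw [h2, Matrix.mulVec_smul, smul_dotProduct, dotProduct_smul, smul_eq_mul, smul_eq_mul] at h1
      rw [← hn]
      have h3 := mul_le_mul_of_nonneg_right h1 (sq_nonneg ‖ξ‖)
      refine h3.trans (le_of_eq ?_)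
      field_simp
  have e : ∀ z : ℂ, ‖z‖ ^ 2 = z.re ^ 2 + z.im ^ 2 := fun z => by
    rw [Complex.sq_norm, Complex.normSq_apply]
    ring
  rw [herm_self_re M]
  simp only [e, Finset.sum_add_distrib, mul_add]
  exact add_le_add (key _) (key _)

end Herm

/-! ### Coefficients -/

/-- Measurable real functions with positive lower and upper bounds. -/
structure IsWeight (m : Measure (E d)) (f : E d → ℝ) : Prop where
  meas : AEStronglyMeasurable f m
  bounds : ∃ c C, 0 < c ∧ ∀ᵐ x ∂m, c ≤ f x ∧ f x ≤ C

namespace IsWeight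

variable {m : Measure (E d)} {f : E d → ℝ} {v w : Scal d}

lemma const {c : ℝ} (hc : 0 < c) (h : ∀ᵐ x ∂m, f x = c) : IsWeight m f := by
  refine ⟨aestronglyMeasurable_const.congr (EventuallyEq.symm h), c, c, hc, ?_⟩
  filter_upwards [h] with x hx
  exact ⟨hx.ge, hx.le⟩

lemma finsetSum {ι : Type*} {s : Finset ι} {m : ι → Measure (E d)} {c : ι → ℝ}
    (h : ∀ i ∈ s, 0 < c i ∧ ∀ᵐ x ∂(m i), f x = c i) : IsWeight (∑ i ∈ s, m i) f := by
  obtain ⟨c₀, hc₀, h₀⟩ := exists_pos_forall_le s c fun i hi => (h i hi).1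
  obtain ⟨C, -, hC⟩ := exists_forall_le s c
  refine ⟨?_, c₀, C, hc₀, ?_⟩
  · rw [← Measure.sum_coe_finset, aestronglyMeasurable_sum_measure_iff]
    exact fun i => aestronglyMeasurable_const.congr (EventuallyEq.symm (h i i.2).2)
  · rw [ae_finsetSum_measure_iff]
    intro i hi
    filter_upwards [(h i hi).2] with x hx
    rw [hx]
    exact ⟨h₀ i hi, hC i hi⟩

variable (hf : IsWeight m f)
include hf

lemma ae_pos : ∀ᵐ x ∂m, 0 < f x := by
  obtain ⟨c, C, hc, h⟩ := hf.bounds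
  filter_upwards [h] with x hx using hc.trans_le hx.1

lemma memLp_mul (hv : MemLp v 2 m) : MemLp (fun x => (f x : ℂ) * v x) 2 m := by
  obtain ⟨c, C, hc, h⟩ := hf.bounds
  refine hv.of_le_mul (c := C)
    ((Complex.continuous_ofReal.comp_aestronglyMeasurable hf.meas).mul hv.1) ?_
  filter_upwards [h] with x hx
  rw [norm_mul, Complex.norm_real, Real.norm_of_nonneg (hc.le.trans hx.1)]
  gcongr
  exact hx.2

lemma integrable_mul (hv : MemLp v 2 m) (hw : MemLp w 2 m) :
    Integrable (fun x => (f x : ℂ) * v x * conj (w x)) m :=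
  integrable_mul_of_memLp (hf.memLp_mul hv) (MemLp.star hw)

lemma integrable_sq (hv : MemLp v 2 m) : Integrable (fun x => f x * ‖v x‖ ^ 2) m := by
  have h := (hf.integrable_mul hv hv).re
  refine h.congr (Eventually.of_forall fun x => ?_)
  have : (f x : ℂ) * v x * conj (v x) = ((f x * ‖v x‖ ^ 2 : ℝ) : ℂ) := by
    rw [mul_assoc, Complex.mul_conj']
    push_cast
    rfl
  simp only [this]
  exact Complex.ofReal_re _

lemma integral_sq_nonneg (v : Scal d) : 0 ≤ ∫ x, f x * ‖v x‖ ^ 2 ∂m := by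
  refine integral_nonneg_of_ae ?_
  filter_upwards [hf.ae_pos] with x hx
  have := hx.le
  positivity

lemma norm_integral_le (hv : MemLp v 2 m) (hw : MemLp w 2 m) :
    ‖∫ x, (f x : ℂ) * v x * conj (w x) ∂m‖ ≤
      √(∫ x, f x * ‖v x‖ ^ 2 ∂m) * √(∫ x, f x * ‖w x‖ ^ 2 ∂m) := by
  refine norm_integral_le_sqrt (hf.integrable_sq hv) (hf.integrable_sq hw) ?_ ?_ ?_
  · filter_upwards [hf.ae_pos] with x hx
    have := hx.le
    positivity
  · filter_upwards [hf.ae_pos] with x hx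
    have := hx.le
    positivity
  · filter_upwards [hf.ae_pos] with x hx
    rw [norm_mul, norm_mul, Complex.norm_real, Real.norm_of_nonneg hx.le, RCLike.norm_conj,
      Real.sqrt_mul hx.le, Real.sqrt_mul hx.le, Real.sqrt_sq (norm_nonneg _),
      Real.sqrt_sq (norm_nonneg _)]
    refine le_of_eq ?_
    conv_lhs => rw [← Real.mul_self_sqrt hx.le]
    ring

lemma exists_integral_sq_le : ∃ C, 0 < C ∧ ∀ v : Scal d, MemLp v 2 m →
    ∫ x, ‖v x‖ ^ 2 ∂m ≤ C * ∫ x, f x * ‖v x‖ ^ 2 ∂m := by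
  obtain ⟨c, C, hc, h⟩ := hf.bounds
  refine ⟨c⁻¹, inv_pos.2 hc, fun v hv => ?_⟩
  rw [← integral_const_mul]
  refine integral_mono_ae hv.norm.integrable_sq ((hf.integrable_sq hv).const_mul _) ?_
  filter_upwards [h] with x hx
  have := mul_le_mul_of_nonneg_right hx.1 (sq_nonneg ‖v x‖)
  rw [← div_eq_inv_mul, le_div_iff₀ hc]
  linarith

end IsWeight

namespace Mesh

variable {P : Problem d} {T : Mesh P} {p : ℕ} {z z' : Vect d} {v w : Scal d}

lemma isWeight_μ (T : Mesh P) : IsWeight (volume.restrict P.Ω) P.μ := by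
  rw [T.restrict_Ω]
  refine IsWeight.finsetSum (c := μK P) fun K hK => ⟨(coeff_cell hK).1.1, ?_⟩
  rw [← ae_restrict_hull]
  filter_upwards [ae_restrict_mem isOpen_interior.measurableSet] with x hx
  exact (coeff_cell hK).1.2 x hx

lemma isWeight_γ (T : Mesh P) (hd : 1 ≤ d) : IsWeight ((surf d).restrict P.ΓR) P.γ := by
  rw [T.restrict_ΓR hd]
  exact IsWeight.finsetSum fun F hF => coeff_face hd hF

lemma isWeight_γF (hd : 1 ≤ d) {F : Finset (E d)} (hF : F ∈ T.facesR) :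
    IsWeight ((surf d).restrict (hull F)) P.γ :=
  IsWeight.const (coeff_face hd hF).1 (coeff_face hd hF).2

lemma ae_A_posDef (T : Mesh P) : ∀ᵐ x ∂(volume.restrict P.Ω), (P.A x).PosDef := by
  rw [ae_Ω_iff (T := T)]
  intro K hK
  filter_upwards [ae_restrict_mem isOpen_interior.measurableSet] with x hx
  rw [(coeff_cell hK).2.2 x hx]
  exact (coeff_cell hK).2.1

lemma ae_A_bounds (T : Mesh P) (hd : 1 ≤ d) : ∃ c C, 0 < c ∧ ∀ᵐ x ∂(volume.restrict P.Ω),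
    (∀ a, c * ∑ i, ‖a i‖ ^ 2 ≤ (herm (P.A x) a a).re) ∧ ∀ i j, |P.A x i j| ≤ C := by
  obtain ⟨c, hc, h⟩ := exists_pos_forall_le T.cells (fun K => minForm (P.A (K.centroid ℝ id)))
    fun K hK => minForm_pos hd (coeff_cell hK).2.1
  obtain ⟨C, -, hC⟩ := exists_forall_le T.cells (fun K => ∑ i, ∑ j, |P.A (K.centroid ℝ id) i j|)
  refine ⟨c, C, hc, ?_⟩
  rw [ae_Ω_iff (T := T)]
  intro K hK
  filter_upwards [ae_restrict_mem isOpen_interior.measurableSet] with x hx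
  rw [(coeff_cell hK).2.2 x hx]
  refine ⟨fun a => ?_, fun i j => ?_⟩
  · exact (mul_le_mul_of_nonneg_right (h K hK) (Finset.sum_nonneg fun i _ => sq_nonneg _)).trans
      (minForm_mul_le (coeff_cell hK).2.1 a)
  · refine le_trans ?_ (hC K hK)
    refine le_trans ?_ (Finset.single_le_sum (fun i _ => Finset.sum_nonneg fun j _ => abs_nonneg _)
      (Finset.mem_univ i))
    exact Finset.single_le_sum (f := fun j => |P.A (K.centroid ℝ id) i j|)
      (fun j _ => abs_nonneg _) (Finset.mem_univ j)

/-- The coefficients are arbitrary functions outside the subdomains. Measurability and boundedness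
come from their being constant inside each element, so membership is checked element by element. -/
lemma memL2Vec_mulVec {B : E d → Matrix (Fin d) (Fin d) ℝ}
    (hB : ∀ K ∈ T.cells, ∃ M, ∀ x ∈ interior (hull K), B x = M) (hz : MemL2Vec P.Ω z) :
    MemL2Vec P.Ω (fun x => cmat (B x) *ᵥ z x) := by
  intro i
  rw [memL2_Ω_iff (T := T)]
  intro K hK
  obtain ⟨M, hM⟩ := hB K hK
  have : MemL2 (interior (hull K)) (fun x => ∑ j, (M i j : ℂ) * z x j) :=
    memLp_finsetSum _ fun j _ => ((hz j).mono (interior_hull_subset hK)).const_mul _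
  refine (memLp_congr_ae ?_).1 this
  filter_upwards [ae_restrict_mem isOpen_interior.measurableSet] with x hx
  rw [hM x hx]
  simp [Matrix.mulVec, dotProduct]

lemma memL2Vec_A (T : Mesh P) (hz : MemL2Vec P.Ω z) :
    MemL2Vec P.Ω (fun x => cmat (P.A x) *ᵥ z x) :=
  memL2Vec_mulVec (T := T) (fun _ hK => ⟨_, (coeff_cell hK).2.2⟩) hz

lemma memL2Vec_A_inv (T : Mesh P) (hz : MemL2Vec P.Ω z) :
    MemL2Vec P.Ω (fun x => cmat (P.A x)⁻¹ *ᵥ z x) :=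
  memL2Vec_mulVec (T := T) (B := fun x => (P.A x)⁻¹)
    (fun _ hK => ⟨_, fun x hx => by rw [(coeff_cell hK).2.2 x hx]⟩) hz

lemma integrable_herm (T : Mesh P) (hz : MemL2Vec P.Ω z) (hz' : MemL2Vec P.Ω z') :
    Integrable (fun x => herm (P.A x) (z x) (z' x)) (volume.restrict P.Ω) :=
  integrable_dot (T.memL2Vec_A hz) hz'.star

lemma integrable_herm_self (T : Mesh P) (hz : MemL2Vec P.Ω z) :
    Integrable (fun x => (herm (P.A x) (z x) (z x)).re) (volume.restrict P.Ω) :=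
  (T.integrable_herm hz hz).re

lemma integrable_herm_inv (T : Mesh P) (hz : MemL2Vec P.Ω z) :
    Integrable (fun x => (herm (P.A x)⁻¹ (z x) (z x)).re) (volume.restrict P.Ω) :=
  (integrable_dot (T.memL2Vec_A_inv hz) hz.star).re

lemma integral_herm_nonneg (T : Mesh P) (z : Vect d) :
    0 ≤ ∫ x in P.Ω, (herm (P.A x) (z x) (z x)).re := by
  refine integral_nonneg_of_ae ?_
  filter_upwards [T.ae_A_posDef] with x hx using herm_self_re_nonneg hx _

lemma norm_integral_herm_le (T : Mesh P) (hz : MemL2Vec P.Ω z) (hz' : MemL2Vec P.Ω z') :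
    ‖∫ x in P.Ω, herm (P.A x) (z x) (z' x)‖ ≤ √(∫ x in P.Ω, (herm (P.A x) (z x) (z x)).re) *
      √(∫ x in P.Ω, (herm (P.A x) (z' x) (z' x)).re) := by
  refine norm_integral_le_sqrt (T.integrable_herm_self hz) (T.integrable_herm_self hz') ?_ ?_ ?_
  all_goals filter_upwards [T.ae_A_posDef] with x hx
  · exact herm_self_re_nonneg hx _
  · exact herm_self_re_nonneg hx _
  · exact norm_herm_le hx _ _

/-! Splitting of integrals -/

lemma integral_ΓR (T : Mesh P) (hd : 1 ≤ d) {V : Type*} [NormedAddCommGroup V] [NormedSpace ℝ V]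
    {f : E d → V} (hf : Integrable f ((surf d).restrict P.ΓR)) :
    ∫ x in P.ΓR, f x ∂(surf d) = ∑ F ∈ T.facesR, ∫ x in hull F, f x ∂(surf d) := by
  rw [T.restrict_ΓR hd, integrable_finsetSum_measure] at hf
  rw [T.restrict_ΓR hd, integral_finsetSum_measure hf]

lemma ae_hull_of_ΓR (T : Mesh P) (hd : 1 ≤ d) {F : Finset (E d)} (hF : F ∈ T.facesR)
    {q : E d → Prop} (h : ∀ᵐ x ∂((surf d).restrict P.ΓR), q x) :
    ∀ᵐ x ∂((surf d).restrict (hull F)), q x := by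
  rw [T.restrict_ΓR hd, ae_finsetSum_measure_iff] at h
  exact h F hF

lemma memL2Surf_hull_of_ΓR (T : Mesh P) (hd : 1 ≤ d) {F : Finset (E d)} (hF : F ∈ T.facesR)
    {g : Scal d} (hg : MemL2Surf P.ΓR g) : MemL2Surf (hull F) g :=
  hg.mono_measure (Measure.restrict_mono'
    (hull_ae_le_part P.partR hd (mem_facesR.1 hF).1 (mem_facesR.1 hF).2) le_rfl)

lemma isTrace_ΓR (T : Mesh P) (hd : 1 ≤ d) (hv : v ∈ P.V) :
    IsTrace P.Ω P.ΓR v (trace P.Ω P.ΓR v) := by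
  obtain ⟨t, ht, -⟩ := exists_isTrace (T := T) hd P.partD.subset_frontier hv
  have hS : P.ΓR ⊆ T.skeleton := P.partR.subset_frontier.trans (frontier_subset_skeleton T hd)
  exact isTrace_trace (ht.mono P.isPolytopal.isOpen P.isPolytopal.isOpen subset_rfl
    (LE.le.eventuallyLE hS) hv.1)

lemma memL2Surf_trace (T : Mesh P) (hd : 1 ≤ d) (hv : v ∈ P.V) :
    MemL2Surf P.ΓR (trace P.Ω P.ΓR v) :=
  (T.isTrace_ΓR hd hv).1

lemma trace_ΓR_linear (T : Mesh P) (hd : 1 ≤ d) (hv : v ∈ P.V) (hw : w ∈ P.V) (c : ℂ) :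
    trace P.Ω P.ΓR (v + c • w) =ᵐ[(surf d).restrict P.ΓR]
      trace P.Ω P.ΓR v + c • trace P.Ω P.ΓR w := by
  have hΩ := P.isPolytopal.isOpen
  exact (tracePair_of_subset T hd P.partR.subset_frontier).trace_ae_eq
    (hv.1.add (hw.1.smul c)) ((T.isTrace_ΓR hd hv).add hΩ hv.1 (hw.1.smul c)
      ((T.isTrace_ΓR hd hw).smul hΩ c hw.1))

lemma trace_ΓR_star (T : Mesh P) (hd : 1 ≤ d) (hv : v ∈ P.V) :
    trace P.Ω P.ΓR (star v) =ᵐ[(surf d).restrict P.ΓR] star (trace P.Ω P.ΓR v) :=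
  (tracePair_of_subset T hd P.partR.subset_frontier).trace_ae_eq hv.1.star
    ((T.isTrace_ΓR hd hv).star P.isPolytopal.isOpen hv.1)

end Mesh

/-! ### The adjoint problem -/

/-- `ξ` solves the adjoint problem with right-hand sides `ψ ∈ L²(Ω)` and `Ψ ∈ L²(Γ_R)`. -/
structure Problem.IsDual (P : Problem d) (ψ Ψ ξ : Scal d) : Prop where
  memL2 : MemL2 P.Ω ψ
  memL2Surf : MemL2Surf P.ΓR Ψ
  mem : ξ ∈ P.V
  eq : ∀ w ∈ P.V, P.b w ξ = (∫ x in P.Ω, (P.μ x : ℂ) * w x * conj (ψ x)) +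
    ∫ x in P.ΓR, (P.γ x : ℂ) * trace P.Ω P.ΓR w x * conj (Ψ x) ∂(surf d)

/-- The divergence of the flux of the solution of the adjoint problem. -/
def Problem.dualDiv (P : Problem d) (ψ ξ : Scal d) : Scal d :=
  fun x => -((P.om : ℂ) ^ 2 * (P.μ x * ξ x) + P.μ x * ψ x)

/-- The normal trace of the flux of the solution of the adjoint problem. -/
def Problem.dualTrace (P : Problem d) (Ψ ξ : Scal d) : Scal d :=
  fun x => P.γ x * Ψ x - Complex.I * P.om * (P.γ x * trace P.Ω P.ΓR ξ x)

lemma IsTest.mem_H1zero {U O Γ : Set (E d)} (hU : IsOpen U) (hb : Bornology.IsBounded U)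
    {φ : Scal d} (hφ : IsTest O φ) (hΓ : MeasurableSet Γ) (hO : Disjoint O Γ) :
    φ ∈ H1zero U Γ := by
  have h0 : (0 : Scal d) =ᵐ[(surf d).restrict Γ] φ := by
    filter_upwards [ae_restrict_mem hΓ] with x hx
    exact (hφ.eq_zero (Set.disjoint_right.1 hO hx)).symm
  have h1 : MemL2Surf Γ φ := (memLp_congr_ae h0).1 MemLp.zero
  have h2 := memH1_of_contDiff hb hφ.1
  exact ⟨h2, (isTrace_of_contDiff hU hb hφ.1 h1).congr hU h2 (ae_eq_refl _) h0.symm⟩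

namespace Mesh

variable {P : Problem d} {p : ℕ} {ψ Ψ ξ v w : Scal d}

lemma memL2Vec_flux (T : Mesh P) (hξ : MemH1 P.Ω ξ) : MemL2Vec P.Ω (P.flux ξ) :=
  T.memL2Vec_A hξ.wgrad_spec.1

lemma memL2_dualDiv (T : Mesh P) (h : P.IsDual ψ Ψ ξ) : MemL2 P.Ω (P.dualDiv ψ ξ) :=
  MemLp.neg (((T.isWeight_μ.memLp_mul h.mem.1.1).const_mul _).add (T.isWeight_μ.memLp_mul h.memL2))

lemma memL2Surf_dualTrace (T : Mesh P) (hd : 1 ≤ d) (h : P.IsDual ψ Ψ ξ) :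
    MemL2Surf P.ΓR (P.dualTrace Ψ ξ) :=
  MemLp.sub ((T.isWeight_γ hd).memLp_mul h.memL2Surf)
    (((T.isWeight_γ hd).memLp_mul (T.memL2Surf_trace hd h.mem)).const_mul _)

/-- This is the adjoint equation tested with the conjugate of `φ` and then conjugated. Weak
divergences and normal traces are defined by pairings that are bilinear, while `b` is sesquilinear.
-/
lemma dual_green (T : Mesh P) (hd : 1 ≤ d) (h : P.IsDual ψ Ψ ξ) {φ : Scal d} (hφ : φ ∈ P.V) :
    (∫ x in P.Ω, P.flux ξ x ⬝ᵥ wgrad P.Ω φ x) + (∫ x in P.Ω, P.dualDiv ψ ξ x * φ x) =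
      ∫ x in P.ΓR, P.dualTrace Ψ ξ x * trace P.Ω P.ΓR φ x ∂(surf d) := by
  have hΩ := P.isPolytopal.isOpen
  have hμ := T.isWeight_μ
  have hγ := T.isWeight_γ hd
  have hφt := T.memL2Surf_trace hd hφ
  have hξt := T.memL2Surf_trace hd h.mem
  have key := h.eq _ (H1zero_star hΩ hφ)
  set tφ := trace P.Ω P.ΓR φ with htφ
  set tξ := trace P.Ω P.ΓR ξ with htξ
  set I₁ := ∫ x in P.Ω, (P.μ x : ℂ) * ξ x * φ x with hI₁
  set I₂ := ∫ x in P.ΓR, (P.γ x : ℂ) * tξ x * tφ x ∂(surf d) with hI₂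
  set I₃ := ∫ x in P.Ω, P.flux ξ x ⬝ᵥ wgrad P.Ω φ x with hI₃
  set J₁ := ∫ x in P.Ω, (P.μ x : ℂ) * ψ x * φ x with hJ₁
  set J₂ := ∫ x in P.ΓR, (P.γ x : ℂ) * Ψ x * tφ x ∂(surf d) with hJ₂
  have hV : ∀ f : Scal d, ∫ x in P.Ω, (P.μ x : ℂ) * star φ x * conj (f x) =
      conj (∫ x in P.Ω, (P.μ x : ℂ) * f x * φ x) := by
    intro f
    rw [← integral_conj]
    refine integral_congr_ae (Eventually.of_forall fun x => ?_)
    simp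
    ring
  have hS : ∀ f : Scal d, ∫ x in P.ΓR, (P.γ x : ℂ) * trace P.Ω P.ΓR (star φ) x * conj (f x) ∂(surf d) =
      conj (∫ x in P.ΓR, (P.γ x : ℂ) * f x * tφ x ∂(surf d)) := by
    intro f
    rw [← integral_conj]
    refine integral_congr_ae ?_
    filter_upwards [T.trace_ΓR_star hd hφ] with x hx
    rw [hx]
    simp [htφ]
    ring
  have hA : ∫ x in P.Ω, herm (P.A x) (wgrad P.Ω (star φ) x) (wgrad P.Ω ξ x) = conj I₃ := by
    rw [hI₃, ← integral_conj]
    refine integral_congr_ae ?_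
    filter_upwards [hφ.1.wgrad_star hΩ, T.ae_A_posDef] with x h1 h2
    rw [h1, herm_eq_dot h2, dotProduct_comm]
    simp [dotProduct, Problem.flux]
  rw [Problem.b, hV, hV, hS, hS, hA] at key
  have key' := congrArg conj key
  simp only [map_add, map_sub, map_neg, map_mul, map_pow, Complex.conj_conj, Complex.conj_I,
    Complex.conj_ofReal] at key'
  have hD : ∫ x in P.Ω, P.dualDiv ψ ξ x * φ x = -((P.om : ℂ) ^ 2 * I₁ + J₁) := by
    have e1 : Integrable (fun x => (P.μ x : ℂ) * ξ x * φ x) (volume.restrict P.Ω) :=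
      integrable_mul_of_memLp (hμ.memLp_mul h.mem.1.1) hφ.1.1
    have e2 : Integrable (fun x => (P.μ x : ℂ) * ψ x * φ x) (volume.restrict P.Ω) :=
      integrable_mul_of_memLp (hμ.memLp_mul h.memL2) hφ.1.1
    rw [hI₁, hJ₁, ← integral_const_mul, ← integral_add (e1.const_mul _) e2, ← integral_neg]
    refine integral_congr_ae (Eventually.of_forall fun x => ?_)
    simp only [Problem.dualDiv]
    ring
  have hG : ∫ x in P.ΓR, P.dualTrace Ψ ξ x * tφ x ∂(surf d) = J₂ - Complex.I * P.om * I₂ := by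
    have e1 : Integrable (fun x => (P.γ x : ℂ) * tξ x * tφ x) ((surf d).restrict P.ΓR) :=
      integrable_mul_of_memLp (hγ.memLp_mul hξt) hφt
    have e2 : Integrable (fun x => (P.γ x : ℂ) * Ψ x * tφ x) ((surf d).restrict P.ΓR) :=
      integrable_mul_of_memLp (hγ.memLp_mul h.memL2Surf) hφt
    rw [hI₂, hJ₂, ← integral_const_mul, ← integral_sub e2 (e1.const_mul _)]
    refine integral_congr_ae (Eventually.of_forall fun x => ?_)
    simp only [Problem.dualTrace]
    ring
  rw [hD, hG]
  linear_combination key'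

/-- Test functions of `Ω` belong to `V` and have zero trace on `Γ_R`, so the boundary term of
`dual_green` disappears. -/
lemma isWeakDiv_flux (T : Mesh P) (hd : 1 ≤ d) (h : P.IsDual ψ Ψ ξ) :
    IsWeakDiv P.Ω (P.flux ξ) (P.dualDiv ψ ξ) := by
  intro φ hφ
  have hΩ := P.isPolytopal.isOpen
  have hdisj : ∀ {Γ : Set (E d)}, Γ ⊆ frontier P.Ω → Disjoint P.Ω Γ := fun hΓ =>
    Set.disjoint_of_subset_right hΓ (Set.disjoint_iff_inter_eq_empty.2 (IsOpen.inter_frontier_eq hΩ))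
  have h1 : φ ∈ P.V := hφ.mem_H1zero hΩ T.isBounded P.partD.measurableSet
    (hdisj P.partD.subset_frontier)
  have h2 := hφ.mem_H1zero hΩ T.isBounded P.partR.measurableSet (hdisj P.partR.subset_frontier)
  have key := T.dual_green hd h h1
  have h3 : ∫ x in P.ΓR, P.dualTrace Ψ ξ x * trace P.Ω P.ΓR φ x ∂(surf d) = 0 := by
    refine integral_eq_zero_of_ae ?_
    filter_upwards [(tracePair_of_subset T hd P.partR.subset_frontier).trace_ae_eq h2.1 h2.2]
      with x hx
    simp [hx]
  have h4 : ∫ x in P.Ω, P.flux ξ x ⬝ᵥ wgrad P.Ω φ x = ∫ x in P.Ω, P.flux ξ x ⬝ᵥ cgrad φ x := by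
    refine integral_congr_ae ?_
    filter_upwards [wgrad_of_contDiff hΩ T.isBounded hφ.1] with x hx
    rw [hx]
  rw [h3, h4] at key
  exact eq_neg_of_add_eq_zero_left key

lemma memHdiv_flux (T : Mesh P) (hd : 1 ≤ d) (h : P.IsDual ψ Ψ ξ) : MemHdiv P.Ω (P.flux ξ) :=
  ⟨T.memL2Vec_flux h.mem.1, _, T.memL2_dualDiv h, T.isWeakDiv_flux hd h⟩

lemma wdiv_flux (T : Mesh P) (hd : 1 ≤ d) (h : P.IsDual ψ Ψ ξ) :
    wdiv P.Ω (P.flux ξ) =ᵐ[volume.restrict P.Ω] P.dualDiv ψ ξ :=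
  wdiv_eq P.isPolytopal.isOpen (T.memL2_dualDiv h) (T.isWeakDiv_flux hd h)

/-- The functions against which the normal trace on `Γ_R` is tested vanish on the rest of the
boundary, in particular on `Γ_D`. They are thus in `V`, and `dual_green` applies to them. -/
lemma isNormalTrace_flux (T : Mesh P) (hd : 1 ≤ d) (h : P.IsDual ψ Ψ ξ) :
    IsNormalTrace P.Ω P.ΓR (P.flux ξ) (P.dualTrace Ψ ξ) := by
  refine ⟨T.memL2Surf_dualTrace hd h, fun φ hφ => ?_⟩
  have h1 : φ ∈ P.V := H1zero_mono P.isPolytopal.isOpen (Set.subset_sdiff.2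
    ⟨P.partD.subset_frontier, P.disjDR⟩) hφ
  rw [← T.dual_green hd h h1]
  congr 1
  refine integral_congr_ae ?_
  filter_upwards [T.wdiv_flux hd h] with x hx
  rw [hx]

/-- Smooth functions supported away from the closed set `frontier Ω \ Γ` are admissible tests, and
they suffice to separate functions on `Γ`. -/
lemma isNormalTrace_unique (T : Mesh P) (hd : 1 ≤ d) {Γ : Set (E d)} (hΓ : IsPolytopalPart P.Ω Γ)
    {z : Vect d} {g g' : Scal d} (hg : IsNormalTrace P.Ω Γ z g) (hg' : IsNormalTrace P.Ω Γ z g') :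
    g =ᵐ[(surf d).restrict Γ] g' := by
  have hfin : IsFiniteMeasure ((surf d).restrict Γ) :=
    isFiniteMeasure_restrict.2 (tracePair_of_subset T hd hΓ.subset_frontier).fin.ne
  have hTP := tracePair_of_subset T hd hΓ.subset_frontier
  have key := ae_eq_zero_of_forall_test hΓ.isClosed_diff.isOpen_compl
    (m := (surf d).restrict Γ) (((MemLp.sub hg.1 hg'.1).integrable (by norm_num)).locallyIntegrable)
    fun φ hφ => by
      have h1 : φ ∈ H1zero P.Ω (frontier P.Ω \ Γ) := hφ.mem_H1zero P.isPolytopal.isOpen T.isBounded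
        hΓ.isClosed_diff.measurableSet disjoint_compl_left
      have h2 := (hg.2 φ h1).symm.trans (hg'.2 φ h1)
      have h3 : ∀ f : Scal d, ∫ x in Γ, f x * trace P.Ω Γ φ x ∂(surf d) =
          ∫ x in Γ, f x * φ x ∂(surf d) := by
        intro f
        refine integral_congr_ae ?_
        filter_upwards [hTP.trace_ae_eq h1.1 (isTrace_of_contDiff P.isPolytopal.isOpen T.isBounded
          hφ.1 (hTP.memL2Surf hφ.1))] with x hx
        rw [hx]
      rw [h3, h3] at h2
      have hφΓ := hTP.memL2Surf hφ.1
      simp only [Pi.sub_apply, sub_mul]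
      rw [integral_sub (integrable_mul_of_memLp hg.1 hφΓ) (integrable_mul_of_memLp hg'.1 hφΓ), h2,
        sub_self]
  filter_upwards [key, ae_restrict_mem hΓ.measurableSet] with x h1 h2
  exact sub_eq_zero.1 (h1 fun h => h.2 h2)

lemma wdiv_sub {z z' : Vect d} (hz : MemHdiv P.Ω z) (hz' : MemHdiv P.Ω z') :
    MemHdiv P.Ω (z - z') ∧
      wdiv P.Ω (z - z') =ᵐ[volume.restrict P.Ω] wdiv P.Ω z - wdiv P.Ω z' := by
  have h1 := IsWeakDiv.sub hz.1 hz'.1 hz.wdiv_spec.1 hz'.wdiv_spec.1 hz.wdiv_spec.2 hz'.wdiv_spec.2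
  have h2 : MemL2 P.Ω (wdiv P.Ω z - wdiv P.Ω z') := MemLp.sub hz.wdiv_spec.1 hz'.wdiv_spec.1
  exact ⟨⟨hz.1.sub hz'.1, _, h2, h1⟩, wdiv_eq P.isPolytopal.isOpen h2 h1⟩

lemma isNormalTrace_sub (T : Mesh P) (hd : 1 ≤ d) {z z' : Vect d} (hz : MemHdiv P.Ω z)
    (hz' : MemHdiv P.Ω z') {Γ : Set (E d)} (hΓ : IsPolytopalPart P.Ω Γ) {g g' : Scal d}
    (hg : IsNormalTrace P.Ω Γ z g) (hg' : IsNormalTrace P.Ω Γ z' g') :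
    IsNormalTrace P.Ω Γ (z - z') (g - g') := by
  refine ⟨MemLp.sub hg.1 hg'.1, fun φ hφ => ?_⟩
  have h1 := hg.2 φ hφ
  have h2 := hg'.2 φ hφ
  obtain ⟨t, ht, -⟩ := exists_isTrace (T := T) hd Set.sdiff_subset hφ
  have htr : MemL2Surf Γ (trace P.Ω Γ φ) := (isTrace_trace (ht.mono P.isPolytopal.isOpen
    P.isPolytopal.isOpen subset_rfl (LE.le.eventuallyLE
      (hΓ.subset_frontier.trans (frontier_subset_skeleton T hd))) hφ.1)).1
  have h3 : ∫ x in P.Ω, wdiv P.Ω (z - z') x * φ x =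
      ∫ x in P.Ω, (wdiv P.Ω z x * φ x - wdiv P.Ω z' x * φ x) := by
    refine integral_congr_ae ?_
    filter_upwards [(wdiv_sub hz hz').2] with x hx
    rw [hx, Pi.sub_apply, sub_mul]
  rw [h3]
  simp only [Pi.sub_apply, sub_mul, sub_dotProduct]
  rw [integral_sub (integrable_dot hz.1 hφ.1.memL2_wgrad) (integrable_dot hz'.1 hφ.1.memL2_wgrad),
    integral_sub (integrable_mul_of_memLp hz.wdiv_spec.1 hφ.1.1)
      (integrable_mul_of_memLp hz'.wdiv_spec.1 hφ.1.1),
    integral_sub (integrable_mul_of_memLp hg.1 htr) (integrable_mul_of_memLp hg'.1 htr), ← h1, ← h2]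
  ring

lemma normalTrace_ae_eq (T : Mesh P) (hd : 1 ≤ d) {Γ : Set (E d)} (hΓ : IsPolytopalPart P.Ω Γ)
    {z : Vect d} {g : Scal d} (hg : IsNormalTrace P.Ω Γ z g) :
    normalTrace P.Ω Γ z =ᵐ[(surf d).restrict Γ] g := by
  have h : ∃ g, IsNormalTrace P.Ω Γ z g := ⟨g, hg⟩
  rw [normalTrace, dif_pos h]
  exact T.isNormalTrace_unique hd hΓ h.choose_spec hg

/-! The residual of the adjoint problem -/

/-- The form `b_h` without stabilization. -/
def bh₀ (T : Mesh P) (p : ℕ) (φ v : Scal d) : ℂ :=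
  -(P.om : ℂ) ^ 2 * (∫ x in P.Ω, (P.μ x : ℂ) * φ x * conj (v x))
  - Complex.I * (P.om : ℂ) *
      (∑ F ∈ T.facesR, ∫ x in hull F, (P.γ x : ℂ) * faceTrace (T.cellOf F) F φ x *
        conj (faceTrace (T.cellOf F) F v x) ∂(surf d))
  + ∫ x in P.Ω, herm (P.A x) (T.𝔊 p φ x) (T.𝔊 p v x)

/-- The right-hand side of the adjoint problem on broken functions. -/
def dualRhs (T : Mesh P) (ψ Ψ w : Scal d) : ℂ :=
  (∫ x in P.Ω, (P.μ x : ℂ) * w x * conj (ψ x)) +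
    ∑ F ∈ T.facesR, ∫ x in hull F,
      (P.γ x : ℂ) * faceTrace (T.cellOf F) F w x * conj (Ψ x) ∂(surf d)

variable {T : Mesh P}

lemma memL2Surf_faceTrace (hd : 1 ≤ d) {F : Finset (E d)} (hF : F ∈ T.facesR)
    (hw : T.IsBroken w) : MemL2Surf (hull F) (faceTrace (T.cellOf F) F w) :=
  (hw.isTrace hd (cellOf_spec (mem_facesR.1 hF).1).1 (mem_facesR.1 hF).1
    (cellOf_spec (mem_facesR.1 hF).1).2).1

/-- This is algebra alone: `dualDiv` and `dualTrace` collect the zeroth-order and boundary terms of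
the adjoint problem. No integration by parts takes place, which is why `w` may be discontinuous. -/
lemma residual_eq (hd : 1 ≤ d) (h : P.IsDual ψ Ψ ξ) (hw : T.IsBroken w) :
    T.bh₀ p w ξ - T.dualRhs ψ Ψ w =
      (∫ x in P.Ω, (T.𝔊 p w x ⬝ᵥ star (P.flux ξ x) + w x * conj (P.dualDiv ψ ξ x))) -
      ∑ F ∈ T.facesR, ∫ x in hull F,
        faceTrace (T.cellOf F) F w x * conj (P.dualTrace Ψ ξ x) ∂(surf d) := by
  have hμ := T.isWeight_μ
  have h1 : ∫ x in P.Ω, herm (P.A x) (T.𝔊 p w x) (T.𝔊 p ξ x) =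
      ∫ x in P.Ω, T.𝔊 p w x ⬝ᵥ star (P.flux ξ x) := by
    refine integral_congr_ae ?_
    filter_upwards [𝔊_of_V (T := T) (p := p) hd h.mem, T.ae_A_posDef] with x hx hA
    rw [hx, herm_eq_dot hA]
    rfl
  have e1 : Integrable (fun x => (P.μ x : ℂ) * w x * conj (ξ x)) (volume.restrict P.Ω) :=
    hμ.integrable_mul hw.memL2 h.mem.1.1
  have e2 : Integrable (fun x => (P.μ x : ℂ) * w x * conj (ψ x)) (volume.restrict P.Ω) :=
    hμ.integrable_mul hw.memL2 h.memL2
  have h2 : ∫ x in P.Ω, w x * conj (P.dualDiv ψ ξ x) =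
      -((P.om : ℂ) ^ 2 * (∫ x in P.Ω, (P.μ x : ℂ) * w x * conj (ξ x)) +
        ∫ x in P.Ω, (P.μ x : ℂ) * w x * conj (ψ x)) := by
    rw [← integral_const_mul, ← integral_add (e1.const_mul _) e2, ← integral_neg]
    refine integral_congr_ae (Eventually.of_forall fun x => ?_)
    simp [Problem.dualDiv]
    ring
  have h3 : ∀ F ∈ T.facesR, ∫ x in hull F,
      faceTrace (T.cellOf F) F w x * conj (P.dualTrace Ψ ξ x) ∂(surf d) =
      (∫ x in hull F, (P.γ x : ℂ) * faceTrace (T.cellOf F) F w x * conj (Ψ x) ∂(surf d)) +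
      Complex.I * P.om * ∫ x in hull F, (P.γ x : ℂ) * faceTrace (T.cellOf F) F w x *
        conj (faceTrace (T.cellOf F) F ξ x) ∂(surf d) := by
    intro F hF
    have hγ := isWeight_γF hd hF
    rw [← integral_const_mul, ← integral_add (hγ.integrable_mul (memL2Surf_faceTrace hd hF hw)
        (T.memL2Surf_hull_of_ΓR hd hF h.memL2Surf))
      ((hγ.integrable_mul (memL2Surf_faceTrace hd hF hw)
        (memL2Surf_faceTrace hd hF (isBroken_of_V h.mem))).const_mul _)]
    refine integral_congr_ae ?_
    filter_upwards [trace_hull_R hd hF h.mem] with x hx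
    rw [hx]
    simp [Problem.dualTrace]
    ring
  have h4 : ∫ x in P.Ω, (T.𝔊 p w x ⬝ᵥ star (P.flux ξ x) + w x * conj (P.dualDiv ψ ξ x)) =
      (∫ x in P.Ω, T.𝔊 p w x ⬝ᵥ star (P.flux ξ x)) + ∫ x in P.Ω, w x * conj (P.dualDiv ψ ξ x) :=
    integral_add (integrable_dot (memL2Vec_𝔊 hd hw) (T.memL2Vec_flux h.mem.1).star)
      (integrable_mul_of_memLp hw.memL2 (MemLp.star (T.memL2_dualDiv h)))
  rw [Finset.sum_congr rfl h3, Finset.sum_add_distrib, ← Finset.mul_sum, h4, h2, bh₀, dualRhs, h1]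
  ring

/-- The residual, expressed with the error of a piecewise polynomial approximation of the flux. -/
lemma residual_eq_sub (hd : 1 ≤ d) (h : P.IsDual ψ Ψ ξ) (hw : T.IsBroken w) {z : Vect d}
    (hz : z ∈ T.polyVec p ∩ P.XN) :
    MemHdiv P.Ω (P.flux ξ - z) ∧
    MemL2Surf P.ΓR (normalTrace P.Ω P.ΓR (P.flux ξ - z)) ∧
    T.bh₀ p w ξ - T.dualRhs ψ Ψ w =
      (∫ x in P.Ω, (T.𝔊 p w x ⬝ᵥ star ((P.flux ξ - z) x) +
        w x * conj (wdiv P.Ω (P.flux ξ - z) x))) -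
      ∑ F ∈ T.facesR, ∫ x in hull F, faceTrace (T.cellOf F) F w x *
        conj (normalTrace P.Ω P.ΓR (P.flux ξ - z) x) ∂(surf d) := by
  obtain ⟨hzp, hzd, hN, g, hg⟩ := hz
  have hfl := T.memHdiv_flux hd h
  have hsub := wdiv_sub hfl hzd
  have hnt := T.isNormalTrace_sub hd hfl hzd P.partR (T.isNormalTrace_flux hd h) hg
  have hnt' := T.normalTrace_ae_eq hd P.partR hnt
  refine ⟨hsub.1, (memLp_congr_ae hnt').2 hnt.1, ?_⟩
  have hG := memL2Vec_𝔊 (p := p) hd hw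
  -- For the piecewise polynomial field `z` the same combination of volume and Robin terms is zero,
  -- so it can be subtracted for free.
  have key := integral_𝔊_add_wdiv hd hzp hzd hN hg hw
  rw [residual_eq hd h hw]
  have e1 : ∫ x in P.Ω, (T.𝔊 p w x ⬝ᵥ star ((P.flux ξ - z) x) +
        w x * conj (wdiv P.Ω (P.flux ξ - z) x)) =
      (∫ x in P.Ω, (T.𝔊 p w x ⬝ᵥ star (P.flux ξ x) + w x * conj (P.dualDiv ψ ξ x))) -
      ∫ x in P.Ω, (T.𝔊 p w x ⬝ᵥ star (z x) + w x * conj (wdiv P.Ω z x)) := by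
    have a1 : Integrable (fun x => T.𝔊 p w x ⬝ᵥ star (P.flux ξ x) + w x * conj (P.dualDiv ψ ξ x))
        (volume.restrict P.Ω) := (integrable_dot hG hfl.1.star).add
          (integrable_mul_of_memLp hw.memL2 (MemLp.star (T.memL2_dualDiv h)))
    have a2 : Integrable (fun x => T.𝔊 p w x ⬝ᵥ star (z x) + w x * conj (wdiv P.Ω z x))
        (volume.restrict P.Ω) := (integrable_dot hG hzd.1.star).add
          (integrable_mul_of_memLp hw.memL2 (MemLp.star hzd.wdiv_spec.1))
    rw [← integral_sub a1 a2]
    refine integral_congr_ae ?_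
    filter_upwards [hsub.2, T.wdiv_flux hd h] with x h1 h2
    rw [h1, Pi.sub_apply, Pi.sub_apply, h2, star_sub, dotProduct_sub, map_sub]
    ring
  have e2 : ∑ F ∈ T.facesR, ∫ x in hull F, faceTrace (T.cellOf F) F w x *
        conj (normalTrace P.Ω P.ΓR (P.flux ξ - z) x) ∂(surf d) =
      (∑ F ∈ T.facesR, ∫ x in hull F,
        faceTrace (T.cellOf F) F w x * conj (P.dualTrace Ψ ξ x) ∂(surf d)) -
      ∑ F ∈ T.facesR, ∫ x in hull F, faceTrace (T.cellOf F) F w x * conj (g x) ∂(surf d) := by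
    rw [← Finset.sum_sub_distrib]
    refine Finset.sum_congr rfl fun F hF => ?_
    have ht := memL2Surf_faceTrace hd hF hw
    have a1 : Integrable (fun x => faceTrace (T.cellOf F) F w x * conj (P.dualTrace Ψ ξ x))
        ((surf d).restrict (hull F)) := integrable_mul_of_memLp ht
          (MemLp.star (T.memL2Surf_hull_of_ΓR hd hF (T.memL2Surf_dualTrace hd h)))
    have a2 : Integrable (fun x => faceTrace (T.cellOf F) F w x * conj (g x))
        ((surf d).restrict (hull F)) := integrable_mul_of_memLp ht
          (MemLp.star (T.memL2Surf_hull_of_ΓR hd hF hg.1))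
    rw [← integral_sub a1 a2]
    refine integral_congr_ae ?_
    filter_upwards [T.ae_hull_of_ΓR hd hF hnt'] with x hx
    rw [hx, Pi.sub_apply, map_sub]
    ring
  rw [e1, e2, key]
  ring

end Mesh

/-! ### Norms -/

namespace Mesh

variable {P : Problem d} {T : Mesh P} {p : ℕ} {ψ Ψ ξ v w : Scal d} {η : Vect d}

lemma αK_pos (hd : 1 ≤ d) {K : Finset (E d)} (hK : K ∈ T.cells) : 0 < αK P K :=
  minForm_pos hd (coeff_cell hK).2.1

lemma αF_pos (hd : 1 ≤ d) {F : Finset (E d)} (hF : F ∈ T.facesR) : 0 < T.αF F :=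
  αK_pos hd (cellOf_spec (mem_facesR.1 hF).1).1

lemma diam_cell_pos (hd : 1 ≤ d) {K : Finset (E d)} (hK : K ∈ T.cells) : 0 < diam K :=
  (isSimplex hK).diam_pos hd

/-- A face has `d` vertices, and two distinct ones are needed for a positive diameter. Here
dimension at least two enters; in dimension one a face would be a point, and the weights involving
`h_F` would degenerate. -/
lemma diam_face_pos (hd : 2 ≤ d) {F : Finset (E d)} (hF : F ∈ T.faces) : 0 < diam F := by
  have hc : 1 < F.card := by
    rw [(T.mem_faces.1 hF).2]
    omega
  obtain ⟨x, hx, y, hy, hxy⟩ := Finset.one_lt_card.1 hc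
  exact (dist_pos.2 hxy).trans_le (Metric.dist_le_diam_of_mem (isCompact_hull F).isBounded
    (subset_convexHull ℝ _ hx) (subset_convexHull ℝ _ hy))

lemma restrict_hull_le {K : Finset (E d)} (hK : K ∈ T.cells) :
    (volume : Measure (E d)).restrict (hull K) ≤ volume.restrict P.Ω := by
  rw [← ae_restrict_hull]
  exact Measure.restrict_mono (interior_hull_subset hK) le_rfl

lemma normμ_sq (T : Mesh P) (v : Scal d) : T.normμ v ^ 2 = ∫ x in P.Ω, P.μ x * ‖v x‖ ^ 2 :=
  Real.sq_sqrt (T.isWeight_μ.integral_sq_nonneg v)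

lemma sum_γ_nonneg (hd : 1 ≤ d) (v : Scal d) : 0 ≤ ∑ F ∈ T.facesR,
    ∫ x in hull F, P.γ x * ‖faceTrace (T.cellOf F) F v x‖ ^ 2 ∂(surf d) :=
  Finset.sum_nonneg fun _ hF => (isWeight_γF hd hF).integral_sq_nonneg _

lemma normγ_sq (hd : 1 ≤ d) (v : Scal d) : T.normγ v ^ 2 = ∑ F ∈ T.facesR,
    ∫ x in hull F, P.γ x * ‖faceTrace (T.cellOf F) F v x‖ ^ 2 ∂(surf d) :=
  Real.sq_sqrt (sum_γ_nonneg hd v)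

/-- As `ϑ_K² = α_K / μ_K`, the second entry of the maximum turns the weight into exactly `ω² μ_K`.
-/
lemma le_max_mul_cell (hd : 1 ≤ d) {K : Finset (E d)} (hK : K ∈ T.cells) :
    P.om ^ 2 * μK P K ≤
      max 1 (P.om ^ 2 * diam K ^ 2 / ϑK P K ^ 2) * (αK P K / diam K ^ 2) := by
  have hα := αK_pos hd hK
  have hμ := (coeff_cell hK).1.1
  have hh := diam_cell_pos hd hK
  refine le_trans (le_of_eq ?_) (mul_le_mul_of_nonneg_right (le_max_right _ _) (by positivity))
  rw [ϑK, Real.sq_sqrt (by positivity)]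
  field_simp

lemma le_max_mul_face (hd : 2 ≤ d) {F : Finset (E d)} (hF : F ∈ T.facesR) :
    P.om * γF P F ≤ max 1 (P.om * diam F / T.ϑF F) * (T.αF F / diam F) := by
  have hd' : 1 ≤ d := by omega
  have hα := αF_pos hd' hF
  have hγ := (coeff_face hd' hF).1
  have hh := diam_face_pos hd (mem_facesR.1 hF).1
  refine le_trans (le_of_eq ?_) (mul_le_mul_of_nonneg_right (le_max_right _ _) (by positivity))
  rw [ϑF]
  field_simp

/-- The energy norm is controlled by `‖·‖_{†,1}`. -/
lemma energy_le_dagger1 (hd : 2 ≤ d) (hv : T.IsBroken v) : T.energy p v ≤ T.dagger1 p v := by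
  have hd' : 1 ≤ d := by omega
  refine Real.sqrt_le_sqrt ?_
  have hμ := T.isWeight_μ
  rw [normμ_sq, normγ_sq hd', integral_Ω_real (T := T) (hμ.integrable_sq hv.memL2),
    integral_Ω_real (T := T) (T.integrable_herm_self (memL2Vec_𝔊 hd' hv)), Finset.mul_sum,
    Finset.mul_sum, Finset.sum_add_distrib]
  have h1 : ∀ K ∈ T.cells, P.om ^ 2 * ∫ x in hull K, P.μ x * ‖v x‖ ^ 2 ≤
      max 1 (P.om ^ 2 * diam K ^ 2 / ϑK P K ^ 2) * (αK P K / diam K ^ 2) *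
        (∫ x in hull K, ‖v x‖ ^ 2) := by
    intro K hK
    have : ∫ x in hull K, P.μ x * ‖v x‖ ^ 2 = μK P K * ∫ x in hull K, ‖v x‖ ^ 2 := by
      rw [← integral_const_mul, ← ae_restrict_hull]
      refine integral_congr_ae ?_
      filter_upwards [ae_restrict_mem isOpen_interior.measurableSet] with x hx
      rw [(coeff_cell hK).1.2 x hx]
    rw [this, ← mul_assoc]
    exact mul_le_mul_of_nonneg_right (le_max_mul_cell hd' hK)
      (integral_nonneg fun x => sq_nonneg _)
  have h2 : ∀ F ∈ T.facesR, P.om * ∫ x in hull F, P.γ x * ‖faceTrace (T.cellOf F) F v x‖ ^ 2 ∂(surf d)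
      ≤ max 1 (P.om * diam F / T.ϑF F) * (T.αF F / diam F) *
        ∫ x in hull F, ‖faceTrace (T.cellOf F) F v x‖ ^ 2 ∂(surf d) := by
    intro F hF
    have : ∫ x in hull F, P.γ x * ‖faceTrace (T.cellOf F) F v x‖ ^ 2 ∂(surf d) =
        γF P F * ∫ x in hull F, ‖faceTrace (T.cellOf F) F v x‖ ^ 2 ∂(surf d) := by
      rw [← integral_const_mul]
      refine integral_congr_ae ?_
      filter_upwards [(coeff_face hd' hF).2] with x hx
      rw [hx]
    rw [this, ← mul_assoc]
    exact mul_le_mul_of_nonneg_right (le_max_mul_face hd hF) (integral_nonneg fun x => sq_nonneg _)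
  have := Finset.sum_le_sum h1
  have := Finset.sum_le_sum h2
  linarith

lemma sqrt_mul_sqrt_of_mul {c a b : ℝ} (hc : 0 < c) : c * (√a * √b) = √(c * a) * √(c * b) := by
  rw [Real.sqrt_mul hc.le, Real.sqrt_mul hc.le]
  conv_lhs => rw [← Real.mul_self_sqrt hc.le]
  ring

/-- Continuity of the Helmholtz form in the energy norm. -/
lemma norm_bh₀_le (hd : 1 ≤ d) (hw : T.IsBroken w) (hv : T.IsBroken v) :
    ‖T.bh₀ p w v‖ ≤ T.energy p w * T.energy p v := by
  have hom := P.om_pos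
  have hμ := T.isWeight_μ
  have h1 : ‖-(P.om : ℂ) ^ 2 * (∫ x in P.Ω, (P.μ x : ℂ) * w x * conj (v x))‖ ≤
      √(P.om ^ 2 * T.normμ w ^ 2) * √(P.om ^ 2 * T.normμ v ^ 2) := by
    rw [norm_mul, norm_neg, norm_pow, Complex.norm_real, Real.norm_of_nonneg hom.le, normμ_sq,
      normμ_sq, ← sqrt_mul_sqrt_of_mul (by positivity)]
    gcongr
    exact hμ.norm_integral_le hw.memL2 hv.memL2
  have h2 : ‖-(Complex.I * (P.om : ℂ) *
      (∑ F ∈ T.facesR, ∫ x in hull F, (P.γ x : ℂ) * faceTrace (T.cellOf F) F w x *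
        conj (faceTrace (T.cellOf F) F v x) ∂(surf d)))‖ ≤
      √(P.om * T.normγ w ^ 2) * √(P.om * T.normγ v ^ 2) := by
    rw [norm_neg, norm_mul, norm_mul, Complex.norm_I, one_mul, Complex.norm_real,
      Real.norm_of_nonneg hom.le, normγ_sq hd, normγ_sq hd, ← sqrt_mul_sqrt_of_mul hom]
    gcongr
    exact norm_sum_le_sqrt _ (fun F hF => (isWeight_γF hd hF).integral_sq_nonneg _)
      (fun F hF => (isWeight_γF hd hF).integral_sq_nonneg _) fun F hF =>
      (isWeight_γF hd hF).norm_integral_le (memL2Surf_faceTrace hd hF hw)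
        (memL2Surf_faceTrace hd hF hv)
  have h3 := T.norm_integral_herm_le (memL2Vec_𝔊 (p := p) hd hw) (memL2Vec_𝔊 (p := p) hd hv)
  have := norm_add_le_sqrt (by positivity) (by positivity) (T.integral_herm_nonneg _)
    (T.integral_herm_nonneg _) (norm_add_le_sqrt (by positivity) (by positivity) (by positivity)
      (by positivity) h1 h2) h3
  rw [bh₀, sub_eq_add_neg]
  exact this

lemma bh₀_linear (hd : 1 ≤ d) (hv : T.IsBroken v) (hw : T.IsBroken w) (hξ : T.IsBroken ξ) (c : ℂ) :
    T.bh₀ p (v + c • w) ξ = T.bh₀ p v ξ + c * T.bh₀ p w ξ := by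
  have hμ := T.isWeight_μ
  have h1 : ∫ x in P.Ω, (P.μ x : ℂ) * (v + c • w) x * conj (ξ x) =
      (∫ x in P.Ω, (P.μ x : ℂ) * v x * conj (ξ x)) +
        c * ∫ x in P.Ω, (P.μ x : ℂ) * w x * conj (ξ x) := by
    rw [← integral_const_mul, ← integral_add (hμ.integrable_mul hv.memL2 hξ.memL2)
      ((hμ.integrable_mul hw.memL2 hξ.memL2).const_mul _)]
    refine integral_congr_ae (Eventually.of_forall fun x => ?_)
    simp
    ring
  have h2 : ∀ F ∈ T.facesR, ∫ x in hull F, (P.γ x : ℂ) * faceTrace (T.cellOf F) F (v + c • w) x *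
        conj (faceTrace (T.cellOf F) F ξ x) ∂(surf d) =
      (∫ x in hull F, (P.γ x : ℂ) * faceTrace (T.cellOf F) F v x *
        conj (faceTrace (T.cellOf F) F ξ x) ∂(surf d)) +
      c * ∫ x in hull F, (P.γ x : ℂ) * faceTrace (T.cellOf F) F w x *
        conj (faceTrace (T.cellOf F) F ξ x) ∂(surf d) := by
    intro F hF
    have hγ := isWeight_γF hd hF
    have hF' := (mem_facesR.1 hF).1
    have hcF := cellOf_spec hF'
    rw [← integral_const_mul, ← integral_add
      (hγ.integrable_mul (memL2Surf_faceTrace hd hF hv) (memL2Surf_faceTrace hd hF hξ))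
      ((hγ.integrable_mul (memL2Surf_faceTrace hd hF hw) (memL2Surf_faceTrace hd hF hξ)).const_mul _)]
    refine integral_congr_ae ?_
    filter_upwards [faceTrace_add hd hcF.1 hF' hcF.2 hv (hw.smul c),
      faceTrace_smul hd hcF.1 hF' hcF.2 c hw] with x a1 a2
    rw [a1, Pi.add_apply, a2, Pi.smul_apply, smul_eq_mul]
    ring
  have h3 : ∫ x in P.Ω, herm (P.A x) (T.𝔊 p (v + c • w) x) (T.𝔊 p ξ x) =
      (∫ x in P.Ω, herm (P.A x) (T.𝔊 p v x) (T.𝔊 p ξ x)) +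
        c * ∫ x in P.Ω, herm (P.A x) (T.𝔊 p w x) (T.𝔊 p ξ x) := by
    rw [← integral_const_mul, ← integral_add
      (T.integrable_herm (memL2Vec_𝔊 hd hv) (memL2Vec_𝔊 hd hξ))
      ((T.integrable_herm (memL2Vec_𝔊 hd hw) (memL2Vec_𝔊 hd hξ)).const_mul _)]
    refine integral_congr_ae ?_
    filter_upwards [𝔊_linear (p := p) hd hv hw c] with x hx
    rw [hx, herm, Matrix.mulVec_add, Matrix.mulVec_smul, add_dotProduct, smul_dotProduct]
    rfl
  rw [bh₀, h1, Finset.sum_congr rfl h2, h3, Finset.sum_add_distrib, ← Finset.mul_sum, bh₀, bh₀]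
  ring

lemma bh₀_sub_right (hd : 1 ≤ d) (hv : T.IsBroken v) (hw : T.IsBroken w) (hξ : T.IsBroken ξ) :
    T.bh₀ p ξ (v - w) = T.bh₀ p ξ v - T.bh₀ p ξ w := by
  have hμ := T.isWeight_μ
  have e : v - w = v + (-1 : ℂ) • w := by rw [neg_one_smul, sub_eq_add_neg]
  have h1 : ∫ x in P.Ω, (P.μ x : ℂ) * ξ x * conj ((v - w) x) =
      (∫ x in P.Ω, (P.μ x : ℂ) * ξ x * conj (v x)) - ∫ x in P.Ω, (P.μ x : ℂ) * ξ x * conj (w x) := by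
    rw [← integral_sub (hμ.integrable_mul hξ.memL2 hv.memL2) (hμ.integrable_mul hξ.memL2 hw.memL2)]
    refine integral_congr_ae (Eventually.of_forall fun x => ?_)
    simp
    ring
  have h2 : ∀ F ∈ T.facesR, ∫ x in hull F, (P.γ x : ℂ) * faceTrace (T.cellOf F) F ξ x *
        conj (faceTrace (T.cellOf F) F (v - w) x) ∂(surf d) =
      (∫ x in hull F, (P.γ x : ℂ) * faceTrace (T.cellOf F) F ξ x *
        conj (faceTrace (T.cellOf F) F v x) ∂(surf d)) -
      ∫ x in hull F, (P.γ x : ℂ) * faceTrace (T.cellOf F) F ξ x *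
        conj (faceTrace (T.cellOf F) F w x) ∂(surf d) := by
    intro F hF
    have hγ := isWeight_γF hd hF
    have hF' := (mem_facesR.1 hF).1
    have hcF := cellOf_spec hF'
    rw [← integral_sub
      (hγ.integrable_mul (memL2Surf_faceTrace hd hF hξ) (memL2Surf_faceTrace hd hF hv))
      (hγ.integrable_mul (memL2Surf_faceTrace hd hF hξ) (memL2Surf_faceTrace hd hF hw))]
    refine integral_congr_ae ?_
    rw [e]
    filter_upwards [faceTrace_add hd hcF.1 hF' hcF.2 hv (hw.smul (-1)),
      faceTrace_smul hd hcF.1 hF' hcF.2 (-1) hw] with x a1 a2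
    rw [a1, Pi.add_apply, a2, Pi.smul_apply, smul_eq_mul, map_add, map_mul, map_neg, map_one]
    ring
  have h3 : ∫ x in P.Ω, herm (P.A x) (T.𝔊 p ξ x) (T.𝔊 p (v - w) x) =
      (∫ x in P.Ω, herm (P.A x) (T.𝔊 p ξ x) (T.𝔊 p v x)) -
        ∫ x in P.Ω, herm (P.A x) (T.𝔊 p ξ x) (T.𝔊 p w x) := by
    rw [← integral_sub
      (T.integrable_herm (memL2Vec_𝔊 hd hξ) (memL2Vec_𝔊 hd hv))
      (T.integrable_herm (memL2Vec_𝔊 hd hξ) (memL2Vec_𝔊 hd hw))]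
    refine integral_congr_ae ?_
    rw [e]
    filter_upwards [𝔊_linear (p := p) hd hv hw (-1)] with x hx
    rw [hx, neg_one_smul, ← sub_eq_add_neg, herm, star_sub, dotProduct_sub]
    rfl
  rw [bh₀, h1, Finset.sum_congr rfl h2, h3, Finset.sum_sub_distrib, bh₀, bh₀]
  ring

lemma bh₀_of_V (hd : 1 ≤ d) (hw : w ∈ P.V) (hv : v ∈ P.V) : T.bh₀ p w v = P.b w v := by
  have h1 : ∫ x in P.Ω, herm (P.A x) (T.𝔊 p w x) (T.𝔊 p v x) =
      ∫ x in P.Ω, herm (P.A x) (wgrad P.Ω w x) (wgrad P.Ω v x) := by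
    refine integral_congr_ae ?_
    filter_upwards [𝔊_of_V (T := T) (p := p) hd hw, 𝔊_of_V (T := T) (p := p) hd hv] with x a1 a2
    rw [a1, a2]
  have h2 : ∫ x in P.ΓR, (P.γ x : ℂ) * trace P.Ω P.ΓR w x * conj (trace P.Ω P.ΓR v x) ∂(surf d) =
      ∑ F ∈ T.facesR, ∫ x in hull F, (P.γ x : ℂ) * faceTrace (T.cellOf F) F w x *
        conj (faceTrace (T.cellOf F) F v x) ∂(surf d) := by
    rw [T.integral_ΓR hd ((T.isWeight_γ hd).integrable_mul (T.memL2Surf_trace hd hw)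
      (T.memL2Surf_trace hd hv))]
    refine Finset.sum_congr rfl fun F hF => integral_congr_ae ?_
    filter_upwards [trace_hull_R hd hF hw, trace_hull_R hd hF hv] with x a1 a2
    rw [a1, a2]
  rw [bh₀, h1, ← h2, Problem.b]

lemma dualRhs_of_V (hd : 1 ≤ d) (h : P.IsDual ψ Ψ ξ) (hw : w ∈ P.V) :
    T.dualRhs ψ Ψ w = P.b w ξ := by
  rw [dualRhs, h.eq w hw, T.integral_ΓR hd ((T.isWeight_γ hd).integrable_mul
    (T.memL2Surf_trace hd hw) h.memL2Surf)]
  congr 1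
  refine Finset.sum_congr rfl fun F hF => integral_congr_ae ?_
  filter_upwards [trace_hull_R hd hF hw] with x a1
  rw [a1]

lemma energy_of_V (hd : 1 ≤ d) (hv : v ∈ P.V) : T.energy p v = P.energy v := by
  have h1 : ∫ x in P.Ω, (herm (P.A x) (T.𝔊 p v x) (T.𝔊 p v x)).re =
      ∫ x in P.Ω, (herm (P.A x) (wgrad P.Ω v x) (wgrad P.Ω v x)).re := by
    refine integral_congr_ae ?_
    filter_upwards [𝔊_of_V (T := T) (p := p) hd hv] with x a1
    rw [a1]
  have h2 : ∫ x in P.ΓR, P.γ x * ‖trace P.Ω P.ΓR v x‖ ^ 2 ∂(surf d) =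
      ∑ F ∈ T.facesR, ∫ x in hull F, P.γ x * ‖faceTrace (T.cellOf F) F v x‖ ^ 2 ∂(surf d) := by
    rw [T.integral_ΓR hd ((T.isWeight_γ hd).integrable_sq (T.memL2Surf_trace hd hv))]
    refine Finset.sum_congr rfl fun F hF => integral_congr_ae ?_
    filter_upwards [trace_hull_R hd hF hv] with x a1
    rw [a1]
  rw [energy, Problem.energy, normμ_sq, normγ_sq hd, h1, h2]

/-- The duality argument uses only conforming test functions, against which the stabilization
vanishes. -/
lemma bh_eq {s : Scal d → Scal d → ℂ} (hs : T.IsStabilization s) (hw : T.IsBroken w)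
    (hv : v ∈ P.V) : T.bh p s w v = T.bh₀ p w v := by
  rw [bh, ah, hs.zero_right w hw.mem_H1 v hv, add_zero, bh₀]

/-- Cauchy–Schwarz inequality for the residual of the adjoint problem. -/
lemma norm_residual_le (hd : 2 ≤ d) (hw : T.IsBroken w) (hη : MemHdiv P.Ω η)
    (hg : MemL2Surf P.ΓR (normalTrace P.Ω P.ΓR η)) :
    ‖(∫ x in P.Ω, (T.𝔊 p w x ⬝ᵥ star (η x) + w x * conj (wdiv P.Ω η x))) -
      ∑ F ∈ T.facesR, ∫ x in hull F, faceTrace (T.cellOf F) F w x *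
        conj (normalTrace P.Ω P.ΓR η x) ∂(surf d)‖ ≤ T.dagger1 p w * T.daggerDiv η := by
  have hd' : 1 ≤ d := by omega
  have hG := memL2Vec_𝔊 (p := p) hd' hw
  have a1 := integrable_dot hG hη.1.star
  have a2 := integrable_mul_of_memLp hw.memL2 (MemLp.star hη.wdiv_spec.1)
  have a3 : Integrable (fun x => T.𝔊 p w x ⬝ᵥ star (η x) + w x * conj (wdiv P.Ω η x))
      (volume.restrict P.Ω) := a1.add a2
  have cs2 : ∀ {m : Measure (E d)} {f g : Scal d}, MemLp f 2 m → MemLp g 2 m →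
      ‖∫ x, f x * conj (g x) ∂m‖ ≤ √(∫ x, ‖f x‖ ^ 2 ∂m) * √(∫ x, ‖g x‖ ^ 2 ∂m) := by
    intro m f g hf hg
    refine norm_integral_le_sqrt hf.norm.integrable_sq hg.norm.integrable_sq
      (Eventually.of_forall fun x => sq_nonneg _) (Eventually.of_forall fun x => sq_nonneg _)
      (Eventually.of_forall fun x => ?_)
    rw [norm_mul, RCLike.norm_conj, Real.sqrt_sq (norm_nonneg _), Real.sqrt_sq (norm_nonneg _)]
  -- The weight `c` of one factor is compensated by `c⁻¹` in the other. The maxima in `‖·‖_{†,1}`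
  -- are at least `1`, so replacing `c` by the actual weight `C` only increases the bound.
  have scale : ∀ {c C a b : ℝ}, 0 < c → c ≤ C → 0 ≤ a → √a * √b ≤ √(C * a) * √(c⁻¹ * b) := by
    intro c C a b hc hC ha
    calc √a * √b = √(c * a) * √(c⁻¹ * b) := by
          rw [Real.sqrt_mul hc.le, Real.sqrt_mul (inv_nonneg.2 hc.le), Real.sqrt_inv]
          have := (Real.sqrt_pos.2 hc).ne'
          field_simp
      _ ≤ _ := by gcongr
  rw [integral_Ω (T := T) a3, sub_eq_add_neg, ← Finset.sum_neg_distrib]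
  have hcell : ∀ K ∈ T.cells, ‖∫ x in hull K, (T.𝔊 p w x ⬝ᵥ star (η x) +
      w x * conj (wdiv P.Ω η x))‖ ≤
      √(max 1 (P.om ^ 2 * diam K ^ 2 / ϑK P K ^ 2) * (αK P K / diam K ^ 2) *
          (∫ x in hull K, ‖w x‖ ^ 2)
        + ∫ x in hull K, (herm (P.A x) (T.𝔊 p w x) (T.𝔊 p w x)).re) *
      √((∫ x in hull K, (herm (P.A x)⁻¹ (η x) (η x)).re)
        + diam K ^ 2 / αK P K * ∫ x in hull K, ‖wdiv P.Ω η x‖ ^ 2) := by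
    intro K hK
    have hle := restrict_hull_le hK
    have hα := αK_pos hd' hK
    have hh := diam_cell_pos hd' hK
    have hA := ae_mono hle T.ae_A_posDef
    have n1 : 0 ≤ ∫ x in hull K, (herm (P.A x) (T.𝔊 p w x) (T.𝔊 p w x)).re := by
      refine integral_nonneg_of_ae ?_
      filter_upwards [hA] with x hx using herm_self_re_nonneg hx _
    have n2 : 0 ≤ ∫ x in hull K, (herm (P.A x)⁻¹ (η x) (η x)).re := by
      refine integral_nonneg_of_ae ?_
      filter_upwards [hA] with x hx using herm_self_re_nonneg hx.inv _
    have n3 : 0 ≤ ∫ x in hull K, ‖w x‖ ^ 2 := integral_nonneg fun x => sq_nonneg _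
    have n4 : 0 ≤ ∫ x in hull K, ‖wdiv P.Ω η x‖ ^ 2 := integral_nonneg fun x => sq_nonneg _
    have e := integral_add (a1.mono_measure hle) (a2.mono_measure hle)
    have b1 : ‖∫ x in hull K, T.𝔊 p w x ⬝ᵥ star (η x)‖ ≤ _ :=
      norm_integral_le_sqrt ((T.integrable_herm_self hG).mono_measure hle)
        ((T.integrable_herm_inv hη.1).mono_measure hle)
        (by filter_upwards [hA] with x hx using herm_self_re_nonneg hx _)
        (by filter_upwards [hA] with x hx using herm_self_re_nonneg hx.inv _)
        (by filter_upwards [hA] with x hx using norm_dot_star_le_herm hx _ _)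
    have b2 : ‖∫ x in hull K, w x * conj (wdiv P.Ω η x)‖ ≤ _ :=
      (cs2 (hw.memL2.mono_measure hle) (hη.wdiv_spec.1.mono_measure hle)).trans
        (scale (c := αK P K / diam K ^ 2)
          (C := max 1 (P.om ^ 2 * diam K ^ 2 / ϑK P K ^ 2) * (αK P K / diam K ^ 2)) (by positivity)
          (le_mul_of_one_le_left (by positivity) (le_max_left _ _)) n3)
    rw [inv_div] at b2
    have := norm_add_le_sqrt (by positivity) (by positivity) (by positivity) (by positivity) b2 b1
    refine (le_of_eq ?_).trans (this.trans (le_of_eq ?_))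
    · rw [add_comm]
      exact congrArg norm e
    · rw [add_comm (diam K ^ 2 / αK P K * _)]
  have hface : ∀ F ∈ T.facesR, ‖-∫ x in hull F, faceTrace (T.cellOf F) F w x *
      conj (normalTrace P.Ω P.ΓR η x) ∂(surf d)‖ ≤
      √(max 1 (P.om * diam F / T.ϑF F) * (T.αF F / diam F) *
        ∫ x in hull F, ‖faceTrace (T.cellOf F) F w x‖ ^ 2 ∂(surf d)) *
      √(diam F / T.αF F * ∫ x in hull F, ‖normalTrace P.Ω P.ΓR η x‖ ^ 2 ∂(surf d)) := by
    intro F hF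
    have hα := αF_pos hd' hF
    have hh := diam_face_pos hd (mem_facesR.1 hF).1
    have := (cs2 (memL2Surf_faceTrace hd' hF hw) (T.memL2Surf_hull_of_ΓR hd' hF hg)).trans
      (scale (c := T.αF F / diam F) (C := max 1 (P.om * diam F / T.ϑF F) * (T.αF F / diam F))
        (by positivity) (le_mul_of_one_le_left (by positivity) (le_max_left _ _))
        (integral_nonneg fun x => sq_nonneg _))
    rwa [inv_div, ← norm_neg] at this
  have posK : ∀ K ∈ T.cells, 0 ≤ max 1 (P.om ^ 2 * diam K ^ 2 / ϑK P K ^ 2) * (αK P K / diam K ^ 2) *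
          (∫ x in hull K, ‖w x‖ ^ 2)
        + ∫ x in hull K, (herm (P.A x) (T.𝔊 p w x) (T.𝔊 p w x)).re := by
    intro K hK
    have hα := αK_pos hd' hK
    have n1 : 0 ≤ ∫ x in hull K, (herm (P.A x) (T.𝔊 p w x) (T.𝔊 p w x)).re := by
      refine integral_nonneg_of_ae ?_
      filter_upwards [ae_mono (restrict_hull_le hK) T.ae_A_posDef] with x hx
        using herm_self_re_nonneg hx _
    have n3 : 0 ≤ ∫ x in hull K, ‖w x‖ ^ 2 := integral_nonneg fun x => sq_nonneg _
    positivity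
  have posK' : ∀ K ∈ T.cells, 0 ≤ (∫ x in hull K, (herm (P.A x)⁻¹ (η x) (η x)).re)
        + diam K ^ 2 / αK P K * ∫ x in hull K, ‖wdiv P.Ω η x‖ ^ 2 := by
    intro K hK
    have hα := αK_pos hd' hK
    have n2 : 0 ≤ ∫ x in hull K, (herm (P.A x)⁻¹ (η x) (η x)).re := by
      refine integral_nonneg_of_ae ?_
      filter_upwards [ae_mono (restrict_hull_le hK) T.ae_A_posDef] with x hx
        using herm_self_re_nonneg hx.inv _
    have n4 : 0 ≤ ∫ x in hull K, ‖wdiv P.Ω η x‖ ^ 2 := integral_nonneg fun x => sq_nonneg _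
    positivity
  have posF : ∀ F ∈ T.facesR, 0 ≤ max 1 (P.om * diam F / T.ϑF F) * (T.αF F / diam F) *
        ∫ x in hull F, ‖faceTrace (T.cellOf F) F w x‖ ^ 2 ∂(surf d) := by
    intro F hF
    have hα := αF_pos hd' hF
    have hh := diam_face_pos hd (mem_facesR.1 hF).1
    have : 0 ≤ ∫ x in hull F, ‖faceTrace (T.cellOf F) F w x‖ ^ 2 ∂(surf d) :=
      integral_nonneg fun x => sq_nonneg _
    positivity
  have posF' : ∀ F ∈ T.facesR, 0 ≤ diam F / T.αF F *
        ∫ x in hull F, ‖normalTrace P.Ω P.ΓR η x‖ ^ 2 ∂(surf d) := by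
    intro F hF
    have hα := αF_pos hd' hF
    have hh := diam_face_pos hd (mem_facesR.1 hF).1
    have : 0 ≤ ∫ x in hull F, ‖normalTrace P.Ω P.ΓR η x‖ ^ 2 ∂(surf d) :=
      integral_nonneg fun x => sq_nonneg _
    positivity
  exact norm_add_le_sqrt (Finset.sum_nonneg posK) (Finset.sum_nonneg posK')
    (Finset.sum_nonneg posF) (Finset.sum_nonneg posF')
    (norm_sum_le_sqrt _ posK posK' hcell) (norm_sum_le_sqrt _ posF posF' hface)

end Mesh

/-! ### Limits in `L²`, continuity of the trace and closedness of `H¹_Γ` -/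

section Limits

variable {α : Type*} [MeasurableSpace α] {m : Measure α} {ι : Type*} {l : Filter ι}

lemma eLpNorm_two_eq_sqrt {v : α → ℂ} (hv : MemLp v 2 m) :
    eLpNorm v 2 m = ENNReal.ofReal √(∫ x, ‖v x‖ ^ 2 ∂m) := by
  have h : eLpNorm v 2 m ^ 2 = ENNReal.ofReal √(∫ x, ‖v x‖ ^ 2 ∂m) ^ 2 := by
    rw [eLpNorm_two_sq, ← ENNReal.ofReal_pow (Real.sqrt_nonneg _),
      Real.sq_sqrt (integral_nonneg fun x => sq_nonneg _),
      ofReal_integral_eq_lintegral_ofReal hv.norm.integrable_sq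
        (Eventually.of_forall fun x => sq_nonneg _)]
    refine lintegral_congr fun x => ?_
    rw [ENNReal.ofReal_pow (norm_nonneg _), ofReal_norm]
  exact (ENNReal.pow_right_strictMono two_ne_zero).injective h

lemma tendsto_integral_sq {v : ι → α → ℂ} (hv : ∀ n, MemLp (v n) 2 m)
    (h : Tendsto (fun n => eLpNorm (v n) 2 m) l (𝓝 0)) :
    Tendsto (fun n => ∫ x, ‖v n x‖ ^ 2 ∂m) l (𝓝 0) := by
  have h1 := (ENNReal.tendsto_toReal ENNReal.zero_ne_top).comp h
  have h2 := h1.pow 2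
  simp only [ENNReal.toReal_zero, ne_eq, OfNat.ofNat_ne_zero, not_false_eq_true, zero_pow] at h2
  refine h2.congr fun n => ?_
  simp only [Function.comp_apply]
  rw [eLpNorm_two_eq_sqrt (hv n), ENNReal.toReal_ofReal (Real.sqrt_nonneg _),
    Real.sq_sqrt (integral_nonneg fun x => sq_nonneg _)]

lemma tendsto_eLpNorm_of_sub {f g : ι → α → ℂ} (hf : ∀ n, MemLp (f n) 2 m)
    (hg : ∀ n, MemLp (g n) 2 m) (h : Tendsto (fun n => eLpNorm (f n - g n) 2 m) l (𝓝 0))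
    (h' : Tendsto (fun n => eLpNorm (g n) 2 m) l (𝓝 0)) :
    Tendsto (fun n => eLpNorm (f n) 2 m) l (𝓝 0) := by
  have h0 := h.add h'
  rw [add_zero] at h0
  refine tendsto_of_tendsto_of_tendsto_of_le_of_le tendsto_const_nhds h0 (fun _ => zero_le)
    fun n => ?_
  calc eLpNorm (f n) 2 m = eLpNorm (f n - g n + g n) 2 m := by rw [sub_add_cancel]
    _ ≤ _ := eLpNorm_add_le ((hf n).sub (hg n)).1 (hg n).1 (by norm_num)

end Limits

lemma IsWeight.exists_le_integral_sq {m : Measure (E d)} {f : E d → ℝ} (h : IsWeight m f) :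
    ∃ C, 0 < C ∧ ∀ v : Scal d, MemLp v 2 m → ∫ x, f x * ‖v x‖ ^ 2 ∂m ≤ C * ∫ x, ‖v x‖ ^ 2 ∂m := by
  obtain ⟨c, C, hc, hb⟩ := h.bounds
  refine ⟨max C 1, by positivity, fun v hv => ?_⟩
  rw [← integral_const_mul]
  refine integral_mono_ae (h.integrable_sq hv) (hv.norm.integrable_sq.const_mul _) ?_
  filter_upwards [hb] with x hx
  exact mul_le_mul_of_nonneg_right (hx.2.trans (le_max_left _ _)) (sq_nonneg _)

lemma norm_herm_le_of_entries {M : Matrix (Fin d) (Fin d) ℝ} {C : ℝ} (hM : ∀ i j, |M i j| ≤ C)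
    (a : Fin d → ℂ) : ‖herm M a a‖ ≤ C * d * ∑ i, ‖a i‖ ^ 2 := by
  have h1 : ‖herm M a a‖ ≤ ∑ i, ∑ j, C * (‖a j‖ * ‖a i‖) := by
    simp only [herm, dotProduct, Matrix.mulVec, Finset.sum_mul]
    refine (norm_sum_le _ _).trans (Finset.sum_le_sum fun i _ =>
      (norm_sum_le _ _).trans (Finset.sum_le_sum fun j _ => ?_))
    simp only [Matrix.map_apply, Pi.star_apply, norm_mul, norm_star, Complex.norm_real,
      Real.norm_eq_abs, mul_assoc]
    exact mul_le_mul_of_nonneg_right (hM i j) (by positivity)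
  refine h1.trans ?_
  rcases isEmpty_or_nonempty (Fin d) with hd | ⟨⟨i₀⟩⟩
  · simp
  have hC : 0 ≤ C := (abs_nonneg _).trans (hM i₀ i₀)
  have h2 : ∑ i, ∑ j, C * (‖a j‖ * ‖a i‖) = C * (∑ i, ‖a i‖) ^ 2 := by
    rw [sq, Finset.sum_mul_sum, Finset.mul_sum]
    refine Finset.sum_congr rfl fun i _ => ?_
    rw [Finset.mul_sum]
    exact Finset.sum_congr rfl fun j _ => by ring
  have h3 := sq_sum_le_card_mul_sum_sq (s := Finset.univ) (f := fun i => ‖a i‖)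
  simp only [Finset.card_univ, Fintype.card_fin] at h3
  rw [h2, mul_assoc]
  exact mul_le_mul_of_nonneg_left h3 hC

/-- Smooth approximation of a sequence, together with its traces. -/
lemma exists_smooth_seq {U S : Set (E d)} {w g : ℕ → Scal d} (h : ∀ n, IsTrace U S (w n) (g n)) :
    ∃ φ : ℕ → Scal d, (∀ n, ContDiff ℝ ∞ (φ n)) ∧
      Tendsto (fun n => eLpNorm (φ n - w n) 2 (volume.restrict U)) atTop (𝓝 0) ∧
      (∀ i, Tendsto (fun n => eLpNorm ((fun x => cgrad (φ n) x i) - fun x => wgrad U (w n) x i) 2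
        (volume.restrict U)) atTop (𝓝 0)) ∧
      Tendsto (fun n => eLpNorm (φ n - g n) 2 ((surf d).restrict S)) atTop (𝓝 0) := by
  -- A diagonal choice: for each `n`, one smooth function is picked whose four kinds of error are at
  -- most `1/(n+1)`.
  have key : ∀ n : ℕ, ∃ φ : Scal d, ContDiff ℝ ∞ φ ∧
      eLpNorm (φ - w n) 2 (volume.restrict U) ≤ ((n : ENNReal) + 1)⁻¹ ∧
      (∀ i, eLpNorm ((fun x => cgrad φ x i) - fun x => wgrad U (w n) x i) 2
        (volume.restrict U) ≤ ((n : ENNReal) + 1)⁻¹) ∧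
      eLpNorm (φ - g n) 2 ((surf d).restrict S) ≤ ((n : ENNReal) + 1)⁻¹ := by
    intro n
    obtain ⟨-, φ, hφ, hs⟩ := isTrace_iff.1 (h n)
    have h0 : (0 : ENNReal) < ((n : ENNReal) + 1)⁻¹ := by
      rw [ENNReal.inv_pos]
      exact ENNReal.add_ne_top.2 ⟨ENNReal.natCast_ne_top n, ENNReal.one_ne_top⟩
    have e1 := hφ.val.eventually (ge_mem_nhds h0)
    have e2 := eventually_all.2 fun i => (hφ.grad i).eventually (ge_mem_nhds h0)
    have e3 := hs.eventually (ge_mem_nhds h0)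
    obtain ⟨k, k1, k2, k3⟩ := (e1.and (e2.and e3)).exists
    exact ⟨φ k, hφ.smooth k, k1, k2, k3⟩
  choose φ h1 h2 h3 h4 using key
  have hlim : Tendsto (fun n : ℕ => ((n : ENNReal) + 1)⁻¹) atTop (𝓝 0) := by
    have := ENNReal.tendsto_inv_nat_nhds_zero.comp (tendsto_add_atTop_nat 1)
    refine this.congr fun n => ?_
    simp
  have sq : ∀ {f : ℕ → ENNReal}, (∀ n, f n ≤ ((n : ENNReal) + 1)⁻¹) → Tendsto f atTop (𝓝 0) :=
    fun hf => tendsto_of_tendsto_of_tendsto_of_le_of_le tendsto_const_nhds hlim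
      (fun _ => zero_le) hf
  exact ⟨φ, h1, sq h2, fun i => sq fun n => h3 n i, sq h4⟩

/-- The trace operator is continuous. -/
lemma TracePair.tendsto_zero {U S : Set (E d)} (hT : TracePair U S) {w g : ℕ → Scal d}
    (hw : ∀ n, MemH1 U (w n)) (h : ∀ n, IsTrace U S (w n) (g n))
    (h0 : Tendsto (fun n => eLpNorm (w n) 2 (volume.restrict U)) atTop (𝓝 0))
    (h1 : ∀ i, Tendsto (fun n => eLpNorm (fun x => wgrad U (w n) x i) 2 (volume.restrict U))
      atTop (𝓝 0)) :
    Tendsto (fun n => eLpNorm (g n) 2 ((surf d).restrict S)) atTop (𝓝 0) := by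
  obtain ⟨φ, hφ, a1, a2, a3⟩ := exists_smooth_seq h
  have b1 := tendsto_eLpNorm_of_sub (fun n => hT.memL2 (hφ n)) (fun n => (hw n).1) a1 h0
  have b2 := fun i => tendsto_eLpNorm_of_sub (fun n => hT.memL2_cgrad (hφ n) i)
    (fun n => (hw n).memL2_wgrad i) (a2 i) (h1 i)
  have b3 := hT.tendsto_surf hφ b1 b2
  refine tendsto_eLpNorm_of_sub (fun n => (h n).memL2Surf) (fun n => hT.memL2Surf (hφ n)) ?_ b3
  exact a3.congr fun n => by rw [← eLpNorm_neg, neg_sub]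

/-- Limits of functions of `H¹_Γ`. -/
lemma H1zero_of_tendsto {U Γ : Set (E d)} (hU : IsOpen U) (hT : TracePair U Γ) {w : ℕ → Scal d}
    {v : Scal d} {G : Vect d} (hw : ∀ n, w n ∈ H1zero U Γ) (hv : MemL2 U v) (hG : MemL2Vec U G)
    (h0 : Tendsto (fun n => eLpNorm (w n - v) 2 (volume.restrict U)) atTop (𝓝 0))
    (h1 : ∀ i, Tendsto (fun n => eLpNorm ((fun x => wgrad U (w n) x i) - fun x => G x i) 2
      (volume.restrict U)) atTop (𝓝 0)) :
    v ∈ H1zero U Γ ∧ ∀ᵐ x ∂(volume.restrict U), wgrad U v x = G x := by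
  have hg : IsWeakGrad U v G := by
    intro φ hφ i
    have a1 := tendsto_integral_mul (fun n => (hw n).1.1) hv (hφ.memLp_cgrad (volume.restrict U) i) h0
    have a2 := (tendsto_integral_mul (fun n => (hw n).1.memL2_wgrad i) (hG i)
      (hφ.memLp (volume.restrict U)) (h1 i)).neg
    refine tendsto_nhds_unique a1 (a2.congr fun n => ?_)
    exact ((hw n).1.wgrad_spec.2 φ hφ i).symm
  have hH : MemH1 U v := ⟨hv, G, hG, hg⟩
  have hwg := wgrad_eq hU hG hg
  refine ⟨⟨hH, ?_⟩, hwg⟩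
  -- The diagonal sequence approaches `v` in `H¹(U)` while its restrictions to `Γ` tend to zero. It
  -- therefore witnesses directly that the trace of `v` vanishes.
  obtain ⟨φ, hφ, a1, a2, a3⟩ := exists_smooth_seq fun n => (hw n).2
  have tri : ∀ {f g : ℕ → Scal d} {k : Scal d}, (∀ n, MemL2 U (f n)) → (∀ n, MemL2 U (g n)) →
      MemL2 U k → Tendsto (fun n => eLpNorm (f n - g n) 2 (volume.restrict U)) atTop (𝓝 0) →
      Tendsto (fun n => eLpNorm (g n - k) 2 (volume.restrict U)) atTop (𝓝 0) →
      Tendsto (fun n => eLpNorm (f n - k) 2 (volume.restrict U)) atTop (𝓝 0) := by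
    intro f g k hf hg hk h h'
    refine tendsto_eLpNorm_of_sub (fun n => MemLp.sub (hf n) hk) (fun n => MemLp.sub (hg n) hk) ?_ h'
    simpa only [sub_sub_sub_cancel_right] using h
  refine isTrace_iff.2 ⟨MemLp.zero, φ, ⟨hφ, ?_, fun i => ?_⟩, a3⟩
  · exact tri (fun n => hT.memL2 (hφ n)) (fun n => (hw n).1.1) hv a1 h0
  · have := tri (fun n => hT.memL2_cgrad (hφ n) i) (fun n => (hw n).1.memL2_wgrad i) (hG i) (a2 i)
      (h1 i)
    refine this.congr fun n => eLpNorm_congr_ae ?_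
    filter_upwards [hwg] with x hx
    simp [hx]

/-! ### Completeness of `H¹_{Γ_D}(Ω)` for the energy norm -/

namespace Mesh

variable {P : Problem d} {v w : Scal d}

/-- The energy norm controls the norm of `H¹(Ω)`. -/
lemma exists_eLpNorm_le_energy (T : Mesh P) (hd : 1 ≤ d) : ∃ C : ℝ, 0 < C ∧ ∀ v ∈ P.V,
    (∫ x in P.Ω, ‖v x‖ ^ 2) ≤ C * P.energy v ^ 2 ∧
    (∫ x in P.ΓR, ‖trace P.Ω P.ΓR v x‖ ^ 2 ∂(surf d)) ≤ C * P.energy v ^ 2 ∧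
    ∀ i, (∫ x in P.Ω, ‖wgrad P.Ω v x i‖ ^ 2) ≤ C * P.energy v ^ 2 := by
  obtain ⟨C₁, hC₁, h₁⟩ := T.isWeight_μ.exists_integral_sq_le
  obtain ⟨C₂, hC₂, h₂⟩ := (T.isWeight_γ hd).exists_integral_sq_le
  obtain ⟨c, C₃, hc, h₃⟩ := T.ae_A_bounds hd
  have hω := P.om_pos
  -- Each summand undoes the weight of one term of the squared energy: mass, Robin and gradient.
  refine ⟨C₁ / P.om ^ 2 + C₂ / P.om + 1 / c, by positivity, fun v hv => ?_⟩
  have hG := hv.1.wgrad_spec.1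
  set m := ∫ x in P.Ω, P.μ x * ‖v x‖ ^ 2
  set g := ∫ x in P.ΓR, P.γ x * ‖trace P.Ω P.ΓR v x‖ ^ 2 ∂(surf d)
  set a := ∫ x in P.Ω, (herm (P.A x) (wgrad P.Ω v x) (wgrad P.Ω v x)).re
  have hm : 0 ≤ m := T.isWeight_μ.integral_sq_nonneg v
  have hg : 0 ≤ g := (T.isWeight_γ hd).integral_sq_nonneg _
  have ha : 0 ≤ a := T.integral_herm_nonneg _
  have hE : P.energy v ^ 2 = P.om ^ 2 * m + P.om * g + a := Real.sq_sqrt (by positivity)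
  rw [hE]
  have e1 : C₁ / P.om ^ 2 * (P.om ^ 2 * m) = C₁ * m := by field_simp
  have e2 : C₂ / P.om * (P.om * g) = C₂ * g := by field_simp
  have p1 : 0 ≤ C₁ / P.om ^ 2 := by positivity
  have p2 : 0 ≤ C₂ / P.om := by positivity
  have p3 : 0 ≤ 1 / c := by positivity
  have q1 : 0 ≤ P.om ^ 2 * m := by positivity
  have q2 : 0 ≤ P.om * g := by positivity
  have expand : ∀ x1 x2 x3 y1 y2 y3 : ℝ, 0 ≤ x1 → 0 ≤ x2 → 0 ≤ x3 → 0 ≤ y1 → 0 ≤ y2 → 0 ≤ y3 →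
      x1 * y1 ≤ (x1 + x2 + x3) * (y1 + y2 + y3) ∧ x2 * y2 ≤ (x1 + x2 + x3) * (y1 + y2 + y3) ∧
      x3 * y3 ≤ (x1 + x2 + x3) * (y1 + y2 + y3) := by
    intro x1 x2 x3 y1 y2 y3 _ _ _ _ _ _
    refine ⟨?_, ?_, ?_⟩ <;> gcongr <;> linarith
  obtain ⟨b1, b2, b3⟩ := expand _ _ _ _ _ _ p1 p2 p3 q1 q2 ha
  refine ⟨(h₁ v hv.1.1).trans (by rwa [← e1]), (h₂ _ (T.memL2Surf_trace hd hv)).trans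
    (by rwa [← e2]), fun i => le_trans ?_ b3⟩
  rw [← integral_const_mul]
  refine integral_mono_ae (hv.1.memL2_wgrad i).norm.integrable_sq
    ((T.integrable_herm_self hG).const_mul _) ?_
  filter_upwards [h₃] with x hx
  have h4 := hx.1 (wgrad P.Ω v x)
  have h5 : ‖wgrad P.Ω v x i‖ ^ 2 ≤ ∑ j, ‖wgrad P.Ω v x j‖ ^ 2 :=
    Finset.single_le_sum (f := fun j => ‖wgrad P.Ω v x j‖ ^ 2) (fun j _ => sq_nonneg _)
      (Finset.mem_univ i)
  rw [one_div, le_inv_mul_iff₀ hc]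
  exact (mul_le_mul_of_nonneg_left h5 hc.le).trans h4

/-- The volume coefficients are bounded, and the Robin term is controlled by continuity of the
trace. -/
lemma tendsto_energy_zero (T : Mesh P) (hd : 1 ≤ d) {w : ℕ → Scal d} (hw : ∀ n, w n ∈ P.V)
    (h0 : Tendsto (fun n => eLpNorm (w n) 2 (volume.restrict P.Ω)) atTop (𝓝 0))
    (h1 : ∀ i, Tendsto (fun n => eLpNorm (fun x => wgrad P.Ω (w n) x i) 2 (volume.restrict P.Ω))
      atTop (𝓝 0)) :
    Tendsto (fun n => P.energy (w n)) atTop (𝓝 0) := by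
  obtain ⟨C₁, hC₁, b1⟩ := T.isWeight_μ.exists_le_integral_sq
  obtain ⟨C₂, hC₂, b2⟩ := (T.isWeight_γ hd).exists_le_integral_sq
  obtain ⟨c, C₃, hc, b3⟩ := T.ae_A_bounds hd
  have h2 := (tracePair_of_subset T hd P.partR.subset_frontier).tendsto_zero (fun n => (hw n).1)
    (fun n => T.isTrace_ΓR hd (hw n)) h0 h1
  have t0 := tendsto_integral_sq (fun n => (hw n).1.1) h0
  have t1 := fun i => tendsto_integral_sq (fun n => (hw n).1.memL2_wgrad i) (h1 i)
  have t2 := tendsto_integral_sq (fun n => T.memL2Surf_trace hd (hw n)) h2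
  have hω := P.om_pos
  have hlim := ((t0.const_mul (P.om ^ 2 * C₁)).add (t2.const_mul (P.om * C₂))).add
    ((tendsto_finsetSum Finset.univ fun i _ => t1 i).const_mul (C₃ * d))
  simp only [mul_zero, Finset.sum_const_zero, add_zero] at hlim
  have hs := (Real.continuous_sqrt.tendsto 0).comp hlim
  rw [Real.sqrt_zero] at hs
  refine squeeze_zero (fun n => Real.sqrt_nonneg _) (fun n => Real.sqrt_le_sqrt ?_) hs
  have hG := (hw n).1.wgrad_spec.1
  refine add_le_add (add_le_add ?_ ?_) ?_
  · rw [mul_assoc]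
    exact mul_le_mul_of_nonneg_left (b1 _ (hw n).1.1) (sq_nonneg _)
  · rw [mul_assoc]
    exact mul_le_mul_of_nonneg_left (b2 _ (T.memL2Surf_trace hd (hw n))) hω.le
  · rw [← integral_finsetSum _ fun i _ => ((hw n).1.memL2_wgrad i).norm.integrable_sq,
      ← integral_const_mul]
    refine integral_mono_ae (T.integrable_herm_self hG) ((integrable_finsetSum _
      fun i _ => ((hw n).1.memL2_wgrad i).norm.integrable_sq).const_mul _) ?_
    filter_upwards [b3] with x hx
    exact (Complex.re_le_norm _).trans (norm_herm_le_of_entries hx.2 _)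

/-- Completeness of `H¹_{Γ_D}(Ω)` for the energy norm. -/
lemma exists_tendsto_energy (T : Mesh P) (hd : 1 ≤ d) {w : ℕ → Scal d} (hw : ∀ n, w n ∈ P.V)
    (hc : Tendsto (fun n : ℕ × ℕ => P.energy (w n.1 - w n.2)) atTop (𝓝 0)) :
    ∃ v ∈ P.V, Tendsto (fun n => P.energy (w n - v)) atTop (𝓝 0) := by
  have hΩ := P.isPolytopal.isOpen
  obtain ⟨C, hC, hb⟩ := T.exists_eLpNorm_le_energy hd
  have hsub : ∀ n k, w n - w k ∈ P.V := fun n k => H1zero_sub hΩ (hw n) (hw k)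
  have wsub : ∀ {v v' : Scal d}, v ∈ P.V → v' ∈ P.V → ∀ᵐ x ∂(volume.restrict P.Ω),
      wgrad P.Ω (v - v') x = wgrad P.Ω v x - wgrad P.Ω v' x := by
    intro v v' hv hv'
    have e : v - v' = v + (-1 : ℂ) • v' := by rw [neg_one_smul, sub_eq_add_neg]
    rw [e]
    filter_upwards [hv.1.wgrad_add hΩ (hv'.1.smul (-1)), hv'.1.wgrad_smul hΩ (-1)] with x h1 h2
    rw [h1, h2, neg_one_smul, sub_eq_add_neg]
  have hlim : Tendsto (fun n : ℕ × ℕ => ENNReal.ofReal √(C * P.energy (w n.1 - w n.2) ^ 2))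
      atTop (𝓝 0) := by
    have h1 := ((hc.pow 2).const_mul C).sqrt
    have h2 := ENNReal.tendsto_ofReal h1
    simpa using h2
  have cauchy : ∀ {f : ℕ × ℕ → Scal d}, (∀ n, MemL2 P.Ω (f n)) →
      (∀ n, ∫ x in P.Ω, ‖f n x‖ ^ 2 ≤ C * P.energy (w n.1 - w n.2) ^ 2) →
      Tendsto (fun n => eLpNorm (f n) 2 (volume.restrict P.Ω)) atTop (𝓝 0) := by
    intro f hf h
    refine tendsto_of_tendsto_of_tendsto_of_le_of_le tendsto_const_nhds hlim (fun _ => zero_le)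
      fun n => ?_
    change eLpNorm (f n) 2 (volume.restrict P.Ω) ≤ _
    rw [eLpNorm_two_eq_sqrt (hf n)]
    exact ENNReal.ofReal_le_ofReal (Real.sqrt_le_sqrt (h n))
  -- The functions and each component of their gradients converge separately in `L²`. That the
  -- second limit is the gradient of the first, and that the limit stays in `V`, is
  -- `H1zero_of_tendsto`.
  obtain ⟨v, hv, hv'⟩ := exists_tendsto_eLpNorm (fun n => (hw n).1.1)
    (cauchy (f := fun n => w n.1 - w n.2) (fun n => (hsub _ _).1.1) fun n => (hb _ (hsub _ _)).1)
  have hG : ∀ i, ∃ g, MemL2 P.Ω g ∧ Tendsto (fun n =>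
      eLpNorm ((fun x => wgrad P.Ω (w n) x i) - g) 2 (volume.restrict P.Ω)) atTop (𝓝 0) := by
    intro i
    refine exists_tendsto_eLpNorm (f := fun n x => wgrad P.Ω (w n) x i)
      (fun n => (hw n).1.memL2_wgrad i) ?_
    refine (cauchy (f := fun n x => wgrad P.Ω (w n.1 - w n.2) x i)
      (fun n => (hsub _ _).1.memL2_wgrad i) fun n => (hb _ (hsub _ _)).2.2 i).congr fun n => ?_
    refine eLpNorm_congr_ae ?_
    filter_upwards [wsub (hw n.1) (hw n.2)] with x hx
    simp [hx]
  choose G hG hG' using hG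
  obtain ⟨hvV, hgv⟩ := H1zero_of_tendsto hΩ (tracePair_of_subset T hd P.partD.subset_frontier) hw hv
    (G := fun x i => G i x) hG hv' hG'
  refine ⟨v, hvV, T.tendsto_energy_zero hd (fun n => H1zero_sub hΩ (hw n) hvV) hv' fun i => ?_⟩
  refine (hG' i).congr fun n => eLpNorm_congr_ae ?_
  filter_upwards [wsub (hw n) hvV, hgv] with x h1 h2
  simp [h1, h2]

end Mesh

/-! ### Sesquilinear forms satisfying inf-sup conditions -/

section InfSup

open InnerProductSpace

/-- A bounded sesquilinear form on a Hilbert space that satisfies the two inf-sup conditions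
represents every bounded linear form. -/
lemma exists_forall_eq_of_infsup {H : Type*} [NormedAddCommGroup H] [InnerProductSpace ℂ H]
    [CompleteSpace H] (B : H →L⋆[ℂ] H →L[ℂ] ℂ) {c : ℝ} (hc : 0 < c)
    (h1 : ∀ v, ‖v‖ = 1 → ∃ w, ‖w‖ = 1 ∧ c ≤ ‖B v w‖) (h2 : ∀ w, ‖w‖ = 1 → ∃ v, B v w ≠ 0)
    (l : H →L[ℂ] ℂ) : ∃ ξ, ∀ w, B ξ w = l w := by
  set S := continuousLinearMapOfBilin B with hS
  have hSB : ∀ v w, inner ℂ (S v) w = B v w := fun v w => continuousLinearMapOfBilin_apply B v w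
  -- The quantitative inf-sup condition bounds `S` from below, so that its range is closed.
  have h3 : ∀ v, ‖v‖ ≤ c⁻¹ * ‖S v‖ := by
    intro v
    by_cases hv : v = 0
    · simp [hv]
    have hv' : 0 < ‖v‖ := norm_pos_iff.2 hv
    obtain ⟨w, hw, hcw⟩ := h1 ((‖v‖⁻¹ : ℂ) • v) (by
      rw [norm_smul, norm_inv, Complex.norm_real, norm_norm, inv_mul_cancel₀ hv'.ne'])
    rw [← hSB] at hcw
    have h4 := hcw.trans (norm_inner_le_norm (𝕜 := ℂ) _ _)
    rw [hw, mul_one, map_smul, norm_smul, norm_inv, Complex.norm_real, norm_norm] at h4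
    rw [le_inv_mul_iff₀ hc]
    rwa [le_inv_mul_iff₀ hv', mul_comm] at h4
  have hanti : AntilipschitzWith (⟨c⁻¹, by positivity⟩ : NNReal) S :=
    ContinuousLinearMap.antilipschitz_of_bound S h3
  have hcl : IsClosed (LinearMap.range (S : H →ₗ[ℂ] H) : Set H) := by
    rw [LinearMap.coe_range]
    exact hanti.isClosed_range S.uniformContinuous
  -- A nonzero vector orthogonal to the range would contradict the second condition after
  -- normalisation.
  have htop : (LinearMap.range (S : H →ₗ[ℂ] H)) = ⊤ := by
    have : CompleteSpace (LinearMap.range (S : H →ₗ[ℂ] H)) := hcl.completeSpace_coe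
    rw [← Submodule.orthogonal_eq_bot_iff, Submodule.eq_bot_iff]
    intro w hw
    by_contra hne
    have hw' : 0 < ‖w‖ := norm_pos_iff.2 hne
    obtain ⟨v, hv⟩ := h2 ((‖w‖⁻¹ : ℂ) • w) (by
      rw [norm_smul, norm_inv, Complex.norm_real, norm_norm, inv_mul_cancel₀ hw'.ne'])
    refine hv ?_
    have h4 : inner ℂ (S v) w = 0 := (Submodule.mem_orthogonal _ _).1 hw _ ⟨v, rfl⟩
    rw [map_smul, ← hSB, h4, smul_zero]
  obtain ⟨ξ, hξ⟩ : (toDual ℂ H).symm l ∈ LinearMap.range (S : H →ₗ[ℂ] H) := htop ▸ trivial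
  refine ⟨ξ, fun w => ?_⟩
  rw [← hSB]
  change inner ℂ ((S : H →ₗ[ℂ] H) ξ) w = _
  rw [hξ, toDual_symm_apply]

/-- Elements of `V` are functions and not classes, so the energy is only a seminorm. The Hilbert
space result is applied in the separation quotient, through its continuous linear section `outCLM`;
the forms do not see null differences because they are bounded by the seminorm. -/
lemma exists_forall_eq_of_infsup_seminormed {X : Type*} [SeminormedAddCommGroup X]
    [InnerProductSpace ℂ X] [CompleteSpace X] (B : X →ₗ⋆[ℂ] X →ₗ[ℂ] ℂ)
    (hB : ∀ v w, ‖B v w‖ ≤ 1 * ‖v‖ * ‖w‖) {c : ℝ} (hc : 0 < c)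
    (h1 : ∀ v, ‖v‖ = 1 → ∃ w, ‖w‖ = 1 ∧ c ≤ ‖B v w‖) (h2 : ∀ w, ‖w‖ = 1 → ∃ v, B v w ≠ 0)
    (l : X →ₗ[ℂ] ℂ) {C : ℝ} (hl : ∀ w, ‖l w‖ ≤ C * ‖w‖) : ∃ ξ, ∀ w, B ξ w = l w := by
  have hnorm : ∀ q : SeparationQuotient X, ‖SeparationQuotient.outCLM ℂ X q‖ = ‖q‖ := fun q => by
    rw [← SeparationQuotient.norm_mk, SeparationQuotient.mk_outCLM]
  have hdiff : ∀ x : X, ‖SeparationQuotient.outCLM ℂ X (SeparationQuotient.mk x) - x‖ = 0 := by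
    intro x
    rw [← SeparationQuotient.norm_mk, SeparationQuotient.mk_sub, SeparationQuotient.mk_outCLM,
      sub_self, norm_zero]
  have hB1 : ∀ v w w', ‖w - w'‖ = 0 → B v w = B v w' := by
    intro v w w' h
    have := hB v (w - w')
    rw [h, mul_zero, map_sub] at this
    exact sub_eq_zero.1 (norm_le_zero_iff.1 this)
  have hB2 : ∀ v v' w, ‖v - v'‖ = 0 → B v w = B v' w := by
    intro v v' w h
    have := hB (v - v') w
    rw [h, mul_zero, zero_mul, map_sub, LinearMap.sub_apply] at this
    exact sub_eq_zero.1 (norm_le_zero_iff.1 this)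
  have hl' : ∀ w w', ‖w - w'‖ = 0 → l w = l w' := by
    intro w w' h
    have := hl (w - w')
    rw [h, mul_zero, map_sub] at this
    exact sub_eq_zero.1 (norm_le_zero_iff.1 this)
  refine (exists_forall_eq_of_infsup
    ((B.mkContinuous₂ 1 hB).bilinearComp (SeparationQuotient.outCLM ℂ X)
      (SeparationQuotient.outCLM ℂ X)) hc ?_ ?_
    ((l.mkContinuous C hl).comp (SeparationQuotient.outCLM ℂ X))).elim fun ξ hξ => ?_
  · intro v hv
    obtain ⟨w, hw, hw'⟩ := h1 (SeparationQuotient.outCLM ℂ X v) (by rw [hnorm, hv])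
    refine ⟨SeparationQuotient.mk w, by rw [SeparationQuotient.norm_mk, hw], ?_⟩
    simp only [ContinuousLinearMap.bilinearComp_apply, LinearMap.mkContinuous₂_apply]
    rwa [hB1 _ _ _ (hdiff w)]
  · intro w hw
    obtain ⟨v, hv⟩ := h2 (SeparationQuotient.outCLM ℂ X w) (by rw [hnorm, hw])
    refine ⟨SeparationQuotient.mk v, ?_⟩
    simp only [ContinuousLinearMap.bilinearComp_apply, LinearMap.mkContinuous₂_apply]
    rwa [hB2 _ _ _ (hdiff v)]
  · refine ⟨SeparationQuotient.outCLM ℂ X ξ, fun w => ?_⟩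
    have := hξ (SeparationQuotient.mk w)
    simp only [ContinuousLinearMap.bilinearComp_apply, LinearMap.mkContinuous₂_apply,
      ContinuousLinearMap.comp_apply, LinearMap.mkContinuous_apply] at this
    rwa [hB1 _ _ _ (hdiff w), hl' _ _ (hdiff w)] at this

end InfSup

/-! ### The Helmholtz form on the energy space and the solvability of the adjoint problem -/

lemma IsPolytopal.isBounded {U : Set (E d)} (h : IsPolytopal U) : Bornology.IsBounded U := by
  obtain ⟨𝒮, -, rfl⟩ := h
  exact ((Bornology.isBounded_biUnion_finset 𝒮).2 fun s _ =>
    (isCompact_hull s).isBounded).subset interior_subset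

/-- Sesquilinear forms with the same structure as the Helmholtz form. -/
def Problem.form (P : Problem d) (a b : ℂ) (φ v : Scal d) : ℂ :=
  a * (∫ x in P.Ω, (P.μ x : ℂ) * φ x * conj (v x))
  + b * (∫ x in P.ΓR, (P.γ x : ℂ) * trace P.Ω P.ΓR φ x * conj (trace P.Ω P.ΓR v x) ∂(surf d))
  + ∫ x in P.Ω, herm (P.A x) (wgrad P.Ω φ x) (wgrad P.Ω v x)

lemma Problem.b_eq_form (P : Problem d) (φ v : Scal d) :
    P.b φ v = P.form (-(P.om : ℂ) ^ 2) (-(Complex.I * P.om)) φ v := by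
  rw [Problem.b, Problem.form, neg_mul (Complex.I * _), ← sub_eq_add_neg]

namespace Mesh

variable {P : Problem d} {v w ξ φ : Scal d} {a b : ℂ}

lemma form_linear (T : Mesh P) (hd : 1 ≤ d) (hv : v ∈ P.V) (hw : w ∈ P.V) (hξ : ξ ∈ P.V) (c : ℂ) :
    P.form a b (v + c • w) ξ = P.form a b v ξ + c * P.form a b w ξ := by
  have hΩ := P.isPolytopal.isOpen
  have hμ := T.isWeight_μ
  have hγ := T.isWeight_γ hd
  have h1 : ∫ x in P.Ω, (P.μ x : ℂ) * (v + c • w) x * conj (ξ x) =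
      (∫ x in P.Ω, (P.μ x : ℂ) * v x * conj (ξ x)) + c * ∫ x in P.Ω, (P.μ x : ℂ) * w x * conj (ξ x) := by
    rw [← integral_const_mul, ← integral_add (hμ.integrable_mul hv.1.1 hξ.1.1)
      ((hμ.integrable_mul hw.1.1 hξ.1.1).const_mul c)]
    refine integral_congr_ae (Eventually.of_forall fun x => ?_)
    simp only [Pi.add_apply, Pi.smul_apply, smul_eq_mul]
    ring
  have h2 : ∫ x in P.ΓR, (P.γ x : ℂ) * trace P.Ω P.ΓR (v + c • w) x *
        conj (trace P.Ω P.ΓR ξ x) ∂(surf d) =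
      (∫ x in P.ΓR, (P.γ x : ℂ) * trace P.Ω P.ΓR v x * conj (trace P.Ω P.ΓR ξ x) ∂(surf d)) +
      c * ∫ x in P.ΓR, (P.γ x : ℂ) * trace P.Ω P.ΓR w x * conj (trace P.Ω P.ΓR ξ x) ∂(surf d) := by
    have tv := T.memL2Surf_trace hd hv
    have tw := T.memL2Surf_trace hd hw
    have tξ := T.memL2Surf_trace hd hξ
    rw [← integral_const_mul, ← integral_add (hγ.integrable_mul tv tξ)
      ((hγ.integrable_mul tw tξ).const_mul c)]
    refine integral_congr_ae ?_
    filter_upwards [T.trace_ΓR_linear hd hv hw c] with x hx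
    rw [hx]
    simp only [Pi.add_apply, Pi.smul_apply, smul_eq_mul]
    ring
  have h3 : ∫ x in P.Ω, herm (P.A x) (wgrad P.Ω (v + c • w) x) (wgrad P.Ω ξ x) =
      (∫ x in P.Ω, herm (P.A x) (wgrad P.Ω v x) (wgrad P.Ω ξ x)) +
      c * ∫ x in P.Ω, herm (P.A x) (wgrad P.Ω w x) (wgrad P.Ω ξ x) := by
    have gv := hv.1.wgrad_spec.1
    have gw := hw.1.wgrad_spec.1
    have gξ := hξ.1.wgrad_spec.1
    rw [← integral_const_mul, ← integral_add (T.integrable_herm gv gξ)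
      ((T.integrable_herm gw gξ).const_mul c)]
    refine integral_congr_ae ?_
    filter_upwards [hv.1.wgrad_add hΩ (hw.1.smul c), hw.1.wgrad_smul hΩ c] with x hx hx'
    rw [hx, hx', herm, herm, herm, Matrix.mulVec_add, Matrix.mulVec_smul, add_dotProduct,
      smul_dotProduct, smul_eq_mul]
  rw [Problem.form, h1, h2, h3, Problem.form, Problem.form]
  ring

/-- The coefficients are real and `A` is symmetric, so exchanging the arguments conjugates only the
two scalar parameters. Linearity in one argument then yields antilinearity in the other. -/
lemma form_conj (T : Mesh P) : conj (P.form a b v w) = P.form (conj a) (conj b) w v := by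
  simp only [Problem.form, map_add, map_mul]
  congr 1
  · congr 2
    · rw [← integral_conj]
      refine integral_congr_ae (Eventually.of_forall fun x => ?_)
      simp only [map_mul, Complex.conj_ofReal, Complex.conj_conj]
      ring
    · rw [← integral_conj]
      refine integral_congr_ae (Eventually.of_forall fun x => ?_)
      simp only [map_mul, Complex.conj_ofReal, Complex.conj_conj]
      ring
  · rw [← integral_conj]
    refine integral_congr_ae ?_
    filter_upwards [T.ae_A_posDef] with x hx
    exact herm_conj hx _ _

/-- The form is complex symmetric, whatever `a` and `b`. This carries the inf-sup condition for `b`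
over to its adjoint with the same constant. -/
lemma form_star (T : Mesh P) (hd : 1 ≤ d) (hv : v ∈ P.V) (hw : w ∈ P.V) :
    P.form a b (star w) (star v) = P.form a b v w := by
  have hΩ := P.isPolytopal.isOpen
  simp only [Problem.form]
  congr 1
  · congr 2
    · refine integral_congr_ae (Eventually.of_forall fun x => ?_)
      simp only [Pi.star_apply, RCLike.star_def, Complex.conj_conj]
      ring
    · refine integral_congr_ae ?_
      filter_upwards [T.trace_ΓR_star hd hv, T.trace_ΓR_star hd hw] with x h1 h2
      rw [h1, h2]
      simp only [Pi.star_apply, RCLike.star_def, Complex.conj_conj]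
      ring
  · refine integral_congr_ae ?_
    filter_upwards [T.ae_A_posDef, hv.1.wgrad_star hΩ, hw.1.wgrad_star hΩ] with x hx h1 h2
    rw [h1, h2, herm_star hx]

lemma form_linear_right (T : Mesh P) (hd : 1 ≤ d) (hv : v ∈ P.V) (hw : w ∈ P.V) (hξ : ξ ∈ P.V)
    (c : ℂ) : P.form a b ξ (v + c • w) = P.form a b ξ v + conj c * P.form a b ξ w := by
  have h := congrArg conj (T.form_linear (a := conj a) (b := conj b) hd hv hw hξ c)
  rw [map_add, map_mul, T.form_conj, T.form_conj, T.form_conj] at h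
  simpa only [Complex.conj_conj] using h

lemma form_self_re (T : Mesh P) (hd : 1 ≤ d) (hv : v ∈ P.V) :
    (P.form ((P.om : ℂ) ^ 2) P.om v v).re = P.energy v ^ 2 := by
  have hω := P.om_pos
  have sq : ∀ {m : Measure (E d)} (f : E d → ℝ) (g : Scal d),
      ∫ x, (f x : ℂ) * g x * conj (g x) ∂m = ((∫ x, f x * ‖g x‖ ^ 2 ∂m : ℝ) : ℂ) := by
    intro m f g
    rw [← integral_complex_ofReal]
    refine integral_congr_ae (Eventually.of_forall fun x => ?_)
    simp only [mul_assoc, Complex.mul_conj, Complex.normSq_eq_norm_sq]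
    push_cast
    rfl
  have hm : 0 ≤ ∫ x in P.Ω, P.μ x * ‖v x‖ ^ 2 := T.isWeight_μ.integral_sq_nonneg v
  have hg : 0 ≤ ∫ x in P.ΓR, P.γ x * ‖trace P.Ω P.ΓR v x‖ ^ 2 ∂(surf d) :=
    (T.isWeight_γ hd).integral_sq_nonneg _
  have ha := T.integral_herm_nonneg (wgrad P.Ω v)
  rw [Problem.energy, Real.sq_sqrt (by positivity), Problem.form, sq, sq]
  have h3 : (∫ x in P.Ω, herm (P.A x) (wgrad P.Ω v x) (wgrad P.Ω v x)).re =
      ∫ x in P.Ω, (herm (P.A x) (wgrad P.Ω v x) (wgrad P.Ω v x)).re :=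
    (Complex.reCLM.integral_comp_comm
      (T.integrable_herm hv.1.wgrad_spec.1 hv.1.wgrad_spec.1)).symm
  rw [Complex.add_re, Complex.add_re, h3, ← Complex.ofReal_pow, ← Complex.ofReal_mul,
    ← Complex.ofReal_mul, Complex.ofReal_re, Complex.ofReal_re]

lemma energy_star (T : Mesh P) (hd : 1 ≤ d) (hv : v ∈ P.V) : P.energy (star v) = P.energy v := by
  have hs := H1zero_star P.isPolytopal.isOpen hv
  have h := T.form_self_re hd hs
  rw [T.form_star hd hv hv, T.form_self_re hd hv] at h
  exact (pow_left_inj₀ (Real.sqrt_nonneg _) (Real.sqrt_nonneg _) two_ne_zero).1 h.symm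

lemma norm_b_le (T : Mesh P) (hd : 1 ≤ d) (hw : w ∈ P.V) (hv : v ∈ P.V) :
    ‖P.b w v‖ ≤ P.energy w * P.energy v := by
  -- The degree is irrelevant: conforming functions have zero lifting, whatever the polynomial
  -- space.
  have h := norm_bh₀_le (T := T) (p := 0) hd (isBroken_of_V hw) (isBroken_of_V hv)
  rwa [bh₀_of_V hd hw hv, energy_of_V hd hw, energy_of_V hd hv] at h

end Mesh

/-- The space `H¹_{Γ_D}(Ω)` as a vector space. -/
def Problem.VSub (P : Problem d) : Submodule ℂ (Scal d) where
  carrier := P.V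
  add_mem' := fun hv hw => H1zero_add P.isPolytopal.isOpen hv hw
  zero_mem' := H1zero_zero P.isPolytopal.isOpen P.isPolytopal.isBounded
  smul_mem' := fun c _ hv => H1zero_smul P.isPolytopal.isOpen c hv

/-- The space `H¹_{Γ_D}(Ω)`, without the topology of pointwise convergence. -/
def Problem.VSpace (P : Problem d) : Type := P.VSub

instance (P : Problem d) : AddCommGroup P.VSpace := inferInstanceAs (AddCommGroup P.VSub)

instance (P : Problem d) : Module ℂ P.VSpace := inferInstanceAs (Module ℂ P.VSub)

/-- The function underlying an element of `H¹_{Γ_D}(Ω)`. -/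
def Problem.VSpace.val {P : Problem d} (v : P.VSpace) : Scal d := Subtype.val v

lemma Problem.VSpace.mem {P : Problem d} (v : P.VSpace) : v.val ∈ P.V := Subtype.property v

/-- The inner product of the energy norm. -/
@[reducible]
def Mesh.core {P : Problem d} (T : Mesh P) (hd : 1 ≤ d) : PreInnerProductSpace.Core ℂ P.VSpace where
  -- The arguments are exchanged because the inner product is antilinear in its first argument and
  -- `form` in its second.
  inner v w := P.form ((P.om : ℂ) ^ 2) P.om w.val v.val
  conj_inner_symm v w := by
    rw [T.form_conj]
    simp
  re_inner_nonneg v := by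
    change 0 ≤ (P.form ((P.om : ℂ) ^ 2) P.om v.val v.val).re
    rw [T.form_self_re hd v.mem]
    exact sq_nonneg _
  add_left v w ξ := by
    have := T.form_linear_right (a := (P.om : ℂ) ^ 2) (b := P.om) hd v.mem w.mem ξ.mem 1
    rwa [one_smul, map_one, one_mul] at this
  smul_left v w c := by
    have h0 : (0 : Scal d) ∈ P.V := H1zero_zero P.isPolytopal.isOpen P.isPolytopal.isBounded
    have h1 := T.form_linear_right (a := (P.om : ℂ) ^ 2) (b := P.om) hd h0 v.mem w.mem c
    have h2 := T.form_linear_right (a := (P.om : ℂ) ^ 2) (b := P.om) hd h0 h0 w.mem 1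
    rw [one_smul, zero_add, map_one, one_mul, left_eq_add] at h2
    rwa [zero_add, h2, zero_add] at h1

/-- The unknown occupies the second slot of `b`, so the abstract result is applied to `B v w = b w
v`. Its quantitative condition follows from well-posedness by conjugation, and its nondegeneracy
condition from well-posedness as it stands. -/
lemma Mesh.exists_forall_b_eq {P : Problem d} (T : Mesh P) (hd : 1 ≤ d) (hP : P.WellPosed)
    (l : Scal d → ℂ) (hl : ∀ v ∈ P.V, ∀ w ∈ P.V, ∀ c : ℂ, l (v + c • w) = l v + c * l w)
    {C : ℝ} (hC : ∀ v ∈ P.V, ‖l v‖ ≤ C * P.energy v) :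
    ∃ ξ ∈ P.V, ∀ w ∈ P.V, P.b w ξ = l w := by
  let _ : SeminormedAddCommGroup P.VSpace :=
    @InnerProductSpace.Core.toSeminormedAddCommGroup ℂ P.VSpace _ _ _ (T.core hd)
  let _ : InnerProductSpace ℂ P.VSpace := InnerProductSpace.ofCore (T.core hd)
  have h0 : (0 : Scal d) ∈ P.V := H1zero_zero P.isPolytopal.isOpen P.isPolytopal.isBounded
  have hnorm : ∀ v : P.VSpace, ‖v‖ = P.energy v.val := by
    intro v
    change √(P.form ((P.om : ℂ) ^ 2) P.om v.val v.val).re = _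
    rw [T.form_self_re hd v.mem]
    exact Real.sqrt_sq (Real.sqrt_nonneg _)
  have hcomplete : CompleteSpace P.VSpace := by
    refine Metric.complete_of_cauchySeq_tendsto fun u hu => ?_
    have h1 : Tendsto (fun n : ℕ × ℕ => P.energy ((u n.1).val - (u n.2).val)) atTop (𝓝 0) := by
      have := cauchySeq_iff_tendsto_dist_atTop_0.1 hu
      refine this.congr fun n => ?_
      rw [dist_eq_norm, hnorm]
      rfl
    obtain ⟨v, hv, hlim⟩ := T.exists_tendsto_energy hd (fun n => (u n).mem) h1
    refine ⟨⟨v, hv⟩, tendsto_iff_norm_sub_tendsto_zero.2 (hlim.congr fun n => ?_)⟩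
    rw [hnorm]
    rfl
  have hlin : ∀ v w ξ : P.VSpace, ∀ c : ℂ,
      P.b (v.val + c • w.val) ξ.val = P.b v.val ξ.val + c * P.b w.val ξ.val := by
    intro v w ξ c
    simp only [Problem.b_eq_form]
    exact T.form_linear hd v.mem w.mem ξ.mem c
  have hlin' : ∀ v w ξ : P.VSpace, ∀ c : ℂ,
      P.b ξ.val (v.val + c • w.val) = P.b ξ.val v.val + conj c * P.b ξ.val w.val := by
    intro v w ξ c
    simp only [Problem.b_eq_form]
    exact T.form_linear_right hd v.mem w.mem ξ.mem c
  have hz : ∀ w : P.VSpace, P.b 0 w.val = 0 ∧ P.b w.val 0 = 0 := by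
    intro w
    have e1 := hlin 0 0 w 1
    have e2 := hlin' 0 0 w 1
    change P.b ((0 : Scal d) + (1 : ℂ) • (0 : Scal d)) _ = P.b (0 : Scal d) _ + _ * P.b (0 : Scal d) _ at e1
    change P.b _ ((0 : Scal d) + (1 : ℂ) • (0 : Scal d)) = P.b _ (0 : Scal d) + _ * P.b _ (0 : Scal d) at e2
    rw [one_smul, zero_add, one_mul, left_eq_add] at e1
    rw [one_smul, zero_add, map_one, one_mul, left_eq_add] at e2
    exact ⟨e1, e2⟩
  have hlz : l 0 = 0 := by
    have := hl 0 h0 0 h0 1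
    rwa [one_smul, zero_add, one_mul, left_eq_add] at this
  let B : P.VSpace →ₗ⋆[ℂ] P.VSpace →ₗ[ℂ] ℂ := LinearMap.mk₂'ₛₗ (starRingEnd ℂ) (RingHom.id ℂ)
    (fun v w => P.b w.val v.val)
    (fun v v' w => by
      have := hlin' v v' w 1
      rwa [one_smul, map_one, one_mul] at this)
    (fun c v w => by
      have := hlin' 0 v w c
      change P.b _ ((0 : Scal d) + c • v.val) = P.b _ (0 : Scal d) + _ at this
      rwa [zero_add, (hz w).2, zero_add] at this)
    (fun v w w' => by
      have := hlin w w' v 1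
      rwa [one_smul, one_mul] at this)
    (fun c v w => by
      have := hlin 0 w v c
      change P.b ((0 : Scal d) + c • w.val) _ = P.b (0 : Scal d) _ + _ at this
      rwa [zero_add, (hz v).1, zero_add] at this)
  let L : P.VSpace →ₗ[ℂ] ℂ :=
    { toFun := fun v => l v.val
      map_add' := fun v w => by
        have := hl v.val v.mem w.val w.mem 1
        rwa [one_smul, one_mul] at this
      map_smul' := fun c v => by
        have := hl 0 h0 v.val v.mem c
        rwa [zero_add, hlz, zero_add] at this }
  obtain ⟨γst, hγ, hinf⟩ := hP
  refine (exists_forall_eq_of_infsup_seminormed B (c := 1 / γst) ?_ (by positivity) ?_ ?_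
    L (C := C) ?_).elim fun ξ hξ => ?_
  · intro v w
    rw [hnorm, hnorm, one_mul, mul_comm]
    exact T.norm_b_le hd w.mem v.mem
  · intro v hv
    rw [hnorm] at hv
    have hs := H1zero_star P.isPolytopal.isOpen v.mem
    obtain ⟨w, hw, hw1, hb⟩ := hinf (star v.val) hs (by rw [T.energy_star hd v.mem, hv])
    -- The partner of `v` is the conjugate of the one that well-posedness attaches to `star v`,
    -- since `b (star w) v = b (star v) w`.
    refine ⟨⟨star w, H1zero_star P.isPolytopal.isOpen hw⟩,
      (hnorm _).trans ((T.energy_star hd hw).trans hw1), ?_⟩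
    · change _ ≤ ‖P.b (star w) v.val‖
      have e : P.b (star w) v.val = P.b (star v.val) w := by
        rw [Problem.b_eq_form, Problem.b_eq_form]
        have := T.form_star (a := -(P.om : ℂ) ^ 2) (b := -(Complex.I * P.om)) hd hs hw
        rwa [star_star] at this
      rw [e]
      exact hb.trans (Complex.re_le_norm _)
  · intro w hw
    rw [hnorm] at hw
    obtain ⟨v, hv, -, hb⟩ := hinf w.val w.mem hw
    refine ⟨⟨v, hv⟩, fun h => ?_⟩
    change P.b w.val v = 0 at h
    rw [h, Complex.zero_re] at hb
    exact absurd hb (not_le.2 (by positivity))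
  · intro w
    rw [hnorm]
    exact hC _ w.mem
  · exact ⟨ξ.val, ξ.mem, fun w hw => hξ ⟨w, hw⟩⟩

/-- The right-hand side of the adjoint problem. -/
def Problem.dualFunctional (P : Problem d) (ψ Ψ w : Scal d) : ℂ :=
  (∫ x in P.Ω, (P.μ x : ℂ) * w x * conj (ψ x)) +
    ∫ x in P.ΓR, (P.γ x : ℂ) * trace P.Ω P.ΓR w x * conj (Ψ x) ∂(surf d)

/-- The norm of the data of the adjoint problem. -/
def Problem.dualNorm (P : Problem d) (ψ Ψ : Scal d) : ℝ :=
  P.om⁻¹ * √(∫ x in P.Ω, P.μ x * ‖ψ x‖ ^ 2) +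
    (√P.om)⁻¹ * √(∫ x in P.ΓR, P.γ x * ‖Ψ x‖ ^ 2 ∂(surf d))

/-! ### Existence and stability for the adjoint problem -/

namespace Mesh

variable {P : Problem d} {v w ψ Ψ ξ : Scal d}

lemma zero_mem_V (P : Problem d) : (0 : Scal d) ∈ P.V :=
  H1zero_zero P.isPolytopal.isOpen P.isPolytopal.isBounded

lemma le_energy (T : Mesh P) (hd : 1 ≤ d) (v : Scal d) :
    P.om * √(∫ x in P.Ω, P.μ x * ‖v x‖ ^ 2) ≤ P.energy v ∧
    √P.om * √(∫ x in P.ΓR, P.γ x * ‖trace P.Ω P.ΓR v x‖ ^ 2 ∂(surf d)) ≤ P.energy v ∧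
    ∫ x in P.Ω, (herm (P.A x) (wgrad P.Ω v x) (wgrad P.Ω v x)).re ≤ P.energy v ^ 2 := by
  have hω := P.om_pos
  have hm : 0 ≤ ∫ x in P.Ω, P.μ x * ‖v x‖ ^ 2 := T.isWeight_μ.integral_sq_nonneg v
  have hg : 0 ≤ ∫ x in P.ΓR, P.γ x * ‖trace P.Ω P.ΓR v x‖ ^ 2 ∂(surf d) :=
    (T.isWeight_γ hd).integral_sq_nonneg _
  have ha := T.integral_herm_nonneg (wgrad P.Ω v)
  have p1 : 0 ≤ P.om ^ 2 * ∫ x in P.Ω, P.μ x * ‖v x‖ ^ 2 := by positivity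
  have p2 : 0 ≤ P.om * ∫ x in P.ΓR, P.γ x * ‖trace P.Ω P.ΓR v x‖ ^ 2 ∂(surf d) := by positivity
  refine ⟨?_, ?_, ?_⟩
  · have e := Real.sqrt_mul (sq_nonneg P.om) (∫ x in P.Ω, P.μ x * ‖v x‖ ^ 2)
    rw [Real.sqrt_sq hω.le] at e
    rw [← e]
    exact Real.sqrt_le_sqrt (by linarith)
  · rw [← Real.sqrt_mul hω.le]
    exact Real.sqrt_le_sqrt (by linarith)
  · rw [Problem.energy, Real.sq_sqrt (by positivity)]
    linarith

lemma norm_dualFunctional_le (T : Mesh P) (hd : 1 ≤ d) (hψ : MemL2 P.Ω ψ)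
    (hΨ : MemL2Surf P.ΓR Ψ) (hw : w ∈ P.V) :
    ‖P.dualFunctional ψ Ψ w‖ ≤ P.dualNorm ψ Ψ * P.energy w := by
  have hω := P.om_pos
  have hs : 0 < √P.om := Real.sqrt_pos.2 hω
  have h1 := T.isWeight_μ.norm_integral_le hw.1.1 hψ
  have h2 := (T.isWeight_γ hd).norm_integral_le (T.memL2Surf_trace hd hw) hΨ
  obtain ⟨e1, e2, -⟩ := T.le_energy hd w
  refine (norm_add_le _ _).trans ?_
  rw [Problem.dualNorm, add_mul]
  refine add_le_add (h1.trans ?_) (h2.trans ?_)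
  · rw [mul_comm, mul_comm P.om⁻¹, mul_assoc]
    refine mul_le_mul_of_nonneg_left ?_ (Real.sqrt_nonneg _)
    rwa [le_inv_mul_iff₀ hω]
  · rw [mul_comm, mul_comm (√P.om)⁻¹, mul_assoc]
    refine mul_le_mul_of_nonneg_left ?_ (Real.sqrt_nonneg _)
    rwa [le_inv_mul_iff₀ hs]

lemma dualFunctional_linear (T : Mesh P) (hd : 1 ≤ d) (hψ : MemL2 P.Ω ψ)
    (hΨ : MemL2Surf P.ΓR Ψ) (hv : v ∈ P.V) (hw : w ∈ P.V) (c : ℂ) :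
    P.dualFunctional ψ Ψ (v + c • w) = P.dualFunctional ψ Ψ v + c * P.dualFunctional ψ Ψ w := by
  have hμ := T.isWeight_μ
  have hγ := T.isWeight_γ hd
  have h1 : ∫ x in P.Ω, (P.μ x : ℂ) * (v + c • w) x * conj (ψ x) =
      (∫ x in P.Ω, (P.μ x : ℂ) * v x * conj (ψ x)) + c * ∫ x in P.Ω, (P.μ x : ℂ) * w x * conj (ψ x) := by
    rw [← integral_const_mul, ← integral_add (hμ.integrable_mul hv.1.1 hψ)
      ((hμ.integrable_mul hw.1.1 hψ).const_mul c)]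
    refine integral_congr_ae (Eventually.of_forall fun x => ?_)
    simp only [Pi.add_apply, Pi.smul_apply, smul_eq_mul]
    ring
  have h2 : ∫ x in P.ΓR, (P.γ x : ℂ) * trace P.Ω P.ΓR (v + c • w) x * conj (Ψ x) ∂(surf d) =
      (∫ x in P.ΓR, (P.γ x : ℂ) * trace P.Ω P.ΓR v x * conj (Ψ x) ∂(surf d)) +
      c * ∫ x in P.ΓR, (P.γ x : ℂ) * trace P.Ω P.ΓR w x * conj (Ψ x) ∂(surf d) := by
    have tv := T.memL2Surf_trace hd hv
    have tw := T.memL2Surf_trace hd hw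
    rw [← integral_const_mul, ← integral_add (hγ.integrable_mul tv hΨ)
      ((hγ.integrable_mul tw hΨ).const_mul c)]
    refine integral_congr_ae ?_
    filter_upwards [T.trace_ΓR_linear hd hv hw c] with x hx
    rw [hx]
    simp only [Pi.add_apply, Pi.smul_apply, smul_eq_mul]
    ring
  rw [Problem.dualFunctional, h1, h2, Problem.dualFunctional, Problem.dualFunctional]
  ring

/-- The adjoint problem is solvable. -/
lemma exists_isDual (T : Mesh P) (hd : 1 ≤ d) (hP : P.WellPosed) (hψ : MemL2 P.Ω ψ)
    (hΨ : MemL2Surf P.ΓR Ψ) : ∃ ξ, P.IsDual ψ Ψ ξ := by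
  obtain ⟨ξ, hξ, h⟩ := T.exists_forall_b_eq hd hP (P.dualFunctional ψ Ψ)
    (fun v hv w hw c => T.dualFunctional_linear hd hψ hΨ hv hw c)
    (fun v hv => T.norm_dualFunctional_le hd hψ hΨ hv)
  exact ⟨ξ, hψ, hΨ, hξ, h⟩

/-- Homogeneity is read off the form whose diagonal is the squared energy; it is needed to normalise
functions before applying well-posedness. -/
lemma energy_smul (T : Mesh P) (hd : 1 ≤ d) (hv : v ∈ P.V) (c : ℂ) :
    P.energy (c • v) = ‖c‖ * P.energy v := by
  have hΩ := P.isPolytopal.isOpen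
  have h0 := zero_mem_V P
  have hcv : c • v ∈ P.V := H1zero_smul hΩ c hv
  have hz : ∀ {u : Scal d}, u ∈ P.V → P.form ((P.om : ℂ) ^ 2) P.om 0 u = 0 ∧
      P.form ((P.om : ℂ) ^ 2) P.om u 0 = 0 := by
    intro u hu
    have h1 := T.form_linear (a := (P.om : ℂ) ^ 2) (b := P.om) hd h0 h0 hu 1
    have h2 := T.form_linear_right (a := (P.om : ℂ) ^ 2) (b := P.om) hd h0 h0 hu 1
    rw [one_smul, zero_add, one_mul, left_eq_add] at h1
    rw [one_smul, zero_add, map_one, one_mul, left_eq_add] at h2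
    exact ⟨h1, h2⟩
  have h1 := T.form_linear (a := (P.om : ℂ) ^ 2) (b := P.om) hd h0 hv hcv c
  have h2 := T.form_linear_right (a := (P.om : ℂ) ^ 2) (b := P.om) hd h0 hv hv c
  rw [zero_add, (hz hcv).1, zero_add] at h1
  rw [zero_add, (hz hv).2, zero_add] at h2
  have h3 := T.form_self_re hd hcv
  have h4 := T.form_self_re hd hv
  rw [h1, h2, ← mul_assoc, Complex.mul_conj, Complex.re_ofReal_mul, h4, Complex.normSq_eq_norm_sq,
    ← mul_pow] at h3
  exact (pow_left_inj₀ (Real.sqrt_nonneg _)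
    (mul_nonneg (norm_nonneg _) (Real.sqrt_nonneg _)) two_ne_zero).1 h3.symm

/-- Stability of the adjoint problem. -/
lemma exists_energy_le_dualNorm (T : Mesh P) (hd : 1 ≤ d) (hP : P.WellPosed) :
    ∃ C, 0 < C ∧ ∀ ψ Ψ ξ, P.IsDual ψ Ψ ξ → P.energy ξ ≤ C * P.dualNorm ψ Ψ := by
  obtain ⟨γst, hγ, hinf⟩ := hP
  refine ⟨γst, hγ, fun ψ Ψ ξ h => ?_⟩
  have hΩ := P.isPolytopal.isOpen
  have hω := P.om_pos
  have hE : 0 ≤ P.energy ξ := Real.sqrt_nonneg _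
  have hN : 0 ≤ P.dualNorm ψ Ψ := by
    rw [Problem.dualNorm]
    positivity
  rcases hE.eq_or_lt with hE0 | hE0
  · rw [← hE0]
    positivity
  have hs := H1zero_star hΩ h.mem
  set c : ℂ := (((P.energy ξ)⁻¹ : ℝ) : ℂ) with hc
  have hcn : ‖c‖ = (P.energy ξ)⁻¹ := by
    rw [hc, Complex.norm_real, Real.norm_of_nonneg (by positivity)]
  -- Well-posedness is applied to the normalised conjugate of `ξ`. By complex symmetry `b (star ξ) v
  -- = b (star v) ξ`, which the adjoint equation evaluates; the stability constant is thus the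
  -- inf-sup constant `γst`.
  obtain ⟨v, hv, hv1, hb⟩ := hinf (c • star ξ) (H1zero_smul hΩ c hs) (by
    rw [T.energy_smul hd hs, T.energy_star hd h.mem, hcn, inv_mul_cancel₀ hE0.ne'])
  have hsv := H1zero_star hΩ hv
  have h0 := zero_mem_V P
  have e1 : P.b (c • star ξ) v = c * P.b (star ξ) v := by
    have h1 := T.form_linear (a := -(P.om : ℂ) ^ 2) (b := -(Complex.I * P.om)) hd h0 hs hv c
    have h2 := T.form_linear (a := -(P.om : ℂ) ^ 2) (b := -(Complex.I * P.om)) hd h0 h0 hv 1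
    rw [one_smul, zero_add, one_mul, left_eq_add] at h2
    rw [zero_add, h2, zero_add] at h1
    rw [Problem.b_eq_form, Problem.b_eq_form, h1]
  have e2 : P.b (star ξ) v = P.b (star v) ξ := by
    have := T.form_star (a := -(P.om : ℂ) ^ 2) (b := -(Complex.I * P.om)) hd hs hv
    rw [star_star] at this
    rw [Problem.b_eq_form, Problem.b_eq_form, this]
  have e3 : P.b (star v) ξ = P.dualFunctional ψ Ψ (star v) := h.eq _ hsv
  have h4 := hb.trans (Complex.re_le_norm _)
  rw [e1, norm_mul, e2, e3, hcn] at h4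
  have h5 := T.norm_dualFunctional_le hd h.memL2 h.memL2Surf hsv
  rw [T.energy_star hd hv, hv1, mul_one] at h5
  have h6 := h4.trans (mul_le_mul_of_nonneg_left h5 (inv_nonneg.2 hE))
  rw [div_le_iff₀ hγ, inv_mul_eq_div, div_mul_eq_mul_div, le_div_iff₀ hE0, one_mul] at h6
  linarith

end Mesh

/-! ### The two normalised adjoint problems as instances of `IsDual` -/

namespace Problem

variable {P : Problem d} {ψ Ψ ξ : Scal d}

/-- The factor `ω` is real and can be moved inside the conjugated datum. Together with its Robin
counterpart, this lets a single argument treat both estimates. -/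
lemma isDualVol_iff (hψ : MemL2 P.Ω ψ) : P.IsDualVol ψ ξ ↔ P.IsDual ((P.om : ℂ) • ψ) 0 ξ := by
  have e : ∀ w : Scal d, (P.om : ℂ) * ∫ x in P.Ω, (P.μ x : ℂ) * w x * conj (ψ x) =
      (∫ x in P.Ω, (P.μ x : ℂ) * w x * conj (((P.om : ℂ) • ψ) x)) +
      ∫ x in P.ΓR, (P.γ x : ℂ) * trace P.Ω P.ΓR w x * conj ((0 : Scal d) x) ∂(surf d) := by
    intro w
    simp only [Pi.zero_apply, map_zero, mul_zero, integral_zero, add_zero]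
    rw [← integral_const_mul]
    refine integral_congr_ae (Eventually.of_forall fun x => ?_)
    simp only [Pi.smul_apply, smul_eq_mul, map_mul, Complex.conj_ofReal]
    ring
  refine ⟨fun h => ⟨MemLp.const_smul hψ _, MemLp.zero, h.1, fun w hw => ?_⟩,
    fun h => ⟨h.mem, fun w hw => ?_⟩⟩
  · rw [h.2 w hw, e]
  · rw [h.eq w hw, e]

lemma isDualRob_iff (hΨ : MemL2Surf P.ΓR Ψ) :
    P.IsDualRob Ψ ξ ↔ P.IsDual 0 (((√P.om : ℝ) : ℂ) • Ψ) ξ := by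
  have e : ∀ w : Scal d, ((√P.om : ℝ) : ℂ) *
      (∫ x in P.ΓR, (P.γ x : ℂ) * trace P.Ω P.ΓR w x * conj (Ψ x) ∂(surf d)) =
      (∫ x in P.Ω, (P.μ x : ℂ) * w x * conj ((0 : Scal d) x)) +
      ∫ x in P.ΓR, (P.γ x : ℂ) * trace P.Ω P.ΓR w x *
        conj ((((√P.om : ℝ) : ℂ) • Ψ) x) ∂(surf d) := by
    intro w
    simp only [Pi.zero_apply, map_zero, mul_zero, integral_zero, zero_add]
    rw [← integral_const_mul]
    refine integral_congr_ae (Eventually.of_forall fun x => ?_)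
    simp only [Pi.smul_apply, smul_eq_mul, map_mul, Complex.conj_ofReal]
    ring
  refine ⟨fun h => ⟨MemLp.zero, MemLp.const_smul hΨ _, h.1, fun w hw => ?_⟩,
    fun h => ⟨h.mem, fun w hw => ?_⟩⟩
  · rw [h.2 w hw, e]
  · rw [h.eq w hw, e]

lemma dualNorm_vol (h : P.UnitVol ψ) : P.dualNorm ((P.om : ℂ) • ψ) 0 = 1 := by
  have hω := P.om_pos
  have e : ∫ x in P.Ω, P.μ x * ‖((P.om : ℂ) • ψ) x‖ ^ 2 =
      P.om ^ 2 * ∫ x in P.Ω, P.μ x * ‖ψ x‖ ^ 2 := by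
    rw [← integral_const_mul]
    refine integral_congr_ae (Eventually.of_forall fun x => ?_)
    simp only [Pi.smul_apply, norm_smul, Complex.norm_real, Real.norm_of_nonneg hω.le]
    ring
  rw [dualNorm, e, Real.sqrt_mul (sq_nonneg _), Real.sqrt_sq hω.le, h.2]
  simp [hω.ne']

lemma dualNorm_rob (h : P.UnitRob Ψ) : P.dualNorm 0 (((√P.om : ℝ) : ℂ) • Ψ) = 1 := by
  have hω := P.om_pos
  have e : ∫ x in P.ΓR, P.γ x * ‖(((√P.om : ℝ) : ℂ) • Ψ) x‖ ^ 2 ∂(surf d) =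
      P.om * ∫ x in P.ΓR, P.γ x * ‖Ψ x‖ ^ 2 ∂(surf d) := by
    rw [← integral_const_mul]
    refine integral_congr_ae (Eventually.of_forall fun x => ?_)
    simp only [Pi.smul_apply, norm_smul, Complex.norm_real, Real.norm_of_nonneg (Real.sqrt_nonneg _),
      mul_pow, Real.sq_sqrt hω.le]
    ring
  rw [dualNorm, e, Real.sqrt_mul hω.le, h.2]
  simp [(Real.sqrt_pos.2 hω).ne']

end Problem

/-! ### Properties of the projections -/

section Argmin

variable {X : Type*} [AddGroup X] {N : X → ℝ} {S : Set X} {v : X}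

/-- Without a minimizer the value of `argmin` is `0`, which also lies in `S`. Existence of best
approximations is therefore never required. -/
lemma argmin_mem (h0 : (0 : X) ∈ S) : argmin N S v ∈ S := by
  rw [argmin]
  split_ifs with h
  · exact h.choose_spec.1
  · exact h0

/-- A minimizer competes with `0`; in the default case there is equality. -/
lemma apply_sub_argmin_le (h0 : (0 : X) ∈ S) : N (v - argmin N S v) ≤ N v := by
  rw [argmin]
  split_ifs with h
  · simpa using h.choose_spec.2 0 h0
  · simp

end Argmin

lemma IsWeight.exists_norm_mul_sq_le {m : Measure (E d)} {f : E d → ℝ} (h : IsWeight m f) :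
    ∃ C, 0 < C ∧ ∀ v : Scal d, MemLp v 2 m →
      ∫ x, ‖(f x : ℂ) * v x‖ ^ 2 ∂m ≤ C * ∫ x, f x * ‖v x‖ ^ 2 ∂m := by
  obtain ⟨c, C, hc, hb⟩ := h.bounds
  refine ⟨max C 1, by positivity, fun v hv => ?_⟩
  rw [← integral_const_mul]
  refine integral_mono_ae (h.memLp_mul hv).norm.integrable_sq ((h.integrable_sq hv).const_mul _) ?_
  filter_upwards [hb] with x hx
  have hf : 0 ≤ f x := hc.le.trans hx.1
  change ‖(f x : ℂ) * v x‖ ^ 2 ≤ max C 1 * (f x * ‖v x‖ ^ 2)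
  rw [norm_mul, Complex.norm_real, Real.norm_of_nonneg hf, mul_pow, sq (f x), mul_assoc]
  exact mul_le_mul_of_nonneg_right (hx.2.trans (le_max_left _ _)) (by positivity)

/-- The squared norm of a sum is at most twice the sum of the squared norms. -/
lemma integral_norm_add_sq_le {m : Measure (E d)} {f g : Scal d} (hf : MemLp f 2 m)
    (hg : MemLp g 2 m) : ∫ x, ‖f x + g x‖ ^ 2 ∂m ≤
      2 * ((∫ x, ‖f x‖ ^ 2 ∂m) + ∫ x, ‖g x‖ ^ 2 ∂m) := by
  rw [← integral_add hf.norm.integrable_sq hg.norm.integrable_sq, ← integral_const_mul]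
  refine integral_mono (MemLp.add hf hg).norm.integrable_sq
    ((hf.norm.integrable_sq.add hg.norm.integrable_sq).const_mul 2) fun x => ?_
  have h1 := norm_add_le (f x) (g x)
  have h2 := pow_le_pow_left₀ (norm_nonneg _) h1 2
  exact h2.trans add_sq_le

/-! ### Boundedness of the approximation errors -/

namespace Mesh

variable {P : Problem d} {T : Mesh P} {p : ℕ} {v w ψ Ψ ξ : Scal d}

lemma setIntegral_hull_le {K : Finset (E d)} (hK : K ∈ T.cells) {f : E d → ℝ}
    (hf : Integrable f (volume.restrict P.Ω)) (h0 : ∀ᵐ x ∂(volume.restrict P.Ω), 0 ≤ f x) :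
    ∫ x in hull K, f x ≤ ∫ x in P.Ω, f x :=
  integral_mono_measure (restrict_hull_le hK) h0 hf

lemma setIntegral_hull_le_ΓR (hd : 1 ≤ d) {F : Finset (E d)} (hF : F ∈ T.facesR) {f : E d → ℝ}
    (hf : Integrable f ((surf d).restrict P.ΓR)) (h0 : ∀ x, 0 ≤ f x) :
    ∫ x in hull F, f x ∂(surf d) ≤ ∫ x in P.ΓR, f x ∂(surf d) := by
  rw [T.integral_ΓR hd hf]
  exact Finset.single_le_sum (f := fun F => ∫ x in hull F, f x ∂(surf d))
    (fun F _ => integral_nonneg h0) hF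

/-- On `V` the discrete gradient and the face traces are the conforming ones. The mesh is fixed, so
its finitely many weights can enter the constant. -/
lemma exists_dagger1_le (T : Mesh P) (hd : 2 ≤ d) (p : ℕ) : ∃ M, 0 ≤ M ∧ ∀ v ∈ P.V,
    T.dagger1 p v ≤ √(M * P.energy v ^ 2) := by
  have hd' : 1 ≤ d := by omega
  obtain ⟨C, hC, hb⟩ := T.exists_eLpNorm_le_energy hd'
  have pK : ∀ K ∈ T.cells,
      0 ≤ max 1 (P.om ^ 2 * diam K ^ 2 / ϑK P K ^ 2) * (αK P K / diam K ^ 2) := by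
    intro K hK
    have := αK_pos hd' hK
    positivity
  have pF : ∀ F ∈ T.facesR, 0 ≤ max 1 (P.om * diam F / T.ϑF F) * (T.αF F / diam F) := by
    intro F hF
    have := αF_pos hd' hF
    have := diam_face_pos hd (mem_facesR.1 hF).1
    positivity
  -- The constant `C` converts `L²` norms to the energy; the `+ 1` of each element accounts for its
  -- gradient term, bounded by the whole squared energy.
  refine ⟨∑ K ∈ T.cells, (max 1 (P.om ^ 2 * diam K ^ 2 / ϑK P K ^ 2) * (αK P K / diam K ^ 2) * C
      + 1) + ∑ F ∈ T.facesR, max 1 (P.om * diam F / T.ϑF F) * (T.αF F / diam F) * C,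
    add_nonneg (Finset.sum_nonneg fun K hK => ?_) (Finset.sum_nonneg fun F hF => ?_),
    fun v hv => Real.sqrt_le_sqrt ?_⟩
  · have := pK K hK
    positivity
  · have := pF F hF
    positivity
  obtain ⟨b1, b2, -⟩ := hb v hv
  have hvB : T.IsBroken v := isBroken_of_V hv
  rw [add_mul, Finset.sum_mul, Finset.sum_mul]
  refine add_le_add (Finset.sum_le_sum fun K hK => ?_) (Finset.sum_le_sum fun F hF => ?_)
  · rw [add_mul, one_mul, mul_assoc (_ * _) C]
    refine add_le_add (mul_le_mul_of_nonneg_left (le_trans ?_ b1) (pK K hK)) ?_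
    · exact setIntegral_hull_le hK hv.1.1.norm.integrable_sq
        (Eventually.of_forall fun x => sq_nonneg _)
    · refine (setIntegral_hull_le hK (T.integrable_herm_self (memL2Vec_𝔊 hd' hvB)) ?_).trans ?_
      · filter_upwards [T.ae_A_posDef] with x hx using herm_self_re_nonneg hx _
      · refine (le_of_eq (integral_congr_ae ?_)).trans (T.le_energy hd' v).2.2
        filter_upwards [𝔊_of_V (T := T) (p := p) hd' hv] with x hx
        rw [hx]
  · rw [mul_assoc (_ * _) C]
    refine mul_le_mul_of_nonneg_left (le_trans ?_ b2) (pF F hF)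
    refine le_trans (le_of_eq (integral_congr_ae ?_)) (setIntegral_hull_le_ΓR hd' hF
      (T.memL2Surf_trace hd' hv).norm.integrable_sq fun x => sq_nonneg _)
    filter_upwards [trace_hull_R hd' hF hv] with x hx
    rw [hx]

/-- The divergence and the normal trace of the flux of the solution of the adjoint problem. -/
lemma exists_dual_le (T : Mesh P) (hd : 1 ≤ d) : ∃ C, 0 < C ∧ ∀ ψ Ψ ξ, P.IsDual ψ Ψ ξ →
    (∫ x in P.Ω, ‖P.dualDiv ψ ξ x‖ ^ 2) ≤ C * (P.energy ξ ^ 2 + P.dualNorm ψ Ψ ^ 2) ∧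
    (∫ x in P.ΓR, ‖P.dualTrace Ψ ξ x‖ ^ 2 ∂(surf d)) ≤
      C * (P.energy ξ ^ 2 + P.dualNorm ψ Ψ ^ 2) := by
  obtain ⟨C₁, hC₁, h₁⟩ := T.isWeight_μ.exists_norm_mul_sq_le
  obtain ⟨C₂, hC₂, h₂⟩ := (T.isWeight_γ hd).exists_norm_mul_sq_le
  have hω := P.om_pos
  have hsω := Real.sqrt_pos.2 hω
  -- The factor `2` comes from the square of a sum of two terms; the two summands bound the
  -- divergence and the normal trace respectively.
  refine ⟨2 * (C₁ * P.om ^ 2) + 2 * (C₂ * P.om), by positivity, fun ψ Ψ ξ h => ?_⟩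
  have hm := T.memL2Surf_trace hd h.mem
  obtain ⟨e1, e2, -⟩ := T.le_energy hd ξ
  set a := ∫ x in P.Ω, P.μ x * ‖ξ x‖ ^ 2
  set b := ∫ x in P.ΓR, P.γ x * ‖trace P.Ω P.ΓR ξ x‖ ^ 2 ∂(surf d)
  have ha : 0 ≤ a := T.isWeight_μ.integral_sq_nonneg _
  have hb : 0 ≤ b := (T.isWeight_γ hd).integral_sq_nonneg _
  have hψ : 0 ≤ ∫ x in P.Ω, P.μ x * ‖ψ x‖ ^ 2 := T.isWeight_μ.integral_sq_nonneg _
  have hΨ : 0 ≤ ∫ x in P.ΓR, P.γ x * ‖Ψ x‖ ^ 2 ∂(surf d) := (T.isWeight_γ hd).integral_sq_nonneg _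
  -- The weights in `dualNorm` are the inverses of those in the energy, so removing them produces
  -- `ω²` here and `ω` in `n2`.
  have n1 : ∫ x in P.Ω, P.μ x * ‖ψ x‖ ^ 2 ≤ P.om ^ 2 * P.dualNorm ψ Ψ ^ 2 := by
    have : √(∫ x in P.Ω, P.μ x * ‖ψ x‖ ^ 2) ≤ P.om * P.dualNorm ψ Ψ := by
      rw [Problem.dualNorm, mul_add, mul_inv_cancel_left₀ hω.ne']
      have : 0 ≤ P.om * ((√P.om)⁻¹ * √(∫ x in P.ΓR, P.γ x * ‖Ψ x‖ ^ 2 ∂(surf d))) := by positivity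
      linarith
    rw [← mul_pow]
    exact (Real.sqrt_le_left (by
      rw [Problem.dualNorm]
      positivity)).1 this
  have n2 : ∫ x in P.ΓR, P.γ x * ‖Ψ x‖ ^ 2 ∂(surf d) ≤ P.om * P.dualNorm ψ Ψ ^ 2 := by
    have : √(∫ x in P.ΓR, P.γ x * ‖Ψ x‖ ^ 2 ∂(surf d)) ≤ √P.om * P.dualNorm ψ Ψ := by
      rw [Problem.dualNorm, mul_add, mul_inv_cancel_left₀ hsω.ne']
      have : 0 ≤ √P.om * (P.om⁻¹ * √(∫ x in P.Ω, P.μ x * ‖ψ x‖ ^ 2)) := by positivity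
      linarith
    have := (Real.sqrt_le_left (by
      rw [Problem.dualNorm]
      positivity)).1 this
    rwa [mul_pow, Real.sq_sqrt hω.le] at this
  have n3 : P.om ^ 2 * a ≤ P.energy ξ ^ 2 := by
    have := pow_le_pow_left₀ (by positivity) e1 2
    rwa [mul_pow, Real.sq_sqrt ha] at this
  have n4 : P.om * b ≤ P.energy ξ ^ 2 := by
    have := pow_le_pow_left₀ (by positivity) e2 2
    rwa [mul_pow, Real.sq_sqrt hω.le, Real.sq_sqrt hb] at this
  have hEN : 0 ≤ P.energy ξ ^ 2 + P.dualNorm ψ Ψ ^ 2 := by positivity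
  constructor
  · have hμξ := T.isWeight_μ.memLp_mul h.mem.1.1
    have k1 := integral_norm_add_sq_le (hμξ.const_mul ((P.om : ℂ) ^ 2))
      (T.isWeight_μ.memLp_mul h.memL2)
    have k2 : ∫ x in P.Ω, ‖(P.om : ℂ) ^ 2 * ((P.μ x : ℂ) * ξ x)‖ ^ 2 =
        P.om ^ 4 * ∫ x in P.Ω, ‖(P.μ x : ℂ) * ξ x‖ ^ 2 := by
      rw [← integral_const_mul]
      refine integral_congr_ae (Eventually.of_forall fun x => ?_)
      simp only [norm_mul, norm_pow, Complex.norm_real, Real.norm_of_nonneg hω.le]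
      ring
    rw [k2] at k1
    have k3 : ∫ x in P.Ω, ‖P.dualDiv ψ ξ x‖ ^ 2 =
        ∫ x in P.Ω, ‖(P.om : ℂ) ^ 2 * ((P.μ x : ℂ) * ξ x) + (P.μ x : ℂ) * ψ x‖ ^ 2 := by
      simp only [Problem.dualDiv, norm_neg]
    rw [k3]
    refine k1.trans ?_
    calc 2 * (P.om ^ 4 * (∫ x in P.Ω, ‖(P.μ x : ℂ) * ξ x‖ ^ 2) + ∫ x in P.Ω, ‖(P.μ x : ℂ) * ψ x‖ ^ 2)
        ≤ 2 * (P.om ^ 4 * (C₁ * a) + C₁ * (P.om ^ 2 * P.dualNorm ψ Ψ ^ 2)) := by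
          gcongr
          · exact h₁ _ h.mem.1.1
          · exact (h₁ _ h.memL2).trans (mul_le_mul_of_nonneg_left n1 hC₁.le)
      _ = 2 * (C₁ * P.om ^ 2) * (P.om ^ 2 * a + P.dualNorm ψ Ψ ^ 2) := by ring
      _ ≤ 2 * (C₁ * P.om ^ 2) * (P.energy ξ ^ 2 + P.dualNorm ψ Ψ ^ 2) := by gcongr
      _ ≤ _ := by
          refine mul_le_mul_of_nonneg_right ?_ hEN
          have : 0 ≤ 2 * (C₂ * P.om) := by positivity
          linarith
  · have hγξ := (T.isWeight_γ hd).memLp_mul hm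
    have k1 := integral_norm_add_sq_le ((T.isWeight_γ hd).memLp_mul h.memL2Surf)
      (hγξ.const_mul (-(Complex.I * P.om)))
    have k2 : ∫ x in P.ΓR, ‖-(Complex.I * P.om) * ((P.γ x : ℂ) * trace P.Ω P.ΓR ξ x)‖ ^ 2 ∂(surf d) =
        P.om ^ 2 * ∫ x in P.ΓR, ‖(P.γ x : ℂ) * trace P.Ω P.ΓR ξ x‖ ^ 2 ∂(surf d) := by
      rw [← integral_const_mul]
      refine integral_congr_ae (Eventually.of_forall fun x => ?_)
      simp only [norm_mul, norm_neg, Complex.norm_I, Complex.norm_real, Real.norm_of_nonneg hω.le]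
      ring
    rw [k2] at k1
    have k3 : ∫ x in P.ΓR, ‖P.dualTrace Ψ ξ x‖ ^ 2 ∂(surf d) =
        ∫ x in P.ΓR, ‖(P.γ x : ℂ) * Ψ x +
          -(Complex.I * P.om) * ((P.γ x : ℂ) * trace P.Ω P.ΓR ξ x)‖ ^ 2 ∂(surf d) := by
      simp only [Problem.dualTrace, neg_mul, ← sub_eq_add_neg]
    rw [k3]
    refine k1.trans ?_
    calc 2 * ((∫ x in P.ΓR, ‖(P.γ x : ℂ) * Ψ x‖ ^ 2 ∂(surf d)) +
          P.om ^ 2 * ∫ x in P.ΓR, ‖(P.γ x : ℂ) * trace P.Ω P.ΓR ξ x‖ ^ 2 ∂(surf d))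
        ≤ 2 * (C₂ * (P.om * P.dualNorm ψ Ψ ^ 2) + P.om ^ 2 * (C₂ * b)) := by
          gcongr
          · exact (h₂ _ h.memL2Surf).trans (mul_le_mul_of_nonneg_left n2 hC₂.le)
          · exact h₂ _ hm
      _ = 2 * (C₂ * P.om) * (P.om * b + P.dualNorm ψ Ψ ^ 2) := by ring
      _ ≤ 2 * (C₂ * P.om) * (P.energy ξ ^ 2 + P.dualNorm ψ Ψ ^ 2) := by gcongr
      _ ≤ _ := by
          refine mul_le_mul_of_nonneg_right ?_ hEN
          have : 0 ≤ 2 * (C₁ * P.om ^ 2) := by positivity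
          linarith

/-- The `A⁻¹`-norm of `A∇ξ` is the `A`-norm of `∇ξ`, while its divergence and normal trace are given
explicitly by `ξ` and the data. -/
lemma exists_daggerDiv_le (T : Mesh P) (hd : 2 ≤ d) : ∃ M, 0 ≤ M ∧ ∀ ψ Ψ ξ, P.IsDual ψ Ψ ξ →
    T.daggerDiv (P.flux ξ) ≤ √(M * (P.energy ξ ^ 2 + P.dualNorm ψ Ψ ^ 2)) := by
  have hd' : 1 ≤ d := by omega
  obtain ⟨C, hC, hb⟩ := T.exists_dual_le hd'
  have pK : ∀ K ∈ T.cells, 0 ≤ diam K ^ 2 / αK P K := by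
    intro K hK
    have := αK_pos hd' hK
    positivity
  have pF : ∀ F ∈ T.facesR, 0 ≤ diam F / T.αF F := by
    intro F hF
    have := αF_pos hd' hF
    have := diam_face_pos hd (mem_facesR.1 hF).1
    positivity
  refine ⟨∑ K ∈ T.cells, (1 + diam K ^ 2 / αK P K * C) + ∑ F ∈ T.facesR, diam F / T.αF F * C,
    add_nonneg (Finset.sum_nonneg fun K hK => ?_) (Finset.sum_nonneg fun F hF => ?_),
    fun ψ Ψ ξ h => Real.sqrt_le_sqrt ?_⟩
  · have := pK K hK
    positivity
  · have := pF F hF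
    positivity
  obtain ⟨b1, b2⟩ := hb ψ Ψ ξ h
  rw [add_mul, Finset.sum_mul, Finset.sum_mul]
  refine add_le_add (Finset.sum_le_sum fun K hK => ?_) (Finset.sum_le_sum fun F hF => ?_)
  · rw [add_mul, one_mul, mul_assoc _ C]
    refine add_le_add ?_ (mul_le_mul_of_nonneg_left (le_trans ?_ b1) (pK K hK))
    · refine (setIntegral_hull_le hK
        (T.integrable_herm_inv (T.memL2Vec_flux h.mem.1)) ?_).trans ?_
      · filter_upwards [T.ae_A_posDef] with x hx using herm_self_re_nonneg hx.inv _
      · have e : ∫ x in P.Ω, (herm (P.A x)⁻¹ (P.flux ξ x) (P.flux ξ x)).re =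
            ∫ x in P.Ω, (herm (P.A x) (wgrad P.Ω ξ x) (wgrad P.Ω ξ x)).re := by
          refine integral_congr_ae ?_
          filter_upwards [T.ae_A_posDef] with x hx
          rw [← herm_inv_mulVec hx]
          rfl
        rw [e]
        exact (T.le_energy hd' ξ).2.2.trans (le_add_of_nonneg_right (sq_nonneg _))
    · refine le_trans (le_of_eq (integral_congr_ae ?_)) (setIntegral_hull_le hK
        (T.memL2_dualDiv h).norm.integrable_sq (Eventually.of_forall fun x => sq_nonneg _))
      filter_upwards [ae_mono (restrict_hull_le hK) (T.wdiv_flux hd' h)] with x hx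
      rw [hx]
  · rw [mul_assoc _ C]
    refine mul_le_mul_of_nonneg_left (le_trans ?_ b2) (pF F hF)
    refine le_trans (le_of_eq (integral_congr_ae ?_)) (setIntegral_hull_le_ΓR hd' hF
      (T.memL2Surf_dualTrace hd' h).norm.integrable_sq fun x => sq_nonneg _)
    filter_upwards [T.ae_hull_of_ΓR hd' hF
      (T.normalTrace_ae_eq hd' P.partR (T.isNormalTrace_flux hd' h))] with x hx
    rw [hx]

lemma zero_mem_XN (P : Problem d) : (0 : Vect d) ∈ P.XN := by
  have hD : IsWeakDiv P.Ω (0 : Vect d) 0 := fun φ _ => by simp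
  have h := wdiv_eq P.isPolytopal.isOpen MemLp.zero hD
  have hN : ∀ Γ : Set (E d), IsNormalTrace P.Ω Γ 0 0 := by
    refine fun Γ => ⟨MemLp.zero, fun φ _ => ?_⟩
    have : ∫ x in P.Ω, wdiv P.Ω 0 x * φ x = 0 := by
      refine integral_eq_zero_of_ae ?_
      filter_upwards [h] with x hx
      simp [hx]
    rw [this]
    simp
  exact ⟨⟨fun i => MemLp.zero, 0, MemLp.zero, hD⟩, hN _, 0, hN _⟩

lemma πhg_mem (T : Mesh P) (p : ℕ) (v : Scal d) : T.πhg p v ∈ T.poly p ∩ P.V :=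
  argmin_mem ⟨poly_zero, zero_mem_V P⟩

lemma πhd_mem (T : Mesh P) (p : ℕ) (z : Vect d) : T.πhd p z ∈ T.polyVec p ∩ P.XN :=
  argmin_mem ⟨polyVec_zero, zero_mem_XN P⟩

lemma πg_mem (T : Mesh P) (p : ℕ) (v : Scal d) : T.πg p v ∈ P.V :=
  argmin_mem (zero_mem_V P)

/-- The approximation errors of the solutions of the adjoint problem are bounded. -/
lemma exists_error_le (T : Mesh P) (hd : 2 ≤ d) (hP : P.WellPosed) (p : ℕ) :
    ∃ M, ∀ ψ Ψ ξ, P.IsDual ψ Ψ ξ → P.dualNorm ψ Ψ = 1 →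
      T.dagger1 p (ξ - T.πhg p ξ) ≤ M ∧
      T.daggerDiv (P.flux ξ - T.πhd p (P.flux ξ)) ≤ M := by
  obtain ⟨C, hC, h⟩ := T.exists_energy_le_dualNorm (by omega) hP
  obtain ⟨M₁, hM₁, h₁⟩ := T.exists_dagger1_le hd p
  obtain ⟨M₂, hM₂, h₂⟩ := T.exists_daggerDiv_le hd
  refine ⟨max √(M₁ * C ^ 2) √(M₂ * (C ^ 2 + 1)), fun ψ Ψ ξ hξ hN => ?_⟩
  have hE := h ψ Ψ ξ hξ
  rw [hN, mul_one] at hE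
  have hE2 : P.energy ξ ^ 2 ≤ C ^ 2 := pow_le_pow_left₀ (Real.sqrt_nonneg _) hE 2
  constructor
  · refine (apply_sub_argmin_le (S := T.poly p ∩ P.V) ⟨poly_zero, zero_mem_V P⟩).trans
      ((h₁ ξ hξ.mem).trans (le_max_of_le_left (Real.sqrt_le_sqrt ?_)))
    gcongr
  · refine (apply_sub_argmin_le (S := T.polyVec p ∩ P.XN) ⟨polyVec_zero, zero_mem_XN P⟩).trans
      ((h₂ ψ Ψ ξ hξ).trans (le_max_of_le_right (Real.sqrt_le_sqrt ?_)))
    rw [hN, one_pow]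
    gcongr

end Mesh

/-! ### The duality argument -/

namespace Mesh

variable {P : Problem d} {T : Mesh P} {p : ℕ} {v w ψ Ψ ξ f u uh : Scal d}

lemma faceTrace_linear (hd : 1 ≤ d) {F : Finset (E d)} (hF : F ∈ T.facesR) (hv : T.IsBroken v)
    (hw : T.IsBroken w) (c : ℂ) : faceTrace (T.cellOf F) F (v + c • w)
      =ᵐ[(surf d).restrict (hull F)]
      faceTrace (T.cellOf F) F v + c • faceTrace (T.cellOf F) F w := by
  have hF' := (mem_facesR.1 hF).1
  have hK := cellOf_spec hF'
  filter_upwards [faceTrace_add hd hK.1 hF' hK.2 hv (hw.smul c),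
    faceTrace_smul hd hK.1 hF' hK.2 c hw] with x h1 h2
  simp only [h1, Pi.add_apply, h2]

lemma dualRhs_linear (hd : 1 ≤ d) (hψ : MemL2 P.Ω ψ) (hΨ : MemL2Surf P.ΓR Ψ)
    (hv : T.IsBroken v) (hw : T.IsBroken w) (c : ℂ) :
    T.dualRhs ψ Ψ (v + c • w) = T.dualRhs ψ Ψ v + c * T.dualRhs ψ Ψ w := by
  have hμ := T.isWeight_μ
  have h1 : ∫ x in P.Ω, (P.μ x : ℂ) * (v + c • w) x * conj (ψ x) =
      (∫ x in P.Ω, (P.μ x : ℂ) * v x * conj (ψ x)) + c * ∫ x in P.Ω, (P.μ x : ℂ) * w x * conj (ψ x) := by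
    rw [← integral_const_mul, ← integral_add (hμ.integrable_mul hv.memL2 hψ)
      ((hμ.integrable_mul hw.memL2 hψ).const_mul c)]
    refine integral_congr_ae (Eventually.of_forall fun x => ?_)
    simp only [Pi.add_apply, Pi.smul_apply, smul_eq_mul]
    ring
  have h2 : ∀ F ∈ T.facesR, ∫ x in hull F, (P.γ x : ℂ) * faceTrace (T.cellOf F) F (v + c • w) x *
        conj (Ψ x) ∂(surf d) =
      (∫ x in hull F, (P.γ x : ℂ) * faceTrace (T.cellOf F) F v x * conj (Ψ x) ∂(surf d)) +
      c * ∫ x in hull F, (P.γ x : ℂ) * faceTrace (T.cellOf F) F w x * conj (Ψ x) ∂(surf d) := by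
    intro F hF
    have hγ := isWeight_γF hd hF
    have tv := memL2Surf_faceTrace hd hF hv
    have tw := memL2Surf_faceTrace hd hF hw
    have tΨ := T.memL2Surf_hull_of_ΓR hd hF hΨ
    rw [← integral_const_mul, ← integral_add (hγ.integrable_mul tv tΨ)
      ((hγ.integrable_mul tw tΨ).const_mul c)]
    refine integral_congr_ae ?_
    filter_upwards [faceTrace_linear hd hF hv hw c] with x hx
    rw [hx]
    simp only [Pi.add_apply, Pi.smul_apply, smul_eq_mul]
    ring
  rw [dualRhs, h1, Finset.sum_congr rfl h2, Finset.sum_add_distrib, ← Finset.mul_sum, dualRhs,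
    dualRhs]
  ring

/-- Galerkin orthogonality with respect to conforming test functions. -/
lemma bh₀_sub_eq_zero (hd : 1 ≤ d) (hu : P.IsWeakSolution f u) {s : Scal d → Scal d → ℂ}
    (hs : T.IsStabilization s) (huh : T.IsDiscreteSolution p s f uh) (hv : v ∈ T.poly p ∩ P.V) :
    T.bh₀ p (u - uh) v = 0 := by
  have hub : T.IsBroken u := isBroken_of_V hu.1
  have huhb : T.IsBroken uh := isBroken_of_poly huh.1
  have hvb : T.IsBroken v := isBroken_of_V hv.2
  have e := bh₀_linear (p := p) hd hub huhb hvb (-1)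
  rw [neg_one_smul, ← sub_eq_add_neg] at e
  rw [e, bh₀_of_V hd hu.1 hv.2, hu.2 v hv.2, ← bh_eq hs huhb hv.2, huh.2 v hv.1]
  ring

/-- The duality argument. -/
lemma norm_dualRhs_le (hd : 2 ≤ d) (hu : P.IsWeakSolution f u) {s : Scal d → Scal d → ℂ}
    (hs : T.IsStabilization s) (huh : T.IsDiscreteSolution p s f uh) (h : P.IsDual ψ Ψ ξ) :
    ‖T.dualRhs ψ Ψ (u - uh)‖ ≤ T.dagger1 p (ξ - T.πhg p ξ) * T.energy p (u - uh) +
      T.daggerDiv (P.flux ξ - T.πhd p (P.flux ξ)) * T.dagger1 p (uh - T.πg p uh) := by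
  have hd' : 1 ≤ d := by omega
  have hub : T.IsBroken u := isBroken_of_V hu.1
  have huhb : T.IsBroken uh := isBroken_of_poly huh.1
  have hξb : T.IsBroken ξ := isBroken_of_V h.mem
  have hξh := T.πhg_mem p ξ
  have hξhb : T.IsBroken (T.πhg p ξ) := isBroken_of_V hξh.2
  have hw := T.πg_mem p uh
  have hwb : T.IsBroken (T.πg p uh) := isBroken_of_V hw
  have hR : ∀ v ∈ P.V, T.bh₀ p v ξ = T.dualRhs ψ Ψ v := fun v hv => by
    rw [bh₀_of_V hd' hv h.mem, dualRhs_of_V hd' h hv]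
  have sub1 : ∀ {v w : Scal d}, T.IsBroken v → T.IsBroken w →
      T.bh₀ p (v - w) ξ = T.bh₀ p v ξ - T.bh₀ p w ξ := by
    intro v w hv hw
    have := bh₀_linear (p := p) hd' hv hw hξb (-1)
    rw [neg_one_smul, ← sub_eq_add_neg] at this
    rw [this]
    ring
  have sub2 : ∀ {v w : Scal d}, T.IsBroken v → T.IsBroken w →
      T.dualRhs ψ Ψ (v - w) = T.dualRhs ψ Ψ v - T.dualRhs ψ Ψ w := by
    intro v w hv hw
    have := dualRhs_linear hd' h.memL2 h.memL2Surf hv hw (-1)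
    rw [neg_one_smul, ← sub_eq_add_neg] at this
    rw [this]
    ring
  obtain ⟨hη, hg, hres⟩ := residual_eq_sub (p := p) hd' h (huhb.sub hwb) (T.πhd_mem p (P.flux ξ))
  -- The decomposition behind the estimate. It combines the adjoint equation on the conforming
  -- functions `u` and `π^g uh` with Galerkin orthogonality against `π_h^g ξ`.
  have e1 : T.dualRhs ψ Ψ (u - uh) = T.bh₀ p (u - uh) (ξ - T.πhg p ξ) +
      (T.bh₀ p (uh - T.πg p uh) ξ - T.dualRhs ψ Ψ (uh - T.πg p uh)) := by
    rw [bh₀_sub_right hd' hξb hξhb (hub.sub huhb), bh₀_sub_eq_zero hd' hu hs huh hξh,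
      sub1 hub huhb, sub1 huhb hwb, sub2 hub huhb, sub2 huhb hwb, hR u hu.1, hR _ hw]
    ring
  rw [e1]
  refine (norm_add_le _ _).trans (add_le_add ?_ ?_)
  · refine (norm_bh₀_le hd' (hub.sub huhb) (hξb.sub hξhb)).trans ?_
    rw [mul_comm]
    exact mul_le_mul_of_nonneg_right (energy_le_dagger1 hd (hξb.sub hξhb)) (Real.sqrt_nonneg _)
  · rw [hres, mul_comm]
    exact norm_residual_le hd (huhb.sub hwb) hη hg

/-- The trace on `Γ_R` of a broken function. -/
def robinTrace (T : Mesh P) (v : Scal d) : Scal d := fun x =>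
  ∑ F ∈ T.facesR, (hull F).indicator (faceTrace (T.cellOf F) F v) x

/-- Distinct faces overlap in null sets only, so the sum of indicators reduces to a single term. -/
lemma robinTrace_ae_eq {F : Finset (E d)} (hF : F ∈ T.facesR) (v : Scal d) :
    ∀ᵐ x ∂((surf d).restrict (hull F)), T.robinTrace v x = faceTrace (T.cellOf F) F v x := by
  filter_upwards [ae_notMem_hull (mem_facesR.1 hF).1, ae_restrict_mem (measurableSet_hull F)]
    with x h1 h2
  rw [robinTrace, Finset.sum_eq_single F, Set.indicator_of_mem h2]
  · intro F' hF' hne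
    exact Set.indicator_of_notMem (h1 F' (mem_facesR.1 hF').1 hne) _
  · exact fun h => absurd hF h

lemma memL2Surf_robinTrace (hd : 1 ≤ d) (hv : T.IsBroken v) :
    MemL2Surf P.ΓR (T.robinTrace v) := by
  refine memLp_finsetSum T.facesR fun F hF => ?_
  rw [memLp_indicator_iff_restrict (measurableSet_hull F),
    Measure.restrict_restrict (measurableSet_hull F)]
  exact MemLp.mono_measure (Measure.restrict_mono Set.inter_subset_left le_rfl)
    (memL2Surf_faceTrace hd hF hv)

/-- The datum `v / ‖v‖_μ` realises the norm: for it, `dualRhs` takes the value `ω‖v‖_μ` at `v`. When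
the norm is zero no normalisation is possible, and `0 ≤ B` is what remains to be used. -/
lemma le_of_forall_isDual_vol (hd : 1 ≤ d) (hP : P.WellPosed) (hv : T.IsBroken v) {B : ℝ}
    (hB : 0 ≤ B) (h : ∀ ψ ξ, P.UnitVol ψ → P.IsDualVol ψ ξ →
      ‖T.dualRhs ((P.om : ℂ) • ψ) 0 v‖ ≤ B) : P.om * T.normμ v ≤ B := by
  have hω := P.om_pos
  have hN : 0 ≤ T.normμ v := Real.sqrt_nonneg _
  rcases hN.eq_or_lt with h0 | h0
  · rwa [← h0, mul_zero]
  set c : ℂ := (((T.normμ v)⁻¹ : ℝ) : ℂ) with hc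
  have hψ : MemL2 P.Ω (c • v) := MemLp.const_smul hv.memL2 c
  have e1 : ∫ x in P.Ω, P.μ x * ‖(c • v) x‖ ^ 2 = ((T.normμ v)⁻¹ * T.normμ v) ^ 2 := by
    rw [mul_pow, normμ_sq, ← integral_const_mul]
    refine integral_congr_ae (Eventually.of_forall fun x => ?_)
    simp only [Pi.smul_apply, norm_smul, hc, Complex.norm_real,
      Real.norm_of_nonneg (inv_nonneg.2 hN)]
    ring
  rw [inv_mul_cancel₀ h0.ne', one_pow] at e1
  have hU : P.UnitVol (c • v) := ⟨hψ, by rw [e1, Real.sqrt_one]⟩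
  obtain ⟨ξ, hξ⟩ := T.exists_isDual hd hP (ψ := (P.om : ℂ) • (c • v)) (Ψ := 0)
    (MemLp.const_smul hψ _) MemLp.zero
  have h1 := h _ ξ hU ((Problem.isDualVol_iff hψ).2 hξ)
  have e2 : T.dualRhs ((P.om : ℂ) • (c • v)) 0 v = ((P.om * T.normμ v : ℝ) : ℂ) := by
    have e3 : ∫ x in P.Ω, (P.μ x : ℂ) * v x * conj (((P.om : ℂ) • (c • v)) x) =
        ((P.om * ((T.normμ v)⁻¹ * T.normμ v ^ 2) : ℝ) : ℂ) := by
      rw [normμ_sq, ← integral_const_mul, ← integral_const_mul, ← integral_complex_ofReal]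
      refine integral_congr_ae (Eventually.of_forall fun x => ?_)
      simp only [Pi.smul_apply, smul_eq_mul, map_mul, hc, Complex.conj_ofReal]
      have := Complex.mul_conj (v x)
      rw [Complex.normSq_eq_norm_sq] at this
      push_cast at this ⊢
      rw [← this]
      ring
    rw [dualRhs, e3]
    simp only [Pi.zero_apply, map_zero, mul_zero, integral_zero, Finset.sum_const_zero, add_zero]
    rw [sq, inv_mul_cancel_left₀ h0.ne']
  rwa [e2, Complex.norm_real, Real.norm_of_nonneg (by positivity)] at h1

/-- The norm is realised by the normalised one-sided trace of `v`. It is assembled from the Robin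
faces by `robinTrace`, since `v` is broken and may have no trace on `Γ_R` as a function on `Ω`. -/
lemma le_of_forall_isDual_rob (hd : 1 ≤ d) (hP : P.WellPosed) (hv : T.IsBroken v) {B : ℝ}
    (hB : 0 ≤ B) (h : ∀ Ψ ξ, P.UnitRob Ψ → P.IsDualRob Ψ ξ →
      ‖T.dualRhs 0 (((√P.om : ℝ) : ℂ) • Ψ) v‖ ≤ B) : √P.om * T.normγ v ≤ B := by
  have hω := Real.sqrt_pos.2 P.om_pos
  have hN : 0 ≤ T.normγ v := Real.sqrt_nonneg _
  rcases hN.eq_or_lt with h0 | h0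
  · rwa [← h0, mul_zero]
  set c : ℂ := (((T.normγ v)⁻¹ : ℝ) : ℂ) with hc
  have hg : MemL2Surf P.ΓR (T.robinTrace v) := memL2Surf_robinTrace hd hv
  have hΨ : MemL2Surf P.ΓR (c • T.robinTrace v) := MemLp.const_smul hg c
  have e1 : ∫ x in P.ΓR, P.γ x * ‖(c • T.robinTrace v) x‖ ^ 2 ∂(surf d) =
      ((T.normγ v)⁻¹ * T.normγ v) ^ 2 := by
    rw [mul_pow, normγ_sq hd, Finset.mul_sum,
      T.integral_ΓR hd ((T.isWeight_γ hd).integrable_sq hΨ)]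
    refine Finset.sum_congr rfl fun F hF => ?_
    rw [← integral_const_mul]
    refine integral_congr_ae ?_
    filter_upwards [robinTrace_ae_eq hF v] with x hx
    simp only [Pi.smul_apply, norm_smul, hc, Complex.norm_real,
      Real.norm_of_nonneg (inv_nonneg.2 hN), hx]
    ring
  rw [inv_mul_cancel₀ h0.ne', one_pow] at e1
  have hU : P.UnitRob (c • T.robinTrace v) := ⟨hΨ, by rw [e1, Real.sqrt_one]⟩
  obtain ⟨ξ, hξ⟩ := T.exists_isDual hd hP (ψ := 0) (Ψ := ((√P.om : ℝ) : ℂ) • (c • T.robinTrace v))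
    MemLp.zero (MemLp.const_smul hΨ _)
  have h1 := h _ ξ hU ((Problem.isDualRob_iff hΨ).2 hξ)
  have e2 : T.dualRhs 0 (((√P.om : ℝ) : ℂ) • (c • T.robinTrace v)) v =
      ((√P.om * T.normγ v : ℝ) : ℂ) := by
    have e3 : ∑ F ∈ T.facesR, ∫ x in hull F, (P.γ x : ℂ) * faceTrace (T.cellOf F) F v x *
        conj ((((√P.om : ℝ) : ℂ) • (c • T.robinTrace v)) x) ∂(surf d) =
        ((√P.om * ((T.normγ v)⁻¹ * T.normγ v ^ 2) : ℝ) : ℂ) := by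
      rw [normγ_sq hd, Finset.mul_sum, Finset.mul_sum, Complex.ofReal_sum]
      refine Finset.sum_congr rfl fun F hF => ?_
      rw [← integral_const_mul, ← integral_const_mul, ← integral_complex_ofReal]
      refine integral_congr_ae ?_
      filter_upwards [robinTrace_ae_eq hF v] with x hx
      simp only [Pi.smul_apply, smul_eq_mul, map_mul, hc, Complex.conj_ofReal, hx]
      have := Complex.mul_conj (faceTrace (T.cellOf F) F v x)
      rw [Complex.normSq_eq_norm_sq] at this
      push_cast at this ⊢
      rw [← this]
      ring
    rw [dualRhs, e3]
    simp only [Pi.zero_apply, map_zero, mul_zero, integral_zero, zero_add]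
    rw [sq, inv_mul_cancel_left₀ h0.ne']
  rwa [e2, Complex.norm_real, Real.norm_of_nonneg (by positivity)] at h1

/-- The set of errors is empty when there are no unit data, as for `Γ_R = ∅`. The supremum is then
`0`, and nonnegativity of the bound still holds. -/
lemma sSup_mul_add_nonneg {S S' : Set ℝ} (h : ∀ r ∈ S, 0 ≤ r) (h' : ∀ r ∈ S', 0 ≤ r) {a b : ℝ}
    (ha : 0 ≤ a) (hb : 0 ≤ b) : 0 ≤ sSup S * a + sSup S' * b :=
  add_nonneg (mul_nonneg (Real.sSup_nonneg h) ha) (mul_nonneg (Real.sSup_nonneg h') hb)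

theorem aubin_nitsche (hd : 2 ≤ d) (hP : P.WellPosed) (hu : P.IsWeakSolution f u)
    {s : Scal d → Scal d → ℂ} (hs : T.IsStabilization s) (huh : T.IsDiscreteSolution p s f uh) :
    (BddAbove (T.errVolG p) ∧ BddAbove (T.errVolD p) ∧
      BddAbove (T.errRobG p) ∧ BddAbove (T.errRobD p)) ∧
    P.om * T.normμ (u - uh) ≤
      T.checkG p * T.energy p (u - uh) + T.checkD p * T.dagger1 p (uh - T.πg p uh) ∧
    √P.om * T.normγ (u - uh) ≤
      T.tildeG p * T.energy p (u - uh) + T.tildeD p * T.dagger1 p (uh - T.πg p uh) := by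
  have hd' : 1 ≤ d := by omega
  -- Both normalisations make `dualNorm` equal to `1`, so one constant bounds all four sets of
  -- errors.
  obtain ⟨M, hM⟩ := T.exists_error_le hd hP p
  have hVol : ∀ {ψ ξ : Scal d}, P.UnitVol ψ → P.IsDualVol ψ ξ → P.IsDual ((P.om : ℂ) • ψ) 0 ξ :=
    fun h h' => (Problem.isDualVol_iff h.1).1 h'
  have hRob : ∀ {Ψ ξ : Scal d}, P.UnitRob Ψ → P.IsDualRob Ψ ξ →
      P.IsDual 0 (((√P.om : ℝ) : ℂ) • Ψ) ξ := fun h h' => (Problem.isDualRob_iff h.1).1 h'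
  have b1 : BddAbove (T.errVolG p) := by
    refine ⟨M, ?_⟩
    rintro r ⟨ψ, ξ, h1, h2, rfl⟩
    exact (hM _ _ ξ (hVol h1 h2) (Problem.dualNorm_vol h1)).1
  have b2 : BddAbove (T.errVolD p) := by
    refine ⟨M, ?_⟩
    rintro r ⟨ψ, ξ, h1, h2, rfl⟩
    exact (hM _ _ ξ (hVol h1 h2) (Problem.dualNorm_vol h1)).2
  have b3 : BddAbove (T.errRobG p) := by
    refine ⟨M, ?_⟩
    rintro r ⟨Ψ, ξ, h1, h2, rfl⟩
    exact (hM _ _ ξ (hRob h1 h2) (Problem.dualNorm_rob h1)).1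
  have b4 : BddAbove (T.errRobD p) := by
    refine ⟨M, ?_⟩
    rintro r ⟨Ψ, ξ, h1, h2, rfl⟩
    exact (hM _ _ ξ (hRob h1 h2) (Problem.dualNorm_rob h1)).2
  have hE : 0 ≤ T.energy p (u - uh) := Real.sqrt_nonneg _
  have hD : 0 ≤ T.dagger1 p (uh - T.πg p uh) := Real.sqrt_nonneg _
  have heb : T.IsBroken (u - uh) := (isBroken_of_V hu.1).sub (isBroken_of_poly huh.1)
  refine ⟨⟨b1, b2, b3, b4⟩, ?_, ?_⟩
  · refine le_of_forall_isDual_vol hd' hP heb (sSup_mul_add_nonneg ?_ ?_ hE hD) fun ψ ξ h1 h2 => ?_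
    · rintro r ⟨-, -, -, -, rfl⟩
      exact Real.sqrt_nonneg _
    · rintro r ⟨-, -, -, -, rfl⟩
      exact Real.sqrt_nonneg _
    · refine (norm_dualRhs_le hd hu hs huh (hVol h1 h2)).trans (add_le_add
        (mul_le_mul_of_nonneg_right (le_csSup b1 ⟨ψ, ξ, h1, h2, rfl⟩) hE)
        (mul_le_mul_of_nonneg_right (le_csSup b2 ⟨ψ, ξ, h1, h2, rfl⟩) hD))
  · refine le_of_forall_isDual_rob hd' hP heb (sSup_mul_add_nonneg ?_ ?_ hE hD) fun Ψ ξ h1 h2 => ?_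
    · rintro r ⟨-, -, -, -, rfl⟩
      exact Real.sqrt_nonneg _
    · rintro r ⟨-, -, -, -, rfl⟩
      exact Real.sqrt_nonneg _
    · refine (norm_dualRhs_le hd hu hs huh (hRob h1 h2)).trans (add_le_add
        (mul_le_mul_of_nonneg_right (le_csSup b3 ⟨Ψ, ξ, h1, h2, rfl⟩) hE)
        (mul_le_mul_of_nonneg_right (le_csSup b4 ⟨Ψ, ξ, h1, h2, rfl⟩) hD))

end Mesh

end IPDG

end

theorem lemma4p1 {d : ℕ} (hd : d = 2 ∨ d = 3) (P : IPDG.Problem d) (hP : P.WellPosed)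
    (f : IPDG.Scal d) (hf : IPDG.MemL2 P.Ω f)
    (u : IPDG.Scal d) (hu : P.IsWeakSolution f u)
    (T : IPDG.Mesh P) (p : ℕ) (hp : 1 ≤ p)
    (s : IPDG.Scal d → IPDG.Scal d → ℂ) (hs : T.IsStabilization s)
    (uh : IPDG.Scal d) (huh : T.IsDiscreteSolution p s f uh) :
    (BddAbove (T.errVolG p) ∧ BddAbove (T.errVolD p) ∧
      BddAbove (T.errRobG p) ∧ BddAbove (T.errRobD p)) ∧
    P.om * T.normμ (u - uh) ≤
      T.checkG p * T.energy p (u - uh) + T.checkD p * T.dagger1 p (uh - T.πg p uh) ∧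
    √P.om * T.normγ (u - uh) ≤
      T.tildeG p * T.energy p (u - uh) + T.tildeD p * T.dagger1 p (uh - T.πg p uh) := by
  exact IPDG.Mesh.aubin_nitsche (by omega) hP hu hs huh
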